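/- \textbf{Theorem (convex polygons).} Consider the word RAM with integer variables and integer arrays, in which each of the following takes one time step: loading a constant, an addition, subtraction, multiplication, integer division, remainder or integer square root $\lfloor\sqrt{x}\rfloor$ of words, reading or writing an array cell, and comparing two words. There are a single program and constants $C$ and $d$ such that the following holds. Let $P$ be a convex polygon with exactly $k\ge 3$ vertices $V_1,\dots,V_k$ (listed in one of the two cyclic orders, no three consecutive ones collinear), whose coordinates are given as fractions of integers with positive denominators, and let $p$ be its perimeter. It is also given, for each side (without its endpoints) and for each vertex, whether it belongs to $P$; so $P$ consists of the interior of the convex hull of $V_1,\dots,V_k$ together with the chosen open sides and the chosen vertices. Let $a=(a_0,\dots,a_n)$ and $b=(b_0,\dots,b_n)$ be sequences of integers, and let $W$ be a natural number such that $n$, $k$, all $|a_i|$, $|b_i|$, and the absolute values of all numerators and denominators of the coordinates are at most $W$. If the program is started with $n,k,a,b$ and the description of $P$ in its memory and all other memory cells equal to $0$, then it halts with an output array that contains, for every $m\in\mathbb{Z}$, the partial sum \[ c_m=\sum_{\substack{i+j=m,\ 0\le i,j\le n\\ (i,j)\in P\cap\mathbb{Z}^2}} a_i b_j \] in its cell $m$,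 after at most \[ C\left(k+p\,(\log p)^2\log k\right) \] steps, and during the execution it uses only words of absolute value at most $(W+2)^d$, that is, words of $\mathcal{O}(\log (W+2))$ bits. -/

import Mathlib

/-! ## The machine: a word RAM with a step count

A program uses finitely many integer variables and finitely many integer arrays, all named by
natural numbers. Every elementary instruction and every test of a condition takes one step. -/

namespace WordRAM

/-- The binary arithmetic operations on words. -/
inductive BinOp
  | add | sub | mul | div | mod

/-- `div` and `mod` are Euclidean quotient and remainder. -/
def BinOp.eval : BinOp → ℤ → ℤ → ℤ
  | .add, u, v => u + v
  | .sub, u, v => u - v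
  | .mul, u, v => u * v
  | .div, u, v => u / v
  | .mod, u, v => u % v

/-- Programs. Variables and arrays are named by natural numbers. -/
inductive Program
  /-- do nothing -/
  | skip : Program
  /-- `x := c` -/
  | const (x : ℕ) (c : ℤ) : Program
  /-- `x := y o z` -/
  | arith (o : BinOp) (x y z : ℕ) : Program
  /-- `x := ⌊√y⌋` -/
  | sqrt (x y : ℕ) : Program
  /-- `x := A[i]` -/
  | load (x A i : ℕ) : Program
  /-- `A[i] := x` -/
  | store (A i x : ℕ) : Program
  /-- first `P`, then `Q` -/
  | seq (P Q : Program) : Program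
  /-- if `x < y` then `P` else `Q` -/
  | cond (x y : ℕ) (P Q : Program) : Program
  /-- while `x < y` do `P` -/
  | loop (x y : ℕ) (P : Program) : Program

/-- A memory configuration: the values of the variables and of the array cells. -/
structure State where
  var : ℕ → ℤ
  arr : ℕ → ℤ → ℤ

/-- Assign `v` to the variable `x`. -/
def State.setVar (s : State) (x : ℕ) (v : ℤ) : State :=
  { s with var := Function.update s.var x v }

/-- Assign `v` to the cell `i` of the array `A`. -/
def State.setArr (s : State) (A : ℕ) (i v : ℤ) : State :=
  { s with arr := Function.update s.arr A (Function.update (s.arr A) i v) }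

/-- `Exec B P s t s'`: the program `P`, started in `s`, halts in `s'` after exactly `t` steps, and
each constant and each result of an operation has absolute value at most `B` (so the words have
about `log₂ B` bits). If some value would exceed `B`, then there is no execution. -/
inductive Exec (B : ℕ) : Program → State → ℕ → State → Prop
  | skip (s : State) : Exec B .skip s 0 s
  | const (s : State) (x : ℕ) (c : ℤ) (h : |c| ≤ B) :
      Exec B (.const x c) s 1 (s.setVar x c)
  | arith (s : State) (o : BinOp) (x y z : ℕ) (h : |o.eval (s.var y) (s.var z)| ≤ B) :
      Exec B (.arith o x y z) s 1 (s.setVar x (o.eval (s.var y) (s.var z)))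
  | sqrt (s : State) (x y : ℕ) (h : 0 ≤ s.var y) (h' : (Nat.sqrt (s.var y).toNat : ℤ) ≤ B) :
      Exec B (.sqrt x y) s 1 (s.setVar x (Nat.sqrt (s.var y).toNat))
  | load (s : State) (x A i : ℕ) :
      Exec B (.load x A i) s 1 (s.setVar x (s.arr A (s.var i)))
  | store (s : State) (A i x : ℕ) :
      Exec B (.store A i x) s 1 (s.setArr A (s.var i) (s.var x))
  | seq {P Q : Program} {s s₁ s₂ : State} {t₁ t₂ : ℕ}
      (h₁ : Exec B P s t₁ s₁) (h₂ : Exec B Q s₁ t₂ s₂) : Exec B (.seq P Q) s (t₁ + t₂) s₂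
  | cond_true {x y : ℕ} {P Q : Program} {s s₁ : State} {t : ℕ}
      (h : s.var x < s.var y) (h₁ : Exec B P s t s₁) : Exec B (.cond x y P Q) s (t + 1) s₁
  | cond_false {x y : ℕ} {P Q : Program} {s s₁ : State} {t : ℕ}
      (h : ¬ s.var x < s.var y) (h₁ : Exec B Q s t s₁) : Exec B (.cond x y P Q) s (t + 1) s₁
  | loop_done {x y : ℕ} {P : Program} {s : State}
      (h : ¬ s.var x < s.var y) : Exec B (.loop x y P) s 1 s
  | loop_step {x y : ℕ} {P : Program} {s s₁ s₂ : State} {t₁ t₂ : ℕ}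
      (h : s.var x < s.var y) (h₁ : Exec B P s t₁ s₁) (h₂ : Exec B (.loop x y P) s₁ t₂ s₂) :
      Exec B (.loop x y P) s (t₁ + 1 + t₂) s₂

end WordRAM

/-! ## Convex polygons with rational vertices -/

/-- Twice the signed area of the triangle `u v w`; it is positive iff `w` lies strictly to the left
of the line directed from `u` to `v`. -/
def orient (u v w : EuclideanSpace ℝ (Fin 2)) : ℝ :=
  (v 0 - u 0) * (w 1 - u 1) - (v 1 - u 1) * (w 0 - u 0)

/-- The data that describe a polygon to the machine: `k` vertices in cyclic order, whose coordinates
are fractions of integers (not necessarily reduced), and, for each side (without its endpoints) and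
each vertex, the information whether it belongs to the polygon. Side `i` joins vertex `i` to its
cyclic successor `finRotate k i`. -/
structure PolygonData (k : ℕ) where
  xNum : Fin k → ℤ
  xDen : Fin k → ℤ
  yNum : Fin k → ℤ
  yDen : Fin k → ℤ
  sideMem : Fin k → Bool
  vertexMem : Fin k → Bool

namespace PolygonData

variable {k : ℕ}

/-- The `i`-th vertex. -/
noncomputable def vertex (P : PolygonData k) (i : Fin k) : EuclideanSpace ℝ (Fin 2) :=
  !₂[(P.xNum i : ℝ) / (P.xDen i : ℝ), (P.yNum i : ℝ) / (P.yDen i : ℝ)]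

/-- `P` describes a convex polygon with exactly the `k` vertices `P.vertex i`, listed in one of the
two cyclic orders: the polygon lies on one and the same side of every side line, and a side line
contains no vertices except the two endpoints of the side. -/
structure IsConvexPolygon (P : PolygonData k) : Prop where
  three_le : 3 ≤ k
  xDen_pos : ∀ i, 0 < P.xDen i
  yDen_pos : ∀ i, 0 < P.yDen i
  convex :
    (∀ i j, j ≠ i → j ≠ finRotate k i →
      0 < orient (P.vertex i) (P.vertex (finRotate k i)) (P.vertex j)) ∨
    (∀ i j, j ≠ i → j ≠ finRotate k i →
      orient (P.vertex i) (P.vertex (finRotate k i)) (P.vertex j) < 0)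

/-- The perimeter. -/
noncomputable def perimeter (P : PolygonData k) : ℝ :=
  ∑ i, dist (P.vertex i) (P.vertex (finRotate k i))

/-- The polygon as a set of points: the interior of the convex hull of the vertices, together with
those open sides and those vertices that are marked as belonging to it. -/
def region (P : PolygonData k) : Set (EuclideanSpace ℝ (Fin 2)) :=
  interior (convexHull ℝ (Set.range P.vertex)) ∪
    {q | ∃ i, P.sideMem i = true ∧ q ∈ openSegment ℝ (P.vertex i) (P.vertex (finRotate k i))} ∪
    {q | ∃ i, P.vertexMem i = true ∧ q = P.vertex i}

end PolygonData

/-! ## The computational problem -/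

open Classical in
/-- The partial sum `∑ a_i b_j` over the integer points `(i, j)` of the polygon with `i + j = m`,
where the sequences are `a_0, …, a_n` and `b_0, …, b_n` (terms with other indices count as `0`). -/
noncomputable def diagonalSum {n k : ℕ} (a b : Fin (n + 1) → ℤ) (P : PolygonData k) (m : ℤ) : ℤ :=
  ∑ i : Fin (n + 1), ∑ j : Fin (n + 1),
    if (i : ℤ) + (j : ℤ) = m ∧ !₂[((i : ℕ) : ℝ), ((j : ℕ) : ℝ)] ∈ P.region then a i * b j else 0

/-- The array with the entries `f 0, …, f (l - 1)` at the indices `0, …, l - 1`, and `0` at all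
other indices. -/
def toArray {l : ℕ} (f : Fin l → ℤ) (z : ℤ) : ℤ :=
  if h : 0 ≤ z ∧ z.toNat < l then f ⟨z.toNat, h.2⟩ else 0

/-- The initial memory: variable `0` holds `n`, variable `1` holds `k`, the arrays `0` to `7` hold
the two sequences and the description of the polygon, and everything else is `0`. -/
def inputState {n k : ℕ} (a b : Fin (n + 1) → ℤ) (P : PolygonData k) : WordRAM.State where
  var
    | 0 => n
    | 1 => k
    | _ => 0
  arr
    | 0 => toArray a
    | 1 => toArray b
    | 2 => toArray P.xNum
    | 3 => toArray P.xDen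
    | 4 => toArray P.yNum
    | 5 => toArray P.yDen
    | 6 => toArray fun i => if P.sideMem i then 1 else 0
    | 7 => toArray fun i => if P.vertexMem i then 1 else 0
    | _ => fun _ => 0

/-- The array that holds the result when the program halts. -/
def outputArray (s : WordRAM.State) : ℤ → ℤ := s.arr 8

/-- All numbers in the input are at most `W` in absolute value. -/
structure InputBounded {n k : ℕ} (a b : Fin (n + 1) → ℤ) (P : PolygonData k) (W : ℕ) : Prop where
  n_le : n ≤ W
  k_le : k ≤ W
  a_le : ∀ i, |a i| ≤ W
  b_le : ∀ i, |b i| ≤ W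
  xNum_le : ∀ i, |P.xNum i| ≤ W
  xDen_le : ∀ i, |P.xDen i| ≤ W
  yNum_le : ∀ i, |P.yNum i| ≤ W
  yDen_le : ∀ i, |P.yDen i| ≤ W

namespace WordRAM

/-! ## A small imperative language that compiles to the machine -/

/-! The sum splits over three disjoint sets of lattice points: marked vertices, marked open sides,
and the interior (`PolygonData.Oriented.latticeSum_region`). The first two are treated point by
point. A vertex costs constant time; a side is scanned column by column, or row by row if it is
vertical, at a cost proportional to its length plus a constant. All of this takes O(k + p) steps.

By convexity the interior lattice points of a column `c` are those with `lo c < j ≤ hi c`, and the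
scan of the sides produces both ends (`PolygonData.Profile.mem_interiorPoints`). Hence the interior
sum is the difference of two sums over regions with a common base line, one below `hi` and one below
`lo` (`PolygonData.Profile.latticeSum_interior`). Since `hi` is quasiconcave and `lo` quasiconvex,
the heights of both regions have total variation O(Q), where Q = O(p + 1) bounds the width and the
height of the polygon.

Such a region is cut into rectangles by a complete binary tree over its columns in which every node
holds the minimal height of its columns. To a node belongs the rectangle over its columns between
the minimum of the parent and its own minimum. Along the path to a leaf these pieces stack up to the
whole column (`MinHeap.sum_nodeSum`). Of two siblings one has the value of the parent, so the
rectangle heights on one level add up to sibling differences and are bounded by the variation on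
that level. Taking pairwise minima does not increase variation (`MinHeap.sum_abs_min_le`), so every
level has total width plus height O(Q) (`MinHeap.sum_sub_half_le`).

A rectangle with sides n and d contributes the convolution of two segments of the sequences, which a
fast Fourier transform computes in O((n + d) log (n + d)) steps (`WordRAM.convolve_spec`). With
O(log Q) levels this gives O(Q (log Q)²) for each region (`WordRAM.treeAdd_spec`).

Words have only O(log (W + 2)) bits, so the transform works with fixed point complex numbers at a
scale polynomial in the length and the entries of the segments. The roots of unity come from
half-angle formulas and integer square roots. The accumulated error stays below the rounding
threshold (`FFT.error_bounds`), so that rounding returns the exact integers (`FFT.round_eq`).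

The programs are written in a small language and verified with triples `Cmd.Spec` that carry a time
bound, a word bound and a frame. For p ≥ 2 the number of steps is O(k + p (log p)²), for p < 2 it is
O(k); the factor log k enters only through log k ≥ 1 (`time_le`). -/

theorem State.var_setVar (s : State) (x : ℕ) (v : ℤ) (y : ℕ) :
    (s.setVar x v).var y = if y = x then v else s.var y := by
  simp [State.setVar, Function.update_apply]

@[simp] theorem State.arr_setVar (s : State) (x : ℕ) (v : ℤ) : (s.setVar x v).arr = s.arr := rfl

@[simp] theorem State.var_setArr (s : State) (A : ℕ) (i v : ℤ) : (s.setArr A i v).var = s.var := rfl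

theorem State.arr_setArr (s : State) (A : ℕ) (i v : ℤ) (A' : ℕ) (j : ℤ) :
    (s.setArr A i v).arr A' j = if A' = A ∧ j = i then v else s.arr A' j := by
  by_cases h : A' = A
  · subst h; simp [State.setArr, Function.update_apply]
  · simp [State.setArr, h]

/-- Integer expressions over the variables and arrays. -/
inductive Ex
  | v (x : ℕ)
  | c (z : ℤ)
  | op (o : BinOp) (e f : Ex)
  | ld (A : ℕ) (e : Ex)
  | sq (e : Ex)

namespace Ex

/-- The value of an expression. -/
def eval (s : State) : Ex → ℤ
  | v x => s.var x
  | c z => z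
  | op o e f => o.eval (e.eval s) (f.eval s)
  | ld A e => s.arr A (e.eval s)
  | sq e => Nat.sqrt (e.eval s).toNat

/-- Only the variables below `100` occur, all intermediate values have absolute value at most `B`,
and square roots are taken of nonnegative numbers only. -/
def ok (B : ℕ) (s : State) : Ex → Prop
  | v x => x < 100
  | c z => |z| ≤ B
  | op o e f => e.ok B s ∧ f.ok B s ∧ |o.eval (e.eval s) (f.eval s)| ≤ B
  | ld _ e => e.ok B s
  | sq e => e.ok B s ∧ 0 ≤ e.eval s ∧ (Nat.sqrt (e.eval s).toNat : ℤ) ≤ B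

/-- The condition under which an expression can be assigned to a variable. -/
def okTo (B : ℕ) (s : State) : Ex → Prop
  | v x => x < 100 ∧ |s.var x| ≤ B
  | e => e.ok B s

/-- The number of instructions needed for the evaluation. -/
def cost : Ex → ℕ
  | v _ => 0
  | c _ => 1
  | op _ e f => e.cost + f.cost + 1
  | ld _ e => e.cost + 1
  | sq e => e.cost + 1

/-- The register that holds the value after the evaluation with target register `r`. -/
def res : Ex → ℕ → ℕ
  | v x, _ => x
  | _, r => r

/-- The code for the evaluation with target register `r`. -/
def code : Ex → ℕ → Program
  | v _, _ => .skip
  | c z, r => .const r z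
  | op o e f, r => .seq (e.code r) (.seq (f.code (r + 1)) (.arith o r (e.res r) (f.res (r + 1))))
  | ld A e, r => .seq (e.code r) (.load r A (e.res r))
  | sq e, r => .seq (e.code r) (.sqrt r (e.res r))

/-- The code for assigning the value of an expression to the variable `x`. -/
def codeTo : Ex → ℕ → Program
  | v y, x => .seq (.const 100 0) (.arith .add x y 100)
  | c z, x => .const x z
  | op o e f, x => .seq (e.code 100) (.seq (f.code 101) (.arith o x (e.res 100) (f.res 101)))
  | ld A e, x => .seq (e.code 100) (.load x A (e.res 100))
  | sq e, x => .seq (e.code 100) (.sqrt x (e.res 100))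

end Ex

/-- The states agree up to the variables from `100` on, which hold intermediate results. -/
def Agree (r s : State) : Prop := r.arr = s.arr ∧ ∀ x < 100, r.var x = s.var x

theorem Agree.refl (s : State) : Agree s s := ⟨rfl, fun _ _ => rfl⟩

theorem Agree.setTemp {r s : State} (h : Agree r s) {x : ℕ} (hx : 100 ≤ x) (v : ℤ) :
    Agree (r.setVar x v) s :=
  ⟨h.1, fun y hy => by rw [State.var_setVar, if_neg (by omega)]; exact h.2 y hy⟩

theorem Agree.setVar {r s : State} (h : Agree r s) (x : ℕ) (v : ℤ) :
    Agree (r.setVar x v) (s.setVar x v) :=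
  ⟨h.1, fun y hy => by simp only [State.var_setVar, h.2 y hy]⟩

theorem Agree.setArr {r s : State} (h : Agree r s) (A : ℕ) (i v : ℤ) :
    Agree (r.setArr A i v) (s.setArr A i v) :=
  ⟨by simp [State.setArr, h.1], h.2⟩

/-- Code with target `r` writes only to registers from `r` on. This keeps the value of a left
operand alive in `r` while the right operand is evaluated with target `r + 1`; an operand that is a
plain variable lies below `100` and is never overwritten. -/
theorem Ex.code_exec {B : ℕ} {s : State} (e : Ex) : ∀ (r : ℕ) (s₀ : State), 100 ≤ r → Agree s₀ s →
    e.ok B s → ∃ s₁, Exec B (e.code r) s₀ e.cost s₁ ∧ Agree s₁ s ∧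
      (∀ x < r, s₁.var x = s₀.var x) ∧ s₁.var (e.res r) = e.eval s := by
  induction e with
  | v x =>
    intro r s₀ hr ha hok
    exact ⟨s₀, .skip _, ha, fun _ _ => rfl, ha.2 x hok⟩
  | c z =>
    intro r s₀ hr ha hok
    exact ⟨_, .const _ _ _ hok, ha.setTemp hr _,
      fun x hx => by rw [State.var_setVar, if_neg (by omega)], by simp [State.var_setVar, res, eval]⟩
  | op o e f ihe ihf =>
    intro r s₀ hr ha hok
    obtain ⟨s₁, e₁, a₁, k₁, v₁⟩ := ihe r s₀ hr ha hok.1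
    obtain ⟨s₂, e₂, a₂, k₂, v₂⟩ := ihf (r + 1) s₁ (by omega) a₁ hok.2.1
    have hv : s₂.var (e.res r) = e.eval s := by
      rw [← v₁]
      cases e with
      | v x => exact (a₂.2 x hok.1).trans (a₁.2 x hok.1).symm
      | _ => exact k₂ r (by omega)
    refine ⟨_, ?_, a₂.setTemp hr ((Ex.op o e f).eval s), ?_, by simp [State.var_setVar, res]⟩
    · have := Exec.arith (B := B) s₂ o r (e.res r) (f.res (r + 1)) (by rw [hv, v₂]; exact hok.2.2)
      rw [hv, v₂] at this
      have := Exec.seq e₁ (Exec.seq e₂ this)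
      rw [show e.cost + (f.cost + 1) = (Ex.op o e f).cost by simp [cost]; ring] at this
      exact this
    · intro x hx
      rw [State.var_setVar, if_neg (by omega), k₂ x (by omega), k₁ x hx]
  | ld A e ih =>
    intro r s₀ hr ha hok
    obtain ⟨s₁, e₁, a₁, k₁, v₁⟩ := ih r s₀ hr ha hok
    refine ⟨_, Exec.seq e₁ (Exec.load s₁ r A (e.res r)), a₁.setTemp hr _, ?_, ?_⟩
    · intro x hx
      rw [State.var_setVar, if_neg (by omega), k₁ x hx]
    · rw [show (ld A e).res r = r from rfl, State.var_setVar, if_pos rfl, v₁, a₁.1]; rfl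
  | sq e ih =>
    intro r s₀ hr ha hok
    obtain ⟨s₁, e₁, a₁, k₁, v₁⟩ := ih r s₀ hr ha hok.1
    refine ⟨_, Exec.seq e₁ (Exec.sqrt s₁ r (e.res r) (by rw [v₁]; exact hok.2.1)
      (by rw [v₁]; exact hok.2.2)), a₁.setTemp hr _, ?_, ?_⟩
    · intro x hx
      rw [State.var_setVar, if_neg (by omega), k₁ x hx]
    · rw [show (sq e).res r = r from rfl, State.var_setVar, if_pos rfl, v₁]; rfl

theorem Ex.code_exec_two {B : ℕ} {s : State} (e f : Ex) (s₀ : State) (ha : Agree s₀ s)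
    (he : e.ok B s) (hf : f.ok B s) :
    ∃ s₁, Exec B (.seq (e.code 100) (f.code 101)) s₀ (e.cost + f.cost) s₁ ∧ Agree s₁ s ∧
      s₁.var (e.res 100) = e.eval s ∧ s₁.var (f.res 101) = f.eval s := by
  obtain ⟨s₁, e₁, a₁, -, v₁⟩ := e.code_exec 100 s₀ le_rfl ha he
  obtain ⟨s₂, e₂, a₂, k₂, v₂⟩ := f.code_exec 101 s₁ (by omega) a₁ hf
  refine ⟨s₂, .seq e₁ e₂, a₂, ?_, v₂⟩
  rw [← v₁]
  cases e with
  | v x => exact (a₂.2 x he).trans (a₁.2 x he).symm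
  | _ => exact k₂ 100 (by omega)

/-- The machine has no move instruction: a variable is copied by adding `0`, which accounts for the
two extra steps and for the size condition on variables in `okTo`. -/
theorem Ex.codeTo_exec {B : ℕ} {s : State} (e : Ex) (x : ℕ) (s₀ : State) (ha : Agree s₀ s)
    (hok : e.okTo B s) :
    ∃ t s₁, Exec B (e.codeTo x) s₀ t s₁ ∧ t ≤ e.cost + 2 ∧ Agree s₁ (s.setVar x (e.eval s)) := by
  cases e with
  | v y =>
    have hy : (s₀.setVar 100 0).var y = s.var y := by
      rw [State.var_setVar, if_neg (by have := hok.1; omega), ha.2 y hok.1]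
    have h0 : (s₀.setVar 100 0).var 100 = 0 := by simp [State.var_setVar]
    have := Exec.arith (B := B) (s₀.setVar 100 0) .add x y 100
      (by rw [hy, h0]; simpa [BinOp.eval] using hok.2)
    refine ⟨_, _, .seq (.const _ _ _ (by simp)) this, by simp [cost], ?_⟩
    rw [hy, h0]
    simpa [BinOp.eval, eval] using (ha.setTemp le_rfl 0).setVar x (s.var y)
  | c z => exact ⟨_, _, .const _ _ _ hok, by simp [cost], ha.setVar _ _⟩
  | op o e f =>
    obtain ⟨s₁, e₁, a₁, k₁, v₁⟩ := e.code_exec 100 s₀ le_rfl ha hok.1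
    obtain ⟨s₂, e₂, a₂, k₂, v₂⟩ := f.code_exec 101 s₁ (by omega) a₁ hok.2.1
    have hv : s₂.var (e.res 100) = e.eval s := by
      rw [← v₁]
      cases e with
      | v x => exact (a₂.2 x hok.1).trans (a₁.2 x hok.1).symm
      | _ => exact k₂ 100 (by omega)
    have := Exec.arith (B := B) s₂ o x (e.res 100) (f.res 101) (by rw [hv, v₂]; exact hok.2.2)
    refine ⟨_, _, .seq e₁ (.seq e₂ this), by simp [cost]; omega, ?_⟩
    rw [hv, v₂]
    exact a₂.setVar _ _
  | ld A e =>
    obtain ⟨s₁, e₁, a₁, k₁, v₁⟩ := e.code_exec 100 s₀ le_rfl ha hok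
    refine ⟨_, _, .seq e₁ (.load _ _ _ _), by simp [cost], ?_⟩
    rw [v₁, a₁.1]
    exact a₁.setVar _ _
  | sq e =>
    obtain ⟨s₁, e₁, a₁, k₁, v₁⟩ := e.code_exec 100 s₀ le_rfl ha hok.1
    refine ⟨_, _, .seq e₁ (Exec.sqrt _ _ _ (by rw [v₁]; exact hok.2.1)
      (by rw [v₁]; exact hok.2.2)), by simp [cost], ?_⟩
    rw [v₁]
    exact a₁.setVar _ _

/-- Commands. -/
inductive Cmd
  | skip
  | assign (x : ℕ) (e : Ex)
  | store (A : ℕ) (i e : Ex)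
  | seq (P Q : Cmd)
  | ite (e f : Ex) (P Q : Cmd)
  | loop (e f : Ex) (P : Cmd)

namespace Cmd

/-- The translation into programs. -/
def compile : Cmd → Program
  | skip => .skip
  | assign x e => e.codeTo x
  | store A i e => .seq (.seq (i.code 100) (e.code 101)) (.store A (i.res 100) (e.res 101))
  | seq P Q => .seq P.compile Q.compile
  | ite e f P Q =>
    .seq (.seq (e.code 100) (f.code 101)) (.cond (e.res 100) (f.res 101) P.compile Q.compile)
  | .loop e f P =>
    .seq (.seq (e.code 100) (f.code 101))
      (.loop (e.res 100) (f.res 101) (.seq P.compile (.seq (e.code 100) (f.code 101))))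

/-- A bound for the number of steps of a command without loops. -/
def cost : Cmd → ℕ
  | skip => 0
  | assign _ e => e.cost + 2
  | store _ i e => i.cost + e.cost + 1
  | seq P Q => P.cost + Q.cost
  | ite e f P Q => e.cost + f.cost + 1 + max P.cost Q.cost
  | .loop _ _ _ => 0

/-- The weakest precondition of a command without loops. -/
def wp (B : ℕ) : Cmd → (State → Prop) → State → Prop
  | skip, Q, s => Q s
  | assign x e, Q, s => e.okTo B s ∧ Q (s.setVar x (e.eval s))
  | store A i e, Q, s => i.ok B s ∧ e.ok B s ∧ Q (s.setArr A (i.eval s) (e.eval s))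
  | seq P R, Q, s => P.wp B (R.wp B Q) s
  | ite e f P R, Q, s => e.ok B s ∧ f.ok B s ∧
      (e.eval s < f.eval s → P.wp B Q s) ∧ (¬ e.eval s < f.eval s → R.wp B Q s)
  | .loop _ _ _, _, _ => False

/-- The command assigns to the variable `x`. -/
def setsVar (x : ℕ) : Cmd → Bool
  | skip => false
  | assign y _ => x == y
  | store _ _ _ => false
  | seq P Q => P.setsVar x || Q.setsVar x
  | ite _ _ P Q => P.setsVar x || Q.setsVar x
  | .loop _ _ P => P.setsVar x

/-- The command writes into the array `A`. -/
def setsArr (A : ℕ) : Cmd → Bool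
  | skip => false
  | assign _ _ => false
  | store A' _ _ => A == A'
  | seq P Q => P.setsArr A || Q.setsArr A
  | ite _ _ P Q => P.setsArr A || Q.setsArr A
  | .loop _ _ P => P.setsArr A

/-- The states differ only in variables and arrays that the command modifies. -/
structure Frame (P : Cmd) (s s' : State) : Prop where
  var : ∀ x, x < 100 → P.setsVar x = false → s'.var x = s.var x
  arr : ∀ A, P.setsArr A = false → s'.arr A = s.arr A

theorem Frame.refl (P : Cmd) (s : State) : P.Frame s s := ⟨fun _ _ _ => rfl, fun _ _ => rfl⟩

theorem Frame.trans {P : Cmd} {s s' s'' : State} (h : P.Frame s s') (h' : P.Frame s' s'') :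
    P.Frame s s'' :=
  ⟨fun x h₁ h₂ => (h'.var x h₁ h₂).trans (h.var x h₁ h₂),
    fun A h₁ => (h'.arr A h₁).trans (h.arr A h₁)⟩

theorem Frame.mono {P Q : Cmd} {s s' : State} (h : P.Frame s s')
    (hv : ∀ x, Q.setsVar x = false → P.setsVar x = false)
    (ha : ∀ A, Q.setsArr A = false → P.setsArr A = false) : Q.Frame s s' :=
  ⟨fun x h₁ h₂ => h.var x h₁ (hv x h₂), fun A h₁ => h.arr A (ha A h₁)⟩

/-- Started in `s`, the command halts after at most `T` steps in a state that satisfies `Q` and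
respects the frame of the command; all words have absolute value at most `B`. -/
def Spec (B : ℕ) (P : Cmd) (s : State) (T : ℕ) (Q : State → Prop) : Prop :=
  ∀ r, Agree r s → ∃ t r' s', Exec B P.compile r t r' ∧ t ≤ T ∧ Agree r' s' ∧ P.Frame s s' ∧ Q s'

variable {B : ℕ}

theorem Spec.mono {P : Cmd} {s : State} {T T' : ℕ} {Q Q' : State → Prop} (h : P.Spec B s T Q)
    (hT : T ≤ T') (hQ : ∀ s', P.Frame s s' → Q s' → Q' s') : P.Spec B s T' Q' := by
  intro r hr
  obtain ⟨t, r', s', h₁, h₂, h₃, h₄, h₅⟩ := h r hr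
  exact ⟨t, r', s', h₁, h₂.trans hT, h₃, h₄, hQ s' h₄ h₅⟩

theorem Spec.seq {P R : Cmd} {s : State} {T T' : ℕ} {Q Q' : State → Prop} (h : P.Spec B s T Q)
    (h' : ∀ s', P.Frame s s' → Q s' → R.Spec B s' T' Q') : (P.seq R).Spec B s (T + T') Q' := by
  intro r hr
  obtain ⟨t, r', s', h₁, h₂, h₃, h₄, h₅⟩ := h r hr
  obtain ⟨t', r'', s'', h₁', h₂', h₃', h₄', h₅'⟩ := h' s' h₄ h₅ r' h₃
  refine ⟨_, r'', s'', .seq h₁ h₁', by omega, h₃', Frame.trans (h₄.mono ?_ ?_) (h₄'.mono ?_ ?_), h₅'⟩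
    <;> simp +contextual [setsVar, setsArr]

theorem Spec.of_wp {P : Cmd} : ∀ {s : State} {Q : State → Prop}, P.wp B Q s → P.Spec B s P.cost Q := by
  induction P with
  | skip =>
    intro s Q h r hr
    exact ⟨_, _, s, .skip _, le_rfl, hr, .refl _ _, h⟩
  | assign x e =>
    intro s Q h r hr
    obtain ⟨t, s₁, h₁, h₂, h₃⟩ := e.codeTo_exec x r hr h.1
    refine ⟨t, s₁, _, h₁, h₂, h₃, ⟨fun y _ hy => ?_, fun _ _ => rfl⟩, h.2⟩
    rw [State.var_setVar, if_neg (by simpa [setsVar] using hy)]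
  | store A i e =>
    intro s Q h r hr
    obtain ⟨s₁, h₁, h₂, h₃, h₄⟩ := i.code_exec_two e r hr h.1 h.2.1
    refine ⟨_, _, _, .seq h₁ (.store _ _ _ _), le_rfl, h₂.setArr _ _ _,
      ⟨fun y _ hy => rfl, fun A' hA => ?_⟩, ?_⟩
    · funext j
      rw [State.arr_setArr, if_neg (by simp [setsArr] at hA; tauto)]
    · rw [h₃, h₄]; exact h.2.2
  | seq P R ihP ihR =>
    intro s Q h
    exact (ihP h).seq fun s' _ hs' => ihR hs'
  | ite e f P R ihP ihR =>
    intro s Q h r hr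
    obtain ⟨s₁, h₁, h₂, h₃, h₄⟩ := e.code_exec_two f r hr h.1 h.2.1
    by_cases hc : e.eval s < f.eval s
    · obtain ⟨t, r', s', i₁, i₂, i₃, i₄, i₅⟩ := ihP (h.2.2.1 hc) s₁ h₂
      refine ⟨_, r', s', .seq h₁ (.cond_true (by rwa [h₃, h₄]) i₁), ?_, i₃, i₄.mono ?_ ?_, i₅⟩
      · simp only [cost]; omega
      all_goals simp +contextual [setsVar, setsArr]
    · obtain ⟨t, r', s', i₁, i₂, i₃, i₄, i₅⟩ := ihR (h.2.2.2 hc) s₁ h₂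
      refine ⟨_, r', s', .seq h₁ (.cond_false (by rwa [h₃, h₄]) i₁), ?_, i₃, i₄.mono ?_ ?_, i₅⟩
      · simp only [cost]; omega
      all_goals simp +contextual [setsVar, setsArr]
  | loop e f P ih =>
    intro s Q h
    exact h.elim

theorem Spec.ite {e f : Ex} {P R : Cmd} {s : State} {T : ℕ} {Q : State → Prop} (he : e.ok B s)
    (hf : f.ok B s) (hP : e.eval s < f.eval s → P.Spec B s T Q)
    (hR : ¬ e.eval s < f.eval s → R.Spec B s T Q) :
    (Cmd.ite e f P R).Spec B s (e.cost + f.cost + 1 + T) Q := by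
  intro r hr
  obtain ⟨s₁, h₁, h₂, h₃, h₄⟩ := e.code_exec_two f r hr he hf
  by_cases hc : e.eval s < f.eval s
  · obtain ⟨t, r', s', i₁, i₂, i₃, i₄, i₅⟩ := hP hc s₁ h₂
    refine ⟨_, r', s', .seq h₁ (.cond_true (by rwa [h₃, h₄]) i₁), by omega, i₃, i₄.mono ?_ ?_, i₅⟩
    all_goals simp +contextual [setsVar, setsArr]
  · obtain ⟨t, r', s', i₁, i₂, i₃, i₄, i₅⟩ := hR hc s₁ h₂
    refine ⟨_, r', s', .seq h₁ (.cond_false (by rwa [h₃, h₄]) i₁), by omega, i₃, i₄.mono ?_ ?_, i₅⟩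
    all_goals simp +contextual [setsVar, setsArr]

/-- The invariant is indexed by the number of completed rounds and the number `n` of rounds is fixed
beforehand. The time `T i` may vary with the round, which allows amortized bounds such as the one
for a level of the tree. -/
theorem Spec.loop {e f : Ex} {P : Cmd} {s : State} (n : ℕ) (I : ℕ → State → Prop) (T : ℕ → ℕ)
    (h₀ : I 0 s)
    (hok : ∀ i ≤ n, ∀ s', I i s' → P.Frame s s' → e.ok B s' ∧ f.ok B s')
    (step : ∀ i < n, ∀ s', I i s' → P.Frame s s' →
      e.eval s' < f.eval s' ∧ P.Spec B s' (T i) (I (i + 1)))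
    (hend : ∀ s', I n s' → P.Frame s s' → ¬ e.eval s' < f.eval s') :
    (Cmd.loop e f P).Spec B s
      (∑ i ∈ Finset.range n, (T i + (e.cost + f.cost + 1)) + (e.cost + f.cost + 1)) (I n) := by
  -- Induction on the number `m` of remaining rounds. On entry both operands of the test are already
  -- in their registers, because the compiled body ends by evaluating them again.
  have main : ∀ m ≤ n, ∀ (s' r : State), I (n - m) s' → P.Frame s s' → Agree r s' →
      r.var (e.res 100) = e.eval s' → r.var (f.res 101) = f.eval s' →
      ∃ t r' s'', Exec B (.loop (e.res 100) (f.res 101)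
          (.seq P.compile (.seq (e.code 100) (f.code 101)))) r t r' ∧
        t ≤ ∑ i ∈ Finset.Ico (n - m) n, (T i + (e.cost + f.cost + 1)) + 1 ∧
        Agree r' s'' ∧ P.Frame s s'' ∧ I n s'' := by
    intro m
    induction m with
    | zero =>
      intro _ s' r hI hF hA he hf
      exact ⟨1, r, s', .loop_done (by rw [he, hf]; exact hend s' hI hF), by simp, hA, hF, hI⟩
    | succ m ih =>
      intro hm s' r hI hF hA he hf
      obtain ⟨hlt, hs⟩ := step (n - (m + 1)) (by omega) s' hI hF
      obtain ⟨t, r', s'', h₁, h₂, h₃, h₄, h₅⟩ := hs r hA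
      rw [show n - (m + 1) + 1 = n - m by omega] at h₅
      obtain ⟨oe, of⟩ := hok (n - m) (by omega) s'' h₅ (hF.trans h₄)
      obtain ⟨r'', k₁, k₂, k₃, k₄⟩ := e.code_exec_two f r' h₃ oe of
      obtain ⟨t', q', q'', l₁, l₂, l₃, l₄, l₅⟩ :=
        ih (by omega) s'' r'' h₅ (hF.trans h₄) k₂ k₃ k₄
      refine ⟨_, q', q'', .loop_step (by rw [he, hf]; exact hlt) (.seq h₁ k₁) l₁, ?_, l₃, l₄, l₅⟩
      rw [Finset.sum_eq_sum_Ico_succ_bot (by omega), show n - (m + 1) + 1 = n - m by omega]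
      omega
  intro r hr
  obtain ⟨oe, of⟩ := hok 0 (by omega) s h₀ (.refl _ _)
  obtain ⟨r₁, k₁, k₂, k₃, k₄⟩ := e.code_exec_two f r hr oe of
  obtain ⟨t, r', s', l₁, l₂, l₃, l₄, l₅⟩ :=
    main n le_rfl s r₁ (by simpa using h₀) (.refl _ _) k₂ k₃ k₄
  refine ⟨_, r', s', .seq k₁ l₁, ?_, l₃, l₄.mono (fun _ h => h) (fun _ h => h), l₅⟩
  rw [Nat.sub_self, Nat.Ico_zero_eq_range] at l₂
  omega

/-- The loop `while x < y do (P; x := x + 1)`. -/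
def forUp (x y : ℕ) (P : Cmd) : Cmd :=
  .loop (.v x) (.v y) (P.seq (.assign x (.op .add (.v x) (.c 1))))

/-- Besides the body, a round costs one step for the test and at most four for the increment. The
invariant has to hold after the increment, hence `setVar` in the postcondition of the body. -/
theorem Spec.forUp {x y : ℕ} {P : Cmd} {s : State} (lo hi : ℤ) (I : ℕ → State → Prop) (T : ℕ → ℕ)
    (hx : x < 100) (hy : y < 100) (hPx : P.setsVar x = false) (hPy : P.setsVar y = false)
    (hxy : x ≠ y) (hlo : s.var x = lo) (hhi : s.var y = hi) (hB : 1 ≤ B)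
    (hBlo : |lo| ≤ B) (hBhi : |hi| ≤ B) (h₀ : I 0 s)
    (step : ∀ i : ℕ, lo + i < hi → ∀ s', s'.var x = lo + i → I i s' →
      (P.seq (.assign x (.op .add (.v x) (.c 1)))).Frame s s' →
      P.Spec B s' (T i) (fun s'' => I (i + 1) (s''.setVar x (lo + i + 1)))) :
    (P.forUp x y).Spec B s (∑ i ∈ Finset.range (hi - lo).toNat, (T i + 5) + 1)
      (fun s' => I (hi - lo).toNat s') := by
  have key := Spec.loop (B := B) (e := .v x) (f := .v y)
    (P := P.seq (.assign x (.op .add (.v x) (.c 1)))) (s := s) (hi - lo).toNat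
    (fun i s' => s'.var x = lo + i ∧ I i s') (fun i => T i + 4) ⟨by simpa using hlo, h₀⟩
    (fun i _ s' _ _ => ⟨hx, hy⟩) (fun i hi' s' hI hF => ?_) (fun s' hI hF => ?_)
  · exact key.mono le_rfl (fun s' _ h => h.2)
  · have hvy : s'.var y = hi := by
      rw [hF.var y hy (by simp [setsVar, hPy, hxy.symm]), hhi]
    refine ⟨by simp only [Ex.eval, hI.1, hvy]; omega, ?_⟩
    refine (Spec.seq (step i (by omega) s' hI.1 hI.2 hF) (T' := 4)
      (Q' := fun s' => s'.var x = lo + ↑(i + 1) ∧ I (i + 1) s') fun s'' hF' hI' => ?_).mono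
      le_rfl (fun s' _ h => h)
    have hvx : s''.var x = lo + i := by rw [hF'.var x hx hPx, hI.1]
    have hb : |lo + i + 1| ≤ (B : ℤ) := by
      rw [abs_le] at *
      constructor <;> omega
    refine (Spec.of_wp (B := B) (P := .assign x (.op .add (.v x) (.c 1))) ?_).mono
      (by simp [cost, Ex.cost]) (fun _ _ h => h)
    simp only [wp, Ex.okTo, Ex.ok, Ex.eval, BinOp.eval, hvx]
    exact ⟨⟨hx, by simpa using hB, hb⟩, by simp [State.var_setVar]; ring, hI'⟩
  · have hvy : s'.var y = hi := by
      rw [hF.var y hy (by simp [setsVar, hPy, hxy.symm]), hhi]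
    simp only [Ex.eval, hI.1, hvy]
    omega

end Cmd

end WordRAM

/-! ### Word sizes: bounding intermediate values by degrees -/

namespace WordRAM

namespace Ex

instance : Add Ex := ⟨.op .add⟩
instance : Sub Ex := ⟨.op .sub⟩
instance : Mul Ex := ⟨.op .mul⟩
instance : Div Ex := ⟨.op .div⟩
instance : Mod Ex := ⟨.op .mod⟩

/-- The variables below `100` and the array cells that are read have absolute value at most `V`,
constants are at most `16`, and square roots are taken of nonnegative numbers only. -/
def leafOk (V : ℕ) (s : State) : Ex → Prop
  | v x => x < 100 ∧ |s.var x| ≤ V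
  | c z => |z| ≤ 16
  | op _ e f => e.leafOk V s ∧ f.leafOk V s
  | ld A e => e.leafOk V s ∧ |s.arr A (e.eval s)| ≤ V
  | sq e => e.leafOk V s ∧ 0 ≤ e.eval s

/-- The exponent of a power of `V` that bounds the value and all intermediate values. -/
def deg : Ex → ℕ
  | v _ => 1
  | c _ => 1
  | op .mul e f => e.deg + f.deg
  | op _ e f => max e.deg f.deg + 1
  | ld _ e => max 1 e.deg
  | sq e => e.deg

@[simp] theorem eval_add (s : State) (e f : Ex) : (e + f).eval s = e.eval s + f.eval s := rfl
@[simp] theorem eval_sub (s : State) (e f : Ex) : (e - f).eval s = e.eval s - f.eval s := rfl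
@[simp] theorem eval_mul (s : State) (e f : Ex) : (e * f).eval s = e.eval s * f.eval s := rfl
@[simp] theorem eval_div (s : State) (e f : Ex) : (e / f).eval s = e.eval s / f.eval s := rfl
@[simp] theorem eval_mod (s : State) (e f : Ex) : (e % f).eval s = e.eval s % f.eval s := rfl
@[simp] theorem eval_v (s : State) (x : ℕ) : (v x).eval s = s.var x := rfl
@[simp] theorem eval_c (s : State) (z : ℤ) : (c z).eval s = z := rfl
@[simp] theorem eval_ld (s : State) (A : ℕ) (e : Ex) : (ld A e).eval s = s.arr A (e.eval s) := rfl
@[simp] theorem eval_sq (s : State) (e : Ex) : (sq e).eval s = Nat.sqrt (e.eval s).toNat := rfl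

section
variable (V : ℕ) (s : State) (e f : Ex)
@[simp] theorem leafOk_add : (e + f).leafOk V s ↔ e.leafOk V s ∧ f.leafOk V s := Iff.rfl
@[simp] theorem leafOk_sub : (e - f).leafOk V s ↔ e.leafOk V s ∧ f.leafOk V s := Iff.rfl
@[simp] theorem leafOk_mul : (e * f).leafOk V s ↔ e.leafOk V s ∧ f.leafOk V s := Iff.rfl
@[simp] theorem leafOk_div : (e / f).leafOk V s ↔ e.leafOk V s ∧ f.leafOk V s := Iff.rfl
@[simp] theorem leafOk_mod : (e % f).leafOk V s ↔ e.leafOk V s ∧ f.leafOk V s := Iff.rfl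
@[simp] theorem leafOk_v (x : ℕ) : (v x).leafOk V s ↔ x < 100 ∧ |s.var x| ≤ V := Iff.rfl
@[simp] theorem leafOk_c (z : ℤ) : (c z).leafOk V s ↔ |z| ≤ 16 := Iff.rfl
@[simp] theorem leafOk_ld (A : ℕ) :
    (ld A e).leafOk V s ↔ e.leafOk V s ∧ |s.arr A (e.eval s)| ≤ V := Iff.rfl
@[simp] theorem leafOk_sq : (sq e).leafOk V s ↔ e.leafOk V s ∧ 0 ≤ e.eval s := Iff.rfl
@[simp] theorem deg_add : (e + f).deg = max e.deg f.deg + 1 := rfl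
@[simp] theorem deg_sub : (e - f).deg = max e.deg f.deg + 1 := rfl
@[simp] theorem deg_mul : (e * f).deg = e.deg + f.deg := rfl
@[simp] theorem deg_div : (e / f).deg = max e.deg f.deg + 1 := rfl
@[simp] theorem deg_mod : (e % f).deg = max e.deg f.deg + 1 := rfl
@[simp] theorem deg_v (x : ℕ) : (v x).deg = 1 := rfl
@[simp] theorem deg_c (z : ℤ) : (c z).deg = 1 := rfl
@[simp] theorem deg_ld (A : ℕ) : (ld A e).deg = max 1 e.deg := rfl
@[simp] theorem deg_sq : (sq e).deg = e.deg := rfl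
end

theorem _root_.Int.abs_emod_le (x y : ℤ) : |x % y| ≤ |x| + |y| := by
  rcases eq_or_ne y 0 with rfl | hy
  · simp
  · rw [abs_of_nonneg (Int.emod_nonneg x hy)]
    have := Int.emod_lt_abs x hy
    have := abs_nonneg x
    omega

/-- Except for a product, the result is at most the sum of two powers of `V`, and a factor `V`
absorbs the sum. A zero divisor needs no exception: `x / 0 = 0` and `x % 0 = x`. -/
theorem BinOp_eval_bound {V : ℕ} (hV : 16 ≤ V) (o : BinOp) {x y : ℤ} {a b : ℕ}
    (hx : |x| ≤ (V : ℤ) ^ a) (hy : |y| ≤ (V : ℤ) ^ b) :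
    |o.eval x y| ≤ (V : ℤ) ^ (match o with | .mul => a + b | _ => max a b + 1) := by
  have hV' : (16 : ℤ) ≤ V := by exact_mod_cast hV
  have h₁ : (V : ℤ) ^ a ≤ V ^ max a b := pow_le_pow_right₀ (by omega) (le_max_left _ _)
  have h₂ : (V : ℤ) ^ b ≤ V ^ max a b := pow_le_pow_right₀ (by omega) (le_max_right _ _)
  have h₃ : (V : ℤ) ^ max a b + V ^ max a b ≤ V ^ (max a b + 1) := by
    rw [pow_succ]
    have : (0 : ℤ) ≤ V ^ max a b := by positivity
    nlinarith
  cases o with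
  | add => exact (abs_add_le x y).trans (by simp only []; omega)
  | sub => exact (abs_sub x y).trans (by simp only []; omega)
  | mul =>
    simp only [BinOp.eval, abs_mul, pow_add]
    exact mul_le_mul hx hy (abs_nonneg _) (by positivity)
  | div =>
    have := Int.abs_ediv_le_abs x y
    have : (0 : ℤ) ≤ V ^ max a b := by positivity
    simp only [BinOp.eval]; omega
  | mod =>
    have := Int.abs_emod_le x y
    simp only [BinOp.eval]; omega

theorem abs_eval_le {V : ℕ} (hV : 16 ≤ V) {s : State} {e : Ex} (h : e.leafOk V s) :
    |e.eval s| ≤ (V : ℤ) ^ e.deg := by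
  induction e with
  | v x => simpa using h.2
  | c z => have : |z| ≤ 16 := h; simp; omega
  | op o e f ihe ihf =>
    refine (BinOp_eval_bound hV o (ihe h.1) (ihf h.2)).trans (le_of_eq ?_)
    cases o <;> rfl
  | ld A e ih =>
    refine h.2.trans ?_
    calc (V : ℤ) = V ^ 1 := (pow_one _).symm
      _ ≤ _ := pow_le_pow_right₀ (by omega) (by simp)
  | sq e ih =>
    have h₁ := ih h.1
    rw [abs_of_nonneg h.2] at h₁
    simp only [eval_sq, Nat.abs_cast, deg_sq]
    have := Nat.sqrt_le_self (e.eval s).toNat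
    have := h.2
    omega

/-- Every subexpression has degree at most `D`, so all intermediate values are controlled by the
leaves alone. In the programs below `D = 10` suffices. -/
theorem ok_of_leafOk {V B D : ℕ} (hV : 16 ≤ V) (hB : V ^ D ≤ B) {s : State} {e : Ex}
    (h : e.leafOk V s) (hD : e.deg ≤ D) : e.ok B s := by
  have hb : ∀ e' : Ex, e'.leafOk V s → e'.deg ≤ D → |e'.eval s| ≤ B := by
    intro e' h' hD'
    refine (abs_eval_le hV h').trans ?_
    have : V ^ e'.deg ≤ B := (Nat.pow_le_pow_right (by omega) hD').trans hB
    exact_mod_cast this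
  induction e with
  | v x => exact h.1
  | c z => exact hb _ h hD
  | op o e f ihe ihf =>
    have : e.deg ≤ D ∧ f.deg ≤ D := by
      cases o <;> simp only [deg] at hD <;> omega
    exact ⟨ihe h.1 this.1, ihf h.2 this.2, hb _ h hD⟩
  | ld A e ih => exact ih h.1 (by simp at hD; omega)
  | sq e ih =>
    have := hb _ h hD
    simp only [eval_sq, Nat.abs_cast] at this
    exact ⟨ih h.1 hD, h.2, this⟩

theorem okTo_of_leafOk {V B D : ℕ} (hV : 16 ≤ V) (hB : V ^ D ≤ B) {s : State} {e : Ex}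
    (h : e.leafOk V s) (hD : e.deg ≤ D) : e.okTo B s := by
  cases e with
  | v x =>
    refine ⟨h.1, h.2.trans ?_⟩
    have : V ^ 1 ≤ B := (Nat.pow_le_pow_right (by omega) hD).trans hB
    rw [pow_one] at this
    exact_mod_cast this
  | _ => exact ok_of_leafOk hV hB h hD

end Ex

namespace Cmd

/-- A sufficient precondition of a command without loops, for words of absolute value at most
`V ^ D`. -/
def wpV (V D : ℕ) : Cmd → (State → Prop) → State → Prop
  | skip, Q, s => Q s
  | assign x e, Q, s => e.deg ≤ D ∧ e.leafOk V s ∧ Q (s.setVar x (e.eval s))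
  | store A i e, Q, s => (i.deg ≤ D ∧ e.deg ≤ D) ∧ i.leafOk V s ∧ e.leafOk V s ∧
      Q (s.setArr A (i.eval s) (e.eval s))
  | seq P R, Q, s => P.wpV V D (R.wpV V D Q) s
  | ite e f P R, Q, s => (e.deg ≤ D ∧ f.deg ≤ D) ∧ e.leafOk V s ∧ f.leafOk V s ∧
      (e.eval s < f.eval s → P.wpV V D Q s) ∧ (f.eval s ≤ e.eval s → R.wpV V D Q s)
  | .loop _ _ _, _, _ => False

theorem wp_of_wpV {V B D : ℕ} (hV : 16 ≤ V) (hB : V ^ D ≤ B) {P : Cmd} :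
    ∀ {s : State} {Q : State → Prop}, P.wpV V D Q s → P.wp B Q s := by
  have mono : ∀ {P : Cmd} {s : State} {Q Q' : State → Prop}, (∀ s, Q s → Q' s) →
      P.wp B Q s → P.wp B Q' s := by
    intro P
    induction P with
    | skip => exact fun h h' => h _ h'
    | assign x e => exact fun h h' => ⟨h'.1, h _ h'.2⟩
    | store A i e => exact fun h h' => ⟨h'.1, h'.2.1, h _ h'.2.2⟩
    | seq P R ihP ihR => exact fun h h' => ihP (fun s hs => ihR h hs) h'
    | ite e f P R ihP ihR =>
      exact fun h h' => ⟨h'.1, h'.2.1, fun hc => ihP h (h'.2.2.1 hc), fun hc => ihR h (h'.2.2.2 hc)⟩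
    | loop e f P ih => exact fun h h' => h'
  induction P with
  | skip => exact fun h => h
  | assign x e => exact fun h => ⟨Ex.okTo_of_leafOk hV hB h.2.1 h.1, h.2.2⟩
  | store A i e =>
    exact fun h => ⟨Ex.ok_of_leafOk hV hB h.2.1 h.1.1, Ex.ok_of_leafOk hV hB h.2.2.1 h.1.2, h.2.2.2⟩
  | seq P R ihP ihR =>
    intro s Q h
    exact mono (P := P) (Q := R.wpV V D Q) (fun s hs => ihR hs) (ihP h)
  | ite e f P R ihP ihR =>
    exact fun h => ⟨Ex.ok_of_leafOk hV hB h.2.1 h.1.1, Ex.ok_of_leafOk hV hB h.2.2.1 h.1.2,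
      fun hc => ihP (h.2.2.2.1 hc), fun hc => ihR (h.2.2.2.2 (not_lt.1 hc))⟩
  | loop e f P ih => exact fun h => h

theorem Spec.of_wpV {V B D : ℕ} (hV : 16 ≤ V) (hB : V ^ D ≤ B) {P : Cmd} {s : State} {T : ℕ}
    {Q : State → Prop} (hT : P.cost ≤ T) (h : P.wpV V D Q s) : P.Spec B s T Q :=
  (Spec.of_wp (wp_of_wpV hV hB h)).mono hT fun _ _ h => h

end Cmd

/-- Sequential composition. -/
infixr:60 " ;; " => Cmd.seq

end WordRAM

namespace WordRAM.Cmd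

/-- Forward symbolic execution: the value `a` is supplied in simplified form, so that the rest of
the program starts from an explicit state. -/
theorem Spec.assign_seq {V B D : ℕ} (hV : 16 ≤ V) (hB : V ^ D ≤ B) {x : ℕ} {e : Ex} {R : Cmd}
    {s : State} {T : ℕ} {Q : State → Prop} (a : ℤ) (hD : e.deg ≤ D) (he : e.leafOk V s)
    (ha : e.eval s = a) (h : R.Spec B (s.setVar x a) T Q) :
    (Cmd.assign x e ;; R).Spec B s (e.cost + 2 + T) Q :=
  Spec.seq (Spec.of_wpV hV hB le_rfl (Q := fun s' => s' = s.setVar x a) ⟨hD, he, by rw [ha]⟩)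
    fun s' _ hs => hs ▸ h

theorem Spec.store_seq {V B D : ℕ} (hV : 16 ≤ V) (hB : V ^ D ≤ B) {A : ℕ} {i e : Ex} {R : Cmd}
    {s : State} {T : ℕ} {Q : State → Prop} (j a : ℤ) (hD : i.deg ≤ D ∧ e.deg ≤ D)
    (hi : i.leafOk V s) (he : e.leafOk V s) (hj : i.eval s = j) (ha : e.eval s = a)
    (h : R.Spec B (s.setArr A j a) T Q) :
    (Cmd.store A i e ;; R).Spec B s (i.cost + e.cost + 1 + T) Q :=
  Spec.seq (Spec.of_wpV hV hB le_rfl (Q := fun s' => s' = s.setArr A j a) ⟨hD, hi, he, by rw [hj, ha]⟩)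
    fun s' _ hs => hs ▸ h

end WordRAM.Cmd

/-! ## The fast Fourier transform -/

namespace FFT

open Complex

/-- The bit reversal of `n`, read as a binary fraction. -/
noncomputable def bitRev (n : ℕ) : ℝ :=
  if n = 0 then 0 else bitRev (n / 2) / 2 + ((n % 2 : ℕ) : ℝ) / 2
decreasing_by omega

theorem bitRev_eq (n : ℕ) : bitRev n = bitRev (n / 2) / 2 + ((n % 2 : ℕ) : ℝ) / 2 := by
  by_cases h : n = 0
  · subst h; rw [bitRev]; simp
  · conv_lhs => rw [bitRev]
    rw [if_neg h]

theorem bitRev_zero : bitRev 0 = 0 := by rw [bitRev]; simp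

/-- A new leading binary digit of the index becomes the last digit of the reversed fraction. -/
theorem bitRev_two_pow_add (l : ℕ) : ∀ j < 2 ^ l, bitRev (2 ^ l + j) = bitRev j + 1 / 2 ^ (l + 1) := by
  induction l with
  | zero =>
    intro j hj
    have : j = 0 := by omega
    subst this
    rw [bitRev_eq]
    norm_num [bitRev_zero]
  | succ l ih =>
    intro j hj
    rw [bitRev_eq (2 ^ (l + 1) + j), bitRev_eq j, show (2 ^ (l + 1) + j) / 2 = 2 ^ l + j / 2 by omega,
      show (2 ^ (l + 1) + j) % 2 = j % 2 by omega, ih (j / 2) (by omega)]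
    ring

/-- The roots of unity in bit reversed order. -/
noncomputable def root (n : ℕ) : ℂ := exp (Real.pi * bitRev n * I)

theorem norm_root (n : ℕ) : ‖root n‖ = 1 := by
  rw [root, show (Real.pi * bitRev n * I : ℂ) = ((Real.pi * bitRev n : ℝ) : ℂ) * I by push_cast; ring,
    norm_exp_ofReal_mul_I]

theorem root_zero : root 0 = 1 := by simp [root, bitRev_zero]

/-- Together with `root_odd_sq` this describes the splitting of X^(2h) - ζ² into X^h - ζ and X^h + ζ
for ζ = `root t`: the children `2 * t` and `2 * t + 1` of the block `t` carry square roots of ζ and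
-ζ. -/
theorem root_even_sq (n : ℕ) : root (2 * n) ^ 2 = root n := by
  rw [root, root, ← exp_nat_mul, bitRev_eq (2 * n)]
  congr 1
  simp
  ring

theorem root_odd_sq (n : ℕ) : root (2 * n + 1) ^ 2 = -root n := by
  rw [root, root, ← exp_nat_mul, bitRev_eq (2 * n + 1), show (2 * n + 1) / 2 = n by omega,
    show (2 * n + 1) % 2 = 1 by omega,
    show ((2 : ℕ) : ℂ) * (Real.pi * ((bitRev n / 2 + ((1 : ℕ) : ℝ) / 2 : ℝ) : ℂ) * I)
      = Real.pi * bitRev n * I + Real.pi * I by push_cast; ring, exp_add, exp_pi_mul_I]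
  ring

/-- Allows a table of the roots to be doubled with one multiplication per new entry. In bit reversed
order one table serves all levels of a transform. -/
theorem root_two_pow_add {l j : ℕ} (hj : j < 2 ^ l) :
    root (2 ^ l + j) = root j * exp ((Real.pi / 2 ^ (l + 1) : ℝ) * I) := by
  rw [root, root, ← exp_add, bitRev_two_pow_add l j hj]
  congr 1
  push_cast
  ring

/-- The intermediate results of the transform: the coefficient of `X ^ (x % m)` of the remainder
of the polynomial with the coefficients `a` modulo `X ^ m - root (x / m) ^ 2`. -/
noncomputable def level (a : ℕ → ℂ) (l m x : ℕ) : ℂ :=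
  ∑ q ∈ Finset.range (2 ^ l), a (q * m + x % m) * (root (x / m) ^ 2) ^ q

theorem sum_range_two_mul {M : Type*} [AddCommMonoid M] (f : ℕ → M) (n : ℕ) :
    ∑ q ∈ Finset.range (2 * n), f q = ∑ q ∈ Finset.range n, (f (2 * q) + f (2 * q + 1)) := by
  induction n with
  | zero => simp
  | succ n ih =>
    rw [show 2 * (n + 1) = 2 * n + 1 + 1 by ring, Finset.sum_range_succ, Finset.sum_range_succ, ih,
      Finset.sum_range_succ, add_assoc]

/-- A remainder modulo X^(2h) - ζ² is reduced modulo its factor X^h - ζ by substituting ζ for X^h.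
In the sums this is the separation of even and odd `q`; `level_high` is the same for the factor X^h
+ ζ. -/
theorem level_low (a : ℕ → ℂ) (l : ℕ) {h x : ℕ} (hx : x % (2 * h) < h) :
    level a (l + 1) h x = level a l (2 * h) x + root (x / (2 * h)) * level a l (2 * h) (x + h) := by
  obtain ⟨t, j, rfl, hj⟩ : ∃ t j, x = 2 * h * t + j ∧ j < h :=
    ⟨x / (2 * h), x % (2 * h), (Nat.div_add_mod _ _).symm, hx⟩
  have hh : 0 < h := by omega
  have e₁ : (2 * h * t + j) / (2 * h) = t := by
    rw [Nat.mul_add_div (by omega), Nat.div_eq_of_lt (by omega), add_zero]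
  have e₂ : (2 * h * t + j) % (2 * h) = j := by
    rw [Nat.mul_add_mod, Nat.mod_eq_of_lt (by omega)]
  have e₃ : (2 * h * t + j + h) / (2 * h) = t := by
    rw [add_assoc, Nat.mul_add_div (by omega), Nat.div_eq_of_lt (by omega), add_zero]
  have e₄ : (2 * h * t + j + h) % (2 * h) = j + h := by
    rw [add_assoc, Nat.mul_add_mod, Nat.mod_eq_of_lt (by omega)]
  have e₅ : (2 * h * t + j) / h = 2 * t := by
    rw [show 2 * h * t + j = h * (2 * t) + j by ring, Nat.mul_add_div hh, Nat.div_eq_of_lt hj, add_zero]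
  have e₆ : (2 * h * t + j) % h = j := by
    rw [show 2 * h * t + j = h * (2 * t) + j by ring, Nat.mul_add_mod, Nat.mod_eq_of_lt hj]
  simp only [level, e₁, e₂, e₃, e₄, e₅, e₆, root_even_sq]
  rw [pow_succ', sum_range_two_mul, Finset.mul_sum, ← Finset.sum_add_distrib]
  refine Finset.sum_congr rfl fun q _ => ?_
  rw [show 2 * q * h + j = q * (2 * h) + j by ring,
    show (2 * q + 1) * h + j = q * (2 * h) + (j + h) by ring]
  ring

theorem level_high (a : ℕ → ℂ) (l : ℕ) {h x : ℕ} (hh : 0 < h) (hx : ¬ x % (2 * h) < h) :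
    level a (l + 1) h x = level a l (2 * h) (x - h) - root (x / (2 * h)) * level a l (2 * h) x := by
  obtain ⟨t, j, rfl, hj⟩ : ∃ t j, x = 2 * h * t + j + h ∧ j < h := by
    refine ⟨x / (2 * h), x % (2 * h) - h, ?_, ?_⟩
    · have := Nat.div_add_mod x (2 * h); omega
    · have := Nat.mod_lt x (show 0 < 2 * h by omega); omega
  have e₁ : (2 * h * t + j) / (2 * h) = t := by
    rw [Nat.mul_add_div (by omega), Nat.div_eq_of_lt (by omega), add_zero]
  have e₂ : (2 * h * t + j) % (2 * h) = j := by
    rw [Nat.mul_add_mod, Nat.mod_eq_of_lt (by omega)]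
  have e₃ : (2 * h * t + j + h) / (2 * h) = t := by
    rw [add_assoc, Nat.mul_add_div (by omega), Nat.div_eq_of_lt (by omega), add_zero]
  have e₄ : (2 * h * t + j + h) % (2 * h) = j + h := by
    rw [add_assoc, Nat.mul_add_mod, Nat.mod_eq_of_lt (by omega)]
  have e₅ : (2 * h * t + j + h) / h = 2 * t + 1 := by
    rw [show 2 * h * t + j + h = h * (2 * t + 1) + j by ring, Nat.mul_add_div hh,
      Nat.div_eq_of_lt hj, add_zero]
  have e₆ : (2 * h * t + j + h) % h = j := by
    rw [show 2 * h * t + j + h = h * (2 * t + 1) + j by ring, Nat.mul_add_mod, Nat.mod_eq_of_lt hj]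
  simp only [level, Nat.add_sub_cancel, e₁, e₂, e₃, e₄, e₅, e₆, root_odd_sq]
  rw [pow_succ', sum_range_two_mul, Finset.mul_sum, ← Finset.sum_sub_distrib]
  refine Finset.sum_congr rfl fun q _ => ?_
  rw [show 2 * q * h + j = q * (2 * h) + j by ring,
    show (2 * q + 1) * h + j = q * (2 * h) + (j + h) by ring, pow_succ (-root t),
    show (-root t) ^ (2 * q) = (root t ^ 2) ^ q by rw [pow_mul, neg_sq]]
  ring

theorem conj_root_mul (n : ℕ) : (starRingEnd ℂ) (root n) * root n = 1 := by
  rw [Complex.conj_mul', norm_root]; simp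

/-- The inverse step without the division by two. The powers of two accumulate to the length of the
transform and are removed together with the scale in the final rounding. -/
theorem two_mul_level_low (a : ℕ → ℂ) (l : ℕ) {h x : ℕ} (hx : x % (2 * h) < h) :
    2 * level a l (2 * h) x = level a (l + 1) h x + level a (l + 1) h (x + h) := by
  have e : (x + h) % (2 * h) = x % (2 * h) + h := by
    rw [Nat.add_mod, Nat.mod_eq_of_lt (show h < 2 * h by omega), Nat.mod_eq_of_lt (by omega)]
  have e' : (x + h) / (2 * h) = x / (2 * h) := by
    have h₁ := Nat.div_add_mod x (2 * h)
    have h₂ := Nat.div_add_mod (x + h) (2 * h)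
    have : 2 * h * ((x + h) / (2 * h)) = 2 * h * (x / (2 * h)) := by omega
    exact Nat.eq_of_mul_eq_mul_left (by omega) this
  rw [level_low a l hx, level_high a l (x := x + h) (by omega) (by omega), e', Nat.add_sub_cancel]
  ring

theorem two_mul_level_high (a : ℕ → ℂ) (l : ℕ) {h x : ℕ} (hh : 0 < h) (hx : ¬ x % (2 * h) < h) :
    2 * level a l (2 * h) x = (starRingEnd ℂ) (root (x / (2 * h))) *
      (level a (l + 1) h (x - h) - level a (l + 1) h x) := by
  have hxh : h ≤ x := by have := Nat.mod_le x (2 * h); omega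
  have hm := Nat.mod_lt x (show 0 < 2 * h by omega)
  have e' : (x - h) / (2 * h) = x / (2 * h) ∧ (x - h) % (2 * h) = x % (2 * h) - h := by
    have h₁ := Nat.div_add_mod x (2 * h)
    rw [Nat.div_mod_unique (by omega)]
    omega
  rw [level_low a l (x := x - h) (by omega), level_high a l hh hx, e'.1, Nat.sub_add_cancel hxh]
  linear_combination (-2 * level a l (2 * h) x) * conj_root_mul (x / (2 * h))

theorem level_zero (a : ℕ → ℂ) {N x : ℕ} (hx : x < N) : level a 0 N x = a x := by
  simp [level, Nat.mod_eq_of_lt hx]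

theorem level_one (a : ℕ → ℂ) (l x : ℕ) :
    level a l 1 x = ∑ q ∈ Finset.range (2 ^ l), a q * (root x ^ 2) ^ q := by
  simp [level, Nat.mod_one]

theorem norm_level_le {a : ℕ → ℂ} {A : ℝ} (ha : ∀ n, ‖a n‖ ≤ A) (l m x : ℕ) :
    ‖level a l m x‖ ≤ 2 ^ l * A := by
  refine (norm_sum_le _ _).trans ?_
  refine (Finset.sum_le_card_nsmul _ _ A fun q _ => ?_).trans (by simp)
  simpa [norm_root] using ha _

/-- The Cauchy product. -/
def conv {R : Type*} [Semiring R] (a b : ℕ → R) (n : ℕ) : R :=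
  ∑ i ∈ Finset.range (n + 1), a i * b (n - i)

/-- Blocks of length `1` hold the values at the points `root x ^ 2`, and evaluation is
multiplicative. The hypothesis `h` ensures that also the product has no coefficients from `2 ^ l`
on, so nothing is truncated. -/
theorem level_conv {a b : ℕ → ℂ} {s d l : ℕ} (ha : ∀ n, s ≤ n → a n = 0) (hb : ∀ n, d ≤ n → b n = 0)
    (h : s + d ≤ 2 ^ l) (x : ℕ) :
    level (conv a b) l 1 x = level a l 1 x * level b l 1 x := by
  open Polynomial in
  have key : ∀ (a : ℕ → ℂ) (s : ℕ), s ≤ 2 ^ l → (∀ n, s ≤ n → a n = 0) →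
      level a l 1 x = (∑ q ∈ Finset.range s, C (a q) * X ^ q : ℂ[X]).eval (root x ^ 2) ∧
      (∀ n, (∑ q ∈ Finset.range s, C (a q) * X ^ q : ℂ[X]).coeff n = a n) := by
    intro a s hs ha
    constructor
    · rw [level_one, eval_finsetSum]
      simp only [eval_mul, eval_C, eval_pow, eval_X]
      symm
      refine Finset.sum_subset (by simpa using hs) fun q _ hq => ?_
      rw [ha q (by simpa using hq), zero_mul]
    · intro n
      simp only [finsetSum_coeff, coeff_C_mul, coeff_X_pow, mul_ite, mul_one, mul_zero]
      rw [Finset.sum_ite_eq]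
      split_ifs with hn
      · rfl
      · exact (ha n (by simpa using hn)).symm
  -- In each product one of the two indices is beyond the support of its factor.
  have hc : ∀ n, s + d ≤ n → conv a b n = 0 := by
    intro n hn
    refine Finset.sum_eq_zero fun i _ => ?_
    by_cases his : s ≤ i
    · rw [ha i his, zero_mul]
    · rw [hb (n - i) (by omega), mul_zero]
  obtain ⟨a₁, a₂⟩ := key a s (by omega) ha
  obtain ⟨b₁, b₂⟩ := key b d (by omega) hb
  obtain ⟨c₁, c₂⟩ := key (conv a b) (s + d) h hc
  rw [a₁, b₁, c₁, ← Polynomial.eval_mul]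
  congr 1
  ext n
  rw [c₂, Polynomial.coeff_mul, Finset.Nat.sum_antidiagonal_eq_sum_range_succ_mk]
  simp only [a₂, b₂, conv]

/-! ### Fixed point arithmetic -/

/-- The Gaussian integer with real part `x` and imaginary part `y`. -/
def gauss (x y : ℤ) : ℂ := ⟨x, y⟩

theorem gauss_add (x y x' y' : ℤ) : gauss (x + x') (y + y') = gauss x y + gauss x' y' := by
  apply Complex.ext <;> simp [gauss]

theorem gauss_sub (x y x' y' : ℤ) : gauss (x - x') (y - y') = gauss x y - gauss x' y' := by
  apply Complex.ext <;> simp [gauss]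

theorem conj_gauss (x y : ℤ) : (starRingEnd ℂ) (gauss x y) = gauss x (-y) := by
  apply Complex.ext <;> simp [gauss]

theorem abs_sub_ediv_le (x : ℤ) {S : ℤ} (hS : 0 < S) : |((x / S : ℤ) : ℝ) - x / S| ≤ 1 := by
  have hS' : (0 : ℝ) < S := by exact_mod_cast hS
  have h₁ : (x : ℝ) = S * (x / S : ℤ) + (x % S : ℤ) := by exact_mod_cast (Int.mul_ediv_add_emod x S).symm
  have h₂ : (0 : ℝ) ≤ (x % S : ℤ) := by exact_mod_cast Int.emod_nonneg x hS.ne'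
  have h₃ : ((x % S : ℤ) : ℝ) ≤ S := by exact_mod_cast (Int.emod_lt_of_pos x hS).le
  rw [abs_le]
  constructor
  · rw [le_sub_iff_add_le, ← sub_nonneg]
    have : ((x / S : ℤ) : ℝ) - (-1 + x / S) = (S - (x % S : ℤ)) / S := by field_simp; linarith
    rw [this]; exact div_nonneg (by linarith) hS'.le
  · rw [sub_le_iff_le_add, ← sub_nonneg]
    have : 1 + x / S - ((x / S : ℤ) : ℝ) = (S + (x % S : ℤ)) / S := by field_simp; linarith
    rw [this]; positivity

/-- With P ≈ S z and Q ≈ S w, write P Q / S - S z w = (P - S z) Q / S + z (Q - S w), where |Q| / S ≤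
M' + 1 because e' ≤ S. The two floor divisions change the real and the imaginary part by at most 1
each, which gives the summand `2`. -/
theorem norm_gauss_mul_sub_le {S : ℤ} (hS : 0 < S) {x y x' y' : ℤ} {z w : ℂ} {e e' M M' : ℝ}
    (he : ‖gauss x y - S * z‖ ≤ e) (he' : ‖gauss x' y' - S * w‖ ≤ e') (hz : ‖z‖ ≤ M)
    (hw : ‖w‖ ≤ M') (heS : e' ≤ S) :
    ‖gauss ((x * x' - y * y') / S) ((x * y' + y * x') / S) - S * (z * w)‖
      ≤ e * (M' + 1) + M * e' + 2 := by
  have hS' : (0 : ℝ) < S := by exact_mod_cast hS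
  have hSc : (S : ℂ) ≠ 0 := by exact_mod_cast hS.ne'
  have hSn : ‖(S : ℂ)‖ = S := by
    rw [show (S : ℂ) = ((S : ℝ) : ℂ) by push_cast; rfl, Complex.norm_real, Real.norm_of_nonneg hS'.le]
  have hround : ‖gauss ((x * x' - y * y') / S) ((x * y' + y * x') / S)
      - gauss x y * gauss x' y' / S‖ ≤ 2 := by
    have h₁ := abs_sub_ediv_le (x * x' - y * y') hS
    have h₂ := abs_sub_ediv_le (x * y' + y * x') hS
    have e : gauss x y * gauss x' y' / S = gauss x y * gauss x' y' / (S : ℝ) := by push_cast; rfl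
    refine (Complex.norm_le_abs_re_add_abs_im _).trans ?_
    rw [Complex.sub_re, Complex.sub_im, e, Complex.div_ofReal_re, Complex.div_ofReal_im,
      Complex.mul_re, Complex.mul_im]
    simp only [gauss]
    push_cast at h₁ h₂ ⊢
    linarith
  have hQ : ‖gauss x' y'‖ ≤ S * (M' + 1) := by
    calc ‖gauss x' y'‖ = ‖(gauss x' y' - S * w) + S * w‖ := by ring_nf
      _ ≤ ‖gauss x' y' - S * w‖ + ‖S * w‖ := norm_add_le _ _
      _ ≤ S + S * M' := by
        rw [norm_mul, hSn]
        have := mul_le_mul_of_nonneg_left hw hS'.le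
        linarith
      _ = S * (M' + 1) := by ring
  have hsplit : gauss ((x * x' - y * y') / S) ((x * y' + y * x') / S) - S * (z * w)
      = (gauss ((x * x' - y * y') / S) ((x * y' + y * x') / S) - gauss x y * gauss x' y' / S)
        + ((gauss x y - S * z) * (gauss x' y' / S) + z * (gauss x' y' - S * w)) := by
    field_simp
    ring
  rw [hsplit]
  refine (norm_add_le _ _).trans ?_
  have h₁ : ‖(gauss x y - S * z) * (gauss x' y' / S)‖ ≤ e * (M' + 1) := by
    rw [norm_mul, norm_div, hSn]
    have : ‖gauss x' y'‖ / S ≤ M' + 1 := by rw [div_le_iff₀ hS']; linarith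
    exact mul_le_mul he this (by positivity) ((norm_nonneg _).trans he)
  have h₂ : ‖z * (gauss x' y' - S * w)‖ ≤ M * e' := by
    rw [norm_mul]
    exact mul_le_mul hz he' (norm_nonneg _) ((norm_nonneg _).trans hz)
  have := norm_add_le ((gauss x y - S * z) * (gauss x' y' / S)) (z * (gauss x' y' - S * w))
  linarith

theorem abs_le_of_norm_gauss_sub_le {x y S : ℤ} (hS : 0 ≤ S) {z : ℂ} {e M : ℝ}
    (h : ‖gauss x y - S * z‖ ≤ e) (hz : ‖z‖ ≤ M) :
    |(x : ℝ)| ≤ S * M + e ∧ |(y : ℝ)| ≤ S * M + e := by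
  have hS' : (0 : ℝ) ≤ S := by exact_mod_cast hS
  have hSn : ‖(S : ℂ)‖ = S := by
    rw [show (S : ℂ) = ((S : ℝ) : ℂ) by push_cast; rfl, Complex.norm_real, Real.norm_of_nonneg hS']
  have hQ : ‖gauss x y‖ ≤ S * M + e := by
    calc ‖gauss x y‖ = ‖(gauss x y - S * z) + S * z‖ := by ring_nf
      _ ≤ ‖gauss x y - S * z‖ + ‖S * z‖ := norm_add_le _ _
      _ ≤ e + S * M := by
        rw [norm_mul, hSn]
        exact add_le_add h (mul_le_mul_of_nonneg_left hz hS')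
      _ = S * M + e := by ring
  exact ⟨(Complex.abs_re_le_norm (gauss x y)).trans hQ, (Complex.abs_im_le_norm (gauss x y)).trans hQ⟩

/-- The formula cos (θ/2) = √((1 + cos θ) / 2). As cos (θ/2) is bounded away from zero, the square
root contracts the error by more than the rounding adds. So the bound `10` reproduces itself, and
repeated halving of the angle does not accumulate errors. -/
theorem sqrt_cos_bound {S c : ℤ} (hS : 1 ≤ S) (hc : 0 ≤ c) (hcS : c ≤ S) {θ : ℝ} (h0 : 0 ≤ θ)
    (hθ : θ ≤ Real.pi / 2) (h : |c - S * Real.cos θ| ≤ 10) :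
    |((Nat.sqrt ((S * S + S * c) / 2).toNat : ℤ) : ℝ) - S * Real.cos (θ / 2)| ≤ 10 ∧
      (Nat.sqrt ((S * S + S * c) / 2).toNat : ℤ) ≤ S := by
  have hS' : (1 : ℝ) ≤ S := by exact_mod_cast hS
  set n := ((S * S + S * c) / 2).toNat with hn
  have hn0 : 0 ≤ (S * S + S * c) / 2 := by positivity
  have hnz : (n : ℤ) = (S * S + S * c) / 2 := Int.toNat_of_nonneg hn0
  have h₁ : (Nat.sqrt n : ℝ) ^ 2 ≤ n := by exact_mod_cast Nat.sqrt_le' n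
  have h₂ : (n : ℝ) < (Nat.sqrt n + 1 : ℝ) ^ 2 := by exact_mod_cast Nat.lt_succ_sqrt' n
  have h₃ : 2 * (n : ℝ) ≤ S * S + S * c := by
    have : 2 * (n : ℤ) ≤ S * S + S * c := by omega
    exact_mod_cast this
  have h₄ : (S * S + S * c : ℝ) ≤ 2 * n + 1 := by
    have : S * S + S * c ≤ 2 * (n : ℤ) + 1 := by omega
    exact_mod_cast this
  have hcos : Real.cos θ = 2 * Real.cos (θ / 2) ^ 2 - 1 := by
    rw [← Real.cos_two_mul]; ring_nf
  have hcn : 0 ≤ Real.cos θ := Real.cos_nonneg_of_neg_pi_div_two_le_of_le (by linarith) hθ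
  have hc2 : 0 ≤ Real.cos (θ / 2) :=
    Real.cos_nonneg_of_neg_pi_div_two_le_of_le (by linarith) (by linarith)
  -- From cos θ ≥ 0 the double angle formula gives 2 cos² (θ/2) ≥ 1.
  have hc7 : 7 / 10 ≤ Real.cos (θ / 2) := by nlinarith
  set C := Real.cos (θ / 2)
  set r : ℝ := (Nat.sqrt n : ℝ)
  have hr : 0 ≤ r := by positivity
  rw [abs_le] at h
  -- Half of S times the error `10` of the given cosine, plus the rounding in the division by two.
  have hd : |(n : ℝ) - (S * C) ^ 2| ≤ 5 * S + 1 / 2 := by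
    rw [abs_le]
    rw [hcos] at h
    constructor <;> nlinarith
  rw [abs_le] at hd
  refine ⟨?_, ?_⟩
  · rw [abs_le]
    have hSC : 7 / 10 * S ≤ S * C := by nlinarith
    push_cast
    constructor
    · by_contra! hlt
      have : (r + 1) ^ 2 ≤ (S * C - 9) ^ 2 := by
        apply pow_le_pow_left₀ (by linarith); linarith
      nlinarith
    · by_contra! hlt
      have : (S * C + 10) ^ 2 ≤ r ^ 2 := by
        apply pow_le_pow_left₀ (by linarith); linarith
      nlinarith
  · have : Nat.sqrt n ≤ S.toNat := by
      rw [← Nat.sqrt_eq' S.toNat]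
      apply Nat.sqrt_le_sqrt
      zify
      rw [hnz, Int.toNat_of_nonneg (by omega)]
      have : S * c ≤ S * S := by nlinarith
      rw [pow_two]
      omega
    omega

/-- The formula sin (θ/2) = √((1 - cos θ) / 2). Near zero the square root amplifies errors, so an
error of order S under the root leaves one of order √S. Taking S = T² makes this order an integer.
The sine is always computed from the accurate cosine and never from a previous sine. -/
theorem sqrt_sin_bound {T c : ℤ} (hT : 1 ≤ T) (hcS : c ≤ T ^ 2) {θ : ℝ} (h0 : 0 ≤ θ)
    (hθ : θ ≤ Real.pi / 2) (h : |c - T ^ 2 * Real.cos θ| ≤ 10) :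
    |((Nat.sqrt ((T ^ 2 * T ^ 2 - T ^ 2 * c) / 2).toNat : ℤ) : ℝ) - T ^ 2 * Real.sin (θ / 2)| ≤ 4 * T := by
  have hT' : (1 : ℝ) ≤ T := by exact_mod_cast hT
  set n := ((T ^ 2 * T ^ 2 - T ^ 2 * c) / 2).toNat with hn
  have hn0 : 0 ≤ (T ^ 2 * T ^ 2 - T ^ 2 * c) / 2 := by
    have : 0 ≤ T ^ 2 * (T ^ 2 - c) := mul_nonneg (by positivity) (by omega)
    have e : T ^ 2 * T ^ 2 - T ^ 2 * c = T ^ 2 * (T ^ 2 - c) := by ring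
    omega
  have hnz : (n : ℤ) = (T ^ 2 * T ^ 2 - T ^ 2 * c) / 2 := Int.toNat_of_nonneg hn0
  have h₁ : (Nat.sqrt n : ℝ) ^ 2 ≤ n := by exact_mod_cast Nat.sqrt_le' n
  have h₂ : (n : ℝ) < (Nat.sqrt n + 1 : ℝ) ^ 2 := by exact_mod_cast Nat.lt_succ_sqrt' n
  have h₃ : 2 * (n : ℝ) ≤ T ^ 2 * T ^ 2 - T ^ 2 * c := by
    have : 2 * (n : ℤ) ≤ T ^ 2 * T ^ 2 - T ^ 2 * c := by omega
    exact_mod_cast this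
  have h₄ : (T ^ 2 * T ^ 2 - T ^ 2 * c : ℝ) ≤ 2 * n + 1 := by
    have : T ^ 2 * T ^ 2 - T ^ 2 * c ≤ 2 * (n : ℤ) + 1 := by omega
    exact_mod_cast this
  have hcos : Real.cos θ = 1 - 2 * Real.sin (θ / 2) ^ 2 := by
    have := Real.cos_two_mul' (θ / 2)
    rw [show 2 * (θ / 2) = θ by ring, Real.cos_sq'] at this
    linarith
  have hs : 0 ≤ Real.sin (θ / 2) :=
    Real.sin_nonneg_of_nonneg_of_le_pi (by linarith) (by linarith [Real.pi_pos])
  set C := Real.sin (θ / 2)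
  set r : ℝ := (Nat.sqrt n : ℝ)
  have hr : 0 ≤ r := by positivity
  rw [abs_le] at h
  have hT2 : (1 : ℝ) ≤ T ^ 2 := by nlinarith
  have hd : |(n : ℝ) - (T ^ 2 * C) ^ 2| ≤ 6 * T ^ 2 := by
    rw [abs_le]
    rw [hcos] at h
    constructor <;> nlinarith
  rw [abs_le] at hd
  rw [abs_le]
  have hTC : 0 ≤ T ^ 2 * C := by positivity
  push_cast
  constructor
  · by_contra! hlt
    have : (r + 1) ^ 2 ≤ (T ^ 2 * C - 3 * T) ^ 2 := by
      apply pow_le_pow_left₀ (by linarith); linarith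
    nlinarith
  · by_contra! hlt
    have : (T ^ 2 * C + 4 * T) ^ 2 ≤ r ^ 2 := by
      apply pow_le_pow_left₀ (by positivity); linarith
    nlinarith

end FFT

/-! ## Convolutions on the machine -/

-- Notations for numerals rather than definitions: whether a command touches a given variable or
-- array can then be settled by evaluation, mostly with `decide`.
notation "regIdx" => (10 : ℕ)
notation "regLen" => (11 : ℕ)
notation "regHalf" => (12 : ℕ)
notation "regBlock" => (13 : ℕ)
notation "regRoot" => (14 : ℕ)
notation "regLow" => (15 : ℕ)
notation "regHigh" => (16 : ℕ)
notation "regSign" => (17 : ℕ)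
notation "regMax" => (18 : ℕ)
notation "regBase" => (19 : ℕ)
notation "regScale" => (20 : ℕ)
notation "regCount" => (21 : ℕ)
notation "regCos" => (22 : ℕ)
notation "regSin" => (23 : ℕ)
notation "regRe" => (24 : ℕ)
notation "regIm" => (25 : ℕ)
notation "memRe" => (10 : ℕ)
notation "memIm" => (11 : ℕ)
notation "memRe2" => (12 : ℕ)
notation "memIm2" => (13 : ℕ)
notation "memRe3" => (14 : ℕ)
notation "memIm3" => (15 : ℕ)
notation "memCos" => (16 : ℕ)
notation "memSin" => (17 : ℕ)

namespace WordRAM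

open Ex Cmd

/-- The cells `0, …, N - 1` of two arrays hold fixed point approximations of complex numbers. -/
def Approx (s : State) (A A' : ℕ) (S : ℤ) (N : ℕ) (z : ℕ → ℂ) (e : ℝ) : Prop :=
  ∀ x < N, ‖FFT.gauss (s.arr A x) (s.arr A' x) - S * z x‖ ≤ e

/-- Copy the third pair of arrays to the first one. -/
def copyBack : Cmd :=
  .assign regIdx (c 0) ;;
  .forUp regIdx regLen (
    .store memRe (v regIdx) (ld memRe3 (v regIdx)) ;;
    .store memIm (v regIdx) (ld memIm3 (v regIdx)))

theorem copyBack_spec {V B : ℕ} (hV : 16 ≤ V) (hB : V ^ 10 ≤ B) {s : State} {N : ℕ}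
    (hN : s.var regLen = N) (hNV : N ≤ V)
    (hZ : ∀ x : ℕ, x < N → |s.arr memRe3 x| ≤ V ∧ |s.arr memIm3 x| ≤ V) :
    copyBack.Spec B s (10 * N + 4) (fun s' => ∀ x : ℕ, x < N →
      s'.arr memRe x = s.arr memRe3 x ∧ s'.arr memIm x = s.arr memIm3 x) := by
  have hVB : V ≤ B := (Nat.le_self_pow (by norm_num) V).trans hB
  have hVB' : (V : ℤ) ≤ B := by exact_mod_cast hVB
  refine (Spec.seq (T' := 10 * N + 1) (Spec.of_wpV hV hB (T := 3) (Q := fun s' => s' = s.setVar regIdx 0)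
    (by decide) ?_) ?_).mono (by omega) fun _ _ h => h
  · simp [wpV]
  rintro s₁ - rfl
  refine (Spec.forUp 0 N (fun i s' => ∀ x : ℕ, x < i →
      s'.arr memRe x = s.arr memRe3 x ∧ s'.arr memIm x = s.arr memIm3 x) (fun _ => 4) (by decide)
      (by decide) (by decide) (by decide) (by decide) (by simp [State.var_setVar])
      (by simp [State.var_setVar, hN]) (by omega) (by simp) (by rw [Nat.abs_cast]; omega) (by simp)
      ?_).mono ?_ ?_
  · intro i hi s' hx hI hF
    simp only [zero_add] at hi hx
    have h₁ : s'.arr memRe3 = s.arr memRe3 := by rw [hF.arr _ (by decide)]; rfl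
    have h₂ : s'.arr memIm3 = s.arr memIm3 := by rw [hF.arr _ (by decide)]; rfl
    obtain ⟨b₁, b₂⟩ := hZ i (by omega)
    refine Spec.of_wpV hV hB (by decide) ?_
    simp only [wpV, State.arr_setArr, State.var_setArr, deg_v, deg_ld, leafOk_v, leafOk_ld, eval_v,
      eval_ld, hx, h₁, h₂, State.arr_setVar]
    refine ⟨by simp, ⟨by simp, by simp; omega⟩, ⟨⟨by simp, by simp; omega⟩, b₁⟩, by simp,
      ⟨by simp, by simp; omega⟩, ⟨⟨by simp, by simp; omega⟩, by simpa using b₂⟩, ?_⟩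
    intro x hx
    rcases Nat.lt_succ_iff_lt_or_eq.1 hx with h | rfl
    · have : ¬ (x : ℤ) = i := by omega
      simpa [this] using hI x h
    · simp
  · simp
    omega
  · intro s' _ h
    simpa using h

/-- One level of the Fourier transform. -/
def forwardLevel : Cmd :=
  .assign regBlock (v regHalf + v regHalf) ;;
  .assign regIdx (c 0) ;;
  .forUp regIdx regLen (
    .assign regRoot (v regIdx / v regBlock) ;;
    .ite (v regIdx % v regBlock) (v regHalf)
      (.assign regLow (v regIdx) ;; .assign regHigh (v regIdx + v regHalf) ;; .assign regSign (c 1))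
      (.assign regLow (v regIdx - v regHalf) ;; .assign regHigh (v regIdx) ;;
        .assign regSign (c (-1))) ;;
    .assign regRe ((ld memRe (v regHigh) * ld memCos (v regRoot) -
      ld memIm (v regHigh) * ld memSin (v regRoot)) / v regScale) ;;
    .assign regIm ((ld memRe (v regHigh) * ld memSin (v regRoot) +
      ld memIm (v regHigh) * ld memCos (v regRoot)) / v regScale) ;;
    -- Both members of a butterfly need the old values of each other, so the new level is built in
    -- the third pair of arrays and copied back afterwards.
    .store memRe3 (v regIdx) (ld memRe (v regLow) + v regSign * v regRe) ;;
    .store memIm3 (v regIdx) (ld memIm (v regLow) + v regSign * v regIm)) ;;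
  copyBack

/-- One level of the inverse Fourier transform. -/
def backwardLevel : Cmd :=
  .assign regBlock (v regHalf + v regHalf) ;;
  .assign regIdx (c 0) ;;
  .forUp regIdx regLen (
    .assign regRoot (v regIdx / v regBlock) ;;
    .ite (v regIdx % v regBlock) (v regHalf)
      (.store memRe3 (v regIdx) (ld memRe (v regIdx) + ld memRe (v regIdx + v regHalf)) ;;
        .store memIm3 (v regIdx) (ld memIm (v regIdx) + ld memIm (v regIdx + v regHalf)))
      (.assign regRe (ld memRe (v regIdx - v regHalf) - ld memRe (v regIdx)) ;;
        .assign regIm (ld memIm (v regIdx - v regHalf) - ld memIm (v regIdx)) ;;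
        .store memRe3 (v regIdx) ((v regRe * ld memCos (v regRoot) -
          v regIm * (c 0 - ld memSin (v regRoot))) / v regScale) ;;
        .store memIm3 (v regIdx) ((v regRe * (c 0 - ld memSin (v regRoot)) +
          v regIm * ld memCos (v regRoot)) / v regScale))) ;;
  copyBack

theorem Approx.abs_le {s : State} {A A' : ℕ} {S : ℤ} {N V : ℕ} {z : ℕ → ℂ} {e M : ℝ}
    (h : Approx s A A' S N z e) (hS : 0 ≤ S) (hz : ∀ x, ‖z x‖ ≤ M) (hV : S * M + e ≤ V) {x : ℕ}
    (hx : x < N) : |s.arr A x| ≤ V ∧ |s.arr A' x| ≤ V := by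
  obtain ⟨h₁, h₂⟩ := FFT.abs_le_of_norm_gauss_sub_le hS (h x hx) (hz x)
  have h₁' := h₁.trans hV
  have h₂' := h₂.trans hV
  exact ⟨by exact_mod_cast h₁', by exact_mod_cast h₂'⟩

/-- The product with an approximate root of norm 1 has error 2e + Mδ + 2 by
`FFT.norm_gauss_mul_sub_le`, and the summand that is not multiplied contributes another e. -/
theorem forwardLevel_spec {V B : ℕ} (hV : 16 ≤ V) (hB : V ^ 10 ≤ B) {s : State} {N h b n : ℕ}
    (hb : b = 2 * h) (hh : 0 < h) (hn0 : 0 < n) (hn : b * n = N) {S : ℤ} (hS : 0 < S) {e δ M : ℝ} {z z' : ℕ → ℂ}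
    (hN : s.var regLen = N) (hhalf : s.var regHalf = h) (hscale : s.var regScale = S)
    (hNV : 2 * N ≤ V) (he : 0 ≤ e) (hδ : 0 ≤ δ) (hδS : δ ≤ S) (hM : ∀ x, ‖z x‖ ≤ M)
    (hM' : ∀ x, ‖z' x‖ ≤ 2 * M) (hVM : S * (2 * M) + (3 * e + M * δ + 2) ≤ V) (hVS : 2 * S ≤ V)
    (hX : Approx s memRe memIm S N z e) (hW : Approx s memCos memSin S N FFT.root δ)
    (hlow : ∀ x, x % b < h → z' x = z x + FFT.root (x / b) * z (x + h))
    (hhigh : ∀ x, ¬ x % b < h → z' x = z (x - h) - FFT.root (x / b) * z x) :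
    forwardLevel.Spec B s (70 * N + 15)
      (fun s' => Approx s' memRe memIm S N z' (3 * e + M * δ + 2)) := by
  have hVB : V ≤ B := (Nat.le_self_pow (by norm_num) V).trans hB
  have hM0 : 0 ≤ M := (norm_nonneg _).trans (hM 0)
  have hSr : (0 : ℝ) < S := by exact_mod_cast hS
  have hMδ : 0 ≤ M * δ := mul_nonneg hM0 hδ
  have hSM : 0 ≤ S * M := mul_nonneg hSr.le hM0
  have bX : ∀ x < N, |s.arr memRe x| ≤ V ∧ |s.arr memIm x| ≤ V :=
    fun x => hX.abs_le hS.le hM (by linarith)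
  have bW : ∀ x < N, |s.arr memCos x| ≤ V ∧ |s.arr memSin x| ≤ V := by
    refine fun x => hW.abs_le hS.le (M := 1) (fun x => (FFT.norm_root x).le) ?_
    have : (2 * S : ℝ) ≤ V := by exact_mod_cast hVS
    linarith
  have hhN : b ≤ N := by
    rw [← hn]; exact Nat.le_mul_of_pos_right _ hn0
  have hroot : ∀ x < N, x / b < N := fun x hx => lt_of_le_of_lt (Nat.div_le_self _ _) hx
  -- The partner `x + h` lies in the same block of length `b`, and `N` consists of whole blocks.
  have hupper : ∀ x < N, x % b < h → x + h < N := by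
    intro x hx hlt
    have h₁ := Nat.div_add_mod x b
    have h₂ : x / b < n := by rw [Nat.div_lt_iff_lt_mul (by omega)]; linarith
    have h₃ : b * (x / b + 1) ≤ b * n := Nat.mul_le_mul_left _ h₂
    rw [mul_add] at h₃
    omega
  refine (Spec.assign_seq hV hB (b : ℤ) (by decide) ?_ ?_ <|
    Spec.assign_seq hV hB 0 (by decide) ?_ ?_ <|
    Spec.seq (T := 60 * N + 1) (Q := fun s' => Approx s' memRe3 memIm3 S N z' (3 * e + M * δ + 2))
      ?_ fun s' hF hs' => (copyBack_spec hV hB (by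
        rw [hF.var _ (by decide) (by decide)]; simp [State.var_setVar, hN]) (by omega)
        fun x hx => hs'.abs_le hS.le hM' hVM hx).mono le_rfl ?_).mono ?_ fun _ _ h => h
  · simp [hhalf]; omega
  · simp [hhalf, hb]; omega
  · simp
  · simp
  · refine (Spec.forUp 0 N (fun i s' => ∀ x : ℕ, x < i →
      ‖FFT.gauss (s'.arr memRe3 x) (s'.arr memIm3 x) - S * z' x‖ ≤ 3 * e + M * δ + 2) (fun _ => 55)
      (by decide)
      (by decide) (by decide) (by decide) (by decide) (by simp [State.var_setVar])
      (by simp [State.var_setVar, hN]) (by omega) (by simp) (by rw [Nat.abs_cast]; omega) (by simp)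
      ?_).mono ?_ ?_
    · intro i hi s' hx hI hF
      simp only [zero_add] at hi hx
      have hi' : i < N := by omega
      have f₁ : s'.arr memRe = s.arr memRe := by rw [hF.arr _ (by decide)]; rfl
      have f₂ : s'.arr memIm = s.arr memIm := by rw [hF.arr _ (by decide)]; rfl
      have f₃ : s'.arr memCos = s.arr memCos := by rw [hF.arr _ (by decide)]; rfl
      have f₄ : s'.arr memSin = s.arr memSin := by rw [hF.arr _ (by decide)]; rfl
      have f₅ : s'.var regBlock = (b : ℤ) := by
        rw [hF.var _ (by decide) (by decide)]; simp [State.var_setVar]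
      have f₆ : s'.var regHalf = h := by
        rw [hF.var _ (by decide) (by decide)]; simp [State.var_setVar, hhalf]
      have f₇ : s'.var regScale = S := by
        rw [hF.var _ (by decide) (by decide)]; simp [State.var_setVar, hscale]
      have bi := bX i hi'
      have br := bW _ (hroot i hi')
      have hri := hroot i hi'
      have hdiv : (i : ℤ) / (b : ℤ) = ((i / b : ℕ) : ℤ) := by push_cast; rfl
      have hmod : (i : ℤ) % (b : ℤ) = ((i % b : ℕ) : ℤ) := by push_cast; rfl
      refine Spec.of_wpV hV hB (by decide) ?_
      have iV : i ≤ V := by omega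
      have hV' : h ≤ V := by omega
      have bV' : b ≤ V := by omega
      have rV : i / b ≤ V := by omega
      have SV : |S| ≤ V := by rw [abs_of_pos hS]; omega
      have oV : 1 ≤ V := by omega
      have prod : ∀ x < N, ‖FFT.gauss
          ((s.arr memRe x * s.arr memCos (i / b : ℕ) - s.arr memIm x * s.arr memSin (i / b : ℕ)) / S)
          ((s.arr memRe x * s.arr memSin (i / b : ℕ) + s.arr memIm x * s.arr memCos (i / b : ℕ)) / S) -
          S * (z x * FFT.root (i / b))‖ ≤ 2 * e + M * δ + 2 := by
        intro x hx
        refine (FFT.norm_gauss_mul_sub_le hS (hX x hx) (hW _ hri) (hM x)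
          (FFT.norm_root _).le hδS).trans (le_of_eq (by ring))
      have cast_le : ∀ y : ℤ, |(y : ℝ)| ≤ S * M + (2 * e + M * δ + 2) → |y| ≤ V := by
        intro y hy
        have : |(y : ℝ)| ≤ V := by linarith
        exact_mod_cast this
      have bprod : ∀ x < N, _ ∧ _ := fun x hx =>
        (FFT.abs_le_of_norm_gauss_sub_le hS.le (prod x hx) (M := M)
        (by rw [norm_mul, FFT.norm_root, mul_one]; exact hM x)).imp (cast_le _) (cast_le _)
      simp [wpV, State.arr_setArr, State.var_setVar, hx, f₁, f₂, f₃, f₄, f₅, f₆, f₇]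
      rw [hdiv, hmod]
      refine ⟨⟨iV, bV'⟩, hV', fun hc => ?_, fun hc => ?_⟩
      · have hc' : i % b < h := by exact_mod_cast hc
        have hu := hupper i hi' hc'
        have bu := bX _ hu
        have uV : i + h ≤ V := by omega
        obtain ⟨p₁, p₂⟩ := bprod _ hu
        have e₁ : (i : ℤ) + h = ((i + h : ℕ) : ℤ) := by push_cast; rfl
        simp only [e₁, Nat.abs_cast, Nat.cast_le, iV, hV', rV, SV, oV, uV, bi.1, bi.2, br.1, br.2,
          bu.1, bu.2, p₁, p₂, true_and]
        intro x hxi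
        by_cases hxe : x = i
        · subst hxe
          simp only [if_true]
          rw [FFT.gauss_add, hlow x hc']
          have q₁ := hX x hi'
          have q₂ := prod _ hu
          have q := (norm_add_le _ _).trans (add_le_add q₁ q₂)
          refine (le_of_eq (congrArg norm ?_)).trans (q.trans (by linarith))
          ring
        · simp only [hxe, if_false]
          exact hI x (by omega)
      · have hc' : ¬ i % b < h := by push_cast at hc; omega
        have hhi : h ≤ i := by have := Nat.mod_le i b; omega
        have bu := bX (i - h) (by omega)
        have uV : i - h ≤ V := by omega
        obtain ⟨p₁, p₂⟩ := bprod _ hi'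
        have e₁ : (i : ℤ) - h = ((i - h : ℕ) : ℤ) := by push_cast [hhi]; rfl
        simp only [e₁, Nat.abs_cast, Nat.cast_le, iV, hV', rV, SV, oV, uV, bi.1, bi.2, br.1, br.2,
          bu.1, bu.2, p₁, p₂, true_and]
        intro x hxi
        by_cases hxe : x = i
        · subst hxe
          simp only [if_true]
          rw [← sub_eq_add_neg, ← sub_eq_add_neg, FFT.gauss_sub, hhigh x hc']
          have q₁ := hX (x - h) (by omega)
          have q₂ := prod _ hi'
          have q := (norm_sub_le _ _).trans (add_le_add q₁ q₂)
          refine (le_of_eq (congrArg norm ?_)).trans (q.trans (by linarith))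
          ring
        · simp only [hxe, if_false]
          exact hI x (by omega)
    · simp
      omega
    · intro s' _ h
      simpa [Approx] using h
  · intro s'' _ h x hx
    rw [(h x hx).1, (h x hx).2]
    exact hs' x hx
  · simp only [show (v regHalf + v regHalf).cost = 1 from rfl, show (c 0).cost = 1 from rfl]
    omega

end WordRAM

namespace WordRAM

open Ex Cmd

theorem Approx.conj_root {s : State} {S : ℤ} {N x : ℕ} {δ : ℝ}
    (h : Approx s memCos memSin S N FFT.root δ) (hx : x < N) :
    ‖FFT.gauss (s.arr memCos x) (0 - s.arr memSin x) - S * (starRingEnd ℂ) (FFT.root x)‖ ≤ δ := by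
  have := h x hx
  rw [← Complex.norm_conj] at this
  simpa [FFT.conj_gauss] using this

/-- In the upper half the difference of two entries has error 2e and norm at most 2M; multiplication
by the conjugate root turns this into 4e + 2Mδ + 2. The lower half, a plain sum, has only 2e. -/
theorem backwardLevel_spec {V B : ℕ} (hV : 16 ≤ V) (hB : V ^ 10 ≤ B) {s : State} {N h b n : ℕ}
    (hb : b = 2 * h) (hh : 0 < h) (hn0 : 0 < n) (hn : b * n = N) {S : ℤ} (hS : 0 < S) {e δ M : ℝ}
    {z z' : ℕ → ℂ}
    (hN : s.var regLen = N) (hhalf : s.var regHalf = h) (hscale : s.var regScale = S)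
    (hNV : 2 * N ≤ V) (he : 0 ≤ e) (hδ : 0 ≤ δ) (hδS : δ ≤ S) (hM : ∀ x, ‖z x‖ ≤ M)
    (hM' : ∀ x, ‖z' x‖ ≤ 2 * M) (hVM : S * (2 * M) + (4 * e + 2 * M * δ + 2) ≤ V) (hVS : 2 * S ≤ V)
    (hX : Approx s memRe memIm S N z e) (hW : Approx s memCos memSin S N FFT.root δ)
    (hlow : ∀ x, x % b < h → z' x = z x + z (x + h))
    (hhigh : ∀ x, ¬ x % b < h →
      z' x = (starRingEnd ℂ) (FFT.root (x / b)) * (z (x - h) - z x)) :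
    backwardLevel.Spec B s (70 * N + 15)
      (fun s' => Approx s' memRe memIm S N z' (4 * e + 2 * M * δ + 2)) := by
  have hVB : V ≤ B := (Nat.le_self_pow (by norm_num) V).trans hB
  have hM0 : 0 ≤ M := (norm_nonneg _).trans (hM 0)
  have hSr : (0 : ℝ) < S := by exact_mod_cast hS
  have hMδ : 0 ≤ M * δ := mul_nonneg hM0 hδ
  have hSM : 0 ≤ S * M := mul_nonneg hSr.le hM0
  have bX : ∀ x < N, |s.arr memRe x| ≤ V ∧ |s.arr memIm x| ≤ V :=
    fun x => hX.abs_le hS.le hM (by linarith)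
  have bW : ∀ x < N, |s.arr memCos x| ≤ V ∧ |s.arr memSin x| ≤ V := by
    refine fun x => hW.abs_le hS.le (M := 1) (fun x => (FFT.norm_root x).le) ?_
    have : (2 * S : ℝ) ≤ V := by exact_mod_cast hVS
    linarith
  have hhN : b ≤ N := by
    rw [← hn]; exact Nat.le_mul_of_pos_right _ hn0
  have hroot : ∀ x < N, x / b < N := fun x hx => lt_of_le_of_lt (Nat.div_le_self _ _) hx
  have hupper : ∀ x < N, x % b < h → x + h < N := by
    intro x hx hlt
    have h₁ := Nat.div_add_mod x b
    have h₂ : x / b < n := by rw [Nat.div_lt_iff_lt_mul (by omega)]; linarith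
    have h₃ : b * (x / b + 1) ≤ b * n := Nat.mul_le_mul_left _ h₂
    rw [mul_add] at h₃
    omega
  refine (Spec.assign_seq hV hB (b : ℤ) (by decide) ?_ ?_ <|
    Spec.assign_seq hV hB 0 (by decide) ?_ ?_ <|
    Spec.seq (T := 60 * N + 1) (Q := fun s' => Approx s' memRe3 memIm3 S N z' (4 * e + 2 * M * δ + 2))
      ?_ fun s' hF hs' => (copyBack_spec hV hB (by
        rw [hF.var _ (by decide) (by decide)]; simp [State.var_setVar, hN]) (by omega)
        fun x hx => hs'.abs_le hS.le hM' hVM hx).mono le_rfl ?_).mono ?_ fun _ _ h => h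
  · simp [hhalf]; omega
  · simp [hhalf, hb]; omega
  · simp
  · simp
  · refine (Spec.forUp 0 N (fun i s' => ∀ x : ℕ, x < i →
      ‖FFT.gauss (s'.arr memRe3 x) (s'.arr memIm3 x) - S * z' x‖ ≤ 4 * e + 2 * M * δ + 2)
      (fun _ => 55) (by decide)
      (by decide) (by decide) (by decide) (by decide) (by simp [State.var_setVar])
      (by simp [State.var_setVar, hN]) (by omega) (by simp) (by rw [Nat.abs_cast]; omega) (by simp)
      ?_).mono ?_ ?_
    · intro i hi s' hx hI hF
      simp only [zero_add] at hi hx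
      have hi' : i < N := by omega
      have f₁ : s'.arr memRe = s.arr memRe := by rw [hF.arr _ (by decide)]; rfl
      have f₂ : s'.arr memIm = s.arr memIm := by rw [hF.arr _ (by decide)]; rfl
      have f₃ : s'.arr memCos = s.arr memCos := by rw [hF.arr _ (by decide)]; rfl
      have f₄ : s'.arr memSin = s.arr memSin := by rw [hF.arr _ (by decide)]; rfl
      have f₅ : s'.var regBlock = (b : ℤ) := by
        rw [hF.var _ (by decide) (by decide)]; simp [State.var_setVar]
      have f₆ : s'.var regHalf = h := by
        rw [hF.var _ (by decide) (by decide)]; simp [State.var_setVar, hhalf]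
      have f₇ : s'.var regScale = S := by
        rw [hF.var _ (by decide) (by decide)]; simp [State.var_setVar, hscale]
      have bi := bX i hi'
      have br := bW _ (hroot i hi')
      have hri := hroot i hi'
      have hdiv : (i : ℤ) / (b : ℤ) = ((i / b : ℕ) : ℤ) := by push_cast; rfl
      have hmod : (i : ℤ) % (b : ℤ) = ((i % b : ℕ) : ℤ) := by push_cast; rfl
      refine Spec.of_wpV hV hB (by decide) ?_
      have iV : i ≤ V := by omega
      have hV' : h ≤ V := by omega
      have bV' : b ≤ V := by omega
      have rV : i / b ≤ V := by omega
      have SV : |S| ≤ V := by rw [abs_of_pos hS]; omega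
      have cast_le : ∀ y : ℤ, |(y : ℝ)| ≤ S * (2 * M) + 2 * e → |y| ≤ V := by
        intro y hy
        have : |(y : ℝ)| ≤ V := by linarith
        exact_mod_cast this
      simp [wpV, State.arr_setArr, State.var_setVar, hx, f₁, f₂, f₃, f₄, f₅, f₆, f₇]
      rw [hdiv, hmod]
      refine ⟨⟨iV, bV'⟩, hV', fun hc => ?_, fun hc => ?_⟩
      · have hc' : i % b < h := by exact_mod_cast hc
        have hu := hupper i hi' hc'
        have bu := bX _ hu
        have uV : i + h ≤ V := by omega
        have e₁ : (i : ℤ) + h = ((i + h : ℕ) : ℤ) := by push_cast; rfl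
        simp only [e₁, Nat.abs_cast, Nat.cast_le, iV, hV', uV, bi.1, bi.2, bu.1, bu.2, true_and]
        intro x hxi
        by_cases hxe : x = i
        · subst hxe
          simp only [if_true]
          rw [FFT.gauss_add, hlow x hc']
          have q := (norm_add_le _ _).trans (add_le_add (hX x hi') (hX _ hu))
          refine (le_of_eq (congrArg norm ?_)).trans (q.trans (by linarith))
          ring
        · simp only [hxe, if_false]
          exact hI x (by omega)
      · have hc' : ¬ i % b < h := by push_cast at hc; omega
        have hhi : h ≤ i := by have := Nat.mod_le i b; omega
        have hih : i - h < N := by omega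
        have bu := bX (i - h) hih
        have uV : i - h ≤ V := by omega
        have hdiff : ‖FFT.gauss (s.arr memRe (i - h : ℕ) - s.arr memRe i)
            (s.arr memIm (i - h : ℕ) - s.arr memIm i) - S * (z (i - h) - z i)‖ ≤ 2 * e := by
          have q := (norm_sub_le _ _).trans (add_le_add (hX _ hih) (hX i hi'))
          rw [FFT.gauss_sub]
          refine (le_of_eq (congrArg norm ?_)).trans (q.trans (by linarith))
          ring
        have hzz : ‖z (i - h) - z i‖ ≤ 2 * M :=
          (norm_sub_le _ _).trans (by linarith [hM (i - h), hM i])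
        have bd := FFT.abs_le_of_norm_gauss_sub_le hS.le hdiff hzz
        have d₁ := cast_le _ bd.1
        have d₂ := cast_le _ bd.2
        have e₁ : (i : ℤ) - h = ((i - h : ℕ) : ℤ) := by push_cast [hhi]; rfl
        simp only [e₁, Nat.abs_cast, Nat.cast_le, iV, hV', rV, SV, uV, bi.1, bi.2, br.1, br.2,
          bu.1, bu.2, d₁, d₂, true_and]
        intro x hxi
        by_cases hxe : x = i
        · subst hxe
          simp only [if_true]
          have q := FFT.norm_gauss_mul_sub_le hS (M' := 1) hdiff (hW.conj_root hri) hzz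
            (by rw [Complex.norm_conj, FFT.norm_root]) hδS
          rw [hhigh x hc', mul_comm ((starRingEnd ℂ) _)]
          simp only [zero_sub, mul_neg, sub_neg_eq_add] at q
          have q' : 2 * e * (1 + 1) + 2 * M * δ + 2 ≤ 4 * e + 2 * M * δ + 2 := by linarith
          refine le_trans ?_ q'
          exact q
        · simp only [hxe, if_false]
          exact hI x (by omega)
    · simp
      omega
    · intro s' _ h
      simpa [Approx] using h
  · intro s'' _ h x hx
    rw [(h x hx).1, (h x hx).2]
    exact hs' x hx
  · simp only [show (v regHalf + v regHalf).cost = 1 from rfl, show (c 0).cost = 1 from rfl]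
    omega

end WordRAM

/-! ### The Fourier transform and its inverse -/

namespace WordRAM

open Ex Cmd

theorem Approx.mono {s : State} {A A' : ℕ} {S : ℤ} {N : ℕ} {z : ℕ → ℂ} {e e' : ℝ}
    (h : Approx s A A' S N z e) (he : e ≤ e') : Approx s A A' S N z e' :=
  fun x hx => (h x hx).trans he

theorem Approx.of_frame {P : Cmd} {s s' : State} (hF : P.Frame s s') {A A' : ℕ}
    (hA : P.setsArr A = false) (hA' : P.setsArr A' = false) {S : ℤ} {N : ℕ} {z : ℕ → ℂ} {e : ℝ}
    (h : Approx s A A' S N z e) : Approx s' A A' S N z e := by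
  intro x hx
  rw [hF.arr _ hA, hF.arr _ hA']
  exact h x hx

/-- The Fourier transform. -/
def forward : Cmd :=
  .assign regHalf (v regLen / c 2) ;;
  .loop (c 0) (v regHalf) (forwardLevel ;; .assign regHalf (v regHalf / c 2))

/-- The input is exact, and a level maps an error e to 3e + c with c = Mδ + 2. The bound 4^l c
survives this since 3 · 4^l + 1 ≤ 4^(l+1). -/
theorem forward_spec {V B : ℕ} (hV : 16 ≤ V) (hB : V ^ 10 ≤ B) {s : State} {K N : ℕ}
    (hNK : N = 2 ^ K) {S : ℤ} (hS : 0 < S) {δ M : ℝ} {a : ℕ → ℂ}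
    (hN : s.var regLen = N) (hscale : s.var regScale = S) (hNV : 2 * N ≤ V)
    (hδ : 0 ≤ δ) (hδS : δ ≤ S) (hM : ∀ l ≤ K, ∀ x, ‖FFT.level a l (2 ^ (K - l)) x‖ ≤ M)
    (hVM : S * (2 * M) + 4 ^ K * (M * δ + 2) ≤ V) (hVS : 2 * S ≤ V)
    (hX : Approx s memRe memIm S N a 0) (hW : Approx s memCos memSin S N FFT.root δ) :
    forward.Spec B s (70 * N * K + 30 * K + 10) (fun s' =>
      Approx s' memRe memIm S N (FFT.level a K 1) (4 ^ K * (M * δ + 2))) := by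
  have hVB : V ≤ B := (Nat.le_self_pow (by norm_num) V).trans hB
  have hVB' : (V : ℤ) ≤ B := by exact_mod_cast hVB
  have hM0 : 0 ≤ M := (norm_nonneg _).trans (hM 0 (by omega) 0)
  have hMδ : 0 ≤ M * δ := mul_nonneg hM0 hδ
  have hNV' : N ≤ V := by omega
  refine (Spec.assign_seq hV hB ((2 ^ K / 2 : ℕ) : ℤ) (by decide) (by simp [hN]; omega) (by simp [hN, hNK]) <|
    -- For `l = K` the half length is `1 / 2 = 0` in the natural numbers, which ends the loop.
    Spec.loop K (fun l s' => s'.var regHalf = ((2 ^ (K - l) / 2 : ℕ) : ℤ) ∧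
      Approx s' memRe memIm S N (FFT.level a l (2 ^ (K - l))) (4 ^ l * (M * δ + 2)))
      (fun _ => 70 * N + 15 + 4) ?_ ?_ ?_ ?_).mono ?_ ?_
  · refine ⟨by simp [State.var_setVar], fun x hx => ?_⟩
    have := hX x hx
    rw [Nat.sub_zero, ← hNK, FFT.level_zero a hx]
    refine this.trans (by positivity)
  · intro l hl s' _ _
    exact ⟨by simp [Ex.ok], by simp [Ex.ok]⟩
  · rintro l hl s' ⟨h₁, h₂⟩ hF
    have hpow : 2 ^ (K - l) = 2 * 2 ^ (K - l - 1) := by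
      rw [← pow_succ']; congr 1; omega
    have hhalf : 2 ^ (K - l) / 2 = 2 ^ (K - l - 1) := by omega
    have hpos : 0 < 2 ^ (K - l - 1) := by positivity
    rw [hhalf] at h₁
    have hbN : 2 ^ (K - l) ≤ N := by rw [hNK]; exact Nat.pow_le_pow_right (by norm_num) (by omega)
    have hsub : K - (l + 1) = K - l - 1 := by omega
    have h4 : (1 : ℝ) ≤ 4 ^ l := one_le_pow₀ (by norm_num)
    have herr : 3 * (4 ^ l * (M * δ + 2)) + M * δ + 2 ≤ 4 ^ (l + 1) * (M * δ + 2) := by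
      rw [pow_succ]; nlinarith
    have herr' : 4 ^ (l + 1) * (M * δ + 2) ≤ 4 ^ K * (M * δ + 2) :=
      mul_le_mul_of_nonneg_right (pow_le_pow_right₀ (by norm_num) (by omega)) (by linarith)
    refine ⟨by simp only [eval_c, eval_v, h₁]; exact_mod_cast hpos, ?_⟩
    refine Spec.seq (forwardLevel_spec hV hB hpow hpos (n := 2 ^ l) (by positivity)
      (by rw [hNK, ← pow_add]; congr 1; omega) hS (e := 4 ^ l * (M * δ + 2))
      (z' := FFT.level a (l + 1) (2 ^ (K - (l + 1))))
      (by rw [hF.var _ (by decide) (by decide)]; simp [State.var_setVar, hN]) h₁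
      (by rw [hF.var _ (by decide) (by decide)]; simp [State.var_setVar, hscale]) hNV (by positivity) hδ hδS
      (hM l hl.le) (fun x => (hM (l + 1) hl x).trans (by linarith)) (by linarith) hVS h₂
      (Approx.of_frame hF (by decide) (by decide) hW) ?_ ?_) ?_
    · intro x hx
      rw [hsub, FFT.level_low a l (by rw [← hpow]; exact hx), ← hpow]
    · intro x hx
      rw [hsub, FFT.level_high a l hpos (by rw [← hpow]; exact hx), ← hpow]
    · intro s'' hF' h₃
      have h₄ : s''.var regHalf = ((2 ^ (K - l - 1) : ℕ) : ℤ) := by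
        rw [hF'.var _ (by decide) (by decide), h₁]
      refine Spec.of_wpV hV hB (by decide) ?_
      simp only [wpV, deg_div, deg_v, deg_c, leafOk_div, leafOk_v, leafOk_c, eval_div, eval_v, eval_c, h₄]
      refine ⟨by decide, ⟨⟨by decide, by rw [Nat.abs_cast]; omega⟩, by norm_num⟩, ?_, ?_⟩
      · simp [State.var_setVar, hsub]
      · intro x hx
        exact (h₃ x hx).trans (by linarith)
  · rintro s' ⟨h₁, -⟩ hF
    simp [h₁]
  · simp [Ex.cost]
    show 4 + _ ≤ _
    ring_nf
    omega
  · rintro s' hF ⟨-, h₂⟩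
    simpa using h₂

/-- The inverse Fourier transform. -/
def backward : Cmd :=
  .assign regHalf (c 1) ;;
  .loop (v regHalf) (v regLen) (backwardLevel ;; .assign regHalf (v regHalf + v regHalf))

/-- Because nothing is halved, the entries after `l` rounds are `2 ^ l` times those of a level, and
`M` is a common bound for all rounds. With c = 2Mδ + 2 a round maps e to 4e + c, and 5^l (e + c)
dominates the iteration. -/
theorem backward_spec {V B : ℕ} (hV : 16 ≤ V) (hB : V ^ 10 ≤ B) {s : State} {K N : ℕ}
    (hNK : N = 2 ^ K) {S : ℤ} (hS : 0 < S) {e δ M : ℝ} {a : ℕ → ℂ} (he : 0 ≤ e)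
    (hN : s.var regLen = N) (hscale : s.var regScale = S) (hNV : 2 * N ≤ V)
    (hδ : 0 ≤ δ) (hδS : δ ≤ S) (hM : ∀ l ≤ K, ∀ x, 2 ^ l * ‖FFT.level a (K - l) (2 ^ l) x‖ ≤ M)
    (hVM : S * (2 * M) + 5 ^ K * (e + 2 * M * δ + 2) ≤ V) (hVS : 2 * S ≤ V)
    (hX : Approx s memRe memIm S N (FFT.level a K 1) e)
    (hW : Approx s memCos memSin S N FFT.root δ) :
    backward.Spec B s (70 * N * K + 30 * K + 10) (fun s' =>
      Approx s' memRe memIm S N (fun x => 2 ^ K * a x) (5 ^ K * (e + 2 * M * δ + 2))) := by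
  have hVB : V ≤ B := (Nat.le_self_pow (by norm_num) V).trans hB
  have hVB' : (V : ℤ) ≤ B := by exact_mod_cast hVB
  have hM0 : 0 ≤ M := le_trans (by positivity) (hM 0 (by omega) 0)
  have hMδ : 0 ≤ M * δ := mul_nonneg hM0 hδ
  have hN1 : 1 ≤ N := by rw [hNK]; exact Nat.one_le_two_pow
  refine (Spec.assign_seq hV hB 1 (by decide) (by simp) (by simp) <|
    Spec.loop K (fun l s' => s'.var regHalf = ((2 ^ l : ℕ) : ℤ) ∧
      Approx s' memRe memIm S N (fun x => 2 ^ l * FFT.level a (K - l) (2 ^ l) x)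
        (5 ^ l * (e + 2 * M * δ + 2)))
      (fun _ => 70 * N + 15 + 4) ?_ ?_ ?_ ?_).mono ?_ ?_
  · refine ⟨by simp [State.var_setVar], fun x hx => ?_⟩
    have := hX x hx
    simp only [pow_zero, one_mul, Nat.sub_zero]
    refine this.trans (by linarith)
  · intro l hl s' _ _
    exact ⟨by simp [Ex.ok], by simp [Ex.ok]⟩
  · rintro l hl s' ⟨h₁, h₂⟩ hF
    have hpow : 2 ^ (l + 1) = 2 * 2 ^ l := pow_succ' _ _
    have hpos : 0 < 2 ^ l := by positivity
    have hbN : 2 ^ (l + 1) ≤ N := by rw [hNK]; exact Nat.pow_le_pow_right (by norm_num) (by omega)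
    have hsub : K - l = K - (l + 1) + 1 := by omega
    have h4 : (1 : ℝ) ≤ 5 ^ l := one_le_pow₀ (by norm_num)
    have herr : 4 * (5 ^ l * (e + 2 * M * δ + 2)) + 2 * M * δ + 2 ≤ 5 ^ (l + 1) * (e + 2 * M * δ + 2) := by
      rw [pow_succ]; nlinarith
    have herr' : 5 ^ (l + 1) * (e + 2 * M * δ + 2) ≤ 5 ^ K * (e + 2 * M * δ + 2) :=
      mul_le_mul_of_nonneg_right (pow_le_pow_right₀ (by norm_num) (by omega)) (by linarith)
    have hN' : s'.var regLen = N := by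
      rw [hF.var _ (by decide) (by decide)]; simp [State.var_setVar, hN]
    have hnorm : ∀ l x, ‖(2 ^ l * FFT.level a (K - l) (2 ^ l) x : ℂ)‖
        = 2 ^ l * ‖FFT.level a (K - l) (2 ^ l) x‖ := by
      intro l x; rw [norm_mul, norm_pow]; simp
    refine ⟨by simp only [eval_v, h₁, hN']; exact_mod_cast (by omega), ?_⟩
    refine Spec.seq (backwardLevel_spec hV hB hpow hpos (n := 2 ^ (K - (l + 1))) (by positivity)
      (by rw [hNK, ← pow_add]; congr 1; omega) hS (e := 5 ^ l * (e + 2 * M * δ + 2))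
      (z' := fun x => 2 ^ (l + 1) * FFT.level a (K - (l + 1)) (2 ^ (l + 1)) x) hN' h₁
      (by rw [hF.var _ (by decide) (by decide)]; simp [State.var_setVar, hscale]) hNV (by positivity) hδ hδS
      (fun x => by rw [hnorm]; exact hM l hl.le x)
      (fun x => by rw [hnorm]; exact (hM (l + 1) hl x).trans (by linarith)) (by linarith) hVS h₂
      (Approx.of_frame hF (by decide) (by decide) hW) ?_ ?_) ?_
    · intro x hx
      have := FFT.two_mul_level_low a (K - (l + 1)) (h := 2 ^ l) (x := x) (by rw [← hpow]; exact hx)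
      rw [hsub, ← mul_add, ← this, ← hpow]
      ring
    · intro x hx
      have := FFT.two_mul_level_high a (K - (l + 1)) hpos (x := x) (by rw [← hpow]; exact hx)
      rw [hsub, ← mul_sub, mul_left_comm, hpow, ← this]
      ring
    · intro s'' hF' h₃
      have h₄ : s''.var regHalf = ((2 ^ l : ℕ) : ℤ) := by
        rw [hF'.var _ (by decide) (by decide), h₁]
      refine Spec.of_wpV hV hB (by decide) ?_
      simp only [wpV, deg_add, deg_v, leafOk_add, leafOk_v, eval_add, eval_v, h₄]
      have : 2 ^ l ≤ V := by omega
      refine ⟨by decide, ⟨⟨by decide, by rw [Nat.abs_cast]; omega⟩, by decide, by rw [Nat.abs_cast]; omega⟩, ?_, ?_⟩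
      · simp [State.var_setVar, pow_succ]; ring
      · intro x hx
        exact (h₃ x hx).trans (by linarith)
  · rintro s' ⟨h₁, -⟩ hF
    have hN' : s'.var regLen = N := by
      rw [hF.var _ (by decide) (by decide)]; simp [State.var_setVar, hN]
    simp [h₁, hN', hNK]
  · simp [Ex.cost]
    ring_nf
    omega
  · rintro s' hF ⟨-, h₂⟩ x hx
    have := h₂ x hx
    simp only [Nat.sub_self] at this
    rwa [← hNK, FFT.level_zero a hx] at this

end WordRAM

/-! ### Tabulation of the roots of unity -/

namespace WordRAM

open Ex Cmd

/-- Tabulate the roots of unity. -/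
def table : Cmd :=
  .store memCos (c 0) (v regScale) ;;
  .store memSin (c 0) (c 0) ;;
  .assign regCount (c 1) ;;
  -- The first angle is π/2, with cosine 0 and sine 1.
  .assign regCos (c 0) ;;
  .assign regSin (v regScale) ;;
  .loop (v regCount) (v regLen) (
    (.assign regIdx (c 0) ;;
    .forUp regIdx regCount (
      .store memCos (v regIdx + v regCount) ((ld memCos (v regIdx) * v regCos -
        ld memSin (v regIdx) * v regSin) / v regScale) ;;
      .store memSin (v regIdx + v regCount) ((ld memCos (v regIdx) * v regSin +
        ld memSin (v regIdx) * v regCos) / v regScale))) ;;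
    .assign regCount (v regCount + v regCount) ;;
    -- The sine has to be updated first, as it is computed from the cosine of the previous angle.
    .assign regSin (sq ((v regScale * v regScale - v regScale * v regCos) / c 2)) ;;
    .assign regCos (sq ((v regScale * v regScale + v regScale * v regCos) / c 2)))

theorem norm_gauss_sub_exp_le {S x y : ℤ} {θ d d' : ℝ} (h : |x - S * Real.cos θ| ≤ d)
    (h' : |y - S * Real.sin θ| ≤ d') :
    ‖FFT.gauss x y - S * Complex.exp (θ * Complex.I)‖ ≤ d + d' := by
  refine (Complex.norm_le_abs_re_add_abs_im _).trans ?_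
  have e : (S : ℂ) = ((S : ℝ) : ℂ) := by push_cast; rfl
  rw [Complex.sub_re, Complex.sub_im, e, Complex.re_ofReal_mul, Complex.im_ofReal_mul,
    Complex.exp_ofReal_mul_I_re, Complex.exp_ofReal_mul_I_im]
  exact add_le_add h h'

/-- Doubles the table: the new half is the old one times the root for the current angle, which has
error η. Both factors have norm 1, so the errors combine to 2e + η + 2. -/
theorem table_inner_spec {V B : ℕ} (hV : 16 ≤ V) (hB : V ^ 10 ≤ B) {s : State} {l m : ℕ}
    (hm : m = 2 ^ l) {S C D : ℤ} (hS : 0 < S) (hcount : s.var regCount = (m : ℤ))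
    (hscale : s.var regScale = S) (hC : s.var regCos = C) (hD : s.var regSin = D)
    (hlV : 2 * m ≤ V) {e η : ℝ} (hη : 0 ≤ η) (hηS : η ≤ S) (he : 0 ≤ e) (hVS : S + (2 * e + η + 2) ≤ V)
    (hCD : ‖FFT.gauss C D - S * Complex.exp ((Real.pi / 2 ^ (l + 1) : ℝ) * Complex.I)‖ ≤ η)
    (hW : Approx s memCos memSin S m FFT.root e) :
    (Cmd.assign regIdx (c 0) ;;
    .forUp regIdx regCount (
      .store memCos (v regIdx + v regCount) ((ld memCos (v regIdx) * v regCos -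
        ld memSin (v regIdx) * v regSin) / v regScale) ;;
      .store memSin (v regIdx + v regCount) ((ld memCos (v regIdx) * v regSin +
        ld memSin (v regIdx) * v regCos) / v regScale))).Spec B s (40 * m + 4)
      (fun s' => Approx s' memCos memSin S (2 * m) FFT.root (2 * e + η + 2)) := by
  have hVB : V ≤ B := (Nat.le_self_pow (by norm_num) V).trans hB
  have hVB' : (V : ℤ) ≤ B := by exact_mod_cast hVB
  have hSr : (0 : ℝ) < S := by exact_mod_cast hS
  have nexp : ∀ θ : ℝ, ‖Complex.exp (θ * Complex.I)‖ = 1 := Complex.norm_exp_ofReal_mul_I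
  have cast_le : ∀ y : ℤ, |(y : ℝ)| ≤ S + (2 * e + η + 2) → |y| ≤ V := by
    intro y hy
    have : |(y : ℝ)| ≤ V := by linarith
    exact_mod_cast this
  have bCD : |C| ≤ V ∧ |D| ≤ V := by
    obtain ⟨h₁, h₂⟩ := FFT.abs_le_of_norm_gauss_sub_le hS.le hCD (nexp _).le
    exact ⟨cast_le _ (by linarith), cast_le _ (by linarith)⟩
  refine (Spec.assign_seq hV hB 0 (by decide) (by simp) (by simp) <|
    Spec.forUp 0 (m : ℤ) (fun i s' => Approx s' memCos memSin S m FFT.root e ∧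
      ∀ j < i, ‖FFT.gauss (s'.arr memCos (m + j : ℕ)) (s'.arr memSin (m + j : ℕ))
        - S * FFT.root (m + j)‖ ≤ 2 * e + η + 2) (fun _ => 30)
      (by decide)
      (by decide) (by decide) (by decide) (by decide) (by simp [State.var_setVar])
      (by simp [State.var_setVar, hcount]) (by omega) (by simp) (by rw [Nat.abs_cast]; omega)
      ⟨hW, by simp⟩ ?_).mono ?_ ?_
  · rintro i hi s' hx ⟨hI, hI'⟩ hF
    simp only [zero_add] at hi hx
    have hi' : i < m := by exact_mod_cast hi
    have f₁ : s'.var regCount = (m : ℤ) := by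
      rw [hF.var _ (by decide) (by decide)]; simp [State.var_setVar, hcount]
    have f₂ : s'.var regScale = S := by
      rw [hF.var _ (by decide) (by decide)]; simp [State.var_setVar, hscale]
    have f₃ : s'.var regCos = C := by
      rw [hF.var _ (by decide) (by decide)]; simp [State.var_setVar, hC]
    have f₄ : s'.var regSin = D := by
      rw [hF.var _ (by decide) (by decide)]; simp [State.var_setVar, hD]
    have bi : |s'.arr memCos i| ≤ V ∧ |s'.arr memSin i| ≤ V :=
      hI.abs_le hS.le (M := 1) (fun x => (FFT.norm_root x).le) (by linarith) hi'
    have hprod := FFT.norm_gauss_mul_sub_le hS (M := 1) (M' := 1) (hI i hi') hCD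
      (FFT.norm_root i).le (nexp _).le hηS
    rw [← FFT.root_two_pow_add (hm ▸ hi'), ← hm] at hprod
    have e₁ : (i : ℤ) + (m : ℤ) = ((m + i : ℕ) : ℤ) := by push_cast; ring
    have iV : i ≤ V := by omega
    have mV : m ≤ V := by omega
    have SV : |S| ≤ V := by
      rw [abs_of_pos hS]
      have : (S : ℝ) ≤ V := by linarith
      exact_mod_cast this
    have e₂ : ¬ (i : ℤ) = ((m + i : ℕ) : ℤ) := by omega
    refine Spec.of_wpV hV hB (by decide) ?_
    simp [wpV, State.arr_setArr, State.var_setVar, hx, f₁, f₂, f₃, f₄, e₁, e₂, -Nat.cast_add, -Int.natCast_add]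
    simp only [e₁, iV, mV, bi.1, bi.2, bCD.1, bCD.2, SV, e₂, if_false, true_and]
    refine ⟨fun x hx => ?_, fun x hxi => ?_⟩
    · have : ¬ (x : ℤ) = ((m + i : ℕ) : ℤ) := by omega
      simp only [this, and_false, if_false, State.arr_setVar, State.arr_setArr]
      exact hI x hx
    · by_cases hxe : x = i
      · subst hxe
        simp only [if_true]
        exact hprod.trans (by linarith)
      · simp only [hxe, if_false]
        exact hI' x (by omega)
  · simp [show (c 0).cost = 1 from rfl]
    omega
  · rintro s' - ⟨h₁, h₂⟩ x hx
    by_cases hxl : x < m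
    · exact (h₁ x hxl).trans (by linarith)
    · have := h₂ (x - m) (by simp; omega)
      rwa [show m + (x - m) = x by omega] at this

/-- With η = (4T) + 10 from the sine and the cosine, the recursion e ↦ 2e + η + 2 starting at 0 has
the exact solution (2^l - 1)(4T + 12). -/
theorem table_spec {V B : ℕ} (hV : 16 ≤ V) (hB : V ^ 10 ≤ B) {s : State} {K N : ℕ}
    (hNK : N = 2 ^ K) {T : ℤ} (hT : 6 ≤ T)
    (hN : s.var regLen = N) (hscale : s.var regScale = T ^ 2) (hNV : 2 * N ≤ V)
    (hVS : T ^ 2 + N * (4 * T + 12) ≤ V) :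
    table.Spec B s (40 * N * K + 80 * K + 30) (fun s' =>
      Approx s' memCos memSin (T ^ 2) N FFT.root (N * (4 * T + 12))) := by
  have hVB : V ≤ B := (Nat.le_self_pow (by norm_num) V).trans hB
  have hVB' : (V : ℤ) ≤ B := by exact_mod_cast hVB
  have hT' : (6 : ℝ) ≤ T := by exact_mod_cast hT
  have hVS' : ((T ^ 2 : ℤ) : ℝ) + N * (4 * T + 12) ≤ V := by
    have : ((T ^ 2 + N * (4 * T + 12) : ℤ) : ℝ) ≤ V := by exact_mod_cast hVS
    push_cast at this ⊢; exact this
  have hS1 : 1 ≤ T ^ 2 := by nlinarith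
  have hSV : |T ^ 2| ≤ V := by
    rw [abs_of_pos (by omega)]
    have : (0 : ℤ) ≤ N * (4 * T + 12) := by positivity
    omega
  -- This is where `6 ≤ T` is needed: the error of the multiplier must not exceed the scale.
  have hη : (4 * T + 10 : ℝ) ≤ ((T ^ 2 : ℤ) : ℝ) := by push_cast; nlinarith
  refine (Spec.store_seq hV hB 0 (T ^ 2) (by decide) (by simp) (by simpa [hscale] using hSV) (by simp)
    (by simp [hscale]) <|
    Spec.store_seq hV hB 0 0 (by decide) (by simp) (by simp) (by simp) (by simp) <|
    Spec.assign_seq hV hB 1 (by decide) (by simp) (by simp) <|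
    Spec.assign_seq hV hB 0 (by decide) (by simp) (by simp) <|
    Spec.assign_seq hV hB (T ^ 2) (by decide) (by simpa [hscale, State.var_setVar] using hSV)
      (by simp [hscale, State.var_setVar]) <|
    Spec.loop K (fun l s' => s'.var regCount = ((2 ^ l : ℕ) : ℤ) ∧ ∃ C D : ℤ, s'.var regCos = C ∧
      s'.var regSin = D ∧ 0 ≤ C ∧ C ≤ T ^ 2 ∧
      |C - ((T ^ 2 : ℤ) : ℝ) * Real.cos (Real.pi / 2 ^ (l + 1))| ≤ 10 ∧
      |D - ((T ^ 2 : ℤ) : ℝ) * Real.sin (Real.pi / 2 ^ (l + 1))| ≤ 4 * T ∧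
      Approx s' memCos memSin (T ^ 2) (2 ^ l) FFT.root ((2 ^ l - 1) * (4 * T + 12)))
      (fun _ => (40 * N + 4) + 30) ?_ ?_ ?_ ?_).mono ?_ ?_
  · refine ⟨by simp [State.var_setVar], 0, T ^ 2, by simp [State.var_setVar],
      by simp [State.var_setVar], le_rfl, by positivity, by simp, ?_, ?_⟩
    · simp; linarith
    · intro x hx
      have : x = 0 := by simpa using hx
      subst this
      have : FFT.gauss (T ^ 2) 0 = ((T ^ 2 : ℤ) : ℂ) := by apply Complex.ext <;> simp [FFT.gauss] <;> norm_cast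
      simp [State.arr_setArr, FFT.root_zero]
      rw [this]
      simp
  · intro l hl s' _ _
    exact ⟨by simp [Ex.ok], by simp [Ex.ok]⟩
  · rintro l hl s' ⟨h₁, C, D, hC, hD, hC0, hCS, hc, hd, hW⟩ hF
    obtain ⟨m, hm⟩ : ∃ m, m = 2 ^ l := ⟨_, rfl⟩
    have hpow : 2 ^ (l + 1) = 2 * m := by rw [hm]; exact pow_succ' _ _
    rw [← hm] at h₁ hW
    have hbN : 2 ^ (l + 1) ≤ N := by rw [hNK]; exact Nat.pow_le_pow_right (by norm_num) (by omega)
    have hbNr : (2 ^ (l + 1) : ℝ) ≤ N := by exact_mod_cast hbN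
    have hN' : s'.var regLen = N := by
      rw [hF.var _ (by decide) (by decide)]; simp [State.var_setVar, hN]
    have hS' : s'.var regScale = T ^ 2 := by
      rw [hF.var _ (by decide) (by decide)]; simp [State.var_setVar, hscale]
    have h2 : (1 : ℝ) ≤ 2 ^ l := one_le_pow₀ (by norm_num)
    have hS0 : 0 < T ^ 2 := by omega
    have hmV : 2 * m ≤ V := by omega
    have herr : 2 * ((2 ^ l - 1) * (4 * T + 12)) + (10 + 4 * T) + 2
        = ((2 ^ (l + 1) - 1) * (4 * T + 12) : ℝ) := by rw [pow_succ]; ring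
    have herr' : ((2 ^ (l + 1) - 1) * (4 * T + 12) : ℝ) ≤ N * (4 * T + 12) :=
      mul_le_mul_of_nonneg_right (by linarith) (by linarith)
    have hmN : m < N := by have : 0 < m := by rw [hm]; positivity
                           omega
    refine ⟨by simp only [eval_v, h₁, hN']; exact_mod_cast hmN, ?_⟩
    refine (Spec.seq (table_inner_spec hV hB hm hS0 h₁ hS' hC hD hmV
      (by linarith) (by linarith) (mul_nonneg (by linarith) (by linarith)) (by linarith)
      (norm_gauss_sub_exp_le hc hd) hW) ?_).mono (T := 40 * m + 4 + 30)
      (by show 40 * m + 4 + 30 ≤ 40 * N + 4 + 30; omega) fun _ _ h => h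
    intro s'' hF' h₃
    have g₁ : s''.var regCount = (m : ℤ) := by rw [hF'.var _ (by decide) (by decide), h₁]
    have g₂ : s''.var regScale = T ^ 2 := by rw [hF'.var _ (by decide) (by decide), hS']
    have g₃ : s''.var regCos = C := by rw [hF'.var _ (by decide) (by decide), hC]
    have hθ : Real.pi / 2 ^ (l + 1) ≤ Real.pi / 2 := by
      apply div_le_div_of_nonneg_left Real.pi_pos.le (by norm_num)
      rw [pow_succ]; linarith
    have hθ0 : 0 ≤ Real.pi / 2 ^ (l + 1) := by have := Real.pi_pos; positivity
    have hhalf : Real.pi / 2 ^ (l + 1) / 2 = Real.pi / 2 ^ (l + 1 + 1) := by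
      rw [pow_succ _ (l + 1), div_div]
    have k₁ := FFT.sqrt_cos_bound hS1 hC0 hCS hθ0 hθ hc
    have k₂ := FFT.sqrt_sin_bound (T := T) (by omega) hCS hθ0 hθ (by exact_mod_cast hc)
    rw [hhalf] at k₁ k₂
    have CV : |C| ≤ V := by
      rw [abs_of_nonneg hC0]
      rw [abs_of_pos (by omega)] at hSV
      omega
    have n₁ : 0 ≤ (T ^ 2 * T ^ 2 - T ^ 2 * C) / 2 := by
      have : 0 ≤ T ^ 2 * (T ^ 2 - C) := mul_nonneg (by positivity) (by omega)
      have e : T ^ 2 * T ^ 2 - T ^ 2 * C = T ^ 2 * (T ^ 2 - C) := by ring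
      omega
    have n₂ : 0 ≤ (T ^ 2 * T ^ 2 + T ^ 2 * C) / 2 := by positivity
    have lV : (m : ℤ) ≤ V := by omega
    have lV' : |(m : ℤ)| ≤ V := by rw [Nat.abs_cast]; omega
    refine Spec.of_wpV hV hB (by decide) ?_
    simp only [wpV, leafOk_add, leafOk_sub, leafOk_mul, leafOk_div, leafOk_v, leafOk_c, leafOk_sq,
      eval_add, eval_sub, eval_mul, eval_div, eval_v, eval_c, eval_sq, State.var_setVar]
    norm_num [g₁, g₂, g₃, hSV, CV, lV', n₁, n₂, -Real.cos_pi_over_two_pow,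
      -Real.sin_pi_over_two_pow_succ]
    rw [abs_of_pos (by omega)] at hSV
    refine ⟨by omega, hSV, ?_, k₁.2, by exact_mod_cast k₁.1, by exact_mod_cast k₂, fun x hx => ?_⟩
    · rw [pow_succ, ← (show ((m : ℕ) : ℤ) = 2 ^ l by rw [hm]; push_cast; rfl)]; ring
    · rw [hpow] at hx
      exact (h₃ x hx).trans herr.le
  · rintro s' ⟨h₁, -⟩ hF
    have hN' : s'.var regLen = N := by
      rw [hF.var _ (by decide) (by decide)]; simp [State.var_setVar, hN]
    simp [h₁, hN', hNK]
  · simp [Ex.cost]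
    ring_nf
    omega
  · rintro s' hF ⟨-, C, D, -, -, -, -, -, -, h₂⟩
    rw [hNK]
    push_cast
    refine h₂.mono ?_
    linarith

end WordRAM

-- Preparing the data of a convolution, and the pointwise product

notation "argI" => (2 : ℕ)
notation "argS" => (3 : ℕ)
notation "argJ" => (4 : ℕ)
notation "argD" => (5 : ℕ)
notation "argSign" => (6 : ℕ)
notation "regStart" => (26 : ℕ)
notation "regSize" => (27 : ℕ)

namespace WordRAM

open Ex Cmd

/-- The terms `f I, …, f (I + n - 1)`, followed by zeros. -/
def segment (f : ℤ → ℤ) (I : ℤ) (n : ℕ) (t : ℕ) : ℤ := if t < n then f (I + t) else 0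

/-- The least power of two that is at least `argS + argD`. -/
def findLen : Cmd :=
  .assign regLen (c 1) ;;
  .loop (v regLen) (v argS + v argD) (.assign regLen (v regLen + v regLen))

theorem findLen_spec {V B : ℕ} (hV : 16 ≤ V) (hB : V ^ 10 ≤ B) {s : State} {n d : ℕ}
    (hS : s.var argS = n) (hD : s.var argD = d) (hVn : 2 * (n + d) ≤ V) :
    findLen.Spec B s (10 * Nat.clog 2 (n + d) + 10)
      (fun s' => s'.var regLen = ((2 ^ Nat.clog 2 (n + d) : ℕ) : ℤ)) := by
  have hVB : V ≤ B := (Nat.le_self_pow (by norm_num) V).trans hB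
  have hVB' : (V : ℤ) ≤ B := by exact_mod_cast hVB
  refine (Spec.assign_seq hV hB 1 (by decide) (by simp) (by simp) <|
    Spec.loop (Nat.clog 2 (n + d)) (fun l s' => s'.var regLen = ((2 ^ l : ℕ) : ℤ))
      (fun _ => 3) ?_ ?_ ?_ ?_).mono ?_ ?_
  · simp [State.var_setVar]
  · intro l hl s' h hF
    have h₁ : s'.var argS = n := by
      rw [hF.var _ (by decide) (by decide)]; simp [State.var_setVar, hS]
    have h₂ : s'.var argD = d := by
      rw [hF.var _ (by decide) (by decide)]; simp [State.var_setVar, hD]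
    refine ⟨by simp [Ex.ok], ok_of_leafOk hV hB ?_ (by decide)⟩
    simp [h₁, h₂]
    omega
  · intro l hl s' h hF
    have h₁ : s'.var argS = n := by
      rw [hF.var _ (by decide) (by decide)]; simp [State.var_setVar, hS]
    have h₂ : s'.var argD = d := by
      rw [hF.var _ (by decide) (by decide)]; simp [State.var_setVar, hD]
    have hlt : 2 ^ l < n + d := (Nat.lt_clog_iff_pow_lt (by norm_num)).1 hl
    generalize hm : 2 ^ l = m at *
    refine ⟨by simp [h, h₁, h₂]; exact_mod_cast hlt, Spec.of_wpV hV hB (by decide) ?_⟩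
    simp [wpV, h, State.var_setVar, pow_succ, hm]
    omega
  · intro s' h hF
    have h₁ : s'.var argS = n := by
      rw [hF.var _ (by decide) (by decide)]; simp [State.var_setVar, hS]
    have h₂ : s'.var argD = d := by
      rw [hF.var _ (by decide) (by decide)]; simp [State.var_setVar, hD]
    have := Nat.le_pow_clog (b := 2) (by norm_num) (n + d)
    simp only [eval_v, eval_add, h, h₁, h₂]
    exact_mod_cast not_lt.2 this
  · simp [Ex.cost, show (v argS + v argD).cost = 1 from rfl]
    omega
  · exact fun _ _ h => h

/-- Add the squares of the terms of a segment of the array `A`. -/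
def addSquares (A : ℕ) : Cmd :=
  .assign regIdx (c 0) ;;
  .forUp regIdx regSize (.assign regMax (v regMax + ld A (v regStart + v regIdx) *
    ld A (v regStart + v regIdx)))

/-- Integers satisfy |x| ≤ x², so the sum of the squares bounds all terms of the segment and is
found without any comparison. -/
theorem addSquares_spec {V B : ℕ} (hV : 16 ≤ V) (hB : V ^ 10 ≤ B) {A : ℕ} {s : State} {n : ℕ} {I X : ℤ}
    {Y : ℕ} (hn : s.var regSize = n) (hI : s.var regStart = I) (hX : s.var regMax = X)
    (hA : ∀ i, |s.arr A i| ≤ Y) (hX0 : 0 ≤ X) (hVn : X + n * Y ^ 2 + |I| + n + Y ≤ V) :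
    (addSquares A).Spec B s (20 * n + 10)
      (fun s' => s'.var regMax = X + ∑ i ∈ Finset.range n, s.arr A (I + i) ^ 2) := by
  have hVB : V ≤ B := (Nat.le_self_pow (by norm_num) V).trans hB
  have hVB' : (V : ℤ) ≤ B := by exact_mod_cast hVB
  have hnY : (0 : ℤ) ≤ n * Y ^ 2 := by positivity
  have hI0 := abs_nonneg I
  refine (Spec.assign_seq hV hB 0 (by decide) (by simp) (by simp) <|
    Spec.forUp 0 n (fun l s' => s'.var regMax = X + ∑ i ∈ Finset.range l, s.arr A (I + i) ^ 2)
      (fun _ => 12) (by decide)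
      (by decide) rfl rfl (by decide) (by simp [State.var_setVar])
      (by simp [State.var_setVar, hn]) (by omega) (by simp) (by rw [Nat.abs_cast]; omega)
      (by simp [State.var_setVar, hX]) ?_).mono ?_ ?_
  · intro i hi s' hx h hF
    simp only [zero_add] at hi hx
    have f₁ : s'.var regStart = I := by
      rw [hF.var _ (by decide) rfl]; simp [State.var_setVar, hI]
    have f₂ : s'.arr A = s.arr A := by rw [hF.arr _ (by simp [setsArr])]; rfl
    have hsum : ∑ j ∈ Finset.range i, s.arr A (I + j) ^ 2 ≤ n * Y ^ 2 := by
      refine (Finset.sum_le_card_nsmul _ _ ((Y : ℤ) ^ 2) fun j _ => ?_).trans ?_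
      · exact sq_le_sq' (by linarith [(abs_le.1 (hA (I + j))).1]) (abs_le.1 (hA (I + j))).2
      · simp only [Finset.card_range, nsmul_eq_mul]
        exact mul_le_mul_of_nonneg_right (by omega) (by positivity)
    have hsum0 : 0 ≤ ∑ j ∈ Finset.range i, s.arr A (I + j) ^ 2 :=
      Finset.sum_nonneg fun _ _ => sq_nonneg _
    have b₁ : |X + ∑ j ∈ Finset.range i, s.arr A (I + j) ^ 2| ≤ V := by
      rw [abs_of_nonneg (by omega)]; omega
    have b₂ : |I| ≤ V := by omega
    have b₃ : i ≤ V := by omega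
    have b₄ : |s.arr A (I + i)| ≤ V := (hA _).trans (by omega)
    refine Spec.of_wpV hV hB (P := .assign _ _) (Nat.le_of_ble_eq_true rfl) ?_
    simp [wpV, hx, h, f₁, f₂, b₁, b₂, b₃, b₄, State.var_setVar, Finset.sum_range_succ]
    ring
  · simp [show (c 0).cost = 1 from rfl]
    omega
  · intro s' _ h
    simpa using h

/-- Load a scaled segment of the array `A` for the Fourier transform. -/
def loadSegment (A : ℕ) : Cmd :=
  .assign regIdx (c 0) ;;
  .forUp regIdx regLen (
    .ite (v regIdx) (v regSize)
      (.store memRe (v regIdx) (v regScale * ld A (v regStart + v regIdx)))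
      (.store memRe (v regIdx) (c 0)) ;;
    .store memIm (v regIdx) (c 0))

/-- The error is `0`: multiples of the scale represent integers exactly. -/
theorem loadSegment_spec {V B : ℕ} (hV : 16 ≤ V) (hB : V ^ 10 ≤ B) {A : ℕ} (hA10 : A < 10) {s : State}
    {n N : ℕ} {I S : ℤ} (hN : s.var regLen = N) (hn : s.var regSize = n) (hI : s.var regStart = I)
    (hS : s.var regScale = S) (hA : ∀ i, |s.arr A i| ≤ V) (hSV : |S| ≤ V) (hIV : |I| ≤ V)
    (hNV : N ≤ V) (hnV : n ≤ V) :
    (loadSegment A).Spec B s (30 * N + 10)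
      (fun s' => Approx s' memRe memIm S N (fun t => ((segment (s.arr A) I n t : ℤ) : ℂ)) 0) := by
  have hVB : V ≤ B := (Nat.le_self_pow (by norm_num) V).trans hB
  have hVB' : (V : ℤ) ≤ B := by exact_mod_cast hVB
  refine (Spec.assign_seq hV hB 0 (by decide) (by simp) (by simp) <|
    Spec.forUp 0 N (fun l s' => ∀ t < l, ‖FFT.gauss (s'.arr memRe (t : ℕ)) (s'.arr memIm (t : ℕ)) -
        S * ((segment (s.arr A) I n t : ℤ) : ℂ)‖ ≤ 0)
      (fun _ => 20) (by decide)
      (by decide) rfl rfl (by decide) (by simp [State.var_setVar])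
      (by simp [State.var_setVar, hN]) (by omega) (by simp) (by rw [Nat.abs_cast]; omega)
      (by simp) ?_).mono ?_ ?_
  · intro i hi s' hx h hF
    simp only [zero_add] at hi hx
    have f₁ : s'.var regStart = I := by
      rw [hF.var _ (by decide) rfl]; simp [State.var_setVar, hI]
    have f₂ : s'.arr A = s.arr A := by
      rw [hF.arr _ (by simp [setsArr]; omega)]; rfl
    have f₃ : s'.var regSize = n := by
      rw [hF.var _ (by decide) rfl]; simp [State.var_setVar, hn]
    have f₄ : s'.var regScale = S := by
      rw [hF.var _ (by decide) rfl]; simp [State.var_setVar, hS]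
    have b₃ : i ≤ V := by omega
    have b₄ : |s.arr A (I + i)| ≤ V := hA _
    refine Spec.of_wpV hV hB (Nat.le_of_ble_eq_true rfl) ?_
    simp [wpV, hx, f₁, f₂, f₃, f₄, b₃, b₄, hnV, hSV, hIV, State.arr_setArr]
    constructor
    all_goals
      intro hin x hxi
      by_cases hxe : x = i
      · subst hxe
        first
        | have h0 : ¬ x < n := by omega
          simp [segment, h0, FFT.gauss]
          rfl
        | simp [segment, hin, FFT.gauss]
          apply Complex.ext <;> simp
      · simpa [hxe] using h x (by omega)
  · simp [show (c 0).cost = 1 from rfl]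
    omega
  · intro s' _ h
    simpa [Approx] using h

/-- Copy the first pair of arrays to the second one. -/
def saveTransform : Cmd :=
  .assign regIdx (c 0) ;;
  .forUp regIdx regLen (
    .store memRe2 (v regIdx) (ld memRe (v regIdx)) ;;
    .store memIm2 (v regIdx) (ld memIm (v regIdx)))

theorem saveTransform_spec {V B : ℕ} (hV : 16 ≤ V) (hB : V ^ 10 ≤ B) {s : State} {N : ℕ}
    (hN : s.var regLen = N) (hNV : N ≤ V) {S : ℤ} {z : ℕ → ℂ} {e : ℝ}
    (hX : Approx s memRe memIm S N z e)
    (hZ : ∀ x : ℕ, x < N → |s.arr memRe x| ≤ V ∧ |s.arr memIm x| ≤ V) :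
    saveTransform.Spec B s (20 * N + 10) (fun s' => Approx s' memRe2 memIm2 S N z e) := by
  have hVB : V ≤ B := (Nat.le_self_pow (by norm_num) V).trans hB
  have hVB' : (V : ℤ) ≤ B := by exact_mod_cast hVB
  refine (Spec.assign_seq hV hB 0 (by decide) (by simp) (by simp) <|
    Spec.forUp 0 N (fun l s' => ∀ t < l, ‖FFT.gauss (s'.arr memRe2 (t : ℕ)) (s'.arr memIm2 (t : ℕ)) -
        S * z t‖ ≤ e)
      (fun _ => 10) (by decide)
      (by decide) (by decide) (by decide) (by decide) (by simp [State.var_setVar])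
      (by simp [State.var_setVar, hN]) (by omega) (by simp) (by rw [Nat.abs_cast]; omega)
      (by simp) ?_).mono ?_ ?_
  · intro i hi s' hx h hF
    simp only [zero_add] at hi hx
    have f₁ : s'.arr memRe = s.arr memRe := by rw [hF.arr _ (by decide)]; rfl
    have f₂ : s'.arr memIm = s.arr memIm := by rw [hF.arr _ (by decide)]; rfl
    have b₃ : i ≤ V := by omega
    have hi' : i < N := by omega
    have b₄ := hZ i hi'
    refine Spec.of_wpV hV hB (show _ ≤ 10 by decide) ?_
    simp [wpV, hx, f₁, f₂, b₃, b₄, State.arr_setArr]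
    intro x hxi
    by_cases hxe : x = i
    · subst hxe
      simpa using hX x hi'
    · simpa [hxe] using h x (by omega)
  · simp [show (c 0).cost = 1 from rfl]
    omega
  · intro s' _ h
    simpa [Approx] using h

/-- Multiply the first pair of arrays by the second one. -/
def pointwise : Cmd :=
  .assign regIdx (c 0) ;;
  .forUp regIdx regLen (
    .assign regRe ((ld memRe (v regIdx) * ld memRe2 (v regIdx) -
      ld memIm (v regIdx) * ld memIm2 (v regIdx)) / v regScale) ;;
    .assign regIm ((ld memRe (v regIdx) * ld memIm2 (v regIdx) +
      ld memIm (v regIdx) * ld memRe2 (v regIdx)) / v regScale) ;;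
    .store memRe (v regIdx) (v regRe) ;;
    .store memIm (v regIdx) (v regIm))

theorem pointwise_spec {V B : ℕ} (hV : 16 ≤ V) (hB : V ^ 10 ≤ B) {s : State} {N : ℕ}
    (hN : s.var regLen = N) (hNV : N ≤ V) {S : ℤ} (hS : 0 < S) (hscale : s.var regScale = S)
    {z w : ℕ → ℂ} {e M : ℝ} (hz : ∀ x, ‖z x‖ ≤ M) (hw : ∀ x, ‖w x‖ ≤ M) (heS : e ≤ S)
    (hX : Approx s memRe memIm S N z e) (hY : Approx s memRe2 memIm2 S N w e)
    (hVM : S * M ^ 2 + (e * (2 * M + 1) + 2) ≤ V) (hVM' : S * M + e ≤ V) (hSV : S ≤ V) :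
    pointwise.Spec B s (50 * N + 10)
      (fun s' => Approx s' memRe memIm S N (fun x => z x * w x) (e * (2 * M + 1) + 2)) := by
  have hVB : V ≤ B := (Nat.le_self_pow (by norm_num) V).trans hB
  have hVB' : (V : ℤ) ≤ B := by exact_mod_cast hVB
  have cast_le : ∀ y : ℤ, |(y : ℝ)| ≤ S * M ^ 2 + (e * (2 * M + 1) + 2) → |y| ≤ V := by
    intro y hy
    have : |(y : ℝ)| ≤ V := by linarith
    exact_mod_cast this
  have hprod : ∀ x < N, ‖FFT.gauss
      ((s.arr memRe x * s.arr memRe2 x - s.arr memIm x * s.arr memIm2 x) / S)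
      ((s.arr memRe x * s.arr memIm2 x + s.arr memIm x * s.arr memRe2 x) / S) - S * (z x * w x)‖
      ≤ e * (2 * M + 1) + 2 := fun x hx =>
    (FFT.norm_gauss_mul_sub_le hS (hX x hx) (hY x hx) (hz x) (hw x) heS).trans (le_of_eq (by ring))
  refine (Spec.assign_seq hV hB 0 (by decide) (by simp) (by simp) <|
    -- The product overwrites its first factor, so the invariant also records that the cells from
    -- `l` on still have their old contents.
    Spec.forUp 0 N (fun l s' => (∀ t < l, ‖FFT.gauss (s'.arr memRe (t : ℕ)) (s'.arr memIm (t : ℕ)) -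
        S * (z t * w t)‖ ≤ e * (2 * M + 1) + 2) ∧ ∀ t : ℕ, l ≤ t → s'.arr memRe t = s.arr memRe t ∧
          s'.arr memIm t = s.arr memIm t)
      (fun _ => 35) (by decide)
      (by decide) (by decide) (by decide) (by decide) (by simp [State.var_setVar])
      (by simp [State.var_setVar, hN]) (by omega) (by simp) (by rw [Nat.abs_cast]; omega)
      (by simp) ?_).mono ?_ ?_
  · rintro i hi s' hx ⟨h, h'⟩ hF
    simp only [zero_add] at hi hx
    have f₁ : s'.arr memRe2 = s.arr memRe2 := by rw [hF.arr _ (by decide)]; rfl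
    have f₂ : s'.arr memIm2 = s.arr memIm2 := by rw [hF.arr _ (by decide)]; rfl
    have f₃ : s'.var regScale = S := by
      rw [hF.var _ (by decide) (by decide)]; simp [State.var_setVar, hscale]
    obtain ⟨f₄, f₅⟩ := h' i le_rfl
    have b₃ : i ≤ V := by omega
    have hi' : i < N := by omega
    obtain ⟨b₄, b₅⟩ := hX.abs_le hS.le hz hVM' hi'
    obtain ⟨b₆, b₇⟩ := hY.abs_le hS.le hw hVM' hi'
    have b₈ : |S| ≤ V := by rwa [abs_of_pos hS]
    have hzw : ‖z i * w i‖ ≤ M ^ 2 := by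
      rw [norm_mul, pow_two]
      exact mul_le_mul (hz i) (hw i) (norm_nonneg _) ((norm_nonneg _).trans (hz i))
    obtain ⟨b₉, b₁₀⟩ := FFT.abs_le_of_norm_gauss_sub_le hS.le (hprod i hi') hzw
    have c₁ := cast_le _ b₉
    have c₂ := cast_le _ b₁₀
    refine Spec.of_wpV hV hB (show _ ≤ 35 by decide) ?_
    simp [wpV, hx, f₁, f₂, f₃, f₄, f₅, b₃, b₄, b₅, b₆, b₇, b₈, c₁, c₂, State.arr_setArr,
      State.var_setVar]
    refine ⟨fun x hxi => ?_, fun x hxi => ?_⟩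
    · by_cases hxe : x = i
      · subst hxe
        simpa using hprod x hi'
      · simpa [hxe] using h x (by omega)
    · have : ¬ x = i := by omega
      simpa [this] using h' x (by omega)
  · simp [show (c 0).cost = 1 from rfl]
    omega
  · intro s' _ h
    simpa [Approx] using h.1

end WordRAM

/-! ### Rounding to the exact result -/

namespace FFT

/-- The quotient is x / (S N) rounded to the nearest integer; an error below half of S N leaves the
integer `c` as the only possibility. The imaginary part is ignored. -/
theorem round_eq {S N x y c : ℤ} (hS : 0 < S) (hN : 0 < N) {e : ℝ}
    (h : ‖gauss x y - S * (N * c)‖ ≤ e) (he : 2 * e < S * N) : (2 * x + S * N) / (2 * S * N) = c := by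
  have h₁ : |((x : ℝ) - S * (N * c))| ≤ e := by
    refine le_trans ?_ h
    have := Complex.abs_re_le_norm (gauss x y - S * (N * c))
    rw [show (S * (N * c) : ℂ) = ((S * (N * c) : ℝ) : ℂ) by push_cast; rfl, Complex.sub_re,
      Complex.ofReal_re] at this
    rw [show (S * (N * c) : ℂ) = ((S * (N * c) : ℝ) : ℂ) by push_cast; rfl]
    exact this
  rw [abs_le] at h₁
  have h₂ : (-(S * N) : ℝ) < 2 * x - 2 * S * N * c := by linarith
  have h₃ : (2 * x - 2 * S * N * c : ℝ) < S * N := by linarith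
  have h₂' : -(S * N) < 2 * x - 2 * S * N * c := by exact_mod_cast h₂
  have h₃' : 2 * x - 2 * S * N * c < S * N := by exact_mod_cast h₃
  have hpos : 0 < S * N := mul_pos hS hN
  rw [Int.ediv_eq_iff_of_pos (by linarith)]
  constructor <;> nlinarith

end FFT

/-! ### Sums over rectangles of index pairs -/

namespace WordRAM

open Ex Cmd

/-- The contribution of the products `f i * g j` with `I ≤ i < I + n` and `J ≤ j < J + d` to the
coefficient `m` of the Cauchy product. -/
def rectSum (f g : ℤ → ℤ) (I : ℤ) (n : ℕ) (J d m : ℤ) : ℤ :=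
  ∑ t ∈ Finset.range n, f (I + t) * if J ≤ m - (I + t) ∧ m - (I + t) < J + d then g (m - (I + t)) else 0

theorem conv_segment_eq_zero (f g : ℤ → ℤ) (I J : ℤ) {n d q : ℕ} (h : n + d ≤ q) :
    FFT.conv (segment f I n) (segment g J d) q = 0 := by
  refine Finset.sum_eq_zero fun i hi => ?_
  simp only [Finset.mem_range] at hi
  by_cases h₁ : i < n
  · rw [segment, segment, if_neg (show ¬ q - i < d by omega), mul_zero]
  · rw [segment, if_neg h₁, zero_mul]

/-- The linear convolution of the two segments lives in the cells below `n + d`, so a transform of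
length `N ≥ n + d` sees all of it; the offset `I + J` moves it to the right place. -/
theorem rectSum_eq (f g : ℤ → ℤ) (I J m : ℤ) {n d N : ℕ} (h : n + d ≤ N) :
    rectSum f g I n J d m = if 0 ≤ m - (I + J) ∧ m - (I + J) < N then
      FFT.conv (segment f I n) (segment g J d) (m - (I + J)).toNat else 0 := by
  by_cases h0 : 0 ≤ m - (I + J)
  · obtain ⟨q, hq⟩ := Int.eq_ofNat_of_zero_le h0
    have hm : m = I + J + q := by omega
    subst hm
    have e₁ : (I + J + q - (I + J)).toNat = q := by omega
    have key : rectSum f g I n J d (I + J + q) = FFT.conv (segment f I n) (segment g J d) q := by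
      unfold rectSum FFT.conv
      have h₁ : ∀ i ∈ Finset.range (q + 1), segment f I n i * segment g J d (q - i) =
          if i < n ∧ i ≤ q ∧ q < i + d then f (I + i) * g (J + q - i) else 0 := by
        intro i hi
        have hi : i < q + 1 := by simpa using hi
        by_cases hc : i < n ∧ i ≤ q ∧ q < i + d
        · rw [if_pos hc, segment, segment, if_pos hc.1, if_pos (by omega)]
          congr 2; push_cast [hc.2.1]; ring
        · rw [if_neg hc, segment, segment]
          split_ifs
          · omega
          all_goals simp
      have h₂ : ∀ i ∈ Finset.range n, (f (I + i) * if J ≤ I + J + q - (I + i) ∧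
          I + J + q - (I + i) < J + d then g (I + J + q - (I + i)) else 0) =
          if i < n ∧ i ≤ q ∧ q < i + d then f (I + i) * g (J + q - i) else 0 := by
        intro i hi
        have hi : i < n := by simpa using hi
        by_cases hc : i < n ∧ i ≤ q ∧ q < i + d
        · rw [if_pos hc, if_pos (by omega)]
          congr 2; ring
        · rw [if_neg hc, if_neg (by omega), mul_zero]
      rw [Finset.sum_congr rfl h₁, Finset.sum_congr rfl h₂]
      rw [Finset.sum_subset (Finset.range_subset_range.2 (show n ≤ n + (q + 1) by omega)),
        Finset.sum_subset (Finset.range_subset_range.2 (show q + 1 ≤ n + (q + 1) by omega))]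
      all_goals
        intro x _ hx
        rw [if_neg (by simp at hx; omega)]
    rw [key, e₁]
    split_ifs with hc
    · rfl
    · exact conv_segment_eq_zero f g I J (by omega)
  · rw [if_neg (by omega)]
    refine Finset.sum_eq_zero fun t _ => ?_
    rw [if_neg (by omega), mul_zero]

/-- Round the result of the inverse transform and add it to the output. -/
def addOut : Cmd :=
  .assign regIdx (c 0) ;;
  .forUp regIdx regLen (
    .store 8 (v argI + v argJ + v regIdx) (ld 8 (v argI + v argJ + v regIdx) +
      v argSign * ((c 2 * ld memRe (v regIdx) + v regScale * v regLen) /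
        (c 2 * v regScale * v regLen))))

theorem addOut_spec {V B : ℕ} (hV : 16 ≤ V) (hB : V ^ 10 ≤ B) {s : State} {N : ℕ}
    (hN : s.var regLen = N) (hN0 : 0 < N) {S I J sg : ℤ} (hS : 0 < S) (hscale : s.var regScale = S)
    (hI : s.var argI = I) (hJ : s.var argJ = J) (hsg : s.var argSign = sg) (hsg1 : |sg| ≤ 1)
    {u : ℕ → ℤ} {e : ℝ} (hX : Approx s memRe memIm S N (fun x => (N : ℂ) * (u x : ℂ)) e)
    (he : 2 * e < S * N) (hXV : ∀ x < N, |s.arr memRe x| ≤ V) (hout : ∀ m, |s.arr 8 m| ≤ V)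
    (hSV : S ≤ V) (hNV : N ≤ V) (hIV : |I| ≤ V) (hJV : |J| ≤ V) :
    addOut.Spec B s (50 * N + 10) (fun s' => ∀ m, s'.arr 8 m = s.arr 8 m + sg *
      if 0 ≤ m - (I + J) ∧ m - (I + J) < N then u (m - (I + J)).toNat else 0) := by
  have hVB : V ≤ B := (Nat.le_self_pow (by norm_num) V).trans hB
  have hVB' : (V : ℤ) ≤ B := by exact_mod_cast hVB
  refine (Spec.assign_seq hV hB 0 (by decide) (by simp) (by simp) <|
    Spec.forUp 0 N (fun l s' => ∀ m, s'.arr 8 m = s.arr 8 m + sg *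
      if 0 ≤ m - (I + J) ∧ m - (I + J) < l then u (m - (I + J)).toNat else 0)
      (fun _ => 40) (by decide)
      (by decide) (by decide) (by decide) (by decide) (by simp [State.var_setVar])
      (by simp [State.var_setVar, hN]) (by omega) (by simp) (by rw [Nat.abs_cast]; omega)
      ?_ ?_).mono ?_ ?_
  · intro m
    rw [if_neg (by omega)]
    simp
  · intro i hi s' hx h hF
    simp only [zero_add] at hi hx
    have f₁ : s'.arr memRe = s.arr memRe := by rw [hF.arr _ (by decide)]; rfl
    have f₃ : s'.var regScale = S := by
      rw [hF.var _ (by decide) (by decide)]; simp [State.var_setVar, hscale]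
    have f₄ : s'.var regLen = N := by
      rw [hF.var _ (by decide) (by decide)]; simp [State.var_setVar, hN]
    have f₅ : s'.var argI = I := by
      rw [hF.var _ (by decide) (by decide)]; simp [State.var_setVar, hI]
    have f₆ : s'.var argJ = J := by
      rw [hF.var _ (by decide) (by decide)]; simp [State.var_setVar, hJ]
    have f₇ : s'.var argSign = sg := by
      rw [hF.var _ (by decide) (by decide)]; simp [State.var_setVar, hsg]
    have b₃ : i ≤ V := by omega
    have hi' : i < N := by omega
    have b₄ := hXV i hi'
    have b₅ : |S| ≤ V := by rwa [abs_of_pos hS]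
    have b₆ : |sg| ≤ V := hsg1.trans (by omega)
    have hr : (2 * s.arr memRe i + S * N) / (2 * S * N) = u i :=
      FFT.round_eq hS (by exact_mod_cast hN0) (hX i hi') (by exact_mod_cast he)
    have h8 : s'.arr 8 (I + J + i) = s.arr 8 (I + J + i) := by
      rw [h, if_neg (by omega)]; simp
    have b₇ := hout (I + J + i)
    refine Spec.of_wpV hV hB (show _ ≤ 40 by decide) ?_
    simp [wpV, hx, f₁, f₃, f₄, f₅, f₆, f₇, b₃, b₄, b₅, b₆, b₇, hNV, hIV, hJV, hr, h8, State.arr_setArr]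
    intro m
    by_cases hm : m = I + J + i
    · subst hm
      simp
      intro h
      omega
    · rw [if_neg hm, h m]
      have : (I + J ≤ m ∧ m - (I + J) < i) ↔ (I + J ≤ m ∧ m - (I + J) < i + 1) := by omega
      simp [this]
  · simp [show (c 0).cost = 1 from rfl]
    omega
  · intro s' _ h
    simpa using h

end WordRAM

namespace FFT

/-- The numbers `p` and `q` stand for 4^K and 5^K with N = 2^K, the growth factors of the errors in
the two transforms. With G = N A all errors are linear in T: δ ≤ 5NT, e ≤ 6G⁴T after the forward
transform, e' ≤ 19G⁵T after the product, and at most 30G⁷NT at the end. The threshold T²N / 2 is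
quadratic in T, so T = 128G⁸ is large enough. -/
theorem error_bounds {N A p q V : ℝ} (hN : 1 ≤ N) (hA : 1 ≤ A) (hp0 : 0 ≤ p)
    (hp : p ≤ N ^ 2) (hq : q ≤ N ^ 3)
    (hV : 4 * (128 * (N * A) ^ 8) ^ 2 * (N * A) ^ 2 ≤ V) {T δ e e' : ℝ} (hT : T = 128 * (N * A) ^ 8)
    (hδ : δ = N * (4 * T + 12)) (he : e = p * (N * A * δ + 2)) (he' : e' = e * (2 * (N * A) + 1) + 2) :
    δ ≤ T ^ 2 ∧ T ^ 2 * (2 * (N * A)) + e ≤ V ∧ e ≤ T ^ 2 ∧ T ^ 2 * (N * A) ^ 2 + e' ≤ V ∧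
      T ^ 2 * (N * A) + e ≤ V ∧ T ^ 2 * (2 * (N * A) ^ 2) + q * (e' + 2 * (N * A) ^ 2 * δ + 2) ≤ V ∧
      2 * (q * (e' + 2 * (N * A) ^ 2 * δ + 2)) < T ^ 2 * N ∧ T ^ 2 + δ ≤ V := by
  rw [← hT] at hV
  set G := N * A with hG
  have hNG : N ≤ G := le_mul_of_one_le_right (by linarith) hA
  have hG1 : 1 ≤ G := hN.trans hNG
  have hG0 : 0 ≤ G := by linarith
  have hN0 : 0 ≤ N := by linarith
  have pw : ∀ {a b : ℕ}, a ≤ b → G ^ a ≤ G ^ b := fun h => pow_le_pow_right₀ hG1 h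
  have hT128 : 128 ≤ T := by
    have : (1 : ℝ) ≤ G ^ 8 := one_le_pow₀ hG1
    linarith
  have hT0 : 0 ≤ T := by linarith
  have d1 : δ ≤ 5 * N * T := by rw [hδ]; nlinarith
  have d2 : δ ≤ 5 * G * T := d1.trans (by gcongr)
  have d0 : 0 ≤ δ := by rw [hδ]; positivity
  have GT : 1 ≤ G ^ 2 * T := by
    have : (1 : ℝ) ≤ G ^ 2 := one_le_pow₀ hG1
    nlinarith
  have e1 : e ≤ 6 * G ^ 4 * T := by
    rw [he]
    have h₁ : G * δ + 2 ≤ 6 * G ^ 2 * T := by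
      have h := mul_le_mul_of_nonneg_left d2 hG0
      have : 2 ≤ G ^ 2 * T := by
        have : (1 : ℝ) ≤ G ^ 2 := one_le_pow₀ hG1
        nlinarith
      nlinarith
    calc p * (G * δ + 2) ≤ G ^ 2 * (6 * G ^ 2 * T) :=
          mul_le_mul (hp.trans (by gcongr)) h₁ (by positivity) (by positivity)
      _ = 6 * G ^ 4 * T := by ring
  have e0 : 0 ≤ e := by rw [he]; positivity
  have e1' : e' ≤ 19 * G ^ 5 * T := by
    rw [he']
    have h₁ : e * (2 * G + 1) ≤ 6 * G ^ 4 * T * (3 * G) :=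
      mul_le_mul e1 (by linarith) (by positivity) (by positivity)
    have h₂ : 2 ≤ G ^ 5 * T := by
      have : (1 : ℝ) ≤ G ^ 5 := one_le_pow₀ hG1
      nlinarith
    nlinarith
  have f1 : e' + 2 * G ^ 2 * δ + 2 ≤ 30 * G ^ 5 * T := by
    have h₁ : 2 * G ^ 2 * δ ≤ 2 * G ^ 2 * (5 * G * T) := by gcongr
    have h₂ : G ^ 3 * T ≤ G ^ 5 * T := mul_le_mul_of_nonneg_right (pw (by norm_num)) hT0
    have h₃ : 2 ≤ G ^ 5 * T := by
      have : (1 : ℝ) ≤ G ^ 5 := one_le_pow₀ hG1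
      nlinarith
    nlinarith
  have f0 : 0 ≤ e' + 2 * G ^ 2 * δ + 2 := by rw [he']; positivity
  have g1 : q * (e' + 2 * G ^ 2 * δ + 2) ≤ 30 * G ^ 7 * N * T := by
    calc q * (e' + 2 * G ^ 2 * δ + 2) ≤ N ^ 3 * (30 * G ^ 5 * T) :=
          mul_le_mul hq f1 f0 (by positivity)
      _ = 30 * (N ^ 2 * G ^ 5) * N * T := by ring
      _ ≤ 30 * (G ^ 2 * G ^ 5) * N * T := by gcongr
      _ = 30 * G ^ 7 * N * T := by ring
  -- The choice of T makes T² a multiple of G⁸ T, against which all error terms are compared by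
  -- `linarith`.
  have hTT : 128 * G ^ 8 * T = T ^ 2 := by rw [pow_two, ← hT]
  have k1 : G ^ 1 * T ≤ G ^ 8 * T := mul_le_mul_of_nonneg_right (pw (by norm_num)) hT0
  have k4 : G ^ 4 * T ≤ G ^ 8 * T := mul_le_mul_of_nonneg_right (pw (by norm_num)) hT0
  have k5 : G ^ 5 * T ≤ G ^ 8 * T := mul_le_mul_of_nonneg_right (pw (by norm_num)) hT0
  have k7 : G ^ 7 * N * T ≤ G ^ 8 * N * T := by gcongr <;> norm_num
  have k7' : G ^ 7 * N * T ≤ G ^ 8 * T := by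
    calc G ^ 7 * N * T ≤ G ^ 7 * G * T := by gcongr
      _ = G ^ 8 * T := by ring
  have hTTN : 128 * (G ^ 8 * N * T) = T ^ 2 * N := by rw [← hTT]; ring
  have hpos : 0 < G ^ 8 * N * T := by positivity
  have hpos' : 0 < G ^ 8 * T := by positivity
  have m1 : T ^ 2 * G ≤ T ^ 2 * G ^ 2 := by
    have := pw (show 1 ≤ 2 by norm_num)
    rw [pow_one] at this
    gcongr
  have m2 : T ^ 2 ≤ T ^ 2 * G ^ 2 := le_mul_of_one_le_right (by positivity) (one_le_pow₀ hG1)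
  have hV' : 4 * (T ^ 2 * G ^ 2) ≤ V := by linarith
  rw [pow_one] at k1
  refine ⟨?_, ?_, ?_, ?_, ?_, ?_, ?_, ?_⟩
  all_goals linarith

end FFT

/-! ### Setting up a convolution -/

namespace WordRAM

open Ex Cmd

/-- Determine the length of a convolution and a bound for its input. -/
def measure : Cmd :=
  findLen ;;
  .assign regMax (c 1) ;;
  .assign regStart (v argI) ;;
  .assign regSize (v argS) ;;
  addSquares 0 ;;
  .assign regStart (v argJ) ;;
  .assign regSize (v argD) ;;
  addSquares 1

/-- Determine the scale and the roots of unity for a convolution. -/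
def scaleTable : Cmd :=
  .assign regBase (v regLen * v regMax) ;;
  .assign regBase (c 8 * c 16 * v regBase * v regBase * v regBase * v regBase * v regBase *
    v regBase * v regBase * v regBase) ;;
  .assign regScale (v regBase * v regBase) ;;
  table

/-- Determine the length, the scale and the roots of unity for a convolution. -/
def setup : Cmd := measure ;; scaleTable

/-- The word size that is needed for a convolution. -/
structure ConvInput (s : State) (I J sg : ℤ) (n d Y : ℕ) : Prop where
  hI : s.var argI = I
  hJ : s.var argJ = J
  hS : s.var argS = n
  hD : s.var argD = d
  hsg : s.var argSign = sg
  hn : 1 ≤ n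
  hY : 16 ≤ Y
  hnd : n + d ≤ Y
  hIY : |I| ≤ Y
  hJY : |J| ≤ Y
  ha : ∀ i, |s.arr 0 i| ≤ Y
  hb : ∀ i, |s.arr 1 i| ≤ Y

theorem two_pow_clog_lt {m : ℕ} (hm : 1 ≤ m) : 2 ^ Nat.clog 2 m < 2 * m := by
  rcases Nat.lt_or_ge 1 m with h | h
  · have := Nat.pow_pred_clog_lt_self (b := 2) (by norm_num) h
    have hc : 0 < Nat.clog 2 m := Nat.clog_pos (by norm_num) h
    calc 2 ^ Nat.clog 2 m = 2 * 2 ^ (Nat.clog 2 m).pred := by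
          rw [← pow_succ']; congr 1; exact (Nat.succ_pred_eq_of_pos hc).symm
      _ < 2 * m := by omega
  · have : m = 1 := by omega
    subst this
    simp

theorem abs_segment_le {f : ℤ → ℤ} {I X : ℤ} {n : ℕ}
    (h : ∑ i ∈ Finset.range n, f (I + i) ^ 2 ≤ X) (hX : 0 ≤ X) (t : ℕ) : |segment f I n t| ≤ X := by
  rw [segment]
  split_ifs with ht
  · have h₁ := Finset.single_le_sum (f := fun i : ℕ => f (I + i) ^ 2) (fun i _ => sq_nonneg _)
      (Finset.mem_range.2 ht)
    have h₂ : |f (I + t)| ≤ f (I + t) ^ 2 := by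
      rw [← sq_abs]
      rcases eq_or_ne (f (I + t)) 0 with h | h
      · simp [h]
      · have := Int.one_le_abs h
        nlinarith
    omega
  · simpa using hX

/-- Everything is a power of `Y` with an absolute exponent: N A ≤ Y⁵, hence T ≤ Y⁴² and T² ≤ Y⁸⁴.
This is why the scale fits into words of O(log Y) bits. -/
theorem scale_bounds {N A T Y V : ℕ} (hY : 16 ≤ Y) (hNY : N ≤ 2 * Y)
    (hAY : A ≤ 2 * Y ^ 3) (hT : T = 128 * (N * A) ^ 8) (hYV : Y ^ 100 ≤ V) :
    N * A ≤ Y ^ 5 ∧ Y ^ 5 ≤ V ∧ T ≤ V ∧ T ^ 2 + N * (4 * T + 12) ≤ V := by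
  have hYpow : ∀ {a b : ℕ}, a ≤ b → Y ^ a ≤ Y ^ b := fun h => Nat.pow_le_pow_right (by omega) h
  have hG : N * A ≤ Y ^ 5 := by
    calc N * A ≤ 2 * Y * (2 * Y ^ 3) := Nat.mul_le_mul hNY hAY
      _ = 4 * Y ^ 4 := by ring
      _ ≤ Y * Y ^ 4 := Nat.mul_le_mul_right _ (by omega)
      _ = Y ^ 5 := by ring
  have hTY : T ≤ Y ^ 42 := by
    calc T = 128 * (N * A) ^ 8 := hT
      _ ≤ Y ^ 2 * (Y ^ 5) ^ 8 := Nat.mul_le_mul (by nlinarith) (Nat.pow_le_pow_left hG 8)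
      _ = Y ^ 42 := by ring
  have hT2 : T ^ 2 ≤ Y ^ 84 := by
    calc T ^ 2 ≤ (Y ^ 42) ^ 2 := Nat.pow_le_pow_left hTY 2
      _ = Y ^ 84 := by ring
  have h42 : 1 ≤ Y ^ 42 := Nat.one_le_pow _ _ (by omega)
  have h1 : N * (4 * T + 12) ≤ Y ^ 84 := by
    calc N * (4 * T + 12) ≤ (2 * Y) * (16 * Y ^ 42) := Nat.mul_le_mul hNY (by omega)
      _ = 32 * Y ^ 43 := by ring
      _ ≤ Y ^ 45 := by
        calc 32 * Y ^ 43 ≤ (Y * Y) * Y ^ 43 := Nat.mul_le_mul_right _ (by nlinarith)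
          _ = Y ^ 45 := by ring
      _ ≤ Y ^ 84 := hYpow (by norm_num)
  have h85 : Y ^ 84 + Y ^ 84 ≤ Y ^ 85 := by
    have : 2 * Y ^ 84 ≤ Y * Y ^ 84 := Nat.mul_le_mul_right _ (by omega)
    calc Y ^ 84 + Y ^ 84 = 2 * Y ^ 84 := by ring
      _ ≤ Y * Y ^ 84 := this
      _ = Y ^ 85 := by ring
  exact ⟨hG, (hYpow (by norm_num)).trans hYV, (hTY.trans (hYpow (by norm_num))).trans hYV,
    ((Nat.add_le_add hT2 h1).trans (h85.trans (hYpow (by norm_num)))).trans hYV⟩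

theorem sum_sq_nonneg_le {f : ℤ → ℤ} {Y : ℕ} (hf : ∀ i, |f i| ≤ Y) (I : ℤ) (n : ℕ) :
    0 ≤ ∑ i ∈ Finset.range n, f (I + i) ^ 2 ∧
      ∑ i ∈ Finset.range n, f (I + i) ^ 2 ≤ n * (Y : ℤ) ^ 2 := by
  refine ⟨Finset.sum_nonneg fun _ _ => sq_nonneg _, ?_⟩
  refine (Finset.sum_le_card_nsmul _ _ ((Y : ℤ) ^ 2) fun j _ => ?_).trans (by simp)
  exact sq_le_sq' (by linarith [(abs_le.1 (hf (I + j))).1]) (abs_le.1 (hf (I + j))).2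

/-- The bound `A` is one plus the sum of all squares in both segments. The start and the size left
in the registers are those of the second segment, which is the first one to be transformed. -/
theorem measure_spec {V B : ℕ} (hV : 16 ≤ V) (hB : V ^ 10 ≤ B) {s : State} {I J sg : ℤ} {n d Y : ℕ}
    (h : ConvInput s I J sg n d Y) (hYV : Y ^ 5 ≤ V) {N K : ℕ} (hK : K = Nat.clog 2 (n + d))
    (hN : N = 2 ^ K) :
    measure.Spec B s (10 * K + 20 * (n + d) + 50) (fun s' =>
      s'.var regLen = N ∧ s'.var regStart = J ∧ s'.var regSize = d ∧
      ∃ A : ℕ, 1 ≤ A ∧ A ≤ 2 * Y ^ 3 ∧ (∀ t, |segment (s.arr 0) I n t| ≤ A) ∧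
        (∀ t, |segment (s.arr 1) J d t| ≤ A) ∧ s'.var regMax = A) := by
  have hY := h.hY
  have hnd := h.hnd
  have hn := h.hn
  have hY2 : 16 * Y ≤ Y ^ 2 := by nlinarith
  have hY3 : 16 * Y ^ 2 ≤ Y ^ 3 := by nlinarith [Nat.zero_le (Y ^ 2)]
  have hY5 : 16 * Y ^ 3 ≤ Y ^ 5 := by nlinarith [Nat.zero_le (Y ^ 3)]
  have yV : Y ≤ V := (Nat.le_self_pow (by norm_num) Y).trans hYV
  have n2V : 2 * (n + d) ≤ V := by omega
  have iV : |I| ≤ V := h.hIY.trans (by exact_mod_cast yV)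
  have jV : |J| ≤ V := h.hJY.trans (by exact_mod_cast yV)
  set a := s.arr 0 with ha
  set b := s.arr 1 with hb
  obtain ⟨X, hX⟩ : ∃ X : ℕ, (X : ℤ) = 1 + ∑ i ∈ Finset.range n, a (I + i) ^ 2 :=
    ⟨_, Int.toNat_of_nonneg (by positivity)⟩
  obtain ⟨A, hA⟩ : ∃ A : ℕ, (A : ℤ) = X + ∑ i ∈ Finset.range d, b (J + i) ^ 2 :=
    ⟨_, Int.toNat_of_nonneg (by positivity)⟩
  obtain ⟨sa0, sa1⟩ := sum_sq_nonneg_le h.ha I n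
  obtain ⟨sb0, sb1⟩ := sum_sq_nonneg_le h.hb J d
  rw [← ha] at sa0 sa1
  rw [← hb] at sb0 sb1
  have hA1 : 1 ≤ A := by omega
  have hAb : A ≤ 1 + (n + d) * Y ^ 2 := by
    zify
    linarith
  have hAb' : A ≤ 2 * Y ^ 3 := by
    have h₁ : (n + d) * Y ^ 2 ≤ Y * Y ^ 2 := Nat.mul_le_mul_right _ hnd
    have h₂ : 1 ≤ Y ^ 3 := Nat.one_le_pow _ _ (by omega)
    have h₃ : Y * Y ^ 2 = Y ^ 3 := by ring
    omega
  have hYn : (n : ℤ) * Y ^ 2 ≤ Y ^ 3 ∧ (d : ℤ) * Y ^ 2 ≤ Y ^ 3 := by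
    have h₁ : n * Y ^ 2 ≤ Y * Y ^ 2 := Nat.mul_le_mul_right _ (by omega)
    have h₂ : d * Y ^ 2 ≤ Y * Y ^ 2 := Nat.mul_le_mul_right _ (by omega)
    have e : Y * Y ^ 2 = Y ^ 3 := by ring
    rw [e] at h₁ h₂
    exact ⟨by exact_mod_cast h₁, by exact_mod_cast h₂⟩
  have hYz : (16 * Y ≤ (Y : ℤ) ^ 2) ∧ (16 * (Y : ℤ) ^ 2 ≤ Y ^ 3) ∧ (16 * (Y : ℤ) ^ 3 ≤ V) :=
    ⟨by exact_mod_cast hY2, by exact_mod_cast hY3, by exact_mod_cast hY5.trans hYV⟩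
  have hXV : (X : ℤ) ≤ 1 + Y ^ 3 := by linarith
  have hYz16 : (16 : ℤ) ≤ Y := by exact_mod_cast hY
  have hndz : (n : ℤ) + d ≤ Y := by exact_mod_cast hnd
  have nV : |(n : ℤ)| ≤ V := by rw [Nat.abs_cast]; omega
  have dV : |(d : ℤ)| ≤ V := by rw [Nat.abs_cast]; omega
  refine (Spec.seq (findLen_spec hV hB h.hS h.hD n2V) fun s₁ F₁ h₁ => ?_).mono
    (T := 10 * Nat.clog 2 (n + d) + 10 + (3 + (2 + (2 + (20 * n + 10 + (2 + (2 + (20 * d + 10))))))))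
    (by subst hK; omega) fun _ _ h => h
  have i₁ : s₁.var argI = I := by rw [F₁.var argI (by decide) (by decide), h.hI]
  have i₂ : s₁.var argS = n := by rw [F₁.var argS (by decide) (by decide), h.hS]
  have i₃ : s₁.var argJ = J := by rw [F₁.var argJ (by decide) (by decide), h.hJ]
  have i₄ : s₁.var argD = d := by rw [F₁.var argD (by decide) (by decide), h.hD]
  have i₅ : s₁.arr 0 = a := F₁.arr 0 (by decide)
  have i₆ : s₁.arr 1 = b := F₁.arr 1 (by decide)
  refine Spec.assign_seq hV hB 1 (by decide) (by simp) (by simp) <|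
    Spec.assign_seq hV hB I (by decide) (by simp [State.var_setVar, i₁, iV])
      (by simp [State.var_setVar, i₁]) <|
    Spec.assign_seq hV hB n (by decide) (by simpa [State.var_setVar, i₂] using nV)
      (by simp [State.var_setVar, i₂]) <|
    Spec.seq (addSquares_spec hV hB (n := n) (I := I) (X := 1) (Y := Y)
      (by simp [State.var_setVar]) (by simp [State.var_setVar]) (by simp [State.var_setVar])
      (by simpa [i₅] using h.ha) (by norm_num) (by
        have := h.hIY
        linarith [hYn.1, hYz.1, hYz.2.1, hYz.2.2])) fun s₂ F₂ h₂ => ?_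
  have j₁ : s₂.var argJ = J := by
    rw [F₂.var argJ (by decide) (by rfl)]; simp [State.var_setVar, i₃]
  have j₂ : s₂.var argD = d := by
    rw [F₂.var argD (by decide) (by rfl)]; simp [State.var_setVar, i₄]
  have j₃ : s₂.arr 1 = b := by
    rw [F₂.arr 1 (by decide)]; simp [i₆]
  have j₄ : s₂.var regLen = (N : ℤ) := by
    rw [F₂.var regLen (by decide) (by rfl), hN, hK]; simpa [State.var_setVar] using h₁
  have j₅ : s₂.var regMax = X := by
    rw [h₂, hX]; simp [i₅]
  refine Spec.assign_seq hV hB J (by decide) (by simp [j₁, jV]) (by simp [j₁]) <|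
    Spec.assign_seq hV hB d (by decide) (by simpa [State.var_setVar, j₂] using dV)
      (by simp [State.var_setVar, j₂]) <|
    (addSquares_spec hV hB (n := d) (I := J) (X := X) (Y := Y)
      (by simp [State.var_setVar]) (by simp [State.var_setVar]) (by simp [State.var_setVar, j₅])
      (by simpa [j₃] using h.hb) (by omega) (by
        have := h.hJY
        linarith [hYn.2, hYz.1, hYz.2.1, hYz.2.2])).mono le_rfl fun s₃ F₃ h₃ => ?_
  refine ⟨?_, ?_, ?_, A, hA1, hAb', ?_, ?_, ?_⟩
  · rw [F₃.var regLen (by decide) (by rfl)]; simp [State.var_setVar, j₄]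
  · rw [F₃.var regStart (by decide) (by rfl)]; simp [State.var_setVar]
  · rw [F₃.var regSize (by decide) (by rfl)]; simp [State.var_setVar]
  · exact abs_segment_le (by rw [hA, hX]; linarith) (by omega)
  · exact abs_segment_le (by rw [hA]; omega) (by omega)
  · rw [h₃, hA]; simp [j₃]

theorem scaleTable_spec {V B : ℕ} (hV : 16 ≤ V) (hB : V ^ 10 ≤ B) {s : State} {N K A T : ℕ}
    (hN : N = 2 ^ K) (hA : 1 ≤ A) (hT : T = 128 * (N * A) ^ 8) (hlen : s.var regLen = N)
    (hmax : s.var regMax = A) (hG : N * A ≤ V) (n2V : 2 * N ≤ V)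
    (hTV : T ^ 2 + N * (4 * T + 12) ≤ V) :
    scaleTable.Spec B s (40 * N * K + 80 * K + 60) (fun s' =>
      s'.var regScale = (T : ℤ) ^ 2 ∧
        Approx s' memCos memSin ((T : ℤ) ^ 2) N FFT.root (N * (4 * T + 12))) := by
  have hN1 : 1 ≤ N := by rw [hN]; exact Nat.one_le_two_pow
  have hG8 : 1 ≤ (N * A) ^ 8 := Nat.one_le_pow _ _ (Nat.mul_pos hN1 hA)
  have t6 : 6 ≤ T := by omega
  have tV : T ≤ V := (Nat.le_self_pow (by norm_num) T).trans ((Nat.le_add_right _ _).trans hTV)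
  obtain ⟨G, hGdef⟩ : ∃ G, G = N * A := ⟨_, rfl⟩
  have nV' : |(N : ℤ)| ≤ V := by rw [Nat.abs_cast]; omega
  have aV' : |(A : ℤ)| ≤ V := by
    rw [Nat.abs_cast]; exact_mod_cast (Nat.le_mul_of_pos_left A hN1).trans hG
  have gV' : |(G : ℤ)| ≤ V := by rw [Nat.abs_cast, hGdef]; exact_mod_cast hG
  have tV' : |(T : ℤ)| ≤ V := by rw [Nat.abs_cast]; exact_mod_cast tV
  refine (Spec.assign_seq hV hB (G : ℤ) (by decide) (by
      simp only [leafOk_mul, leafOk_v, hlen, hmax]; exact ⟨⟨by decide, nV'⟩, by decide, aV'⟩) (by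
      simp [hlen, hmax, hGdef]) <|
    Spec.assign_seq hV hB (T : ℤ) (by decide) (by
      simp only [leafOk_mul, leafOk_v, leafOk_c, State.var_setVar]; simp [-Nat.abs_cast, gV']) (by
      simp [State.var_setVar, hT, ← hGdef]; ring) <|
    Spec.assign_seq hV hB ((T : ℤ) ^ 2) (by decide) (by
      simp only [leafOk_mul, leafOk_v, State.var_setVar]; simp [-Nat.abs_cast, tV']) (by
      simp [State.var_setVar]; ring) <|
    (table_spec hV hB hN (T := T) (by exact_mod_cast t6) (by simp [State.var_setVar, hlen])
      (by simp [State.var_setVar]) n2V (by exact_mod_cast hTV)).mono le_rfl fun s₄ F₄ h₄ =>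
    ⟨by simp [F₄.var regScale (by decide) (by decide), State.var_setVar], by simpa using h₄⟩).mono ?_ fun _ _ h => h
  simp only [show (v regLen * v regMax).cost = 1 from rfl, show (v regBase * v regBase).cost = 1 from rfl,
      show (c 8 * c 16 * v regBase * v regBase * v regBase * v regBase * v regBase *
        v regBase * v regBase * v regBase).cost = 11 from rfl]
  omega

theorem setup_spec {V B : ℕ} (hV : 16 ≤ V) (hB : V ^ 10 ≤ B) {s : State} {I J sg : ℤ} {n d Y : ℕ}
    (h : ConvInput s I J sg n d Y) (hYV : Y ^ 100 ≤ V) {N K : ℕ} (hK : K = Nat.clog 2 (n + d))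
    (hN : N = 2 ^ K) :
    setup.Spec B s (60 * N * (K + 1) + 90 * (K + 1) + 200) (fun s' =>
      s'.var regLen = N ∧ s'.var regStart = J ∧ s'.var regSize = d ∧
      ∃ A T : ℕ, 1 ≤ A ∧ (∀ t, |segment (s.arr 0) I n t| ≤ A) ∧ (∀ t, |segment (s.arr 1) J d t| ≤ A) ∧
        N * A ≤ Y ^ 5 ∧ T = 128 * (N * A) ^ 8 ∧ s'.var regScale = (T : ℤ) ^ 2 ∧
        Approx s' memCos memSin ((T : ℤ) ^ 2) N FFT.root (N * (4 * T + 12))) := by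
  have hnd := h.hnd
  have hn := h.hn
  have hN1 : 1 ≤ N := by rw [hN]; exact Nat.one_le_two_pow
  have hndN : n + d ≤ N := by rw [hN, hK]; exact Nat.le_pow_clog (by norm_num) _
  have hN2 : N ≤ 2 * (n + d) := by rw [hN, hK]; exact (two_pow_clog_lt (by omega)).le
  have hY1 : 1 ≤ Y := le_trans (by norm_num) h.hY
  have hY5 : Y ^ 5 ≤ V := (Nat.pow_le_pow_right hY1 (by norm_num)).trans hYV
  have n2V : 2 * N ≤ V := by
    have h₁ : Y ^ 2 ≤ V := (Nat.pow_le_pow_right hY1 (by norm_num)).trans hYV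
    have := h.hY
    nlinarith
  refine (Spec.seq (measure_spec hV hB h hY5 hK hN) fun s₁ F₁ h₁ => ?_).mono
    (T := 10 * K + 20 * (n + d) + 50 + (40 * N * K + 80 * K + 60)) (by nlinarith) fun _ _ h => h
  obtain ⟨hlen, hst, hsz, A, hA1, hA, ha, hb, hmax⟩ := h₁
  obtain ⟨T, hT⟩ : ∃ T, T = 128 * (N * A) ^ 8 := ⟨_, rfl⟩
  obtain ⟨hG, hY5V, tV, tabV⟩ := scale_bounds h.hY (by omega) hA hT hYV
  refine (scaleTable_spec hV hB hN hA1 hT hlen hmax (hG.trans hY5V) n2V tabV).mono le_rfl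
    fun s₂ F₂ h₂ => ⟨?_, ?_, ?_, A, T, hA1, ha, hb, hG, hT, h₂⟩
  · rw [F₂.var regLen (by decide) (by decide), hlen]
  · rw [F₂.var regStart (by decide) (by decide), hst]
  · rw [F₂.var regSize (by decide) (by decide), hsz]

end WordRAM

/-! ### The complete convolution -/

namespace FFT

theorem conv_cast (a b : ℕ → ℤ) (q : ℕ) :
    ((conv a b q : ℤ) : ℂ) = conv (fun t => (a t : ℂ)) (fun t => (b t : ℂ)) q := by
  simp [conv]

/-- At most `N` of the summands are nonzero, however large `q` is. -/
theorem norm_conv_le {a b : ℕ → ℂ} {A : ℝ} {s N : ℕ} (ha : ∀ t, ‖a t‖ ≤ A) (hb : ∀ t, ‖b t‖ ≤ A)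
    (ha0 : ∀ n, s ≤ n → a n = 0) (hN : s ≤ N) (q : ℕ) : ‖conv a b q‖ ≤ N * A ^ 2 := by
  have hA : 0 ≤ A := (norm_nonneg _).trans (ha 0)
  have h₁ : conv a b q = ∑ i ∈ Finset.range (min (q + 1) N), a i * b (q - i) := by
    refine (Finset.sum_subset (Finset.range_subset_range.2 (min_le_left _ _)) fun x hx hx' => ?_).symm
    simp only [Finset.mem_range] at hx hx'
    rw [ha0 x (by omega), zero_mul]
  rw [h₁]
  refine (norm_sum_le _ _).trans ?_
  refine (Finset.sum_le_card_nsmul _ _ (A ^ 2) fun i _ => ?_).trans ?_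
  · rw [norm_mul, pow_two]
    exact mul_le_mul (ha _) (hb _) (norm_nonneg _) hA
  · rw [Finset.card_range, nsmul_eq_mul]
    gcongr
    exact min_le_right _ _

end FFT

namespace WordRAM

open Ex Cmd

/-- Compute the Fourier transform of a segment of the array `A`. -/
def transform (A : ℕ) : Cmd := loadSegment A ;; forward

/-- Multiply two Fourier transforms, transform back and add the result to the output. -/
def multiply : Cmd := pointwise ;; backward ;; addOut

/-- Add the convolution of a segment of the array `0` and a segment of the array `1` to the
output. -/
def convolve : Cmd :=
  setup ;; transform 1 ;; saveTransform ;;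
  .assign regStart (v argI) ;; .assign regSize (v argS) ;; transform 0 ;; multiply

theorem segment_eq_zero {f : ℤ → ℤ} {I : ℤ} {n : ℕ} (t : ℕ) (h : n ≤ t) :
    ((segment f I n t : ℤ) : ℂ) = 0 := by
  rw [segment, if_neg (by omega)]; simp

theorem norm_segment_le {f : ℤ → ℤ} {I : ℤ} {n A : ℕ} (h : ∀ t, |segment f I n t| ≤ A) (t : ℕ) :
    ‖((segment f I n t : ℤ) : ℂ)‖ ≤ A := by
  rw [Complex.norm_intCast]
  exact_mod_cast h t

theorem transform_spec {V B : ℕ} (hV : 16 ≤ V) (hB : V ^ 10 ≤ B) {A : ℕ} (hA10 : A < 10)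
    (hpre : (loadSegment A).setsVar regLen = false ∧ (loadSegment A).setsVar regScale = false ∧
      (loadSegment A).setsArr memCos = false ∧ (loadSegment A).setsArr memSin = false)
    {s : State} {n N K X : ℕ} {I S : ℤ} {δ : ℝ} (hN : N = 2 ^ K) (hlen : s.var regLen = N)
    (hn : s.var regSize = n) (hI : s.var regStart = I) (hS : s.var regScale = S)
    (hA : ∀ i, |s.arr A i| ≤ V) (hX : ∀ t, |segment (s.arr A) I n t| ≤ X) (hS0 : 0 < S)
    (hS2V : 2 * S ≤ V) (hIV : |I| ≤ V) (hNV : 2 * N ≤ V) (hnV : n ≤ V) (hδ : 0 ≤ δ) (hδS : δ ≤ S)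
    (hVM : S * (2 * (N * X)) + 4 ^ K * (N * X * δ + 2) ≤ V)
    (hW : Approx s memCos memSin S N FFT.root δ) :
    (transform A).Spec B s (30 * N + 10 + (70 * N * K + 30 * K + 10)) (fun s' =>
      Approx s' memRe memIm S N (FFT.level (fun t => ((segment (s.arr A) I n t : ℤ) : ℂ)) K 1)
        (4 ^ K * (N * X * δ + 2))) := by
  refine Spec.seq (loadSegment_spec hV hB hA10 hlen hn hI hS hA
    (by rw [abs_of_pos hS0]; omega) hIV (by omega) hnV) fun s₁ F₁ h₁ => ?_
  refine forward_spec hV hB hN hS0 (by rw [F₁.var _ (by decide) hpre.1, hlen])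
    (by rw [F₁.var _ (by decide) hpre.2.1, hS]) hNV hδ hδS (fun l hl x => ?_) hVM hS2V h₁
    (hW.of_frame F₁ hpre.2.2.1 hpre.2.2.2)
  refine (FFT.norm_level_le (norm_segment_le hX) _ _ _).trans ?_
  rw [hN]
  push_cast
  gcongr
  norm_num

theorem multiply_spec {V B : ℕ} (hV : 16 ≤ V) (hB : V ^ 10 ≤ B) {s : State} {N K X : ℕ} (hX1 : 1 ≤ X)
    {n d : ℕ} {f g : ℤ → ℤ} {S I J sg : ℤ} {δ e : ℝ} (hN : N = 2 ^ K) (hlen : s.var regLen = N)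
    (hS : s.var regScale = S) (hI : s.var argI = I) (hJ : s.var argJ = J) (hsg : s.var argSign = sg)
    (hsg1 : |sg| ≤ 1) (hnd : n + d ≤ N)
    (hf : ∀ t, |segment f I n t| ≤ X) (hg : ∀ t, |segment g J d t| ≤ X) (hS0 : 0 < S)
    (hS2V : 2 * S ≤ V) (hIV : |I| ≤ V) (hJV : |J| ≤ V) (hNV : 2 * N ≤ V) (hδ : 0 ≤ δ) (hδS : δ ≤ S)
    (he : 0 ≤ e) (heS : e ≤ S) (hV₁ : S * (N * X) ^ 2 + (e * (2 * (N * X) + 1) + 2) ≤ V)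
    (hV₂ : S * (N * X) + e ≤ V)
    (hV₃ : S * (2 * (N * X) ^ 2) + 5 ^ K * (e * (2 * (N * X) + 1) + 2 + 2 * (N * X) ^ 2 * δ + 2) ≤ V)
    (hV₄ : 2 * (5 ^ K * (e * (2 * (N * X) + 1) + 2 + 2 * (N * X) ^ 2 * δ + 2)) < S * N)
    (hW : Approx s memCos memSin S N FFT.root δ)
    (h₁ : Approx s memRe memIm S N (FFT.level (fun t => ((segment f I n t : ℤ) : ℂ)) K 1) e)
    (h₂ : Approx s memRe2 memIm2 S N (FFT.level (fun t => ((segment g J d t : ℤ) : ℂ)) K 1) e)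
    (hout : ∀ m, |s.arr 8 m| ≤ V) :
    multiply.Spec B s (50 * N + 10 + (70 * N * K + 30 * K + 10 + (50 * N + 10))) (fun s' =>
      ∀ m, s'.arr 8 m = s.arr 8 m + sg * rectSum f g I n J d m) := by
  have hN' : (N : ℝ) = 2 ^ K := by rw [hN]; push_cast; rfl
  have hN1 : 1 ≤ N := by rw [hN]; exact Nat.one_le_two_pow
  have bnd : ∀ {f : ℤ → ℤ} {I : ℤ} {n : ℕ}, (∀ t, |segment f I n t| ≤ X) → ∀ x,
      ‖FFT.level (fun t => ((segment f I n t : ℤ) : ℂ)) K 1 x‖ ≤ N * X := fun h x => by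
    rw [hN']; exact FFT.norm_level_le (norm_segment_le h) _ _ _
  have hconv : ∀ x, ‖FFT.conv (fun t => ((segment f I n t : ℤ) : ℂ))
      (fun t => ((segment g J d t : ℤ) : ℂ)) x‖ ≤ N * (X : ℝ) ^ 2 :=
    FFT.norm_conv_le (norm_segment_le hf) (norm_segment_le hg) segment_eq_zero (by omega)
  have hlev := FFT.level_conv (segment_eq_zero (f := f) (I := I) (n := n))
    (segment_eq_zero (f := g) (I := J) (n := d)) (hN ▸ hnd)
  refine Spec.seq (pointwise_spec hV hB hlen (by omega) hS0 hS (bnd hf) (bnd hg) heS h₁ h₂ hV₁ hV₂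
    (by omega)) fun s₁ F₁ k₁ => ?_
  have l₁ : s₁.var regLen = N := by rw [F₁.var _ (by decide) (by decide), hlen]
  have l₂ : s₁.var regScale = S := by rw [F₁.var _ (by decide) (by decide), hS]
  refine Spec.seq (backward_spec hV hB (M := (N * X) ^ 2) (a := FFT.conv (fun t => ((segment f I n t : ℤ) : ℂ))
      (fun t => ((segment g J d t : ℤ) : ℂ))) hN hS0 (by positivity) l₁ l₂ hNV hδ hδS
      (fun l hl x => ?_) hV₃ hS2V ?_ (hW.of_frame F₁ (by decide) (by decide))) fun s₂ F₂ k₂ => ?_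
  -- A level sums 2^(K - l) coefficients of the convolution, each at most N X²; with the factor 2^l
  -- this is (N X)², independently of `l`.
  · calc (2 : ℝ) ^ l * ‖FFT.level _ (K - l) (2 ^ l) x‖ ≤ 2 ^ l * (2 ^ (K - l) * (N * (X : ℝ) ^ 2)) := by
          gcongr
          exact FFT.norm_level_le hconv _ _ _
      _ = (N * X) ^ 2 := by
        rw [← mul_assoc, ← pow_add, Nat.add_sub_cancel' hl, ← hN']; ring
  · intro x hx
    rw [hlev]
    exact k₁ x hx
  have m₁ : s₂.var regLen = N := by rw [F₂.var _ (by decide) (by decide), l₁]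
  have m₂ : s₂.var regScale = S := by rw [F₂.var _ (by decide) (by decide), l₂]
  have m₃ : s₂.arr 8 = s.arr 8 := by rw [F₂.arr _ (by decide), F₁.arr _ (by decide)]
  refine (addOut_spec hV hB (u := FFT.conv (segment f I n) (segment g J d)) m₁ hN1 hS0 m₂
    (by rw [F₂.var _ (by decide) (by decide), F₁.var _ (by decide) (by decide), hI])
    (by rw [F₂.var _ (by decide) (by decide), F₁.var _ (by decide) (by decide), hJ])
    (by rw [F₂.var _ (by decide) (by decide), F₁.var _ (by decide) (by decide), hsg]) hsg1 (e := 5 ^ K * (e * (2 * (N * X) + 1) + 2 + 2 * (N * X) ^ 2 * δ + 2)) ?_ hV₄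
    (fun x hx => ?_) (by simpa [m₃] using hout) (by omega) (by omega) hIV hJV).mono le_rfl fun s₃ F₃ k₃ m => ?_
  · intro x hx
    have := k₂ x hx
    simp only [FFT.conv_cast, hN, Nat.cast_pow, Nat.cast_ofNat]
    simpa only [hN, Nat.cast_pow, Nat.cast_ofNat] using this
  · refine (k₂.abs_le hS0.le (M := (N * X) ^ 2) (fun x => ?_) ?_ hx).1
    · rw [norm_mul, norm_pow, Complex.norm_ofNat, ← hN']
      calc N * ‖_‖ ≤ N * (N * (X : ℝ) ^ 2) := by gcongr; exact hconv x
        _ = _ := by ring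
    · refine le_trans ?_ hV₃
      have : (0 : ℝ) < S := by exact_mod_cast hS0
      have : 0 ≤ (S : ℝ) * (N * X) ^ 2 := by positivity
      linarith
  · rw [k₃ m, m₃, rectSum_eq f g I J m hnd]

/-- Three transforms of length N ≤ 2 (n + d), a table of the same length, and linear passes. The
linear dependence on `n + d` rather than on n d is what the decomposition into rectangles relies on.
-/
theorem convolve_spec {V B : ℕ} (hV : 16 ≤ V) (hB : V ^ 10 ≤ B) {s : State} {I J sg : ℤ} {n d Y : ℕ}
    (h : ConvInput s I J sg n d Y) (hsg1 : |sg| ≤ 1) (hout : ∀ m, |s.arr 8 m| ≤ V)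
    (hYV : Y ^ 200 ≤ V) :
    convolve.Spec B s (3000 * (n + d) * (Nat.clog 2 (n + d) + 1)) (fun s' =>
      ∀ m, s'.arr 8 m = s.arr 8 m + sg * rectSum (s.arr 0) (s.arr 1) I n J d m) := by
  obtain ⟨K, hK⟩ : ∃ K, K = Nat.clog 2 (n + d) := ⟨_, rfl⟩
  obtain ⟨N, hN⟩ : ∃ N, N = 2 ^ K := ⟨_, rfl⟩
  have hnd := h.hnd
  have hn := h.hn
  have hY := h.hY
  have hN1 : 1 ≤ N := by rw [hN]; exact Nat.one_le_two_pow
  have hndN : n + d ≤ N := by rw [hN, hK]; exact Nat.le_pow_clog (by norm_num) _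
  have hN2 : N ≤ 2 * (n + d) := by rw [hN, hK]; exact (two_pow_clog_lt (by omega)).le
  have hYV' : ∀ k ≤ 200, Y ^ k ≤ V := fun k hk => (Nat.pow_le_pow_right (by omega) hk).trans hYV
  clear hYV
  have yV : 16 * Y ≤ V := le_trans (by nlinarith) (hYV' 2 (by norm_num))
  have iV : |I| ≤ V := by have := h.hIY; omega
  have jV : |J| ≤ V := by have := h.hJY; omega
  have aV : ∀ i, |s.arr 0 i| ≤ V := fun i => by have := h.ha i; omega
  have bV : ∀ i, |s.arr 1 i| ≤ V := fun i => by have := h.hb i; omega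
  rw [← hK]
  refine (Spec.seq (setup_spec hV hB h (hYV' 100 (by norm_num)) hK hN) fun s₁ F₁ h₁ => ?_).mono
    (T := 60 * N * (K + 1) + 90 * (K + 1) + 200 + (30 * N + 10 + (70 * N * K + 30 * K + 10) +
      (20 * N + 10 + (2 + (2 + (30 * N + 10 + (70 * N * K + 30 * K + 10) + 
        (50 * N + 10 + (70 * N * K + 30 * K + 10 + (50 * N + 10)))))))))
    ?_ fun _ _ h => h
  · obtain ⟨hlen, hst, hsz, X, T, hX, ha, hb, hG, hT, hscale, htab⟩ := h₁
    obtain ⟨δ, hδ⟩ : ∃ δ : ℝ, δ = N * (4 * T + 12) := ⟨_, rfl⟩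
    obtain ⟨e, he⟩ : ∃ e : ℝ, e = 4 ^ K * (N * X * δ + 2) := ⟨_, rfl⟩
    have hG1 : 1 ≤ N * X := Nat.mul_pos hN1 hX
    have hpow : ∀ k : ℕ, (2 ^ k : ℝ) ^ K = N ^ k := fun k => by
      rw [hN]; push_cast; rw [← pow_mul, ← pow_mul, mul_comm]
    have hVb : 4 * (128 * ((N : ℝ) * X) ^ 8) ^ 2 * (N * X) ^ 2 ≤ V := by
      have h₁ : 4 * (128 * (N * X) ^ 8) ^ 2 * (N * X) ^ 2 ≤ V := by
        refine le_trans ?_ (hYV' 96 (by norm_num))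
        have : 65536 ≤ Y ^ 4 := by
          calc 65536 = 16 ^ 4 := by norm_num
            _ ≤ Y ^ 4 := Nat.pow_le_pow_left hY 4
        calc 4 * (128 * (N * X) ^ 8) ^ 2 * (N * X) ^ 2 = 65536 * (N * X) ^ 18 := by ring
          _ ≤ Y ^ 6 * (Y ^ 5) ^ 18 := Nat.mul_le_mul (this.trans
            (Nat.pow_le_pow_right (by omega) (by norm_num))) (Nat.pow_le_pow_left hG 18)
          _ = Y ^ 96 := by ring
      exact_mod_cast h₁
    have hT1 : (1 : ℤ) ≤ T := by
      have : 1 ≤ (N * X) ^ 8 := Nat.one_le_pow _ _ hG1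
      omega
    have hS0 : (0 : ℤ) < (T : ℤ) ^ 2 := by positivity
    -- The growth factors in terms of the length: 4^K = N² and 5^K ≤ 8^K = N³.
    obtain ⟨b₁, b₂, b₃, b₄, b₅, b₆, b₇, b₈⟩ := FFT.error_bounds (N := N) (A := X) (p := 4 ^ K)
      (q := 5 ^ K) (V := V) (T := T) (δ := δ) (e := e) (by exact_mod_cast hN1) (by exact_mod_cast hX)
      (by positivity) (by rw [← hpow]; norm_num)
      (by rw [← hpow]; exact pow_le_pow_left₀ (by norm_num) (by norm_num) _) hVb
      (by rw [hT]; push_cast; rfl) hδ he rfl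
    have hcast : ((((T : ℤ) ^ 2 : ℤ) : ℝ)) = (T : ℝ) ^ 2 := by push_cast; rfl
    have hδ0 : 0 ≤ δ := by rw [hδ]; positivity
    have he0 : 0 ≤ e := by rw [he]; positivity
    have hS2V : 2 * (T : ℤ) ^ 2 ≤ V := by
      have h₁ : (1 : ℝ) ≤ N * X := by exact_mod_cast hG1
      have h₂ : 2 * (T : ℝ) ^ 2 ≤ V := by nlinarith [sq_nonneg (T : ℝ)]
      exact_mod_cast h₂
    have hNV : 2 * N ≤ V := by omega
    have c₁ : s₁.arr 1 = s.arr 1 := F₁.arr _ (by decide)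
    rw [← hδ] at htab
    refine Spec.seq (transform_spec hV hB (by decide) (by decide) (X := X) (δ := δ) hN hlen hsz hst
      hscale (by simpa [c₁] using bV) (by simpa [c₁] using hb) hS0 hS2V jV hNV (by omega) hδ0
      (by rw [hcast]; exact b₁) (by rw [hcast, ← he]; exact b₂) htab) fun s₂ F₂ h₂ => ?_
    rw [← he, c₁] at h₂
    have d₁ : s₂.var regLen = N := by rw [F₂.var _ (by decide) (by decide), hlen]
    refine Spec.seq (saveTransform_spec hV hB d₁ (by omega) h₂ fun x hx => ?_) fun s₃ F₃ h₃ => ?_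
    · refine h₂.abs_le hS0.le (M := N * X) (fun x => ?_) (by rw [hcast]; exact b₅) hx
      have := FFT.norm_level_le (norm_segment_le hb) K 1 x
      simpa [hN] using this
    have e₁ : s₃.var argI = I := by
      rw [F₃.var _ (by decide) (by decide), F₂.var _ (by decide) (by decide),
        F₁.var _ (by decide) (by decide), h.hI]
    have e₂ : s₃.var argS = n := by
      rw [F₃.var _ (by decide) (by decide), F₂.var _ (by decide) (by decide),
        F₁.var _ (by decide) (by decide), h.hS]
    have e₃ : s₃.arr 0 = s.arr 0 := by
      rw [F₃.arr _ (by decide), F₂.arr _ (by decide), F₁.arr _ (by decide)]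
    have e₄ : s₃.var regLen = N := by rw [F₃.var _ (by decide) (by decide), d₁]
    have e₅ : s₃.var regScale = (T : ℤ) ^ 2 := by
      rw [F₃.var _ (by decide) (by decide), F₂.var _ (by decide) (by decide), hscale]
    have e₆ : Approx s₃ memCos memSin ((T : ℤ) ^ 2) N FFT.root δ :=
      (htab.of_frame F₂ (by decide) (by decide)).of_frame F₃ (by decide) (by decide)
    have e₇ : s₃.var argJ = J := by
      rw [F₃.var _ (by decide) (by decide), F₂.var _ (by decide) (by decide),
        F₁.var _ (by decide) (by decide), h.hJ]
    have e₈ : s₃.var argSign = sg := by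
      rw [F₃.var _ (by decide) (by decide), F₂.var _ (by decide) (by decide),
        F₁.var _ (by decide) (by decide), h.hsg]
    have e₉ : s₃.arr 8 = s.arr 8 := by
      rw [F₃.arr _ (by decide), F₂.arr _ (by decide), F₁.arr _ (by decide)]
    refine Spec.assign_seq hV hB I (by decide) (by simp [e₁, iV]) (by simp [e₁]) <|
      Spec.assign_seq hV hB n (by decide) (by simp [State.var_setVar, e₂]; omega)
        (by simp [State.var_setVar, e₂]) <|
      Spec.seq (transform_spec hV hB (by decide) (by decide) (X := X) (n := n) (I := I)
        (S := (T : ℤ) ^ 2) (δ := δ) hN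
        (by simp [State.var_setVar, e₄]) (by simp [State.var_setVar])
        (by simp [State.var_setVar]) (by simp [State.var_setVar, e₅])
        (by simpa [e₃] using aV) (by simpa [e₃] using ha) hS0 hS2V iV hNV (by omega) hδ0
        (by rw [hcast]; exact b₁) (by rw [hcast, ← he]; exact b₂) (by simpa [Approx] using e₆))
        fun s₄ F₄ h₄ => ?_
    rw [← he, State.arr_setVar, State.arr_setVar, e₃] at h₄
    have g₁ : s₄.arr 8 = s.arr 8 := by rw [F₄.arr _ (by decide)]; simp [e₉]
    refine (multiply_spec hV hB hX (n := n) (d := d) (f := s.arr 0) (g := s.arr 1) (δ := δ) (e := e) (I := I) (J := J)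
      (sg := sg) (S := (T : ℤ) ^ 2) hN
      (by rw [F₄.var _ (by decide) (by decide)]; simp [State.var_setVar, e₄])
      (by rw [F₄.var _ (by decide) (by decide)]; simp [State.var_setVar, e₅])
      (by rw [F₄.var _ (by decide) (by decide)]; simp [State.var_setVar, e₁])
      (by rw [F₄.var _ (by decide) (by decide)]; simp [State.var_setVar, e₇])
      (by rw [F₄.var _ (by decide) (by decide)]; simp [State.var_setVar, e₈])
      hsg1 hndN ha hb hS0 hS2V iV jV hNV hδ0 (by rw [hcast]; exact b₁) he0
      (by rw [hcast]; exact b₃) (by rw [hcast]; exact b₄) (by rw [hcast]; exact b₅)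
      (by rw [hcast]; exact b₆) (by rw [hcast]; exact b₇) ?_ h₄ ?_ (by simpa [g₁] using hout)).mono
      le_rfl fun s₅ F₅ h₅ m => by rw [h₅ m, g₁]
    · exact Approx.of_frame (P := transform 0) F₄ (by decide) (by decide) (by simpa [Approx] using e₆)
    · exact Approx.of_frame (P := transform 0) F₄ (by decide) (by decide) (by simpa [Approx] using h₃)
  · have : N * K ≤ 2 * (n + d) * K := Nat.mul_le_mul_right _ hN2
    have : K + 1 ≤ (n + d) * (K + 1) := Nat.le_mul_of_pos_left _ (by omega)
    nlinarith

end WordRAM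

/-! ### Cutting a region under a height function into rectangles -/

namespace MinHeap

/-- The values of a complete binary tree with `n` leaves `H n, …, H (2 * n - 1)`, in which each inner
node `v` holds the minimum of its children `2 * v` and `2 * v + 1`. -/
structure IsMinHeap (H : ℕ → ℕ) (n : ℕ) : Prop where
  zero : H 0 = 0
  eq_min : ∀ v, 1 ≤ v → v < n → H v = min (H (2 * v)) (H (2 * v + 1))

theorem IsMinHeap.half_le {H : ℕ → ℕ} {n : ℕ} (h : IsMinHeap H n) {v : ℕ} (hv : v < 2 * n) :
    H (v / 2) ≤ H v := by
  rcases Nat.lt_or_ge (v / 2) 1 with h₁ | h₁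
  · rw [show v / 2 = 0 by omega, h.zero]; exact Nat.zero_le _
  · rw [h.eq_min _ h₁ (by omega)]
    rcases Nat.mod_two_eq_zero_or_one v with h₂ | h₂
    · rw [show 2 * (v / 2) = v by omega]; exact min_le_left _ _
    · rw [show 2 * (v / 2) + 1 = v by omega]; exact min_le_right _ _

/-- The intervals between consecutive values of an increasing sequence are stacked without gaps, so
exactly one of them contains a `j` in the total range. -/
theorem sum_ite_telescope {w : ℕ → ℕ} (hw : ∀ l, w l ≤ w (l + 1)) (h0 : w 0 = 0) (b j x : ℤ) (n : ℕ) :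
    ∑ l ∈ Finset.range n, (if b + 1 + w l ≤ j ∧ j < b + 1 + w l + ((w (l + 1) - w l : ℕ) : ℤ) then x else 0) =
      if b < j ∧ j ≤ b + w n then x else 0 := by
  induction n with
  | zero => simp [h0]
  | succ n ih =>
    rw [Finset.sum_range_succ, ih, Nat.cast_sub (hw n)]
    have := hw n
    split_ifs <;> omega

theorem sum_blocks {M : Type*} [AddCommMonoid M] (F : ℕ → M) (s n : ℕ) :
    ∑ q ∈ Finset.range n, ∑ t ∈ Finset.range s, F (q * s + t) = ∑ t ∈ Finset.range (n * s), F t := by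
  induction n with
  | zero => simp
  | succ n ih => rw [Finset.sum_range_succ, ih, Nat.succ_mul, Finset.sum_range_add]

/-- The part of the sum that belongs to the node `q` of level `l` of a tree of height `L`. -/
def nodeSum (f g : ℤ → ℤ) (H : ℕ → ℕ) (X b m : ℤ) (L l q : ℕ) : ℤ :=
  WordRAM.rectSum f g (X + (q * 2 ^ (L - l) : ℕ)) (2 ^ (L - l)) (b + 1 + H ((2 ^ l + q) / 2))
    ((H (2 ^ l + q) - H ((2 ^ l + q) / 2) : ℕ) : ℤ) m

/-- Fix a leaf and follow its ancestors from the root. Their values increase to the height of the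
leaf, and the increments are the vertical sides of the rectangles that contain the column. Summed
over the levels, the rectangles thus give the full column. -/
theorem sum_nodeSum (f g : ℤ → ℤ) {H : ℕ → ℕ} {L : ℕ} (h : IsMinHeap H (2 ^ L)) (X b m : ℤ) :
    ∑ l ∈ Finset.range (L + 1), ∑ q ∈ Finset.range (2 ^ l), nodeSum f g H X b m L l q =
      ∑ t ∈ Finset.range (2 ^ L), f (X + t) *
        if b < m - (X + t) ∧ m - (X + t) ≤ b + H (2 ^ L + t) then g (m - (X + t)) else 0 := by
  have key : ∀ l ∈ Finset.range (L + 1), ∑ q ∈ Finset.range (2 ^ l), nodeSum f g H X b m L l q =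
      ∑ t ∈ Finset.range (2 ^ L), f (X + t) *
        if b + 1 + H ((2 ^ L + t) / 2 ^ (L - l) / 2) ≤ m - (X + t) ∧ m - (X + t) <
          b + 1 + H ((2 ^ L + t) / 2 ^ (L - l) / 2) +
            ((H ((2 ^ L + t) / 2 ^ (L - l)) - H ((2 ^ L + t) / 2 ^ (L - l) / 2) : ℕ) : ℤ)
        then g (m - (X + t)) else 0 := by
    intro l hl
    have hl : l ≤ L := by simp at hl; omega
    have e : (2 : ℕ) ^ L = 2 ^ l * 2 ^ (L - l) := by rw [← pow_add, Nat.add_sub_cancel' hl]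
    rw [e, ← sum_blocks _ (2 ^ (L - l)) (2 ^ l)]
    refine Finset.sum_congr rfl fun q _ => ?_
    rw [nodeSum, WordRAM.rectSum]
    refine Finset.sum_congr rfl fun t ht => ?_
    have ht : t < 2 ^ (L - l) := by simpa using ht
    have e₂ : (2 ^ l * 2 ^ (L - l) + (q * 2 ^ (L - l) + t)) / 2 ^ (L - l) = 2 ^ l + q := by
      rw [← add_assoc, ← add_mul, mul_comm, Nat.mul_add_div (by positivity), Nat.div_eq_of_lt ht,
        add_zero]
    rw [e₂, show X + ((q * 2 ^ (L - l) : ℕ) : ℤ) + t = X + ((q * 2 ^ (L - l) + t : ℕ) : ℤ) by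
      push_cast; ring]
  rw [Finset.sum_congr rfl key, Finset.sum_comm]
  refine Finset.sum_congr rfl fun t ht => ?_
  have ht : t < 2 ^ L := by simpa using ht
  rw [← Finset.mul_sum]
  congr 1
  -- `w l` is the value at the parent of the ancestor on level `l`. It starts with the cell `0`, the
  -- fictitious parent of the root with value 0, and reaches the leaf at `l = L + 1`; beyond that it
  -- is continued as a constant.
  have := sum_ite_telescope (w := fun l => if l ≤ L + 1 then H ((2 ^ L + t) / 2 ^ (L + 1 - l)) else H (2 ^ L + t))
    (fun l => ?_) ?_ b (m - (X + t)) (g (m - (X + t))) (L + 1)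
  · simp only [le_refl, if_true, Nat.sub_self, pow_zero, Nat.div_one] at this
    rw [← this]
    refine Finset.sum_congr rfl fun l hl => ?_
    have hl : l ≤ L := by simp at hl; omega
    rw [if_pos (show l ≤ L + 1 by omega), if_pos (show l + 1 ≤ L + 1 by omega),
      Nat.div_div_eq_div_mul, ← pow_succ, show L - l + 1 = L + 1 - l by omega,
      show L + 1 - (l + 1) = L - l by omega]
  · split_ifs with h₁ h₂ h₂
    · rw [show L + 1 - l = (L + 1 - (l + 1)) + 1 by omega, pow_succ, ← Nat.div_div_eq_div_mul]
      refine h.half_le ((Nat.div_le_self _ _).trans_lt (by omega))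
    · rw [show L + 1 - l = 0 by omega]; simp
    · omega
    · rfl
  · simp only [Nat.zero_le, if_true, Nat.sub_zero]
    rw [Nat.div_eq_of_lt (by rw [pow_succ]; omega), h.zero]

/-- Each pairwise minimum is a value of the sequence, and passing through a subsequence does not
increase the variation. The additional term, the way from the last minimum to the last entry, makes
the induction work. -/
theorem sum_abs_min_le (u : ℕ → ℤ) (n : ℕ) :
    ∑ q ∈ Finset.range n, |min (u (2 * (q + 1))) (u (2 * (q + 1) + 1)) - min (u (2 * q)) (u (2 * q + 1))| +
      |min (u (2 * n)) (u (2 * n + 1)) - u (2 * n + 1)| ≤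
      ∑ i ∈ Finset.range (2 * n + 1), |u (i + 1) - u i| := by
  induction n with
  | zero =>
    simp only [Finset.range_zero, Finset.sum_empty, mul_zero, zero_add, Finset.sum_range_one]
    rcases min_choice (u 0) (u 1) with h | h <;> rw [h]
    · rw [abs_sub_comm]
    · simp
  | succ n ih =>
    rw [Finset.sum_range_succ, show 2 * (n + 1) + 1 = 2 * n + 1 + 1 + 1 by ring, Finset.sum_range_succ,
      Finset.sum_range_succ, show 2 * (n + 1) = 2 * n + 1 + 1 by ring]
    set p := u (2 * n + 1)
    set a := u (2 * n + 1 + 1)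
    set c := u (2 * n + 1 + 1 + 1)
    set w := min (u (2 * n)) p
    have h₁ := abs_sub_le (min a c) p w
    rw [abs_sub_comm p w] at h₁
    rcases min_choice a c with h | h <;> rw [h] at h₁ ⊢
    · rw [abs_sub_comm a c]; linarith
    · have := abs_sub_le c a p
      rw [sub_self, abs_zero]
      linarith

/-- The variation of the values on the level `l`. -/
def variation (H : ℕ → ℕ) (l : ℕ) : ℤ :=
  ∑ i ∈ Finset.range (2 ^ l - 1), |(H (2 ^ l + (i + 1)) : ℤ) - H (2 ^ l + i)|

theorem variation_le_succ {H : ℕ → ℕ} {n : ℕ} (h : IsMinHeap H n) {l : ℕ} (hl : 2 ^ (l + 1) ≤ n) :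
    variation H l ≤ variation H (l + 1) := by
  have h1 : 1 ≤ 2 ^ l := Nat.one_le_two_pow
  have e : 2 ^ (l + 1) = 2 * 2 ^ l := by ring
  have := sum_abs_min_le (fun i => (H (2 ^ (l + 1) + i) : ℤ)) (2 ^ l - 1)
  rw [variation, variation]
  refine le_trans (le_trans (le_of_eq (Finset.sum_congr rfl fun i hi => ?_))
    (le_add_of_nonneg_right (abs_nonneg _))) (this.trans (le_of_eq ?_))
  · have hi : i < 2 ^ l - 1 := by simpa using hi
    rw [h.eq_min (2 ^ l + i) (by omega) (by omega), h.eq_min (2 ^ l + (i + 1)) (by omega) (by omega)]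
    push_cast
    rw [e, show 2 * (2 ^ l + (i + 1)) = 2 * 2 ^ l + 2 * (i + 1) by ring,
      show 2 * (2 ^ l + i) = 2 * 2 ^ l + 2 * i by ring]
    simp only [add_assoc]
  · rw [show 2 * (2 ^ l - 1) + 1 = 2 ^ (l + 1) - 1 by omega]

theorem variation_le {H : ℕ → ℕ} {L : ℕ} (h : IsMinHeap H (2 ^ L)) {l : ℕ} (hl : l ≤ L) :
    variation H l ≤ variation H L := by
  induction hl using Nat.decreasingInduction with
  | self => exact le_rfl
  | of_succ k hk ih =>
    exact (variation_le_succ h (Nat.pow_le_pow_right (by norm_num) hk)).trans ih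

/-- The parent has the smaller of the values x and y of two siblings, so their rectangles have
heights summing to |x - y|. Adding over sibling pairs gives at most the variation of the level. Only
the root, whose parent is the cell `0`, contributes its full value `H 1`. -/
theorem sum_sub_half_le {H : ℕ → ℕ} {L : ℕ} (h : IsMinHeap H (2 ^ L)) {l : ℕ} (hl : l ≤ L) :
    ((∑ q ∈ Finset.range (2 ^ l), (H (2 ^ l + q) - H ((2 ^ l + q) / 2)) : ℕ) : ℤ) ≤
      H 1 + variation H L := by
  have hv : variation H l ≤ variation H L := variation_le h hl
  cases l with
  | zero =>
    have : 0 ≤ variation H L := Finset.sum_nonneg fun _ _ => abs_nonneg _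
    simp only [pow_zero, Finset.sum_range_one, add_zero, h.zero, Nat.reduceDiv, tsub_zero]
    omega
  | succ l =>
    have h1 : 1 ≤ 2 ^ l := Nat.one_le_two_pow
    have hle : 2 ^ (l + 1) ≤ 2 ^ L := Nat.pow_le_pow_right (by norm_num) hl
    have e : 2 ^ (l + 1) = 2 * 2 ^ l := by ring
    refine le_trans ?_ (le_add_of_nonneg_of_le (Int.natCast_nonneg _) hv)
    rw [e, FFT.sum_range_two_mul, variation, e]
    -- The differences within sibling pairs are those at even positions; the others are dropped.
    have h₂ : ∑ q ∈ Finset.range (2 ^ l), |(H (2 * 2 ^ l + (2 * q + 1)) : ℤ) - H (2 * 2 ^ l + 2 * q)| ≤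
        ∑ i ∈ Finset.range (2 * 2 ^ l - 1), |(H (2 * 2 ^ l + (i + 1)) : ℤ) - H (2 * 2 ^ l + i)| := by
      have := Finset.sum_image (s := Finset.range (2 ^ l)) (g := fun q => 2 * q)
        (f := fun i => |(H (2 * 2 ^ l + (i + 1)) : ℤ) - H (2 * 2 ^ l + i)|)
        (fun x _ y _ hxy => by simpa using hxy)
      rw [← this]
      refine Finset.sum_le_sum_of_subset_of_nonneg (fun x hx => ?_) fun _ _ _ => abs_nonneg _
      simp only [Finset.mem_image, Finset.mem_range] at hx ⊢
      omega
    refine le_trans ?_ h₂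
    rw [Nat.cast_sum]
    refine Finset.sum_le_sum fun q hq => ?_
    have hq : q < 2 ^ l := by simpa using hq
    have hm := h.eq_min (2 ^ l + q) (by omega) (by omega)
    rw [show 2 * (2 ^ l + q) = 2 * 2 ^ l + 2 * q by ring] at hm
    rw [show (2 * 2 ^ l + 2 * q) / 2 = 2 ^ l + q by omega,
      show (2 * 2 ^ l + (2 * q + 1)) / 2 = 2 ^ l + q by omega, ← add_assoc, hm]
    generalize H (2 * 2 ^ l + 2 * q) = x
    generalize H (2 * 2 ^ l + 2 * q + 1) = y
    rw [le_abs]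
    omega

end MinHeap

/-! ### Processing the tree on the machine -/

namespace WordRAM

open Ex Cmd

notation "treeX" => (30 : ℕ)
notation "treeM" => (31 : ℕ)
notation "treeB" => (32 : ℕ)
notation "treeTop" => (33 : ℕ)
notation "treeV" => (34 : ℕ)
notation "treeP" => (35 : ℕ)
notation "treeS" => (36 : ℕ)
notation "treeQ" => (37 : ℕ)
notation "memHeap" => (20 : ℕ)

theorem abs_rectSum_le {f g : ℤ → ℤ} {Y : ℕ} (hf : ∀ i, |f i| ≤ Y) (hg : ∀ i, |g i| ≤ Y) (I J d m : ℤ)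
    (n : ℕ) : |rectSum f g I n J d m| ≤ n * (Y : ℤ) ^ 2 := by
  refine (Finset.abs_sum_le_sum_abs _ _).trans
    ((Finset.sum_le_card_nsmul _ _ ((Y : ℤ) ^ 2) fun t _ => ?_).trans (by simp))
  rw [abs_mul, pow_two]
  refine mul_le_mul (hf _) ?_ (abs_nonneg _) (by positivity)
  split_ifs
  · exact hg _
  · simp

/-- Process one level of the tree. -/
def treeLevel : Cmd :=
  .assign treeQ (c 0) ;;
  .forUp treeQ treeP (
    .assign argI (v treeX + v treeQ * v treeS) ;;
    .assign argS (v treeS) ;;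
    .assign argJ (v treeB + c 1 + ld memHeap ((v treeP + v treeQ) / c 2)) ;;
    .assign argD (ld memHeap (v treeP + v treeQ) - ld memHeap ((v treeP + v treeQ) / c 2)) ;;
    convolve)

/-- The data of the tree are in the memory. -/
structure TreeInput (s : State) (X b sg : ℤ) (H : ℕ → ℕ) (L Q Y : ℕ) : Prop where
  hX : s.var treeX = X
  hB : s.var treeB = b
  hsg : s.var argSign = sg
  heap : ∀ v : ℕ, v < 2 * 2 ^ L → s.arr memHeap v = H v
  isMinHeap : MinHeap.IsMinHeap H (2 ^ L)
  hsg1 : |sg| ≤ 1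
  ha : ∀ i, |s.arr 0 i| ≤ Y
  hb : ∀ i, |s.arr 1 i| ≤ Y
  hXY : |X| + 2 * Q ≤ Y
  hbY : |b| + 1 + Q ≤ Y
  hQY : 3 * Q ≤ Y
  hLQ : 2 ^ L ≤ 2 * Q
  hHQ : ∀ v < 2 * 2 ^ L, H v ≤ Q
  hY : 16 ≤ Y
  hvar : MinHeap.variation H L ≤ 3 * Q

theorem TreeInput.of_eq {s s' : State} {X b sg : ℤ} {H : ℕ → ℕ} {L Q Y : ℕ}
    (h : TreeInput s X b sg H L Q Y) (hX : s'.var treeX = s.var treeX)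
    (hB : s'.var treeB = s.var treeB) (hsg : s'.var argSign = s.var argSign)
    (h₀ : s'.arr 0 = s.arr 0) (h₁ : s'.arr 1 = s.arr 1) (h₂ : s'.arr memHeap = s.arr memHeap) :
    TreeInput s' X b sg H L Q Y :=
  ⟨hX ▸ h.hX, hB ▸ h.hB, hsg ▸ h.hsg, h₂ ▸ h.heap, h.isMinHeap, h.hsg1, h₀ ▸ h.ha, h₁ ▸ h.hb, h.hXY,
    h.hbY, h.hQY, h.hLQ, h.hHQ, h.hY, h.hvar⟩

/-- The nodes of a level have total width 2^L and, by `MinHeap.sum_sub_half_le`, total rectangle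
height O(Q). Each single convolution has size at most 3Q, so a common logarithm can be factored out.
-/
theorem treeLevel_spec {V B : ℕ} (hV : 16 ≤ V) (hB : V ^ 10 ≤ B) {s : State} {X b sg : ℤ} {H : ℕ → ℕ}
    {L Q Y l Z : ℕ} (h : TreeInput s X b sg H L Q Y) (hl : l ≤ L) (hP : s.var treeP = ((2 ^ l : ℕ) : ℤ))
    (hS : s.var treeS = ((2 ^ (L - l) : ℕ) : ℤ)) (hYV : Y ^ 200 ≤ V) (hout : ∀ m, |s.arr 8 m| ≤ Z)
    (hZ : Z + 2 ^ L * Y ^ 2 ≤ V) :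
    treeLevel.Spec B s (20000 * Q * (Nat.clog 2 (3 * Q) + 1)) (fun s' => ∀ m, s'.arr 8 m = s.arr 8 m +
      sg * ∑ q ∈ Finset.range (2 ^ l), MinHeap.nodeSum (s.arr 0) (s.arr 1) H X b m L l q) := by
  have hVB : V ≤ B := (Nat.le_self_pow (by norm_num) V).trans hB
  have hVB' : (V : ℤ) ≤ B := by exact_mod_cast hVB
  have hY := h.hY
  have yV : 16 * Y ≤ V := by
    have : Y ^ 2 ≤ V := (Nat.pow_le_pow_right (by omega) (by norm_num)).trans hYV
    nlinarith
  have hYV' := hYV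
  clear hYV
  have e : 2 ^ l * 2 ^ (L - l) = 2 ^ L := by rw [← pow_add, Nat.add_sub_cancel' hl]
  have hlL : 2 ^ l ≤ 2 ^ L := Nat.pow_le_pow_right (by norm_num) hl
  have hLQ := h.hLQ
  have hQY := h.hQY
  have hsl : 2 ^ (L - l) ≤ 2 ^ L := Nat.pow_le_pow_right (by norm_num) (Nat.sub_le _ _)
  have hs1 : 1 ≤ 2 ^ (L - l) := Nat.one_le_two_pow
  have hp1 : 1 ≤ 2 ^ l := Nat.one_le_two_pow
  obtain ⟨p, hp⟩ : ∃ p, p = 2 ^ l := ⟨_, rfl⟩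
  obtain ⟨σ, hσ⟩ : ∃ σ, σ = 2 ^ (L - l) := ⟨_, rfl⟩
  have hdQ : ∀ q < p, p + q < 2 * 2 ^ L ∧ H (p + q) ≤ Q ∧ H ((p + q) / 2) ≤ H (p + q) := by
    intro q hq
    have : p + q < 2 * 2 ^ L := by omega
    exact ⟨this, h.hHQ _ this, h.isMinHeap.half_le this⟩
  have hns : ∀ m q, |sg * MinHeap.nodeSum (s.arr 0) (s.arr 1) H X b m L l q| ≤ 2 ^ (L - l) * Y ^ 2 := by
    intro m q
    rw [abs_mul]
    have h₁ := h.hsg1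
    have h₂ := abs_rectSum_le h.ha h.hb (X + (q * 2 ^ (L - l) : ℕ)) (b + 1 + H ((2 ^ l + q) / 2))
      ((H (2 ^ l + q) - H ((2 ^ l + q) / 2) : ℕ) : ℤ) m (2 ^ (L - l))
    calc |sg| * |_| ≤ 1 * |_| := mul_le_mul_of_nonneg_right h₁ (abs_nonneg _)
      _ ≤ 2 ^ (L - l) * Y ^ 2 := by rw [one_mul]; exact_mod_cast h₂
  rw [← hp] at hP e hlL hp1
  rw [← hσ] at hS e hsl hs1
  -- Also the output after part of a level has to fit into a word. A node contributes at most its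
  -- width times Y², and the widths add up to 2^L.
  have hnext : ∀ m, ∀ i ≤ p, |s.arr 8 m + sg * ∑ q ∈ Finset.range i,
      MinHeap.nodeSum (s.arr 0) (s.arr 1) H X b m L l q| ≤ V := by
    intro m i hi
    refine (abs_add_le _ _).trans ?_
    rw [Finset.mul_sum]
    have h₁ : |∑ q ∈ Finset.range i, sg * MinHeap.nodeSum (s.arr 0) (s.arr 1) H X b m L l q| ≤
        i * (2 ^ (L - l) * Y ^ 2) :=
      (Finset.abs_sum_le_sum_abs _ _).trans
        ((Finset.sum_le_card_nsmul _ _ _ fun q _ => hns m q).trans (by simp))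
    have h₂ : i * (2 ^ (L - l) * Y ^ 2) ≤ 2 ^ L * Y ^ 2 := by
      rw [← hσ, ← e, ← mul_assoc]; gcongr
    have h₃ := hout m
    have h₄ : (i * (2 ^ (L - l) * Y ^ 2) : ℤ) ≤ 2 ^ L * Y ^ 2 := by exact_mod_cast h₂
    have h₅ : (Z + 2 ^ L * Y ^ 2 : ℤ) ≤ V := by exact_mod_cast hZ
    linarith
  refine (Spec.assign_seq hV hB 0 (by decide) (by simp) (by simp) <|
    Spec.forUp 0 p (fun i s' => ∀ m, s'.arr 8 m = s.arr 8 m +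
      sg * ∑ q ∈ Finset.range i, MinHeap.nodeSum (s.arr 0) (s.arr 1) H X b m L l q)
      -- The time depends on the node, so that the heights can be summed over the level instead of
      -- being estimated one by one.
      (fun q => 40 + 3000 * (σ + (H (p + q) - H ((p + q) / 2))) * (Nat.clog 2 (3 * Q) + 1))
      (by decide) (by decide) (by decide) (by decide) (by decide) (by simp [State.var_setVar])
      (by simp [State.var_setVar, hP]) (by omega) (by simp) (by rw [Nat.abs_cast]; omega)
      (by simp) ?_).mono ?_ ?_
  · intro i hi s' hx hI hF
    simp only [zero_add] at hi hx
    have hi : i < p := by exact_mod_cast hi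
    obtain ⟨d₁, d₂, d₃⟩ := hdQ i hi
    obtain ⟨d, hd⟩ : ∃ d, d = H (p + i) - H ((p + i) / 2) := ⟨_, rfl⟩
    have f₁ : s'.var treeX = X := by
      rw [hF.var _ (by decide) (by decide)]; simp [State.var_setVar, h.hX]
    have f₂ : s'.var treeB = b := by
      rw [hF.var _ (by decide) (by decide)]; simp [State.var_setVar, h.hB]
    have f₃ : s'.var treeS = σ := by
      rw [hF.var _ (by decide) (by decide)]; simp [State.var_setVar, hS]
    have f₄ : s'.var treeP = p := by
      rw [hF.var _ (by decide) (by decide)]; simp [State.var_setVar, hP]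
    have f₅ : s'.var argSign = sg := by
      rw [hF.var _ (by decide) (by decide)]; simp [State.var_setVar, h.hsg]
    have f₆ : s'.arr 0 = s.arr 0 := by rw [hF.arr _ (by decide)]; rfl
    have f₇ : s'.arr 1 = s.arr 1 := by rw [hF.arr _ (by decide)]; rfl
    have f₈ : s'.arr memHeap = s.arr memHeap := by rw [hF.arr _ (by decide)]; rfl
    have g₁ : s'.arr memHeap ((p : ℤ) + i) = H (p + i) := by
      rw [f₈]; exact_mod_cast h.heap (p + i) d₁
    have g₂ : s'.arr memHeap (((p : ℤ) + i) / 2) = H ((p + i) / 2) := by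
      rw [f₈]; exact_mod_cast h.heap ((p + i) / 2) (by omega)
    have bX := h.hXY
    have bb := h.hbY
    have b₁ : |X| ≤ V := by omega
    have b₂ : |b| ≤ V := by omega
    have b₃ : i ≤ V := by omega
    have b₄ : σ ≤ V := by omega
    have b₅ : p ≤ V := by omega
    have b₆ : H (p + i) ≤ V := by omega
    have b₇ : H ((p + i) / 2) ≤ V := by omega
    have hdz : (H (p + i) : ℤ) - H ((p + i) / 2) = d := by omega
    have hiσ : i * σ ≤ 2 ^ L := by rw [← e]; gcongr
    have hσd : σ + d ≤ 3 * Q := by omega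
    refine Spec.mono (T := 2 + 2 + (0 + 2 + (7 + 2 + (7 + 2 +
        3000 * (σ + d) * (Nat.clog 2 (σ + d) + 1)))))
      (Q := fun s'' => ∀ m, s''.arr 8 m = s'.arr 8 m + sg * rectSum (s.arr 0) (s.arr 1)
        (X + (i * σ : ℕ)) σ (b + 1 + H ((p + i) / 2)) d m) ?_ ?_ ?_
    · refine (Spec.assign_seq hV hB (X + (i * σ : ℕ)) (by decide) ?_ ?_ <|
        Spec.assign_seq hV hB σ (by decide) ?_ ?_ <|
        Spec.assign_seq hV hB (b + 1 + H ((p + i) / 2)) (by decide) ?_ ?_ <|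
        Spec.assign_seq hV hB d (by decide) ?_ ?_ <|
        (convolve_spec hV hB (I := X + (i * σ : ℕ)) (J := b + 1 + H ((p + i) / 2)) (sg := sg) (n := σ)
          (d := d) (Y := Y)
          ⟨?_, ?_, ?_, ?_, ?_, hs1, hY, by omega, ?_, ?_, ?_, ?_⟩ h.hsg1 ?_ hYV').mono le_rfl ?_)
      · simp [hx, f₁, f₃, b₁, b₃, b₄]
      · simp [hx, f₁, f₃]
      · simp [State.var_setVar, f₃, b₄]
      · simp [State.var_setVar, f₃]
      · simp [State.var_setVar, f₂, f₄, hx, g₂, b₂, b₃, b₅, b₇]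
      · simp [State.var_setVar, f₂, f₄, hx, g₂]
      · simp [State.var_setVar, f₄, hx, g₁, g₂, b₃, b₅, b₆, b₇]
      · simp [State.var_setVar, f₄, hx, g₁, g₂, hdz]
      · simp [State.var_setVar]
      · simp [State.var_setVar]
      · simp [State.var_setVar]
      · simp [State.var_setVar]
      · simp [State.var_setVar, f₅]
      · refine (abs_add_le _ _).trans ?_
        rw [Nat.abs_cast]; omega
      · refine (abs_add_le _ _).trans ?_
        rw [Nat.abs_cast]
        have := abs_add_le b 1
        rw [abs_one] at this
        omega
      · simpa [f₆] using h.ha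
      · simpa [f₇] using h.hb
      · intro m
        simp only [State.arr_setVar]
        rw [hI m]
        exact hnext m i hi.le
      · intro s'' _ hs m
        simpa [f₆, f₇] using hs m
    · rw [← hd]
      have h₁ : Nat.clog 2 (σ + d) ≤ Nat.clog 2 (3 * Q) := Nat.clog_mono_right 2 hσd
      have h₂ : 3000 * (σ + d) * (Nat.clog 2 (σ + d) + 1) ≤
          3000 * (σ + d) * (Nat.clog 2 (3 * Q) + 1) := by gcongr
      omega
    · intro s'' _ hs m
      rw [State.arr_setVar, hs m, hI m, Finset.sum_range_succ, mul_add, ← add_assoc, MinHeap.nodeSum, ← hp, ← hσ, ← hd]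
  · have hsum := MinHeap.sum_sub_half_le h.isMinHeap hl
    have hvar := h.hvar
    have h1 := h.hHQ 1 (by omega)
    rw [← hp] at hsum
    -- The root value is at most Q and the variation at most 3Q.
    have h₁ : ∑ q ∈ Finset.range p, (H (p + q) - H ((p + q) / 2)) ≤ 4 * Q := by zify; push_cast at hsum; linarith
    obtain ⟨k, hk⟩ : ∃ k, k = Nat.clog 2 (3 * Q) + 1 := ⟨_, rfl⟩
    simp only [sub_zero, Int.toNat_natCast]
    rw [← hk, show (c 0).cost = 1 from rfl]
    simp only [mul_assoc, ← hk]
    rw [Finset.sum_add_distrib, Finset.sum_add_distrib, ← Finset.mul_sum, ← Finset.sum_mul,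
      Finset.sum_add_distrib]
    simp only [Finset.sum_const, Finset.card_range, smul_eq_mul]
    rw [e]
    have h₂ : 2 ^ L + ∑ q ∈ Finset.range p, (H (p + q) - H ((p + q) / 2)) ≤ 6 * Q := by omega
    have h₃ := Nat.mul_le_mul_right k h₂
    have hk1 : 1 ≤ k := by omega
    have hQk : Q ≤ Q * k := Nat.le_mul_of_pos_right _ hk1
    have : 6 * Q * k = 6 * (Q * k) := by ring
    omega
  · intro s' _ h'
    rw [← hp]
    simpa using h'

end WordRAM

namespace WordRAM

open Ex Cmd

/-- Process all levels of the tree. -/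
def treeLevels : Cmd :=
  .assign treeP (c 1) ;;
  .assign treeS (v treeTop) ;;
  .loop (c 0) (v treeS) (treeLevel ;;
    .assign treeP (v treeP + v treeP) ;;
    .assign treeS (v treeS / c 2))

theorem abs_sum_nodeSum_le {f g : ℤ → ℤ} {Y : ℕ} (hf : ∀ i, |f i| ≤ Y) (hg : ∀ i, |g i| ≤ Y)
    (H : ℕ → ℕ) (X b m : ℤ) {L l : ℕ} (hl : l ≤ L) :
    |∑ q ∈ Finset.range (2 ^ l), MinHeap.nodeSum f g H X b m L l q| ≤ ((2 ^ L * Y ^ 2 : ℕ) : ℤ) := by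
  refine (Finset.abs_sum_le_sum_abs _ _).trans
    ((Finset.sum_le_card_nsmul _ _ _ fun q _ => abs_rectSum_le hf hg _ _ _ m _).trans ?_)
  rw [Finset.card_range, nsmul_eq_mul, ← mul_assoc, ← Nat.cast_mul, ← pow_add, Nat.add_sub_cancel' hl]
  push_cast
  rfl

theorem treeLevels_spec {V B : ℕ} (hV : 16 ≤ V) (hB : V ^ 10 ≤ B) {s : State} {X b sg : ℤ} {H : ℕ → ℕ}
    {L Q Y Z : ℕ} (h : TreeInput s X b sg H L Q Y) (htop : s.var treeTop = ((2 ^ L : ℕ) : ℤ))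
    (hYV : Y ^ 200 ≤ V) (hout : ∀ m, |s.arr 8 m| ≤ Z)
    (hZ : Z + (L + 1) * (2 ^ L * Y ^ 2) ≤ V) :
    treeLevels.Spec B s ((L + 1) * (20000 * Q * (Nat.clog 2 (3 * Q) + 1) + 20) + 10)
      (fun s' => ∀ m, s'.arr 8 m = s.arr 8 m + sg * ∑ t ∈ Finset.range (2 ^ L), s.arr 0 (X + t) *
        if b < m - (X + t) ∧ m - (X + t) ≤ b + H (2 ^ L + t) then s.arr 1 (m - (X + t)) else 0) := by
  have hVB : V ≤ B := (Nat.le_self_pow (by norm_num) V).trans hB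
  have hVB' : (V : ℤ) ≤ B := by exact_mod_cast hVB
  have hY := h.hY
  have hLQ := h.hLQ
  have hQY := h.hQY
  have yV : 16 * Y ≤ V := by
    have : Y ^ 2 ≤ V := (Nat.pow_le_pow_right (by omega) (by norm_num)).trans hYV
    nlinarith
  have hYV' := hYV
  clear hYV
  have hLV : 2 * 2 ^ L ≤ V := by omega
  refine Spec.mono (Spec.assign_seq hV hB 1 (by decide) (by simp) (by simp) <|
    Spec.assign_seq hV hB ((2 ^ L : ℕ) : ℤ) (by decide) (by
      simp only [leafOk_v, State.var_setVar]
      rw [if_neg (by decide), htop, Nat.abs_cast]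
      exact ⟨by decide, by omega⟩) (by simp [State.var_setVar, htop]) <|
    -- The width `2 ^ L / 2 ^ l` of a node becomes zero exactly after the leaves, at `l = L + 1`.
    Spec.loop (L + 1) (fun l s' => s'.var treeP = ((2 ^ l : ℕ) : ℤ) ∧
      s'.var treeS = ((2 ^ L / 2 ^ l : ℕ) : ℤ) ∧ ∀ m, s'.arr 8 m = s.arr 8 m + sg *
        ∑ l' ∈ Finset.range l, ∑ q ∈ Finset.range (2 ^ l'),
          MinHeap.nodeSum (s.arr 0) (s.arr 1) H X b m L l' q)
      (fun _ => 20000 * Q * (Nat.clog 2 (3 * Q) + 1) + 10) ?_ ?_ ?_ ?_) ?_ ?_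
  · simp [State.var_setVar]
  · rintro l hl s' ⟨-, h₁, -⟩ -
    refine ⟨by simp [Ex.ok], ok_of_leafOk hV hB ?_ (by decide)⟩
    rw [leafOk_v, h₁, Nat.abs_cast]
    have := Nat.div_le_self (2 ^ L) (2 ^ l)
    exact ⟨by decide, by omega⟩
  · rintro l hl s' ⟨h₁, h₂, h₃⟩ hF
    have hl : l ≤ L := by omega
    have e : 2 ^ L / 2 ^ l = 2 ^ (L - l) := Nat.pow_div hl (by norm_num)
    have f₀ : s'.arr 0 = s.arr 0 := by rw [hF.arr _ (by decide)]; rfl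
    have f₁ : s'.arr 1 = s.arr 1 := by rw [hF.arr _ (by decide)]; rfl
    have h' : TreeInput s' X b sg H L Q Y := by
      refine h.of_eq ?_ ?_ ?_ f₀ f₁ ?_
      · rw [hF.var _ (by decide) (by decide)]; simp [State.var_setVar]
      · rw [hF.var _ (by decide) (by decide)]; simp [State.var_setVar]
      · rw [hF.var _ (by decide) (by decide)]; simp [State.var_setVar]
      · rw [hF.arr _ (by decide)]; rfl
    refine ⟨by simp [h₂, e], Spec.mono (T := 20000 * Q * (Nat.clog 2 (3 * Q) + 1) + (3 + 4))
      (Spec.seq (treeLevel_spec hV hB h' hl h₁ (h₂.trans (by rw [e])) hYV'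
        (Z := Z + l * (2 ^ L * Y ^ 2)) ?_ ?_) fun s'' F hs => ?_) (by omega) fun _ _ h => h⟩
    · intro m
      rw [h₃ m]
      refine (abs_add_le _ _).trans ?_
      have k₁ : |∑ l' ∈ Finset.range l, ∑ q ∈ Finset.range (2 ^ l'),
          MinHeap.nodeSum (s.arr 0) (s.arr 1) H X b m L l' q| ≤ ((l * (2 ^ L * Y ^ 2) : ℕ) : ℤ) := by
        refine (Finset.abs_sum_le_sum_abs _ _).trans ((Finset.sum_le_card_nsmul _ _ ((2 ^ L * Y ^ 2 : ℕ) : ℤ)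
          fun l' hl' => abs_sum_nodeSum_le h.ha h.hb H X b m ?_).trans ?_)
        · simp at hl'; omega
        · simp
      rw [abs_mul]
      have := mul_le_mul h.hsg1 k₁ (abs_nonneg _) (by norm_num)
      have := hout m
      push_cast at *
      linarith
    · have : (l + 1) * (2 ^ L * Y ^ 2) ≤ (L + 1) * (2 ^ L * Y ^ 2) := by gcongr
      linarith
    · have g₁ : s''.var treeP = ((2 ^ l : ℕ) : ℤ) := by rw [F.var _ (by decide) (by decide), h₁]
      have g₂ : s''.var treeS = ((2 ^ (L - l) : ℕ) : ℤ) := by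
        rw [F.var _ (by decide) (by decide), h₂, e]
      have b₁ : 2 ^ l ≤ V := (Nat.pow_le_pow_right (by norm_num) hl).trans (by omega)
      have b₂ : 2 ^ (L - l) ≤ V := (Nat.pow_le_pow_right (by norm_num) (Nat.sub_le _ _)).trans (by omega)
      refine Spec.of_wpV hV hB (by decide) ?_
      have hd : ((2 ^ (L - l) : ℕ) : ℤ) / 2 = ((2 ^ L / 2 ^ (l + 1) : ℕ) : ℤ) := by
        rw [pow_succ, ← Nat.div_div_eq_div_mul, e]; rfl
      have hsum : ((2 ^ l : ℕ) : ℤ) + ((2 ^ l : ℕ) : ℤ) = ((2 ^ (l + 1) : ℕ) : ℤ) := by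
        push_cast; ring
      simp only [wpV, leafOk_add, leafOk_div, leafOk_v, leafOk_c, State.var_setVar, eval_add, eval_div, eval_v,
        eval_c, g₁, g₂, if_true, hsum]
      simp only [show (treeS = treeP) = False by simp, if_false, g₂, hd, Nat.abs_cast, State.arr_setVar]
      refine ⟨by decide, ⟨⟨by decide, by exact_mod_cast b₁⟩, by decide, by exact_mod_cast b₁⟩, by decide,
        ⟨⟨by decide, by exact_mod_cast b₂⟩, by decide⟩, by simp, by simp, fun m => ?_⟩
      rw [hs m, h₃ m, f₀, f₁, Finset.sum_range_succ]
      ring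
  · rintro s' ⟨-, h₁, -⟩ -
    rw [pow_succ, ← Nat.div_div_eq_div_mul, Nat.div_self (by positivity)] at h₁
    simp [h₁]
  · simp only [Finset.sum_const, Finset.card_range, smul_eq_mul, show (c 1).cost = 1 from rfl,
      show (c 0).cost = 1 from rfl, show (v treeTop).cost = 0 from rfl, show (v treeS).cost = 0 from rfl]
    generalize 20000 * Q * (Nat.clog 2 (3 * Q) + 1) = x
    nlinarith
  · rintro s' - ⟨-, -, h'⟩ m
    rw [h' m, MinHeap.sum_nodeSum _ _ h.isMinHeap]

end WordRAM

/-! ### Building the tree of minima -/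

namespace WordRAM

open Ex Cmd

/-- Determine the number of leaves of the tree. -/
def treeSize : Cmd :=
  .assign treeTop (c 1) ;; .loop (v treeTop) (v treeM) (.assign treeTop (v treeTop + v treeTop))

/-- Store the leaves of the tree. -/
def treeLeaves (A : ℕ) : Cmd :=
  .assign treeV (c 0) ;;
  .forUp treeV treeTop (
    .ite (v treeV) (v treeM)
      (.store memHeap (v treeTop + v treeV) (ld A (v treeX + v treeV) - v treeB))
      (.store memHeap (v treeTop + v treeV) (c 0)))

/-- Compute the minima at the inner nodes. -/
def treeMinima : Cmd :=
  .assign treeV (v treeTop - c 1) ;;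
  .loop (c 0) (v treeV) (
    .ite (ld memHeap (c 2 * v treeV)) (ld memHeap (c 2 * v treeV + c 1))
      (.store memHeap (v treeV) (ld memHeap (c 2 * v treeV)))
      (.store memHeap (v treeV) (ld memHeap (c 2 * v treeV + c 1))) ;;
    .assign treeV (v treeV - c 1)) ;;
  .store memHeap (c 0) (c 0)

theorem treeSize_spec {V B : ℕ} (hV : 16 ≤ V) (hB : V ^ 10 ≤ B) {s : State} {M : ℕ}
    (hM : s.var treeM = M) (hVM : 2 * M ≤ V) :
    treeSize.Spec B s (10 * Nat.clog 2 M + 10)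
      (fun s' => s'.var treeTop = ((2 ^ Nat.clog 2 M : ℕ) : ℤ)) := by
  have hVB : V ≤ B := (Nat.le_self_pow (by norm_num) V).trans hB
  have hVB' : (V : ℤ) ≤ B := by exact_mod_cast hVB
  refine Spec.mono (Spec.assign_seq hV hB 1 (by decide) (by simp) (by simp) <|
    Spec.loop (Nat.clog 2 M) (fun l s' => s'.var treeTop = ((2 ^ l : ℕ) : ℤ))
      (fun _ => 3) ?_ ?_ ?_ ?_) ?_ ?_
  · simp [State.var_setVar]
  · intro l hl s' h hF
    exact ⟨by simp [Ex.ok], by simp [Ex.ok]⟩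
  · intro l hl s' h hF
    have h₁ : s'.var treeM = M := by
      rw [hF.var _ (by decide) (by decide)]; simp [State.var_setVar, hM]
    have hlt : 2 ^ l < M := (Nat.lt_clog_iff_pow_lt (by norm_num)).1 hl
    generalize hm : 2 ^ l = m at *
    refine ⟨by simp [h, h₁]; exact_mod_cast hlt, Spec.of_wpV hV hB (by decide) ?_⟩
    simp [wpV, h, State.var_setVar, pow_succ, hm]
    omega
  · intro s' h hF
    have h₁ : s'.var treeM = M := by
      rw [hF.var _ (by decide) (by decide)]; simp [State.var_setVar, hM]
    have := Nat.le_pow_clog (b := 2) (by norm_num) M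
    simp only [eval_v, h, h₁]
    exact_mod_cast not_lt.2 this
  · simp [Ex.cost]
    omega
  · exact fun _ _ h => h

theorem treeLeaves_spec {V B : ℕ} (hV : 16 ≤ V) (hB : V ^ 10 ≤ B) {A : ℕ} (hA : A ≠ memHeap) {s : State}
    {X b : ℤ} {M N : ℕ} {h : ℕ → ℕ} (hX : s.var treeX = X) (hb : s.var treeB = b)
    (hM : s.var treeM = M) (hN : s.var treeTop = N) (hXV : |X| ≤ V) (hbV : |b| ≤ V)
    (hMN : M ≤ N) (hNV : N ≤ V) (hh : ∀ t : ℕ, t < M → s.arr A (X + t) = b + h t)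
    (hAV : ∀ t : ℕ, t < M → |s.arr A (X + t)| ≤ V) (h0 : ∀ t, M ≤ t → h t = 0) :
    (treeLeaves A).Spec B s (20 * N + 10)
      (fun s' => ∀ t : ℕ, t < N → s'.arr memHeap (N + t : ℕ) = h t) := by
  have hVB : V ≤ B := (Nat.le_self_pow (by norm_num) V).trans hB
  have hVB' : (V : ℤ) ≤ B := by exact_mod_cast hVB
  refine Spec.mono (Spec.assign_seq hV hB 0 (by decide) (by simp) (by simp) <|
    Spec.forUp 0 N (fun i s' => ∀ t : ℕ, t < i → s'.arr memHeap (N + t : ℕ) = h t)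
      (fun _ => 15) (by decide)
      (by decide) (by rfl) (by rfl) (by decide) (by simp [State.var_setVar])
      (by simp [State.var_setVar, hN]) (by omega) (by simp) (by rw [Nat.abs_cast]; omega)
      (by simp) ?_) ?_ ?_
  · intro i hi s' hx hI hF
    simp only [zero_add] at hi hx
    have f₁ : s'.var treeX = X := by
      rw [hF.var _ (by decide) (by rfl)]; simp [State.var_setVar, hX]
    have f₂ : s'.var treeB = b := by
      rw [hF.var _ (by decide) (by rfl)]; simp [State.var_setVar, hb]
    have f₃ : s'.var treeM = M := by
      rw [hF.var _ (by decide) (by rfl)]; simp [State.var_setVar, hM]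
    have f₄ : s'.var treeTop = N := by
      rw [hF.var _ (by decide) (by rfl)]; simp [State.var_setVar, hN]
    have f₅ : s'.arr A = s.arr A := by
      rw [hF.arr _ (by simpa [setsArr] using hA)]; rfl
    have b₁ : i ≤ V := by omega
    have b₂ : M ≤ V := by omega
    refine Spec.of_wpV hV hB (Nat.le_of_ble_eq_true rfl) ?_
    have hst : ∀ x : ℤ, x = h i → ∀ t : ℕ, t < i + 1 →
        ((s'.setArr memHeap (N + i) x).setVar treeV (i + 1)).arr memHeap (N + t : ℕ) = h t := by
      intro x hxi t ht
      rw [State.arr_setVar, State.arr_setArr]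
      by_cases hti : t = i
      · rw [if_pos ⟨rfl, by push_cast; omega⟩, hti, hxi]
      · rw [if_neg (by push_cast; omega), hI t (by omega)]
    simp [wpV, hx, f₁, f₂, f₃, f₄, b₁, b₂, hNV, f₅, hXV, hbV]
    refine ⟨fun hiM => ⟨hAV i hiM, ?_⟩, fun hMi => ?_⟩
    · simpa using hst _ (by rw [hh i hiM]; ring)
    · simpa using hst 0 (by rw [h0 i hMi]; rfl)
  · simp [show (c 0).cost = 1 from rfl]
    omega
  · intro s' _ hs
    simpa using hs

/-- The inner nodes are visited in decreasing order, so both children are final when their parent is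
computed. After `i` rounds the heap property holds at the inner nodes above `N - 1 - i`. -/
theorem treeMinima_spec {V B : ℕ} (hV : 16 ≤ V) (hB : V ^ 10 ≤ B) {s : State} {N Q : ℕ} {h : ℕ → ℕ}
    (hN : s.var treeTop = N) (hN1 : 1 ≤ N) (hNV : 2 * N ≤ V) (hQV : Q ≤ V)
    (hh : ∀ t : ℕ, t < N → s.arr memHeap (N + t : ℕ) = h t) (hQ : ∀ t, h t ≤ Q) :
    treeMinima.Spec B s (40 * N + 10) (fun s' => ∃ H : ℕ → ℕ, MinHeap.IsMinHeap H N ∧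
      (∀ t < N, H (N + t) = h t) ∧ ∀ w : ℕ, w < 2 * N → s'.arr memHeap w = H w ∧ H w ≤ Q) := by
  have hVB : V ≤ B := (Nat.le_self_pow (by norm_num) V).trans hB
  have hVB' : (V : ℤ) ≤ B := by exact_mod_cast hVB
  have hNV' : (2 * N : ℤ) ≤ V := by exact_mod_cast hNV
  have hN1' : (1 : ℤ) ≤ N := by exact_mod_cast hN1
  have ab : |(N : ℤ)| ≤ V := by rw [Nat.abs_cast]; omega
  refine Spec.mono (Spec.assign_seq hV hB (N - 1) (by decide) (by simpa [hN] using ab)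
    (by simp [hN]) <| Spec.seq (Spec.loop (N - 1) (fun i s' => s'.var treeV = N - 1 - i ∧
      (∀ t : ℕ, t < N → s'.arr memHeap (N + t : ℕ) = h t) ∧
      (∀ w : ℕ, N - 1 - i < w → w < 2 * N → 0 ≤ s'.arr memHeap w ∧ s'.arr memHeap w ≤ Q) ∧
      ∀ w : ℕ, N - 1 - i < w → w < N → s'.arr memHeap w =
        min (s'.arr memHeap (2 * w : ℕ)) (s'.arr memHeap (2 * w + 1 : ℕ)))
      (fun _ => 30) ?_ ?_ ?_ ?_) fun s₁ F₁ h₁ => 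
        Spec.of_wpV hV hB (T := 3) ?_ (Q := fun s' => ∃ H : ℕ → ℕ, MinHeap.IsMinHeap H N ∧
          (∀ t < N, H (N + t) = h t) ∧ ∀ w : ℕ, w < 2 * N → s'.arr memHeap w = H w ∧ H w ≤ Q) ?_) ?_ ?_
  · refine ⟨by simp [State.var_setVar], by simpa using hh, fun w hw hw' => ?_, fun w hw hw' => by omega⟩
    obtain ⟨t, rfl⟩ : ∃ t, w = N + t := ⟨w - N, by omega⟩
    rw [State.arr_setVar, hh t (by omega)]
    have := hQ t
    omega
  · rintro i hi s' ⟨h₁, -⟩ -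
    exact ⟨by simp [Ex.ok], by simp [Ex.ok]⟩
  · rintro i hi s' ⟨h₁, h₂, h₃, h₄⟩ hF
    obtain ⟨u, hu⟩ : ∃ u : ℕ, u = N - 1 - i := ⟨_, rfl⟩
    have h₁' : s'.var treeV = u := by rw [h₁]; omega
    have hu1 : 1 ≤ u := by omega
    refine ⟨by simp only [eval_c, eval_v, h₁']; omega, Spec.of_wpV hV hB (by decide) ?_⟩
    have k₁ := h₃ (2 * u) (by omega) (by omega)
    have k₂ := h₃ (2 * u + 1) (by omega) (by omega)
    have a₁ : |s'.arr memHeap (2 * u : ℕ)| ≤ V := by rw [abs_of_nonneg k₁.1]; omega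
    have a₂ : |s'.arr memHeap (2 * u + 1 : ℕ)| ≤ V := by rw [abs_of_nonneg k₂.1]; omega
    have uV : u ≤ V := by omega
    push_cast at a₁ a₂
    have hst : ∀ x : ℤ, x = min (s'.arr memHeap (2 * u : ℕ)) (s'.arr memHeap (2 * u + 1 : ℕ)) →
        (∀ t : ℕ, t < N → (s'.setArr memHeap u x).arr memHeap (N + t : ℕ) = h t) ∧
        (∀ w : ℕ, N - 1 - (i + 1) < w → w < 2 * N → 0 ≤ (s'.setArr memHeap u x).arr memHeap w ∧
          (s'.setArr memHeap u x).arr memHeap w ≤ Q) ∧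
        ∀ w : ℕ, N - 1 - (i + 1) < w → w < N → (s'.setArr memHeap u x).arr memHeap w =
          min ((s'.setArr memHeap u x).arr memHeap (2 * w : ℕ))
            ((s'.setArr memHeap u x).arr memHeap (2 * w + 1 : ℕ)) := by
      intro x hx
      refine ⟨fun t ht => ?_, fun w hw hw' => ?_, fun w hw hw' => ?_⟩
      · rw [State.arr_setArr, if_neg (by push_cast; omega), h₂ t ht]
      · rw [State.arr_setArr]
        split_ifs with hc
        · rw [hx]; omega
        · exact h₃ w (by omega) hw'
      · rw [State.arr_setArr, State.arr_setArr, State.arr_setArr,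
          if_neg (show ¬ ((20 : ℕ) = 20 ∧ ((2 * w : ℕ) : ℤ) = u) by push_cast; omega),
          if_neg (show ¬ ((20 : ℕ) = 20 ∧ ((2 * w + 1 : ℕ) : ℤ) = u) by push_cast; omega)]
        split_ifs with hc
        · rw [hx, show w = u by omega]
        · exact h₄ w (by omega) hw'
    have e : (u : ℤ) - 1 = N - 1 - (i + 1 : ℕ) := by push_cast; omega
    have hsv : ∀ (t : State) (x : ℤ), (t.setVar treeV x).var treeV = x := fun t x => by
      simp [State.var_setVar]
    simp [-Nat.cast_add, wpV, h₁', uV, a₁, a₂, hsv, e]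
    refine ⟨fun hc => ?_, fun hc => ?_⟩
    · have := hst _ (min_eq_left (by push_cast; omega)).symm
      push_cast at this ⊢
      exact this
    · have := hst _ (min_eq_right (by push_cast; omega)).symm
      push_cast at this ⊢
      exact this
  · rintro s' ⟨h₁, -⟩ -
    simp only [eval_c, eval_v, h₁]
    omega
  · decide
  · obtain ⟨-, h₂, h₃, h₄⟩ := h₁
    simp only [wpV, deg_c, leafOk_c, eval_c]
    -- The heap as natural numbers: all cells from `1` on are nonnegative, and the cell `0` has just
    -- been cleared.
    refine ⟨by decide, by decide, by decide, fun w => if w = 0 then 0 else (s₁.arr memHeap w).toNat,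
      ⟨by simp, fun w hw hw' => ?_⟩, fun t ht => ?_, fun w hw => ?_⟩
    · rw [if_neg (by omega), if_neg (by omega), if_neg (by omega), h₄ w (by omega) hw']
      omega
    · simp only
      rw [if_neg (by omega), h₂ t ht]
      simp
    · rw [State.arr_setArr]
      rcases Nat.eq_zero_or_pos w with rfl | hw0
      · simp
      · have := h₃ w (by omega) hw
        simp only
        rw [if_neg (by omega), if_neg (by omega)]
        omega
  · simp [Ex.cost, show (v treeTop - c 1).cost = 2 from rfl]
    omega
  · exact fun _ _ h => h

end WordRAM

/-! ### The sum over the region below a height function -/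

namespace WordRAM

open Ex Cmd

/-- Add to the output, with the sign `sg`, the products `f i * g j` for the columns
`i = X, …, X + M - 1`, where `j` runs from `b + 1` to the height that the array `A` holds for the
column. -/
def treeAdd (A : ℕ) (sg : ℤ) : Cmd :=
  .assign argSign (c sg) ;; treeSize ;; treeLeaves A ;; treeMinima ;; treeLevels

/-- The sum of the products `f i * g j` with `i + j = m` over the columns `i = X, …, X + M - 1`, where
`j` runs from `b + 1` to `b + h (i - X)`. -/
def columnSum (f g : ℤ → ℤ) (X : ℤ) (M : ℕ) (b : ℤ) (h : ℕ → ℕ) (m : ℤ) : ℤ :=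
  ∑ t ∈ Finset.range M, f (X + t) *
    if b < m - (X + t) ∧ m - (X + t) ≤ b + h t then g (m - (X + t)) else 0

/-- The columns that the tree is built from. -/
structure TreeColumns (s : State) (X b : ℤ) (M Q Y : ℕ) : Prop where
  hX : s.var treeX = X
  hM : s.var treeM = M
  hB : s.var treeB = b
  hMQ : M ≤ Q
  hQ1 : 1 ≤ Q
  ha : ∀ i, |s.arr 0 i| ≤ Y
  hb : ∀ i, |s.arr 1 i| ≤ Y
  hXY : |X| + 2 * Q ≤ Y
  hbY : |b| + 1 + Q ≤ Y
  hQY : 3 * Q ≤ Y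
  hY : 16 ≤ Y

/-- The columns are padded to a power of two by columns of height zero, which contribute nothing to
the sum. The bound `hvar` has to include the drop to the padding. -/
theorem treeAdd_spec {V B : ℕ} (hV : 16 ≤ V) (hB : V ^ 10 ≤ B) {A : ℕ} (hA : 18 ≤ A ∧ A < 20) {sg : ℤ}
    (hsg : |sg| ≤ 1) {s : State} {X b : ℤ} {M Q Y Z : ℕ} {h : ℕ → ℕ} (hs : TreeColumns s X b M Q Y)
    (hh : ∀ t : ℕ, t < M → s.arr A (X + t) = b + h t)
    (h0 : ∀ t, M ≤ t → h t = 0) (hQ : ∀ t, h t ≤ Q)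
    (hvar : ∀ n, ∑ i ∈ Finset.range n, |(h (i + 1) : ℤ) - h i| ≤ 3 * Q)
    (hYV : Y ^ 200 ≤ V) (hout : ∀ m, |s.arr 8 m| ≤ Z) (hZ : Z + Y ^ 4 ≤ V) :
    (treeAdd A sg).Spec B s (21000 * Q * (Nat.clog 2 (3 * Q) + 1) ^ 2)
      (fun s' => ∀ m, s'.arr 8 m = s.arr 8 m + sg * columnSum (s.arr 0) (s.arr 1) X M b h m) := by
  have hY := hs.hY
  have hMQ := hs.hMQ
  have hQ1 := hs.hQ1
  have hQY := hs.hQY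
  have hXY := hs.hXY
  have hbY := hs.hbY
  obtain ⟨L, hL⟩ : ∃ L, L = Nat.clog 2 M := ⟨_, rfl⟩
  obtain ⟨N, hN⟩ : ∃ N, N = 2 ^ L := ⟨_, rfl⟩
  have yV : 16 * Y ≤ V := by
    have : Y ^ 2 ≤ V := (Nat.pow_le_pow_right (by omega) (by norm_num)).trans hYV
    nlinarith
  have hYV' := hYV
  clear hYV
  have hN1 : 1 ≤ N := by rw [hN]; exact Nat.one_le_two_pow
  have hMN : M ≤ N := by rw [hN, hL]; exact Nat.le_pow_clog (by norm_num) _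
  -- Without columns the tree still has one leaf, which is why `1 ≤ Q` is required.
  have hNQ : N ≤ 2 * Q := by
    rcases Nat.eq_zero_or_pos M with h | h
    · rw [hN, hL, h]; simp; omega
    · rw [hN, hL]; exact (two_pow_clog_lt h).le.trans (by omega)
  have hLk : L ≤ Nat.clog 2 (3 * Q) := by rw [hL]; exact Nat.clog_mono_right 2 (by omega)
  refine Spec.mono (Spec.assign_seq hV hB sg (by simp) (by simpa using hsg.trans (by norm_num))
    (by simp) <| Spec.seq (treeSize_spec hV hB (M := M) (by simp [State.var_setVar, hs.hM]) (by omega))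
    fun s₁ F₁ h₁ => Spec.seq (treeLeaves_spec hV hB (X := X) (b := b) (M := M) (N := N) (h := h)
      (by omega) ?_ ?_ ?_ ?_ (by omega) (by omega) hMN (by omega) ?_ ?_ h0) fun s₂ F₂ h₂ =>
    Spec.seq (treeMinima_spec hV hB (N := N) (Q := Q) (h := h) ?_ hN1 (by omega) (by omega) h₂ hQ)
    fun s₃ F₃ h₃ => Spec.mono (Q := fun s' => ∀ m, s'.arr 8 m = s.arr 8 m + sg * columnSum (s.arr 0) (s.arr 1) X M b h m)
      (T' := (L + 1) * (20000 * Q * (Nat.clog 2 (3 * Q) + 1) + 20) + 10) ?_ le_rfl fun _ _ h => h)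
    ?_ fun _ _ h => h
  · rw [F₁.var _ (by decide) (by decide)]; simp [State.var_setVar, hs.hX]
  · rw [F₁.var _ (by decide) (by decide)]; simp [State.var_setVar, hs.hB]
  · rw [F₁.var _ (by decide) (by decide)]; simp [State.var_setVar, hs.hM]
  · rw [h₁, ← hL, ← hN]
  · intro t ht
    rw [F₁.arr _ (by rfl), State.arr_setVar, hh t ht]
  · intro t ht
    rw [F₁.arr _ (by rfl), State.arr_setVar, hh t ht]
    have := hQ t
    exact (abs_add_le _ _).trans (by rw [Nat.abs_cast]; omega)
  · rw [F₂.var _ (by decide) (by rfl), h₁, ← hL, ← hN]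
  · obtain ⟨H, hH, hHh, hHw⟩ := h₃
    have arr : ∀ A', A' ≠ 20 → s₃.arr A' = s.arr A' := by
      intro A' hA'
      rw [F₃.arr _ (by simpa [setsArr, treeMinima] using hA'),
        F₂.arr _ (by simpa [setsArr, treeLeaves, forUp] using hA'), F₁.arr _ (by rfl)]
      rfl
    have a₀ := arr 0 (by norm_num)
    have a₁ := arr 1 (by norm_num)
    have a₈ := arr 8 (by norm_num)
    have hin : TreeInput s₃ X b sg H L Q Y := by
      refine ⟨?_, ?_, ?_, fun w hw => (hHw w (by omega)).1, hN ▸ hH, hsg, a₀ ▸ hs.ha, a₁ ▸ hs.hb, hXY, hbY,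
        hQY, hN ▸ hNQ, fun w hw => (hHw w (by omega)).2, hY, ?_⟩
      · rw [F₃.var _ (by decide) (by decide), F₂.var _ (by decide) (by rfl),
          F₁.var _ (by decide) (by decide)]
        simp [State.var_setVar, hs.hX]
      · rw [F₃.var _ (by decide) (by decide), F₂.var _ (by decide) (by rfl),
          F₁.var _ (by decide) (by decide)]
        simp [State.var_setVar, hs.hB]
      · rw [F₃.var _ (by decide) (by decide), F₂.var _ (by decide) (by rfl),
          F₁.var _ (by decide) (by decide)]
        simp [State.var_setVar]
      · refine le_trans (le_of_eq ?_) (hvar (2 ^ L - 1))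
        rw [MinHeap.variation]
        refine Finset.sum_congr rfl fun i hi => ?_
        have hi : i < 2 ^ L - 1 := by simpa using hi
        rw [← hN] at hi ⊢
        rw [hHh _ (by omega), hHh _ (by omega)]
    have htop : s₃.var treeTop = ((2 ^ L : ℕ) : ℤ) := by
      rw [F₃.var _ (by decide) (by decide), F₂.var _ (by decide) (by rfl), h₁, ← hL]
    refine (treeLevels_spec hV hB hin htop hYV' (Z := Z) (by simpa [a₈] using hout) ?_).mono le_rfl
      fun s₄ _ h₄ m => ?_
    · refine le_trans (Nat.add_le_add_left ?_ _) hZ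
      have hL1 : L + 1 ≤ 2 ^ L := Nat.lt_two_pow_self
      rw [← hN] at hL1 ⊢
      calc (L + 1) * (N * Y ^ 2) ≤ Y * (Y * Y ^ 2) := by gcongr <;> omega
        _ = Y ^ 4 := by ring
    · rw [h₄ m, a₀, a₁, a₈, columnSum, ← hN]
      congr 2
      refine (Finset.sum_subset_zero_on_sdiff (Finset.range_subset_range.2 hMN) (fun t ht => ?_)
        fun t ht => ?_).symm
      · simp only [Finset.mem_sdiff, Finset.mem_range] at ht
        rw [hHh t ht.1, h0 t (by omega), if_neg (by push_cast; omega), mul_zero]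
      · rw [hHh t ((Finset.mem_range.1 ht).trans_le hMN)]
  · rw [← hL]
    generalize Nat.clog 2 (3 * Q) = k at *
    simp only [show (c sg).cost = 1 from rfl]
    have h1 : (L + 1) * (20000 * Q * (k + 1) + 20) ≤ (k + 1) * (20000 * Q * (k + 1) + 20) := by gcongr
    have h2 : k + 1 ≤ Q * (k + 1) ^ 2 := by nlinarith
    have h3 : Q ≤ Q * (k + 1) ^ 2 := Nat.le_mul_of_pos_right _ (by positivity)
    nlinarith

end WordRAM

/-! ## Convex polygons as intersections of half planes -/

theorem orient_combo (u v q r : EuclideanSpace ℝ (Fin 2)) {a b : ℝ} (h : a + b = 1) :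
    orient u v (a • q + b • r) = a * orient u v q + b * orient u v r := by
  obtain rfl : a = 1 - b := by linarith
  simp only [orient, PiLp.add_apply, PiLp.smul_apply, smul_eq_mul]
  ring

theorem orient_left (u v : EuclideanSpace ℝ (Fin 2)) : orient u v u = 0 := by simp [orient]

theorem orient_right (u v : EuclideanSpace ℝ (Fin 2)) : orient u v v = 0 := by
  simp only [orient]; ring

/-- Cramer's rule: the coordinates of `q - v` with respect to `u - v` and `w - v` are quotients of
signed areas. -/
theorem orient_smul_sub (u v w q : EuclideanSpace ℝ (Fin 2)) :
    orient u v w • (q - v) = orient v w q • (u - v) + orient u v q • (w - v) := by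
  ext i
  fin_cases i <;> simp [orient] <;> ring

theorem continuous_orient (u v : EuclideanSpace ℝ (Fin 2)) : Continuous (orient u v) := by
  unfold orient
  fun_prop

theorem IsOpen.exists_pos_add_smul_mem {E : Type*} [NormedAddCommGroup E] [NormedSpace ℝ E] {U : Set E}
    (hU : IsOpen U) {q : E} (hq : q ∈ U) (d : E) : ∃ t > (0 : ℝ), q + t • d ∈ U := by
  have hc : Continuous fun t : ℝ => q + t • d := by fun_prop
  have h₁ : ∀ᶠ t in nhds (0 : ℝ), q + t • d ∈ U :=
    hc.continuousAt.eventually_mem (hU.mem_nhds (by simpa using hq))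
  obtain ⟨t, ht, ht'⟩ := ((h₁.filter_mono nhdsWithin_le_nhds).and
    (self_mem_nhdsWithin : Set.Ioi (0 : ℝ) ∈ nhdsWithin 0 (Set.Ioi 0))).exists
  exact ⟨t, ht', ht⟩

theorem coe_finRotate_eq {k : ℕ} (i : Fin k) : ((finRotate k i : Fin k) : ℕ) =
    if (i : ℕ) + 1 < k then (i : ℕ) + 1 else 0 := by
  cases k with
  | zero => exact i.elim0
  | succ n =>
    split_ifs with h
    · exact coe_finRotate_of_ne_last fun h' => by rw [h'] at h; simp at h
    · have hi : i = Fin.last n := Fin.ext (by have := i.2; simp; omega)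
      rw [hi]
      simp [finRotate_last]

theorem finRotate_ne {k : ℕ} (hk : 3 ≤ k) (i : Fin k) : finRotate k i ≠ i := by
  intro h
  have h₁ := coe_finRotate_eq i
  rw [h] at h₁
  split_ifs at h₁ <;> omega

theorem finRotate_finRotate_ne {k : ℕ} (hk : 3 ≤ k) (i : Fin k) : finRotate k (finRotate k i) ≠ i := by
  intro h
  have h₁ := coe_finRotate_eq i
  have h₂ := coe_finRotate_eq (finRotate k i)
  rw [h] at h₂
  split_ifs at h₁ h₂ <;> omega

namespace PolygonData

variable {k : ℕ}

/-- The orientation of `q` with respect to the side `i`, normalized by the sign `σ`. -/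
noncomputable def turn (P : PolygonData k) (σ : ℝ) (i : Fin k) (q : EuclideanSpace ℝ (Fin 2)) : ℝ :=
  σ * orient (P.vertex i) (P.vertex (finRotate k i)) q

/-- The vertices of a convex polygon, with the sign `σ` of the orientation. -/
structure Oriented (P : PolygonData k) (σ : ℝ) : Prop where
  three_le : 3 ≤ k
  pos : ∀ i j, j ≠ i → j ≠ finRotate k i → 0 < P.turn σ i (P.vertex j)

theorem IsConvexPolygon.exists_oriented {P : PolygonData k} (h : P.IsConvexPolygon) :
    ∃ σ, P.Oriented σ := by
  rcases h.convex with h₁ | h₁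
  · exact ⟨1, h.three_le, fun i j hi hj => by simpa [turn] using h₁ i j hi hj⟩
  · exact ⟨-1, h.three_le, fun i j hi hj => by simpa [turn] using h₁ i j hi hj⟩

/-- The closed polygon. -/
def hull (P : PolygonData k) : Set (EuclideanSpace ℝ (Fin 2)) := convexHull ℝ (Set.range P.vertex)

theorem vertex_mem_hull (P : PolygonData k) (i : Fin k) : P.vertex i ∈ P.hull :=
  subset_convexHull ℝ _ ⟨i, rfl⟩

theorem convex_hull (P : PolygonData k) : Convex ℝ P.hull := convex_convexHull ℝ _

theorem segment_subset_hull (P : PolygonData k) (i j : Fin k) :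
    segment ℝ (P.vertex i) (P.vertex j) ⊆ P.hull :=
  P.convex_hull.segment_subset (P.vertex_mem_hull i) (P.vertex_mem_hull j)

theorem isClosed_hull (P : PolygonData k) : IsClosed P.hull :=
  ((Set.finite_range P.vertex).isCompact_convexHull (𝕜 := ℝ)).isClosed

theorem turn_combo (P : PolygonData k) (σ : ℝ) (i : Fin k) (q r : EuclideanSpace ℝ (Fin 2)) {a b : ℝ}
    (h : a + b = 1) : P.turn σ i (a • q + b • r) = a * P.turn σ i q + b * P.turn σ i r := by
  rw [turn, orient_combo _ _ _ _ h, turn, turn]; ring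

theorem continuous_turn (P : PolygonData k) (σ : ℝ) (i : Fin k) : Continuous (P.turn σ i) :=
  continuous_const.mul (continuous_orient _ _)

theorem turn_self (P : PolygonData k) (σ : ℝ) (i : Fin k) : P.turn σ i (P.vertex i) = 0 := by
  rw [turn, orient_left, mul_zero]

theorem turn_next (P : PolygonData k) (σ : ℝ) (i : Fin k) :
    P.turn σ i (P.vertex (finRotate k i)) = 0 := by
  rw [turn, orient_right, mul_zero]

namespace Oriented

variable {P : PolygonData k} {σ : ℝ}

theorem turn_vertex_nonneg (h : P.Oriented σ) (i j : Fin k) : 0 ≤ P.turn σ i (P.vertex j) := by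
  by_cases h₁ : j = i
  · rw [h₁, turn_self]
  by_cases h₂ : j = finRotate k i
  · rw [h₂, turn_next]
  exact (h.pos i j h₁ h₂).le

theorem turn_nonneg_of_mem_hull (h : P.Oriented σ) {q : EuclideanSpace ℝ (Fin 2)} (hq : q ∈ P.hull) (i : Fin k) :
    0 ≤ P.turn σ i q := by
  have hc : Convex ℝ {q | 0 ≤ P.turn σ i q} := by
    intro x hx y hy a b ha hb hab
    simp only [Set.mem_ofPred_eq] at *
    rw [turn_combo _ _ _ _ _ hab]
    positivity
  have hs : Set.range P.vertex ⊆ {q | 0 ≤ P.turn σ i q} := by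
    rintro _ ⟨j, rfl⟩
    exact h.turn_vertex_nonneg i j
  exact convexHull_min hs hc hq

theorem wedge_pos (h : P.Oriented σ) (i : Fin k) :
    0 < P.turn σ i (P.vertex (finRotate k (finRotate k i))) :=
  h.pos _ _ (finRotate_finRotate_ne h.three_le i) (finRotate_ne h.three_le _)

/-- At the corner after side `i`, the position of `q` is expressed through the two adjacent sides,
with coefficients that are nonnegative whenever `q` is on the inner side of both. -/
theorem wedge (i : Fin k) (q : EuclideanSpace ℝ (Fin 2)) :
    P.turn σ i (P.vertex (finRotate k (finRotate k i))) • (q - P.vertex (finRotate k i)) =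
      P.turn σ (finRotate k i) q • (P.vertex i - P.vertex (finRotate k i)) +
        P.turn σ i q • (P.vertex (finRotate k (finRotate k i)) - P.vertex (finRotate k i)) := by
  simp only [turn, mul_smul]
  rw [← smul_add, ← orient_smul_sub]

/-- A point outside the hull is separated from it by a linear functional. At a vertex where the
functional is maximal, both adjacent sides lead to smaller or equal values; a point on the inner
side of both is a nonnegative combination of them and so cannot have a larger value. -/
theorem mem_hull_iff (h : P.Oriented σ) {q : EuclideanSpace ℝ (Fin 2)} : q ∈ P.hull ↔ ∀ i, 0 ≤ P.turn σ i q := by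
  refine ⟨h.turn_nonneg_of_mem_hull, fun hq => ?_⟩
  by_contra hn
  obtain ⟨f, u, hf, hu⟩ := geometric_hahn_banach_closed_point P.convex_hull P.isClosed_hull hn
  have : Nonempty (Fin k) := ⟨⟨0, by have := h.three_le; omega⟩⟩
  obtain ⟨m, hm⟩ := Finite.exists_max fun j => f (P.vertex j)
  -- The maximal vertex is written as the successor of a side's first vertex, in order to apply
  -- `wedge`.
  obtain ⟨i, rfl⟩ := (finRotate k).surjective m
  have h₁ := congrArg f (wedge (P := P) (σ := σ) i q)
  simp only [map_smul, map_add, map_sub, smul_eq_mul] at h₁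
  have h₂ := h.wedge_pos i
  have h₃ := hf _ (P.vertex_mem_hull (finRotate k i))
  have h₄ := mul_nonneg (hq (finRotate k i)) (sub_nonneg.2 (hm i))
  have h₅ := mul_nonneg (hq i) (sub_nonneg.2 (hm (finRotate k (finRotate k i))))
  have h₆ := mul_pos h₂ (sub_pos.2 (h₃.trans hu))
  linarith

theorem isOpen_pos (h : P.Oriented σ) : IsOpen {q | ∀ i, 0 < P.turn σ i q} := by
  simp only [Set.ofPred_forall]
  exact isOpen_iInter_of_finite fun i => isOpen_lt continuous_const (P.continuous_turn σ i)

theorem exists_pos (h : P.Oriented σ) (i : Fin k) : ∃ j, 0 < P.turn σ i (P.vertex j) :=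
  ⟨_, h.wedge_pos i⟩

/-- From an interior point one can still move a little away from a vertex that lies strictly inside
the side `i`. An affine function that is positive at this vertex and nonnegative after the move is
positive at the point itself. -/
theorem mem_interior_iff (h : P.Oriented σ) {q : EuclideanSpace ℝ (Fin 2)} :
    q ∈ interior P.hull ↔ ∀ i, 0 < P.turn σ i q := by
  constructor
  · intro hq i
    obtain ⟨j, hj⟩ := h.exists_pos i
    obtain ⟨t, ht, hm⟩ := isOpen_interior.exists_pos_add_smul_mem hq (q - P.vertex j)
    have h₁ := h.turn_nonneg_of_mem_hull (interior_subset hm) i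
    rw [show q + t • (q - P.vertex j) = (1 + t) • q + (-t) • P.vertex j by module,
      turn_combo _ _ _ _ _ (by ring)] at h₁
    have : 0 < t * P.turn σ i (P.vertex j) := mul_pos ht hj
    by_contra hc
    nlinarith
  · intro hq
    exact interior_maximal (fun q hq => h.mem_hull_iff.2 fun i => (hq i).le) h.isOpen_pos hq

theorem vertex_ne_next (h : P.Oriented σ) (i : Fin k) : P.vertex i ≠ P.vertex (finRotate k i) := by
  intro he
  obtain ⟨j, hj⟩ := h.exists_pos i
  rw [turn, ← he] at hj
  simp only [orient] at hj
  ring_nf at hj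
  exact lt_irrefl _ hj

/-- On the side line the wedges at both endpoints degenerate: the point is reached from each
endpoint by a nonnegative multiple of the side, and the two multiples add up to 1. -/
theorem mem_segment_of_turn_eq_zero (h : P.Oriented σ) {q : EuclideanSpace ℝ (Fin 2)} (hq : q ∈ P.hull) {i : Fin k}
    (hi : P.turn σ i q = 0) : q ∈ segment ℝ (P.vertex i) (P.vertex (finRotate k i)) := by
  have hnn := h.mem_hull_iff.1 hq
  obtain ⟨p, hp⟩ := (finRotate k).surjective i
  have h₁ := wedge (P := P) (σ := σ) p q
  have h₂ := wedge (P := P) (σ := σ) i q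
  rw [hp, hi, zero_smul, zero_add] at h₁
  rw [hi, zero_smul, add_zero] at h₂
  have d₁ := h.wedge_pos p
  have d₂ := h.wedge_pos i
  rw [hp] at d₁
  set D₁ := P.turn σ p (P.vertex (finRotate k i))
  set D₂ := P.turn σ i (P.vertex (finRotate k (finRotate k i)))
  have e₁ : q - P.vertex i = (P.turn σ p q / D₁) • (P.vertex (finRotate k i) - P.vertex i) := by
    rw [div_eq_inv_mul, mul_smul, ← h₁, smul_smul, inv_mul_cancel₀ d₁.ne', one_smul]
  have e₂ : q - P.vertex (finRotate k i) =
      (P.turn σ (finRotate k i) q / D₂) • (P.vertex i - P.vertex (finRotate k i)) := by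
    rw [div_eq_inv_mul, mul_smul, ← h₂, smul_smul, inv_mul_cancel₀ d₂.ne', one_smul]
  have n₁ : 0 ≤ P.turn σ p q / D₁ := div_nonneg (hnn p) d₁.le
  have n₂ : 0 ≤ P.turn σ (finRotate k i) q / D₂ := div_nonneg (hnn _) d₂.le
  set b := P.turn σ p q / D₁
  set a := P.turn σ (finRotate k i) q / D₂
  have e₃ : (1 - a - b) • (P.vertex (finRotate k i) - P.vertex i) = 0 := by
    have : P.vertex (finRotate k i) - P.vertex i = (q - P.vertex i) - (q - P.vertex (finRotate k i)) := by
      abel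
    rw [e₁, e₂] at this
    have h' : (1 - a - b) • (P.vertex (finRotate k i) - P.vertex i) =
        (P.vertex (finRotate k i) - P.vertex i) - (b • (P.vertex (finRotate k i) - P.vertex i) -
          a • (P.vertex i - P.vertex (finRotate k i))) := by module
    rw [h', ← this, sub_self]
  have e₄ : 1 - a - b = 0 :=
    (smul_eq_zero.1 e₃).resolve_right (sub_ne_zero.2 (h.vertex_ne_next i).symm)
  refine ⟨1 - b, b, by linarith, n₁, by ring, ?_⟩
  rw [eq_comm, ← sub_eq_zero, ← sub_eq_zero.2 e₁]
  module

theorem turn_pos_of_mem_openSegment (h : P.Oriented σ) {q : EuclideanSpace ℝ (Fin 2)} {i i' : Fin k} (hne : i' ≠ i)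
    (hq : q ∈ openSegment ℝ (P.vertex i) (P.vertex (finRotate k i))) : 0 < P.turn σ i' q := by
  obtain ⟨a, b, ha, hb, hab, rfl⟩ := hq
  rw [turn_combo _ _ _ _ _ hab]
  have h₁ := h.turn_vertex_nonneg i' i
  have h₂ := h.turn_vertex_nonneg i' (finRotate k i)
  have h₃ : finRotate k i' ≠ finRotate k i := fun h => hne ((finRotate k).injective h)
  by_cases h₄ : finRotate k i = i'
  · have h₅ : i ≠ finRotate k i' := by
      rw [← h₄]
      exact (finRotate_finRotate_ne h.three_le i).symm
    have := h.pos i' i hne.symm h₅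
    positivity
  · have := h.pos i' _ h₄ h₃.symm
    positivity

theorem turn_eq_zero_of_mem_openSegment (h : P.Oriented σ) {q : EuclideanSpace ℝ (Fin 2)} {i : Fin k}
    (hq : q ∈ openSegment ℝ (P.vertex i) (P.vertex (finRotate k i))) : P.turn σ i q = 0 := by
  obtain ⟨a, b, ha, hb, hab, rfl⟩ := hq
  rw [turn_combo _ _ _ _ _ hab, turn_self, turn_next]
  ring

theorem openSegment_disjoint (h : P.Oriented σ) {q : EuclideanSpace ℝ (Fin 2)} {i i' : Fin k}
    (hq : q ∈ openSegment ℝ (P.vertex i) (P.vertex (finRotate k i)))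
    (hq' : q ∈ openSegment ℝ (P.vertex i') (P.vertex (finRotate k i'))) : i' = i := by
  by_contra hne
  have h₁ := h.turn_pos_of_mem_openSegment hne hq
  rw [h.turn_eq_zero_of_mem_openSegment hq'] at h₁
  exact lt_irrefl _ h₁

/-- A vertex lies on two side lines, while a point of an open side is strictly inside all other
sides. -/
theorem vertex_notMem_openSegment (h : P.Oriented σ) (i j : Fin k) :
    P.vertex j ∉ openSegment ℝ (P.vertex i) (P.vertex (finRotate k i)) := by
  intro hq
  obtain ⟨p, hp⟩ := (finRotate k).surjective j
  have hpj : p ≠ j := fun e => finRotate_ne h.three_le p (hp.trans e.symm)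
  have key : ∀ i', i' ≠ i → P.turn σ i' (P.vertex j) ≠ 0 := fun i' hi' =>
    (h.turn_pos_of_mem_openSegment hi' hq).ne'
  by_cases hpi : p = i
  · exact key j (fun e => hpj (hpi.trans e.symm)) (P.turn_self σ j)
  · exact key p hpi (by rw [← hp]; exact P.turn_next σ p)

theorem vertex_injective (h : P.Oriented σ) : Function.Injective P.vertex := by
  intro i j he
  by_contra hne
  obtain ⟨p, hp⟩ := (finRotate k).surjective i
  have h₁ : finRotate k i = j := by
    by_contra hc
    have := h.pos i j (Ne.symm hne) (Ne.symm hc)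
    rw [← he, turn_self] at this
    exact lt_irrefl _ this
  exact h.vertex_ne_next i (by rw [h₁, he])

end Oriented

end PolygonData

/-! ## Columns of a convex polygon -/

namespace PolygonData

variable {k : ℕ}

/-- The first coordinate of a vertex. -/
noncomputable def x (P : PolygonData k) (i : Fin k) : ℝ := P.vertex i 0

/-- The second coordinate of a vertex. -/
noncomputable def y (P : PolygonData k) (i : Fin k) : ℝ := P.vertex i 1

/-- A side that is not vertical contains the point `(c, z)`. -/
def Crosses (P : PolygonData k) (c z : ℝ) : Prop :=
  ∃ i, P.x i ≠ P.x (finRotate k i) ∧ !₂[c, z] ∈ segment ℝ (P.vertex i) (P.vertex (finRotate k i))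

theorem Crosses.mem_hull {P : PolygonData k} {c z : ℝ} (h : P.Crosses c z) : !₂[c, z] ∈ P.hull := by
  obtain ⟨i, -, hi⟩ := h
  exact P.segment_subset_hull _ _ hi

theorem exists_coord_le (P : PolygonData k) {q : EuclideanSpace ℝ (Fin 2)} (hq : q ∈ P.hull) (l : Fin 2) :
    (∃ a, P.vertex a l ≤ q l) ∧ ∃ b, q l ≤ P.vertex b l := by
  constructor
  · by_contra! hc
    have hcv : Convex ℝ {r : EuclideanSpace ℝ (Fin 2) | q l < r l} := by
      intro r hr s hs a b ha hb hab
      simp only [Set.mem_ofPred_eq, PiLp.add_apply, PiLp.smul_apply, smul_eq_mul] at *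
      have h₁ : a * q l ≤ a * r l := by gcongr
      have h₂ : b * q l ≤ b * s l := by gcongr
      obtain rfl : a = 1 - b := by linarith
      rcases hb.eq_or_lt with rfl | hb
      · simpa using hr
      · have h₂ : b * q l < b * s l := by gcongr
        linarith
    have hs : Set.range P.vertex ⊆ {r | q l < r l} := by
      rintro _ ⟨j, rfl⟩
      exact hc j
    have hm := convexHull_min hs hcv hq
    rw [Set.mem_ofPred_eq] at hm
    exact lt_irrefl _ hm
  · by_contra! hc
    have hcv : Convex ℝ {r : EuclideanSpace ℝ (Fin 2) | r l < q l} := by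
      intro r hr s hs a b ha hb hab
      simp only [Set.mem_ofPred_eq, PiLp.add_apply, PiLp.smul_apply, smul_eq_mul] at *
      have h₁ : a * r l ≤ a * q l := by gcongr
      obtain rfl : a = 1 - b := by linarith
      rcases hb.eq_or_lt with rfl | hb
      · simpa using hr
      · have h₂ : b * s l < b * q l := by gcongr
        linarith
    have hs : Set.range P.vertex ⊆ {r | r l < q l} := by
      rintro _ ⟨j, rfl⟩
      exact hc j
    have hm := convexHull_min hs hcv hq
    rw [Set.mem_ofPred_eq] at hm
    exact lt_irrefl _ hm

theorem turn_vertical (P : PolygonData k) (σ : ℝ) (i : Fin k) (c z s : ℝ) :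
    P.turn σ i !₂[c, z + s] = P.turn σ i !₂[c, z] + s * (σ * (P.x (finRotate k i) - P.x i)) := by
  simp [turn, orient, x]
  ring

namespace Oriented

variable {P : PolygonData k} {σ : ℝ}

/-- Move vertically from the point, upwards for `τ = 1` and downwards for `τ = -1`, until the
polygon is left. The side through which it is left is not vertical. This makes both ends of a column
visible on the sides that are not vertical. -/
theorem exists_crosses (h : P.Oriented σ) {c z : ℝ} (hq : !₂[c, z] ∈ P.hull) {τ : ℝ} (hτ : |τ| = 1) :
    ∃ t, 0 ≤ t ∧ P.Crosses c (z + τ * t) ∧ (!₂[c, z] ∈ interior P.hull → 0 < t) := by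
  classical
  -- The rate at which the distance to the side line `i`, as measured by `turn`, decreases during
  -- the movement.
  set g : Fin k → ℝ := fun i => -(τ * (σ * (P.x (finRotate k i) - P.x i)))
  have hturn : ∀ i t, P.turn σ i !₂[c, z + τ * t] = P.turn σ i !₂[c, z] - t * g i := by
    intro i t
    rw [turn_vertical]
    simp only [g]
    ring
  -- If no side were approached, the whole ray would stay in the hull, which is bounded.
  have hS : (Finset.univ.filter fun i => 0 < g i).Nonempty := by
    by_contra hS
    rw [Finset.not_nonempty_iff_eq_empty, Finset.filter_eq_empty_iff] at hS
    obtain ⟨R, hR⟩ := ((Set.finite_range P.vertex).isCompact_convexHull (𝕜 := ℝ)).isBounded.exists_norm_le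
    have hR0 : 0 ≤ R := (norm_nonneg _).trans (hR _ hq)
    have hm : !₂[c, z + τ * (R + |z| + 1)] ∈ P.hull := by
      refine h.mem_hull_iff.2 fun i => ?_
      rw [hturn]
      have h₁ := h.mem_hull_iff.1 hq i
      have h₂ := not_lt.1 (hS (Finset.mem_univ i))
      have h₃ : 0 ≤ (R + |z| + 1) * -g i := mul_nonneg (by positivity) (by linarith)
      linarith
    have h₁ := (PiLp.norm_apply_le _ (1 : Fin 2)).trans (hR _ hm)
    have h₁ : |z + τ * (R + |z| + 1)| ≤ R := by simpa using h₁
    have h₂ : |τ * (R + |z| + 1)| = R + |z| + 1 := by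
      rw [abs_mul, hτ, one_mul, abs_of_pos (by positivity)]
    have h₃ := abs_sub (z + τ * (R + |z| + 1)) z
    rw [add_sub_cancel_left] at h₃
    linarith
  -- The side that is reached first.
  obtain ⟨i, hi, hmin⟩ := Finset.exists_min_image _ (fun i => P.turn σ i !₂[c, z] / g i) hS
  simp only [Finset.mem_filter, Finset.mem_univ, true_and] at hi hmin
  have hnn := h.mem_hull_iff.1 hq
  have ht0 : 0 ≤ P.turn σ i !₂[c, z] / g i := div_nonneg (hnn i) hi.le
  have hm : !₂[c, z + τ * (P.turn σ i !₂[c, z] / g i)] ∈ P.hull := by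
    refine h.mem_hull_iff.2 fun j => ?_
    rw [hturn]
    rcases le_or_gt (g j) 0 with hj | hj
    · have := hnn j
      nlinarith
    · have := hmin j hj
      rw [le_div_iff₀ hj] at this
      linarith
  refine ⟨_, ht0, ⟨i, fun he => ?_, h.mem_segment_of_turn_eq_zero hm ?_⟩, fun hint => ?_⟩
  -- A vertical side would have rate zero.
  · simp only [g, he, sub_self, mul_zero, neg_zero, lt_irrefl] at hi
  · rw [hturn, div_mul_cancel₀ _ hi.ne', sub_self]
  · exact div_pos (h.mem_interior_iff.1 hint i) hi

/-- Some vertex has another first coordinate than the point, since the polygon is not degenerate.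
Moving away from it inside the hull shows that there are vertices on the opposite side too. -/
theorem x_lt_of_mem_interior (h : P.Oriented σ) {q : EuclideanSpace ℝ (Fin 2)} (hq : q ∈ interior P.hull) :
    (∃ a, P.x a < q 0) ∧ ∃ b, q 0 < P.x b := by
  have hne : ∃ a, P.x a ≠ q 0 := by
    by_contra! hc
    obtain ⟨j, hj⟩ := h.exists_pos ⟨0, by have := h.three_le; omega⟩
    simp only [x] at hc
    simp only [turn, orient, hc] at hj
    ring_nf at hj
    exact lt_irrefl _ hj
  obtain ⟨a, ha⟩ := hne
  obtain ⟨t, ht, hm⟩ := isOpen_interior.exists_pos_add_smul_mem hq (q - P.vertex a)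
  obtain ⟨⟨b, hb⟩, ⟨d, hd⟩⟩ := P.exists_coord_le (interior_subset hm) 0
  simp only [PiLp.add_apply, PiLp.smul_apply, PiLp.sub_apply, smul_eq_mul] at hb hd
  change P.x b ≤ _ + _ * (_ - P.x a) at hb
  change _ + _ * (_ - P.x a) ≤ P.x d at hd
  rcases lt_or_gt_of_ne ha with ha | ha
  · exact ⟨⟨a, ha⟩, d, by nlinarith⟩
  · exact ⟨⟨b, by nlinarith⟩, a, ha⟩

/-- Along the column `turn` is affine with slope `D`. If it is nonnegative at two points and not
positive strictly between them, then `D = 0` and it vanishes on the column, so the side lies in the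
column. Vertices to the left and to the right then contradict convexity. -/
theorem mem_interior_of_crosses (h : P.Oriented σ) {c z z₁ z₂ : ℝ} (ha : ∃ a, P.x a < c)
    (hb : ∃ b, c < P.x b) (h₁ : !₂[c, z₁] ∈ P.hull) (h₂ : !₂[c, z₂] ∈ P.hull) (hz₁ : z₁ < z) (hz₂ : z < z₂) :
    !₂[c, z] ∈ interior P.hull := by
  refine h.mem_interior_iff.2 fun i => ?_
  have n₁ := h.mem_hull_iff.1 h₁ i
  have n₂ := h.mem_hull_iff.1 h₂ i
  have e₁ := P.turn_vertical σ i c z (z₁ - z)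
  have e₂ := P.turn_vertical σ i c z (z₂ - z)
  rw [add_sub_cancel] at e₁ e₂
  rw [e₁] at n₁
  rw [e₂] at n₂
  set D := σ * (P.x (finRotate k i) - P.x i) with hD
  by_contra hc
  rw [not_lt] at hc
  have hD0 : D = 0 := by
    have d₁ : 0 ≤ (z₁ - z) * D := by linarith
    have d₂ : 0 ≤ (z₂ - z) * D := by linarith
    apply le_antisymm <;> nlinarith
  rw [hD0, mul_zero, add_zero] at n₁
  have ht : P.turn σ i !₂[c, z] = 0 := le_antisymm hc n₁
  have key : ∀ q : EuclideanSpace ℝ (Fin 2), P.turn σ i q =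
      (σ * (P.y (finRotate k i) - P.y i)) * (c - q 0) := by
    intro q
    have : P.turn σ i q = P.turn σ i !₂[c, z] + D * (q 1 - z) +
        (σ * (P.y (finRotate k i) - P.y i)) * (c - q 0) := by
      simp [turn, orient, hD, x, y]
      ring
    rw [this, ht, hD0]
    ring
  obtain ⟨a, ha⟩ := ha
  obtain ⟨b, hb⟩ := hb
  obtain ⟨j, hj⟩ := h.exists_pos i
  have ka := h.turn_vertex_nonneg i a
  have kb := h.turn_vertex_nonneg i b
  rw [key] at ka kb hj
  change 0 ≤ _ * (c - P.x a) at ka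
  change 0 ≤ _ * (c - P.x b) at kb
  have s₁ := nonneg_of_mul_nonneg_left ka (by linarith)
  have s₂ : σ * (P.y (finRotate k i) - P.y i) = 0 := by
    apply le_antisymm _ s₁
    nlinarith
  rw [s₂, zero_mul] at hj
  exact lt_irrefl _ hj

theorem mem_interior_iff_crosses (h : P.Oriented σ) {c z : ℝ} :
    !₂[c, z] ∈ interior P.hull ↔ ((∃ a, P.x a < c) ∧ ∃ b, c < P.x b) ∧
      (∃ z₁ < z, P.Crosses c z₁) ∧ ∃ z₂ > z, P.Crosses c z₂ := by
  constructor
  · intro hq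
    have hx := h.x_lt_of_mem_interior hq
    obtain ⟨t, -, h₁, h₂⟩ := h.exists_crosses (interior_subset hq) (τ := -1) (by simp)
    obtain ⟨t', -, h₁', h₂'⟩ := h.exists_crosses (interior_subset hq) (τ := 1) (by simp)
    have := h₂ hq
    have := h₂' hq
    exact ⟨by simpa using hx, ⟨_, by linarith, h₁⟩, ⟨_, by linarith, h₁'⟩⟩
  · rintro ⟨⟨ha, hb⟩, ⟨z₁, hz₁, h₁⟩, z₂, hz₂, h₂⟩
    exact h.mem_interior_of_crosses ha hb h₁.mem_hull h₂.mem_hull hz₁ hz₂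

/-- The centroid of the vertices: on each side some vertex is strictly inside and none is outside.
-/
theorem exists_mem_interior (h : P.Oriented σ) : ∃ q, q ∈ interior P.hull := by
  have hk := h.three_le
  have hk0 : (0 : ℝ) < k := by exact_mod_cast (by omega : 0 < k)
  have hturn : ∀ i, P.turn σ i ((k : ℝ)⁻¹ • ∑ j, P.vertex j) =
      (k : ℝ)⁻¹ * ∑ j, P.turn σ i (P.vertex j) := by
    intro i
    simp only [turn, orient, PiLp.smul_apply, WithLp.ofLp_sum, Finset.sum_apply, smul_eq_mul]
    simp only [mul_sub, Finset.sum_sub_distrib, ← Finset.mul_sum, Finset.sum_const, Finset.card_univ,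
      Fintype.card_fin, nsmul_eq_mul]
    field_simp
  refine ⟨(k : ℝ)⁻¹ • ∑ j, P.vertex j, h.mem_interior_iff.2 fun i => ?_⟩
  rw [hturn]
  obtain ⟨j, hj⟩ := h.exists_pos i
  exact mul_pos (inv_pos.2 hk0) (Finset.sum_pos' (fun j _ => h.turn_vertex_nonneg i j) ⟨j, Finset.mem_univ j, hj⟩)

/-- On the segment from an interior point to a vertex beyond the column, all points except possibly
the vertex are interior. -/
theorem exists_mem_interior_column (h : P.Oriented σ) {c : ℝ} (ha : ∃ a, P.x a < c)
    (hb : ∃ b, c < P.x b) : ∃ z, !₂[c, z] ∈ interior P.hull := by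
  obtain ⟨q, hq⟩ := h.exists_mem_interior
  have step : ∀ r ∈ P.hull, ∀ s : ℝ, 0 ≤ s → s < 1 → (1 - s) * q 0 + s * r 0 = c →
      ∃ z, !₂[c, z] ∈ interior P.hull := by
    intro r hr s hs hs1 hc
    refine ⟨(1 - s) * q 1 + s * r 1, ?_⟩
    have e : !₂[c, (1 - s) * q 1 + s * r 1] = (1 - s) • q + s • r := by
      ext l
      fin_cases l
      · simp [← hc]
      · simp
    rw [e, h.mem_interior_iff]
    intro i
    rw [turn_combo _ _ _ _ _ (by ring)]
    have h₁ := h.mem_interior_iff.1 hq i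
    have h₂ := h.mem_hull_iff.1 hr i
    have : 0 < (1 - s) * P.turn σ i q := mul_pos (by linarith) h₁
    positivity
  obtain ⟨a, ha⟩ := ha
  obtain ⟨b, hb⟩ := hb
  rcases lt_trichotomy (q 0) c with hc | hc | hc
  · have hd : 0 < P.x b - q 0 := by linarith
    refine step _ (P.vertex_mem_hull b) ((c - q 0) / (P.x b - q 0)) (div_nonneg (by linarith) hd.le)
      ((div_lt_one hd).2 (by linarith)) ?_
    change _ + _ * P.x b = c
    field_simp
    ring
  · exact step _ (P.vertex_mem_hull b) 0 le_rfl one_pos (by rw [hc]; ring)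
  · have hd : 0 < q 0 - P.x a := by linarith
    refine step _ (P.vertex_mem_hull a) ((q 0 - c) / (q 0 - P.x a)) (div_nonneg (by linarith) hd.le)
      ((div_lt_one hd).2 (by linarith)) ?_
    change _ + _ * P.x a = c
    field_simp
    ring

theorem exists_crosses_lt (h : P.Oriented σ) {c : ℝ} (ha : ∃ a, P.x a < c) (hb : ∃ b, c < P.x b) :
    ∃ z₁ z₂, z₁ < z₂ ∧ P.Crosses c z₁ ∧ P.Crosses c z₂ := by
  obtain ⟨z, hz⟩ := h.exists_mem_interior_column ha hb
  obtain ⟨-, ⟨z₁, h₁, c₁⟩, z₂, h₂, c₂⟩ := h.mem_interior_iff_crosses.1 hz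
  exact ⟨z₁, z₂, h₁.trans h₂, c₁, c₂⟩

theorem exists_hull_between {c₁ c₂ c₃ z₁ z₃ : ℝ} (h₁ : !₂[c₁, z₁] ∈ P.hull)
    (h₃ : !₂[c₃, z₃] ∈ P.hull) (h₁₂ : c₁ ≤ c₂) (h₂₃ : c₂ ≤ c₃) :
    ∃ z, min z₁ z₃ ≤ z ∧ z ≤ max z₁ z₃ ∧ !₂[c₂, z] ∈ P.hull := by
  rcases (h₁₂.trans h₂₃).eq_or_lt with he | hlt
  · exact ⟨z₁, min_le_left _ _, le_max_left _ _, by rwa [show c₂ = c₁ by linarith]⟩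
  set s := (c₂ - c₁) / (c₃ - c₁) with hs
  have hd : 0 < c₃ - c₁ := by linarith
  have s0 : 0 ≤ s := div_nonneg (by linarith) hd.le
  have s1 : s ≤ 1 := (div_le_one hd).2 (by linarith)
  refine ⟨(1 - s) * z₁ + s * z₃, ?_, ?_, ?_⟩
  · nlinarith [min_le_left z₁ z₃, min_le_right z₁ z₃]
  · nlinarith [le_max_left z₁ z₃, le_max_right z₁ z₃]
  · have e : !₂[c₂, (1 - s) * z₁ + s * z₃] = (1 - s) • !₂[c₁, z₁] + s • !₂[c₃, z₃] := by
      ext l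
      fin_cases l
      · simp [hs]; field_simp; ring
      · simp
    rw [e]
    exact P.convex_hull h₁ h₃ (by linarith) s0 (by ring)

/-- The chord between the two crossings meets the middle column inside the hull; going up and down
from there leads to crossings. -/
theorem crosses_between (h : P.Oriented σ) {c₁ c₂ c₃ z₁ z₃ : ℝ} (h₁ : P.Crosses c₁ z₁)
    (h₃ : P.Crosses c₃ z₃) (h₁₂ : c₁ ≤ c₂) (h₂₃ : c₂ ≤ c₃) :
    (∃ z, P.Crosses c₂ z ∧ min z₁ z₃ ≤ z) ∧ ∃ z, P.Crosses c₂ z ∧ z ≤ max z₁ z₃ := by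
  obtain ⟨z, hz, hz', hm⟩ := exists_hull_between h₁.mem_hull h₃.mem_hull h₁₂ h₂₃
  obtain ⟨t, ht, hc, -⟩ := h.exists_crosses hm (τ := 1) (by simp)
  obtain ⟨t', ht', hc', -⟩ := h.exists_crosses hm (τ := -1) (by simp)
  exact ⟨⟨_, hc, by linarith⟩, ⟨_, hc', by linarith⟩⟩

end Oriented

end PolygonData

/-! ## Sums over lattice points -/

open Classical in
/-- The sum of the products `f i * g j` over the points `(i, j)` of `S` with `i + j = m` and
`0 ≤ i ≤ n`. -/
noncomputable def latticeSum (f g : ℤ → ℤ) (n : ℕ) (S : Set (ℤ × ℤ)) (m : ℤ) : ℤ :=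
  ∑ c ∈ Finset.range (n + 1), if ((c : ℤ), m - c) ∈ S then f c * g (m - c) else 0

theorem latticeSum_empty (f g : ℤ → ℤ) (n : ℕ) (m : ℤ) : latticeSum f g n ∅ m = 0 := by
  simp [latticeSum]

theorem latticeSum_union (f g : ℤ → ℤ) (n : ℕ) {S T : Set (ℤ × ℤ)} (h : ∀ p ∈ S, p ∉ T) (m : ℤ) :
    latticeSum f g n (S ∪ T) m = latticeSum f g n S m + latticeSum f g n T m := by
  classical
  rw [latticeSum, latticeSum, latticeSum, ← Finset.sum_add_distrib]
  refine Finset.sum_congr rfl fun c _ => ?_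
  by_cases h₁ : ((c : ℤ), m - (c : ℤ)) ∈ S
  · simp [h₁, h _ h₁]
  · simp [h₁]

theorem latticeSum_singleton {f : ℤ → ℤ} (g : ℤ → ℤ) {n : ℕ} (hf : ∀ i, f i ≠ 0 → 0 ≤ i ∧ i ≤ n)
    (p q m : ℤ) : latticeSum f g n {(p, q)} m = if m = p + q then f p * g q else 0 := by
  have h₁ : latticeSum f g n {(p, q)} m = ∑ c ∈ Finset.range (n + 1),
      if (c : ℤ) = p then if m = p + q then f p * g q else 0 else 0 := by
    refine Finset.sum_congr rfl fun c _ => ?_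
    simp only [Set.mem_singleton_iff, Prod.mk.injEq]
    by_cases hc : (c : ℤ) = p
    · subst hc
      by_cases hm : m = c + q
      · subst hm; simp
      · rw [if_neg (by omega), if_pos rfl, if_neg hm]
    · simp [hc]
  rw [h₁]
  by_cases hp : 0 ≤ p ∧ p ≤ n
  · lift p to ℕ using hp.1
    rw [Finset.sum_eq_single p]
    · simp
    · intro c _ hc; rw [if_neg (by exact_mod_cast hc)]
    · intro hc; simp at hc; omega
  · have : f p = 0 := by
      by_contra hc
      exact hp (hf p hc)
    simp [this]

theorem abs_latticeSum_le {f g : ℤ → ℤ} {Y : ℕ} (hf : ∀ i, |f i| ≤ Y) (hg : ∀ i, |g i| ≤ Y) (n : ℕ)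
    (S : Set (ℤ × ℤ)) (m : ℤ) : |latticeSum f g n S m| ≤ (n + 1) * (Y : ℤ) ^ 2 := by
  refine (Finset.abs_sum_le_sum_abs _ _).trans
    ((Finset.sum_le_card_nsmul _ _ ((Y : ℤ) ^ 2) fun c _ => ?_).trans (by simp))
  split_ifs
  · rw [abs_mul, pow_two]
    exact mul_le_mul (hf _) (hg _) (abs_nonneg _) (by positivity)
  · simp

theorem sum_range_eq_sum_Ico {M : Type*} [AddCommMonoid M] (F : ℤ → M) (X : ℤ) (n : ℕ) :
    ∑ t ∈ Finset.range n, F (X + t) = ∑ c ∈ Finset.Ico X (X + n), F c := by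
  refine Finset.sum_bij' (fun t _ => X + t) (fun c _ => (c - X).toNat) ?_ ?_ ?_ ?_ ?_
  · intro t ht; simp at ht ⊢; omega
  · intro c hc; simp at hc ⊢; omega
  · intro t ht; simp
  · intro c hc; simp at hc ⊢; omega
  · intro t ht; rfl

/-- Columns outside `0, …, n` may occur on the left and drop out because `f` vanishes there. The
algorithm therefore never has to clip the polygon to the index range. -/
theorem columnSum_eq_latticeSum {f : ℤ → ℤ} (g : ℤ → ℤ) {n : ℕ} (hf : ∀ i, f i ≠ 0 → 0 ≤ i ∧ i ≤ n)
    (X : ℤ) (M : ℕ) (b : ℤ) (h : ℕ → ℕ) (m : ℤ) : WordRAM.columnSum f g X M b h m =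
      latticeSum f g n {p | (X ≤ p.1 ∧ p.1 < X + M) ∧ b < p.2 ∧ p.2 ≤ b + h (p.1 - X).toNat} m := by
  classical
  set F : ℤ → ℤ := fun c => f c * if b < m - c ∧ m - c ≤ b + h (c - X).toNat then g (m - c) else 0
  have h₁ : WordRAM.columnSum f g X M b h m = ∑ c ∈ Finset.Ico X (X + M), F c := by
    rw [← sum_range_eq_sum_Ico]
    refine Finset.sum_congr rfl fun t _ => ?_
    simp [F]
  have h₂ : latticeSum f g n {p | (X ≤ p.1 ∧ p.1 < X + M) ∧ b < p.2 ∧ p.2 ≤ b + h (p.1 - X).toNat} m =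
      ∑ c ∈ Finset.Ico (0 : ℤ) (0 + (n + 1 : ℕ)), if X ≤ c ∧ c < X + M then F c else 0 := by
    rw [← sum_range_eq_sum_Ico]
    refine Finset.sum_congr rfl fun c _ => ?_
    simp only [Set.mem_ofPred_eq, zero_add, F]
    by_cases hc : X ≤ (c : ℤ) ∧ (c : ℤ) < X + M
    · simp [hc]
    · simp [hc]
  rw [h₁, h₂, ← Finset.sum_filter]
  symm
  refine Finset.sum_subset (fun c hc => ?_) fun c hc hc' => ?_
  · simp at hc ⊢; omega
  · simp at hc hc'
    have : f c = 0 := by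
      by_contra h0
      have := hf c h0
      omega
    simp [F, this]

theorem toArray_ne_zero {n : ℕ} (a : Fin (n + 1) → ℤ) (i : ℤ) (h : toArray a i ≠ 0) : 0 ≤ i ∧ i ≤ n := by
  unfold toArray at h
  split_ifs at h with hc
  · omega
  · exact absurd rfl h

theorem toArray_natCast {l : ℕ} (f : Fin l → ℤ) (i : Fin l) : toArray f (i : ℕ) = f i := by
  simp [toArray]

theorem abs_toArray_le {l : ℕ} {f : Fin l → ℤ} {W : ℕ} (h : ∀ i, |f i| ≤ W) (z : ℤ) : |toArray f z| ≤ W := by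
  unfold toArray
  split_ifs
  · exact h _
  · simp

/-- On a diagonal the column determines the row, so the inner sum has at most one term; if the row
is out of range, the zero extension of `b` takes its place. -/
theorem diagonalSum_eq {n k : ℕ} (a b : Fin (n + 1) → ℤ) (P : PolygonData k) (m : ℤ) :
    diagonalSum a b P m = latticeSum (toArray a) (toArray b) n {p | !₂[(p.1 : ℝ), (p.2 : ℝ)] ∈ P.region} m := by
  classical
  rw [diagonalSum, latticeSum, ← Fin.sum_univ_eq_sum_range
    (fun c => if ((c : ℤ), m - (c : ℤ)) ∈ {p : ℤ × ℤ | !₂[(p.1 : ℝ), (p.2 : ℝ)] ∈ P.region} then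
      toArray a c * toArray b (m - c) else 0)]
  refine Finset.sum_congr rfl fun i _ => ?_
  simp only [Set.mem_ofPred_eq]
  by_cases hm : 0 ≤ m - i ∧ (m - i).toNat < n + 1
  · rw [Finset.sum_eq_single ⟨(m - i).toNat, hm.2⟩]
    · have e : ((⟨(m - i).toNat, hm.2⟩ : Fin (n + 1)) : ℕ) = (m - i).toNat := rfl
      have e' : (((m - i).toNat : ℕ) : ℤ) = m - i := Int.toNat_of_nonneg hm.1
      have e'' : (((m - i).toNat : ℕ) : ℝ) = ((m - i : ℤ) : ℝ) := by rw [← e']; push_cast; rfl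
      rw [toArray_natCast, toArray, dif_pos hm]
      simp only [e, e', e'']
      simp
    · intro j _ hj
      rw [if_neg]
      rintro ⟨h, -⟩
      exact hj (Fin.ext (by simp; omega))
    · simp
  · rw [toArray.eq_def b, dif_neg hm, mul_zero, ite_self]
    refine Finset.sum_eq_zero fun j _ => ?_
    rw [if_neg]
    rintro ⟨h, -⟩
    have := j.2
    omega

/-! ## The variation of unimodal sequences -/

/-- A quasiconcave sequence rises to its maximum and then falls. In the induction, a rise at the end
forces the previous maximum to equal the previous entry, so the new last entry becomes the maximum.
-/
theorem sum_abs_le_of_quasiconcave {u : ℕ → ℤ} {n : ℕ}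
    (h : ∀ i j l, i ≤ j → j ≤ l → l ≤ n → min (u i) (u l) ≤ u j) :
    ∃ p ≤ n, (∀ i ≤ n, u i ≤ u p) ∧ ∑ i ∈ Finset.range n, |u (i + 1) - u i| ≤ 2 * u p - u 0 - u n := by
  induction n with
  | zero => exact ⟨0, le_rfl, fun i hi => by rw [Nat.le_zero.1 hi], by simp; omega⟩
  | succ n ih =>
    obtain ⟨p, hp, hmax, hsum⟩ := ih fun i j l h₁ h₂ h₃ => h i j l h₁ h₂ (h₃.trans n.le_succ)
    rw [Finset.sum_range_succ]
    rcases le_or_gt (u (n + 1)) (u n) with hc | hc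
    · refine ⟨p, by omega, fun i hi => ?_, ?_⟩
      · rcases Nat.lt_or_ge n i with h₁ | h₁
        · rw [show i = n + 1 by omega]; exact hc.trans (hmax n le_rfl)
        · exact hmax i h₁
      · rw [abs_of_nonpos (by omega)]; omega
    · have h₁ := h p n (n + 1) hp (by omega) le_rfl
      have h₂ : u p ≤ u n := by omega
      refine ⟨n + 1, le_rfl, fun i hi => ?_, ?_⟩
      · rcases Nat.lt_or_ge n i with h₁ | h₁
        · rw [show i = n + 1 by omega]
        · have := hmax i h₁; omega
      · rw [abs_of_pos (by omega)]; omega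

/-- A unimodal sequence with values in `[0, Q]` has variation at most 2Q, and the drop to zero after
the last column adds at most Q. The quasiconvex case is reduced to the quasiconcave one by `Q - h`.
-/
theorem sum_abs_pad_le {h : ℕ → ℕ} {M Q : ℕ} (h0 : ∀ t, M ≤ t → h t = 0) (hQ : ∀ t, h t ≤ Q)
    (hq : (∀ i j l, i ≤ j → j ≤ l → l < M → min (h i) (h l) ≤ h j) ∨
      ∀ i j l, i ≤ j → j ≤ l → l < M → h j ≤ max (h i) (h l)) (n : ℕ) :
    ∑ i ∈ Finset.range n, |(h (i + 1) : ℤ) - h i| ≤ 3 * Q := by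
  have key : ∀ n, n < M → ∑ i ∈ Finset.range n, |(h (i + 1) : ℤ) - h i| ≤ 2 * Q := by
    intro n hn
    rcases hq with hq | hq
    · obtain ⟨p, -, -, hs⟩ := sum_abs_le_of_quasiconcave (u := fun i => (h i : ℤ)) (n := n)
        fun i j l h₁ h₂ h₃ => by have := hq i j l h₁ h₂ (by omega); omega
      have := hQ p
      omega
    · obtain ⟨p, -, -, hs⟩ := sum_abs_le_of_quasiconcave (u := fun i => (Q : ℤ) - h i) (n := n)
        fun i j l h₁ h₂ h₃ => by have := hq i j l h₁ h₂ (by omega); omega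
      have e : ∀ i, |((Q : ℤ) - h (i + 1)) - (Q - h i)| = |(h (i + 1) : ℤ) - h i| := by
        intro i
        rw [abs_sub_comm]
        congr 1
        ring
      simp only [e] at hs
      have := hQ 0
      have := hQ n
      omega
  rcases Nat.lt_or_ge n M with hn | hn
  · have := key n hn
    omega
  · have h₁ : ∑ i ∈ Finset.range n, |(h (i + 1) : ℤ) - h i| =
        ∑ i ∈ Finset.range M, |(h (i + 1) : ℤ) - h i| := by
      symm
      refine Finset.sum_subset (Finset.range_subset_range.2 hn) fun i _ hi => ?_
      simp at hi
      rw [h0 i hi, h0 (i + 1) (by omega)]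
      simp
    rw [h₁]
    cases M with
    | zero => simp
    | succ M =>
      rw [Finset.sum_range_succ, h0 (M + 1) le_rfl]
      have := key M (by omega)
      have := hQ M
      simp only [Nat.cast_zero, zero_sub, abs_neg, Nat.abs_cast]
      omega

/-! ## Lattice points of a convex polygon -/

theorem Int.ediv_lt_iff_div_lt {a d : ℤ} (hd : 0 < d) (c : ℤ) : a / d < c ↔ (a : ℝ) / d < c := by
  have hd' : (0 : ℝ) < d := by exact_mod_cast hd
  rw [Int.ediv_lt_iff_lt_mul hd, div_lt_iff₀ hd']
  exact_mod_cast Iff.rfl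

/-- The quotient `(a - 1) / d` is ⌈a/d⌉ - 1, the largest integer strictly below a/d. -/
theorem Int.le_pred_ediv_iff {a d : ℤ} (hd : 0 < d) (c : ℤ) : c ≤ (a - 1) / d ↔ (c : ℝ) < a / d := by
  have hd' : (0 : ℝ) < d := by exact_mod_cast hd
  rw [Int.le_ediv_iff_mul_le hd, lt_div_iff₀ hd', Int.le_sub_one_iff]
  exact_mod_cast Iff.rfl

namespace PolygonData

variable {k : ℕ}

/-- All denominators are positive. -/
structure DenPos (P : PolygonData k) : Prop where
  x : ∀ i, 0 < P.xDen i
  y : ∀ i, 0 < P.yDen i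

theorem x_eq (P : PolygonData k) (i : Fin k) : P.x i = (P.xNum i : ℝ) / P.xDen i := by simp [x, vertex]

theorem y_eq (P : PolygonData k) (i : Fin k) : P.y i = (P.yNum i : ℝ) / P.yDen i := by simp [y, vertex]

theorem vertex_eq (P : PolygonData k) (i : Fin k) : P.vertex i = !₂[P.x i, P.y i] := by
  rw [x_eq, y_eq, vertex]

namespace DenPos

variable {P : PolygonData k}

theorem xFloor_lt (h : P.DenPos) (i : Fin k) (c : ℤ) : P.xNum i / P.xDen i < c ↔ P.x i < c := by
  rw [x_eq]; exact Int.ediv_lt_iff_div_lt (h.x i) c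

theorem yFloor_lt (h : P.DenPos) (i : Fin k) (c : ℤ) : P.yNum i / P.yDen i < c ↔ P.y i < c := by
  rw [y_eq]; exact Int.ediv_lt_iff_div_lt (h.y i) c

theorem le_xCeil (h : P.DenPos) (i : Fin k) (c : ℤ) : c ≤ (P.xNum i - 1) / P.xDen i ↔ c < P.x i := by
  rw [x_eq]; exact Int.le_pred_ediv_iff (h.x i) c

theorem le_yCeil (h : P.DenPos) (i : Fin k) (c : ℤ) : c ≤ (P.yNum i - 1) / P.yDen i ↔ c < P.y i := by
  rw [y_eq]; exact Int.le_pred_ediv_iff (h.y i) c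

end DenPos

/-- The integers strictly between the extreme coordinates are those in `(l, r]` and `(b, t]`. -/
structure Extent (P : PolygonData k) (l r b t : ℤ) : Prop where
  l_le : ∀ i, l ≤ P.xNum i / P.xDen i
  l_eq : ∃ i, P.xNum i / P.xDen i = l
  le_r : ∀ i, (P.xNum i - 1) / P.xDen i ≤ r
  r_eq : ∃ i, (P.xNum i - 1) / P.xDen i = r
  b_le : ∀ i, b ≤ P.yNum i / P.yDen i
  b_eq : ∃ i, P.yNum i / P.yDen i = b
  le_t : ∀ i, (P.yNum i - 1) / P.yDen i ≤ t
  t_eq : ∃ i, (P.yNum i - 1) / P.yDen i = t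

/-- In each column, `lo` and `hi` delimit the lattice points in the interior. -/
structure Profile (P : PolygonData k) (l r b t : ℤ) (lo hi : ℤ → ℤ) : Prop where
  -- The alternatives `t + 1 < j` here and `j ≤ b - 1` below come from the initial values of the
  -- running minimum and maximum. They have no effect in the end, since every column has crossings
  -- and all of them lie between `b` and `t + 1`.
  lo_lt : ∀ c, l < c → c ≤ r → ∀ j, lo c < j ↔ t + 1 < j ∨ ∃ z : ℝ, z < j ∧ P.Crosses c z
  le_hi : ∀ c, l < c → c ≤ r → ∀ j, j ≤ hi c ↔ j ≤ b - 1 ∨ ∃ z : ℝ, j < z ∧ P.Crosses c z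

/-- The heights above `b` in the columns `l + 1, …, r`. -/
def heights (l r b : ℤ) (f : ℤ → ℤ) (t : ℕ) : ℕ := if t < (r - l).toNat then (f (l + 1 + t) - b).toNat else 0

variable {P : PolygonData k} {σ : ℝ} {l r b t : ℤ} {lo hi : ℤ → ℤ}

theorem Extent.mem_columns (h : P.Extent l r b t) (hd : P.DenPos) (c : ℤ) :
    l < c ∧ c ≤ r ↔ (∃ a, P.x a < c) ∧ ∃ b, c < P.x b := by
  simp only [← hd.xFloor_lt, ← hd.le_xCeil]
  obtain ⟨i, hi⟩ := h.l_eq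
  obtain ⟨j, hj⟩ := h.r_eq
  constructor
  · rintro ⟨h₁, h₂⟩
    exact ⟨⟨i, by omega⟩, j, by omega⟩
  · rintro ⟨⟨a, ha⟩, b, hb⟩
    have := h.l_le a
    have := h.le_r b
    omega

theorem Extent.crosses_le (h : P.Extent l r b t) (hd : P.DenPos) {c z : ℝ} (hz : P.Crosses c z) :
    b ≤ z ∧ z ≤ t + 1 := by
  obtain ⟨⟨i, hi⟩, j, hj⟩ := P.exists_coord_le hz.mem_hull 1
  have hi : P.y i ≤ z := by simpa [y] using hi
  have hj : z ≤ P.y j := by simpa [y] using hj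
  have h₁ := h.b_le i
  have h₂ := h.le_t j
  rw [← not_lt, hd.yFloor_lt, not_lt] at h₁
  have h₃ : ¬ (t + 1 ≤ (P.yNum j - 1) / P.yDen j) := by omega
  rw [hd.le_yCeil, not_lt] at h₃
  push_cast at h₃
  exact ⟨h₁.trans hi, hj.trans h₃⟩

theorem Profile.lo_lt_iff (hP : P.Profile l r b t lo hi) (h : P.Oriented σ) (hd : P.DenPos)
    (hE : P.Extent l r b t) {c : ℤ} (hc : l < c ∧ c ≤ r) (j : ℤ) :
    lo c < j ↔ ∃ z : ℝ, z < j ∧ P.Crosses c z := by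
  rw [hP.lo_lt c hc.1 hc.2, or_iff_right_of_imp]
  intro hj
  obtain ⟨ha, hb⟩ := (hE.mem_columns hd c).1 hc
  obtain ⟨z, -, -, hz, -⟩ := h.exists_crosses_lt ha hb
  refine ⟨z, (hE.crosses_le hd hz).2.trans_lt ?_, hz⟩
  exact_mod_cast hj

theorem Profile.le_hi_iff (hP : P.Profile l r b t lo hi) (h : P.Oriented σ) (hd : P.DenPos)
    (hE : P.Extent l r b t) {c : ℤ} (hc : l < c ∧ c ≤ r) (j : ℤ) :
    j ≤ hi c ↔ ∃ z : ℝ, j < z ∧ P.Crosses c z := by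
  rw [hP.le_hi c hc.1 hc.2, or_iff_right_of_imp]
  intro hj
  obtain ⟨ha, hb⟩ := (hE.mem_columns hd c).1 hc
  obtain ⟨z, -, -, hz, -⟩ := h.exists_crosses_lt ha hb
  refine ⟨z, lt_of_lt_of_le ?_ (hE.crosses_le hd hz).1, hz⟩
  exact_mod_cast (by omega : j < b)

/-- A column has crossings z₁ < z₂, and ⌊z₁⌋ ≤ ⌈z₂⌉ - 1. Hence `lo ≤ hi` even in a column without
interior lattice points, and the difference of the two column sums is correct there as well. -/
theorem Profile.bounds (hP : P.Profile l r b t lo hi) (h : P.Oriented σ) (hd : P.DenPos)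
    (hE : P.Extent l r b t) {c : ℤ} (hc : l < c ∧ c ≤ r) : b ≤ lo c ∧ lo c ≤ hi c ∧ hi c ≤ t := by
  refine ⟨?_, ?_, ?_⟩
  · by_contra! hlt
    obtain ⟨z, hz, hz'⟩ := (hP.lo_lt_iff h hd hE hc b).1 hlt
    exact absurd (hE.crosses_le hd hz').1 (not_le.2 hz)
  · obtain ⟨ha, hb⟩ := (hE.mem_columns hd c).1 hc
    obtain ⟨z₁, z₂, hz, h₁, h₂⟩ := h.exists_crosses_lt ha hb
    refine (hP.le_hi_iff h hd hE hc _).2 ⟨z₂, lt_of_le_of_lt ?_ hz, h₂⟩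
    by_contra! hlt
    exact lt_irrefl _ ((hP.lo_lt_iff h hd hE hc (lo c)).2 ⟨z₁, hlt, h₁⟩)
  · by_contra! hlt
    obtain ⟨z, hz, hz'⟩ := (hP.le_hi_iff h hd hE hc (t + 1)).1 hlt
    push_cast at hz
    exact absurd (hE.crosses_le hd hz').2 (not_le.2 hz)

/-- The minimum of the outer values is strictly below a crossing in each outer column, hence by
`Oriented.crosses_between` also below one in the middle column. -/
theorem Profile.hi_quasiconcave (hP : P.Profile l r b t lo hi) (h : P.Oriented σ) (hd : P.DenPos)
    (hE : P.Extent l r b t) {c₁ c₂ c₃ : ℤ} (h₁ : l < c₁) (h₁₂ : c₁ ≤ c₂) (h₂₃ : c₂ ≤ c₃) (h₃ : c₃ ≤ r) :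
    min (hi c₁) (hi c₃) ≤ hi c₂ := by
  obtain ⟨z₁, k₁, i₁⟩ := (hP.le_hi_iff h hd hE (c := c₁) (by omega) _).1 (min_le_left (hi c₁) (hi c₃))
  obtain ⟨z₃, k₃, i₃⟩ := (hP.le_hi_iff h hd hE (c := c₃) (by omega) _).1 (min_le_right (hi c₁) (hi c₃))
  obtain ⟨z, hz, hz'⟩ := (h.crosses_between i₁ i₃ (c₂ := c₂) (by exact_mod_cast h₁₂)
    (by exact_mod_cast h₂₃)).1
  exact (hP.le_hi_iff h hd hE (by omega) _).2 ⟨z, (lt_min k₁ k₃).trans_le hz', hz⟩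

theorem Profile.lo_quasiconvex (hP : P.Profile l r b t lo hi) (h : P.Oriented σ) (hd : P.DenPos)
    (hE : P.Extent l r b t) {c₁ c₂ c₃ : ℤ} (h₁ : l < c₁) (h₁₂ : c₁ ≤ c₂) (h₂₃ : c₂ ≤ c₃) (h₃ : c₃ ≤ r) :
    lo c₂ ≤ max (lo c₁) (lo c₃) := by
  obtain ⟨z₁, k₁, i₁⟩ := (hP.lo_lt_iff h hd hE (c := c₁) (by omega) (max (lo c₁) (lo c₃) + 1)).1 (by omega)
  obtain ⟨z₃, k₃, i₃⟩ := (hP.lo_lt_iff h hd hE (c := c₃) (by omega) (max (lo c₁) (lo c₃) + 1)).1 (by omega)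
  obtain ⟨z, hz, hz'⟩ := (h.crosses_between i₁ i₃ (c₂ := c₂) (by exact_mod_cast h₁₂)
    (by exact_mod_cast h₂₃)).2
  have := (hP.lo_lt_iff h hd hE (c := c₂) (by omega) _).2 ⟨z, hz'.trans_lt (max_lt k₁ k₃), hz⟩
  omega

theorem heights_of_le {f : ℤ → ℤ} {u : ℕ} (hu : (r - l).toNat ≤ u) : heights l r b f u = 0 :=
  if_neg (by omega)

theorem heights_eq {f : ℤ → ℤ} (hf : ∀ c, l < c → c ≤ r → b ≤ f c) {u : ℕ} (hu : u < (r - l).toNat) :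
    f (l + 1 + u) = b + heights l r b f u := by
  have := hf (l + 1 + u) (by omega) (by omega)
  rw [heights, if_pos hu]
  omega

theorem heights_le {f : ℤ → ℤ} (hf : ∀ c, l < c → c ≤ r → f c ≤ t) (u : ℕ) :
    heights l r b f u ≤ (t - b).toNat := by
  rw [heights]
  split_ifs with hu
  · have := hf (l + 1 + u) (by omega) (by omega)
    omega
  · exact Nat.zero_le _

theorem Profile.variation_hi (hP : P.Profile l r b t lo hi) (h : P.Oriented σ) (hd : P.DenPos)
    (hE : P.Extent l r b t) (n : ℕ) :
    ∑ i ∈ Finset.range n, |(heights l r b hi (i + 1) : ℤ) - heights l r b hi i| ≤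
      3 * (t - b).toNat := by
  refine sum_abs_pad_le (fun u hu => heights_of_le hu)
    (heights_le fun c h₁ h₂ => (hP.bounds h hd hE ⟨h₁, h₂⟩).2.2) (Or.inl fun i j u hij hju hu => ?_) n
  rw [heights, heights, heights, if_pos hu, if_pos (by omega), if_pos (by omega)]
  have := hP.hi_quasiconcave h hd hE (c₁ := l + 1 + i) (c₂ := l + 1 + j) (c₃ := l + 1 + u) (by omega)
    (by omega) (by omega) (by omega)
  omega

theorem Profile.variation_lo (hP : P.Profile l r b t lo hi) (h : P.Oriented σ) (hd : P.DenPos)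
    (hE : P.Extent l r b t) (n : ℕ) :
    ∑ i ∈ Finset.range n, |(heights l r b lo (i + 1) : ℤ) - heights l r b lo i| ≤
      3 * (t - b).toNat := by
  refine sum_abs_pad_le (fun u hu => heights_of_le hu)
    (heights_le fun c h₁ h₂ => (hP.bounds h hd hE ⟨h₁, h₂⟩).2.1.trans (hP.bounds h hd hE ⟨h₁, h₂⟩).2.2)
    (Or.inr fun i j u hij hju hu => ?_) n
  rw [heights, heights, heights, if_pos hu, if_pos (by omega), if_pos (by omega)]
  have := hP.lo_quasiconvex h hd hE (c₁ := l + 1 + i) (c₂ := l + 1 + j) (c₃ := l + 1 + u) (by omega)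
    (by omega) (by omega) (by omega)
  omega

/-- The lattice points in the interior. -/
def interiorPoints (P : PolygonData k) : Set (ℤ × ℤ) := {p | !₂[(p.1 : ℝ), (p.2 : ℝ)] ∈ interior P.hull}

/-- The lattice points on the first `i` sides that belong to the polygon, without endpoints. -/
def sidePoints (P : PolygonData k) (i : ℕ) : Set (ℤ × ℤ) :=
  {p | ∃ e : Fin k, (e : ℕ) < i ∧ P.sideMem e = true ∧
    !₂[(p.1 : ℝ), (p.2 : ℝ)] ∈ openSegment ℝ (P.vertex e) (P.vertex (finRotate k e))}

/-- The lattice points among the first `i` vertices that belong to the polygon. -/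
def vertexPoints (P : PolygonData k) (i : ℕ) : Set (ℤ × ℤ) :=
  {p | ∃ e : Fin k, (e : ℕ) < i ∧ P.vertexMem e = true ∧ !₂[(p.1 : ℝ), (p.2 : ℝ)] = P.vertex e}

theorem Profile.mem_interiorPoints (hP : P.Profile l r b t lo hi) (h : P.Oriented σ) (hd : P.DenPos)
    (hE : P.Extent l r b t) (p : ℤ × ℤ) :
    p ∈ P.interiorPoints ↔ (l < p.1 ∧ p.1 ≤ r) ∧ lo p.1 < p.2 ∧ p.2 ≤ hi p.1 := by
  rw [interiorPoints, Set.mem_ofPred_eq, h.mem_interior_iff_crosses, ← hE.mem_columns hd]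
  refine and_congr_right fun hc => ?_
  rw [hP.lo_lt_iff h hd hE hc, hP.le_hi_iff h hd hE hc]

theorem Profile.latticeSum_interior (hP : P.Profile l r b t lo hi) (h : P.Oriented σ) (hd : P.DenPos)
    (hE : P.Extent l r b t) {f : ℤ → ℤ} (g : ℤ → ℤ) {n : ℕ} (hf : ∀ i, f i ≠ 0 → 0 ≤ i ∧ i ≤ n) (m : ℤ) :
    latticeSum f g n P.interiorPoints m =
      WordRAM.columnSum f g (l + 1) (r - l).toNat b (heights l r b hi) m -
      WordRAM.columnSum f g (l + 1) (r - l).toNat b (heights l r b lo) m := by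
  rw [columnSum_eq_latticeSum g hf, columnSum_eq_latticeSum g hf, eq_sub_iff_add_eq,
    ← latticeSum_union]
  · congr 1
    ext ⟨c, j⟩
    rw [Set.mem_union, hP.mem_interiorPoints h hd hE]
    simp only [Set.mem_ofPred_eq]
    by_cases hc : l < c ∧ c ≤ r
    · have hb := hP.bounds h hd hE hc
      have e₁ := heights_eq (b := b) (f := lo) (fun c h₁ h₂ => (hP.bounds h hd hE ⟨h₁, h₂⟩).1)
        (u := (c - (l + 1)).toNat) (by omega)
      have e₂ := heights_eq (b := b) (f := hi) (fun c h₁ h₂ =>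
        (hP.bounds h hd hE ⟨h₁, h₂⟩).1.trans (hP.bounds h hd hE ⟨h₁, h₂⟩).2.1)
        (u := (c - (l + 1)).toNat) (by omega)
      rw [show l + 1 + ((c - (l + 1)).toNat : ℤ) = c by omega] at e₁ e₂
      omega
    · omega
  · rintro ⟨c, j⟩ hp
    rw [hP.mem_interiorPoints h hd hE] at hp
    simp only [Set.mem_ofPred_eq] at hp ⊢
    have e₁ := heights_eq (b := b) (f := lo) (fun c h₁ h₂ => (hP.bounds h hd hE ⟨h₁, h₂⟩).1)
      (u := (c - (l + 1)).toNat) (by omega)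
    rw [show l + 1 + ((c - (l + 1)).toNat : ℤ) = c by omega] at e₁
    omega

/-- The pieces are disjoint: interior points are strictly inside all sides, a vertex or a point of
an open side is not strictly inside its own side, and no vertex lies in an open side. -/
theorem Oriented.latticeSum_region (h : P.Oriented σ) (f g : ℤ → ℤ) (n : ℕ) (m : ℤ) :
    latticeSum f g n {p | !₂[(p.1 : ℝ), (p.2 : ℝ)] ∈ P.region} m =
      latticeSum f g n (P.vertexPoints k) m + latticeSum f g n (P.sidePoints k) m +
        latticeSum f g n P.interiorPoints m := by
  rw [← latticeSum_union, ← latticeSum_union]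
  · congr 1
    ext p
    have h₁ : ∀ e : Fin k, (e : ℕ) < k := fun e => e.2
    simp only [region, interiorPoints, vertexPoints, sidePoints, hull, Set.mem_union, Set.mem_ofPred_eq, h₁,
      true_and]
    exact ⟨fun h => h.elim (fun h => h.elim Or.inr fun h => Or.inl (Or.inr h)) fun h => Or.inl (Or.inl h),
      fun h => h.elim (fun h => h.elim Or.inr fun h => Or.inl (Or.inr h)) fun h => Or.inl (Or.inl h)⟩
  · rintro p (⟨e, -, -, he⟩ | ⟨e, -, -, he⟩) hp
    · rw [interiorPoints, Set.mem_ofPred_eq, he, h.mem_interior_iff] at hp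
      have := hp e
      rw [turn_self] at this
      exact lt_irrefl _ this
    · rw [interiorPoints, Set.mem_ofPred_eq, h.mem_interior_iff] at hp
      have := hp e
      rw [h.turn_eq_zero_of_mem_openSegment he] at this
      exact lt_irrefl _ this
  · rintro p ⟨e, -, -, he⟩ ⟨e', -, -, he'⟩
    rw [he] at he'
    exact h.vertex_notMem_openSegment _ _ he'

theorem vertexPoints_zero (P : PolygonData k) : P.vertexPoints 0 = ∅ := by
  ext p; simp [vertexPoints]

theorem sidePoints_zero (P : PolygonData k) : P.sidePoints 0 = ∅ := by
  ext p; simp [sidePoints]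

theorem Oriented.latticeSum_vertexPoints_succ (h : P.Oriented σ) (f g : ℤ → ℤ) (n : ℕ) (i : Fin k) (m : ℤ) :
    latticeSum f g n (P.vertexPoints (i + 1)) m = latticeSum f g n (P.vertexPoints i) m +
      latticeSum f g n {p | P.vertexMem i = true ∧ !₂[(p.1 : ℝ), (p.2 : ℝ)] = P.vertex i} m := by
  rw [← latticeSum_union]
  · congr 1
    ext p
    simp only [vertexPoints, Set.mem_union, Set.mem_ofPred_eq]
    constructor
    · rintro ⟨e, h₁, h₂⟩
      rcases Nat.lt_succ_iff_lt_or_eq.1 h₁ with h₃ | h₃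
      · exact Or.inl ⟨e, h₃, h₂⟩
      · rw [← Fin.ext h₃]; exact Or.inr h₂
    · rintro (⟨e, h₁, h₂⟩ | h₂)
      · exact ⟨e, by omega, h₂⟩
      · exact ⟨i, by omega, h₂⟩
  · rintro p ⟨e, h₁, -, h₂⟩ ⟨-, h₃⟩
    have := h.vertex_injective (h₂.symm.trans h₃)
    omega

theorem Oriented.latticeSum_sidePoints_succ (h : P.Oriented σ) (f g : ℤ → ℤ) (n : ℕ) (i : Fin k) (m : ℤ) :
    latticeSum f g n (P.sidePoints (i + 1)) m = latticeSum f g n (P.sidePoints i) m +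
      latticeSum f g n {p | P.sideMem i = true ∧
        !₂[(p.1 : ℝ), (p.2 : ℝ)] ∈ openSegment ℝ (P.vertex i) (P.vertex (finRotate k i))} m := by
  rw [← latticeSum_union]
  · congr 1
    ext p
    simp only [sidePoints, Set.mem_union, Set.mem_ofPred_eq]
    constructor
    · rintro ⟨e, h₁, h₂⟩
      rcases Nat.lt_succ_iff_lt_or_eq.1 h₁ with h₃ | h₃
      · exact Or.inl ⟨e, h₃, h₂⟩
      · rw [← Fin.ext h₃]; exact Or.inr h₂
    · rintro (⟨e, h₁, h₂⟩ | h₂)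
      · exact ⟨e, by omega, h₂⟩
      · exact ⟨i, by omega, h₂⟩
  · rintro p ⟨e, h₁, -, h₂⟩ ⟨-, h₃⟩
    have := h.openSegment_disjoint h₂ h₃
    omega

end PolygonData

/-! ## Sides and perimeter -/

/-- Integrality test for a fraction without a remainder: ⌊a/d⌋ exceeds ⌈a/d⌉ - 1 exactly when a/d is
an integer. -/
theorem Int.cast_eq_div_iff {a d : ℤ} (hd : 0 < d) (j : ℤ) :
    (j : ℝ) = a / d ↔ j = a / d ∧ (a - 1) / d < a / d := by
  have h₁ : ¬ (a : ℝ) / d < (a / d : ℤ) := by rw [← Int.ediv_lt_iff_div_lt hd]; omega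
  have h₂ : (a - 1) / d < a / d ↔ ¬ ((a / d : ℤ) : ℝ) < a / d := by
    rw [← Int.le_pred_ediv_iff hd]; omega
  constructor
  · intro h
    have h₃ : a / d = j := by
      have e₁ := Int.ediv_lt_iff_div_lt (a := a) hd j
      have e₂ := Int.ediv_lt_iff_div_lt (a := a) hd (j + 1)
      rw [← h] at e₁ e₂
      have h₄ := e₂.2 (by push_cast; linarith)
      have h₅ := mt e₁.1 (lt_irrefl _)
      omega
    exact ⟨h₃.symm, h₂.2 (by rw [h₃, ← h]; exact lt_irrefl _)⟩
  · rintro ⟨rfl, h⟩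
    exact le_antisymm (not_lt.1 h₁) (not_lt.1 (h₂.1 h))

namespace PolygonData

variable {k : ℕ} {P : PolygonData k} {σ : ℝ}

/-- The denominator of the height of the side line through two vertices. -/
def heightDen (P : PolygonData k) (u w : Fin k) : ℤ :=
  P.yDen u * P.yDen w * (P.xNum w * P.xDen u - P.xNum u * P.xDen w)

/-- The numerator of the height of the side line through two vertices in column `c`. -/
def heightNum (P : PolygonData k) (u w : Fin k) (c : ℤ) : ℤ :=
  P.yNum u * P.yDen w * (P.xNum w * P.xDen u - P.xNum u * P.xDen w) +
    (P.yNum w * P.yDen u - P.yNum u * P.yDen w) * (c * P.xDen u - P.xNum u) * P.xDen w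

namespace DenPos

theorem xDen_pos (h : P.DenPos) (i : Fin k) : (0 : ℝ) < P.xDen i := by exact_mod_cast h.x i

theorem yDen_pos (h : P.DenPos) (i : Fin k) : (0 : ℝ) < P.yDen i := by exact_mod_cast h.y i

theorem x_lt_iff (h : P.DenPos) (u w : Fin k) :
    P.x u < P.x w ↔ P.xNum u * P.xDen w < P.xNum w * P.xDen u := by
  rw [x_eq, x_eq, div_lt_div_iff₀ (h.xDen_pos u) (h.xDen_pos w)]
  exact_mod_cast Iff.rfl

theorem heightDen_pos (h : P.DenPos) {u w : Fin k} (hx : P.x u < P.x w) : 0 < P.heightDen u w :=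
  mul_pos (mul_pos (h.y u) (h.y w)) (sub_pos.2 ((h.x_lt_iff u w).1 hx))

theorem height_eq (h : P.DenPos) {u w : Fin k} (hx : P.x u < P.x w) (c : ℤ) :
    (P.heightNum u w c : ℝ) / P.heightDen u w =
      P.y u + (c - P.x u) / (P.x w - P.x u) * (P.y w - P.y u) := by
  have h₁ := h.xDen_pos u
  have h₂ := h.xDen_pos w
  have h₃ := h.yDen_pos u
  have h₄ := h.yDen_pos w
  have h₅ : (0 : ℝ) < P.xNum w * P.xDen u - P.xNum u * P.xDen w := by
    have := (h.x_lt_iff u w).1 hx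
    exact_mod_cast sub_pos.2 this
  have e : P.x w - P.x u = (P.xNum w * P.xDen u - P.xNum u * P.xDen w) / (P.xDen u * P.xDen w) := by
    rw [x_eq, x_eq]; field_simp
  rw [e, heightNum, heightDen, x_eq, y_eq, y_eq]
  push_cast
  field_simp

theorem mem_segment_iff (h : P.DenPos) {u w : Fin k} (hx : P.x u < P.x w) (c : ℤ) (z : ℝ) :
    !₂[(c : ℝ), z] ∈ segment ℝ (P.vertex u) (P.vertex w) ↔
      P.x u ≤ c ∧ c ≤ P.x w ∧ z = P.heightNum u w c / P.heightDen u w := by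
  have hpos := sub_pos.2 hx
  rw [h.height_eq hx, segment_eq_image']
  constructor
  · rintro ⟨s, ⟨hs₀, hs₁⟩, hs⟩
    have e₀ : P.x u + s * (P.x w - P.x u) = c := by simpa [PolygonData.x] using congrArg (fun q => q 0) hs
    have e₁ : P.y u + s * (P.y w - P.y u) = z := by simpa [PolygonData.y] using congrArg (fun q => q 1) hs
    rw [← e₀, ← e₁]
    refine ⟨by nlinarith, by nlinarith, ?_⟩
    rw [add_sub_cancel_left, mul_div_cancel_right₀ _ hpos.ne']
  · rintro ⟨h₁, h₂, rfl⟩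
    refine ⟨(c - P.x u) / (P.x w - P.x u), ⟨div_nonneg (by linarith) hpos.le,
      (div_le_one hpos).2 (by linarith)⟩, ?_⟩
    rw [vertex_eq, vertex_eq]
    ext l
    fin_cases l
    · simp; field_simp; ring
    · simp

theorem mem_openSegment_iff (h : P.DenPos) {u w : Fin k} (hx : P.x u < P.x w) (c : ℤ) (z : ℝ) :
    !₂[(c : ℝ), z] ∈ openSegment ℝ (P.vertex u) (P.vertex w) ↔
      P.x u < c ∧ c < P.x w ∧ z = P.heightNum u w c / P.heightDen u w := by
  have hpos := sub_pos.2 hx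
  rw [h.height_eq hx, openSegment_eq_image']
  constructor
  · rintro ⟨s, ⟨hs₀, hs₁⟩, hs⟩
    have e₀ : P.x u + s * (P.x w - P.x u) = c := by simpa [PolygonData.x] using congrArg (fun q => q 0) hs
    have e₁ : P.y u + s * (P.y w - P.y u) = z := by simpa [PolygonData.y] using congrArg (fun q => q 1) hs
    rw [← e₀, ← e₁]
    refine ⟨by nlinarith, by nlinarith, ?_⟩
    rw [add_sub_cancel_left, mul_div_cancel_right₀ _ hpos.ne']
  · rintro ⟨h₁, h₂, rfl⟩
    refine ⟨(c - P.x u) / (P.x w - P.x u), ⟨div_pos (by linarith) hpos,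
      (div_lt_one hpos).2 (by linarith)⟩, ?_⟩
    rw [vertex_eq, vertex_eq]
    ext l
    fin_cases l
    · simp; field_simp; ring
    · simp

end DenPos

theorem mem_openSegment_of_x_eq {u w : Fin k} (hx : P.x u = P.x w) (hy : P.y u < P.y w) (c z : ℝ) :
    !₂[c, z] ∈ openSegment ℝ (P.vertex u) (P.vertex w) ↔ c = P.x u ∧ P.y u < z ∧ z < P.y w := by
  have hpos := sub_pos.2 hy
  rw [openSegment_eq_image']
  constructor
  · rintro ⟨s, ⟨hs₀, hs₁⟩, hs⟩
    have e₀ : P.x u + s * (P.x w - P.x u) = c := by simpa [PolygonData.x] using congrArg (fun q => q 0) hs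
    have e₁ : P.y u + s * (P.y w - P.y u) = z := by simpa [PolygonData.y] using congrArg (fun q => q 1) hs
    rw [← e₀, ← e₁]
    exact ⟨by rw [hx]; ring, by nlinarith, by nlinarith⟩
  · rintro ⟨rfl, h₁, h₂⟩
    refine ⟨(z - P.y u) / (P.y w - P.y u), ⟨div_pos (by linarith) hpos,
      (div_lt_one hpos).2 (by linarith)⟩, ?_⟩
    rw [vertex_eq, vertex_eq, ← hx]
    ext l
    fin_cases l
    · simp
    · simp; field_simp; ring

/-- The side `e` belongs to the polygon, it joins `u` and `w`, and `u` comes first in the lexicographic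
order: the lattice points on this side. -/
def directedPoints (P : PolygonData k) (e u w : Fin k) : Set (ℤ × ℤ) :=
  {p | P.sideMem e = true ∧ (P.x u < P.x w ∨ P.x u = P.x w ∧ P.y u < P.y w) ∧
    !₂[(p.1 : ℝ), (p.2 : ℝ)] ∈ openSegment ℝ (P.vertex u) (P.vertex w)}

/-- The endpoints differ, so exactly one of the two directions is lexicographically increasing.
Processing every side in both directions therefore counts its points once. -/
theorem Oriented.latticeSum_side (h : P.Oriented σ) (f g : ℤ → ℤ) (n : ℕ) (i : Fin k) (m : ℤ) :
    latticeSum f g n {p | P.sideMem i = true ∧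
        !₂[(p.1 : ℝ), (p.2 : ℝ)] ∈ openSegment ℝ (P.vertex i) (P.vertex (finRotate k i))} m =
      latticeSum f g n (P.directedPoints i i (finRotate k i)) m +
        latticeSum f g n (P.directedPoints i (finRotate k i) i) m := by
  have hne : ¬ (P.x i = P.x (finRotate k i) ∧ P.y i = P.y (finRotate k i)) := by
    rintro ⟨h₁, h₂⟩
    exact h.vertex_ne_next i (by rw [vertex_eq, vertex_eq, h₁, h₂])
  rw [← latticeSum_union]
  · congr 1
    ext p
    simp only [directedPoints, Set.mem_union, Set.mem_ofPred_eq,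
      openSegment_symm ℝ (P.vertex (finRotate k i))]
    generalize finRotate k i = w at *
    rcases lt_trichotomy (P.x i) (P.x w) with h₁ | h₁ | h₁
    · simp [h₁, h₁.ne', not_lt_of_gt h₁]
    · rcases lt_trichotomy (P.y i) (P.y w) with h₂ | h₂ | h₂
      · simp [h₁, h₂, not_lt_of_gt h₂]
      · exact absurd ⟨h₁, h₂⟩ hne
      · simp [h₁, h₂, not_lt_of_gt h₂]
    · simp [h₁, h₁.ne', not_lt_of_gt h₁]
  · rintro p ⟨-, h₁, -⟩ ⟨-, h₂, -⟩
    rcases h₁ with h₁ | h₁ <;> rcases h₂ with h₂ | h₂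
    · exact lt_asymm h₁ h₂
    · exact h₁.ne' h₂.1
    · exact h₂.ne' h₁.1
    · exact lt_asymm h₁.2 h₂.2

theorem abs_coord_sub_le (u w : EuclideanSpace ℝ (Fin 2)) (l : Fin 2) : |u l - w l| ≤ dist u w := by
  rw [dist_eq_norm]
  simpa using PiLp.norm_apply_le (u - w) l

theorem perimeter_nonneg (P : PolygonData k) : 0 ≤ P.perimeter :=
  Finset.sum_nonneg fun _ _ => dist_nonneg

/-- Both vertices are reached from vertex `0` along the boundary. The constant is not the best one,
but only linearity in the perimeter matters. -/
theorem dist_vertex_le (P : PolygonData k) (i j : Fin k) :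
    dist (P.vertex i) (P.vertex j) ≤ 2 * P.perimeter := by
  have key : ∀ m (hm : m < k), dist (P.vertex ⟨0, by omega⟩) (P.vertex ⟨m, hm⟩) ≤
      ∑ e : Fin k, if (e : ℕ) < m then dist (P.vertex e) (P.vertex (finRotate k e)) else 0 := by
    intro m
    induction m with
    | zero => intro hm; simp
    | succ m ih =>
      intro hm
      have h₁ : finRotate k ⟨m, by omega⟩ = ⟨m + 1, hm⟩ := by
        ext; rw [coe_finRotate_eq]; simp [hm]
      refine (dist_triangle _ (P.vertex ⟨m, by omega⟩) _).trans ?_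
      have h₂ : ∑ e : Fin k, (if (e : ℕ) < m + 1 then dist (P.vertex e) (P.vertex (finRotate k e)) else 0) =
          (∑ e : Fin k, if (e : ℕ) < m then dist (P.vertex e) (P.vertex (finRotate k e)) else 0) +
          ∑ e : Fin k, if e = ⟨m, by omega⟩ then dist (P.vertex e) (P.vertex (finRotate k e)) else 0 := by
        rw [← Finset.sum_add_distrib]
        refine Finset.sum_congr rfl fun e _ => ?_
        simp only [Fin.ext_iff]
        split_ifs <;> first | omega | simp
      rw [h₂, Finset.sum_ite_eq' Finset.univ, if_pos (Finset.mem_univ _), h₁]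
      exact add_le_add (ih (by omega)) le_rfl
  have key' : ∀ m : Fin k, dist (P.vertex ⟨0, by have := i.2; omega⟩) (P.vertex m) ≤ P.perimeter := by
    intro m
    refine (key m m.2).trans (Finset.sum_le_sum fun e _ => ?_)
    split_ifs
    · exact le_rfl
    · exact dist_nonneg
  refine (dist_triangle_left _ _ (P.vertex ⟨0, by have := i.2; omega⟩)).trans ?_
  linarith [key' i, key' j]

theorem Extent.width_lt {l r b t : ℤ} (h : P.Extent l r b t) (hd : P.DenPos) :
    ((r - l : ℤ) : ℝ) < 2 * P.perimeter + 1 := by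
  obtain ⟨i, hi⟩ := h.r_eq
  obtain ⟨j, hj⟩ := h.l_eq
  have h₁ := (hd.le_xCeil i r).1 hi.ge
  have h₂ := (hd.xFloor_lt j (l + 1)).1 (by omega)
  have h₃ := (le_abs_self _).trans (abs_coord_sub_le (P.vertex i) (P.vertex j) 0)
  have h₄ := P.dist_vertex_le i j
  simp only [x] at h₁ h₂
  push_cast at h₂ ⊢
  linarith

theorem Extent.height_lt {l r b t : ℤ} (h : P.Extent l r b t) (hd : P.DenPos) :
    ((t - b : ℤ) : ℝ) < 2 * P.perimeter + 1 := by
  obtain ⟨i, hi⟩ := h.t_eq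
  obtain ⟨j, hj⟩ := h.b_eq
  have h₁ := (hd.le_yCeil i t).1 hi.ge
  have h₂ := (hd.yFloor_lt j (b + 1)).1 (by omega)
  have h₃ := (le_abs_self _).trans (abs_coord_sub_le (P.vertex i) (P.vertex j) 1)
  have h₄ := P.dist_vertex_le i j
  simp only [y] at h₁ h₂
  push_cast at h₂ ⊢
  linarith

end PolygonData

namespace WordRAM

open Cmd Ex

/-! ## The pass over the sides of the polygon -/

/-- The registers `42` to `50` describe a directed segment: the endpoints `(x₁, y₁)` and `(x₂, y₂)` as
fractions, and the mark. -/
structure SideRegs (s : State) {k : ℕ} (P : PolygonData k) (e u w : Fin k) : Prop where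
  x₁n : s.var 42 = P.xNum u
  x₁d : s.var 43 = P.xDen u
  y₁n : s.var 44 = P.yNum u
  y₁d : s.var 45 = P.yDen u
  x₂n : s.var 46 = P.xNum w
  x₂d : s.var 47 = P.xDen w
  y₂n : s.var 48 = P.yNum w
  y₂d : s.var 49 = P.yDen w
  mark : s.var 50 = if P.sideMem e then 1 else 0

theorem SideRegs.congr {s s' : State} {k : ℕ} {P : PolygonData k} {e u w : Fin k} (h : SideRegs s P e u w)
    (hs : ∀ r, 42 ≤ r → r ≤ 50 → s'.var r = s.var r) : SideRegs s' P e u w where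
  x₁n := (hs _ (by norm_num) (by norm_num)).trans h.x₁n
  x₁d := (hs _ (by norm_num) (by norm_num)).trans h.x₁d
  y₁n := (hs _ (by norm_num) (by norm_num)).trans h.y₁n
  y₁d := (hs _ (by norm_num) (by norm_num)).trans h.y₁d
  x₂n := (hs _ (by norm_num) (by norm_num)).trans h.x₂n
  x₂d := (hs _ (by norm_num) (by norm_num)).trans h.x₂d
  y₂n := (hs _ (by norm_num) (by norm_num)).trans h.y₂n
  y₂d := (hs _ (by norm_num) (by norm_num)).trans h.y₂d
  mark := (hs _ (by norm_num) (by norm_num)).trans h.mark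

/-- The numbers that describe the polygon are at most `Y` in absolute value. -/
structure _root_.PolygonData.Bounded {k : ℕ} (P : PolygonData k) (Y : ℕ) : Prop where
  xNum_le : ∀ i, |P.xNum i| ≤ Y
  xDen_le : ∀ i, |P.xDen i| ≤ Y
  yNum_le : ∀ i, |P.yNum i| ≤ Y
  yDen_le : ∀ i, |P.yDen i| ≤ Y

/-- `A[i] := A[i] + e` for the output array. -/
def addCell (i e : Ex) : Cmd := .store 8 i (ld 8 i + e)

/-- The height of the segment in the column `r53`, as a numerator. -/
def heightEx : Ex := v 44 * v 49 * v 51 + v 52 * (v 53 * v 43 - v 42) * v 47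

/-- Update the profile in the column `r53`. -/
def profileStep : Cmd :=
  .assign 56 heightEx ;;
  .assign 57 (v 56 / v 55) ;;
  .assign 58 ((v 56 - c 1) / v 55) ;;
  .ite (v 57) (ld 18 (v 53)) (.store 18 (v 53) (v 57)) .skip ;;
  .ite (ld 19 (v 53)) (v 58) (.store 19 (v 53) (v 58)) .skip

/-- Count the lattice point of the segment in the column `r53` if there is one. -/
def sidePoint : Cmd :=
  .ite (v 58) (v 57) (.ite (c 0) (v 50) (.ite (v 42) (v 53 * v 43) (.ite (v 53 * v 47) (v 46)
    (addCell (v 53 + v 57) (ld 0 (v 53) * ld 1 (v 57))) .skip) .skip) .skip) .skip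

/-- The numbers are the values of expressions of degree at most 10 in an auxiliary state that holds
the coordinates, so the general bound `abs_eval_le` applies. -/
theorem abs_heightNum_le {k : ℕ} {P : PolygonData k} {Y : ℕ} (hP : P.Bounded Y) (hY : 16 ≤ Y) (u w : Fin k)
    {z : ℤ} (hz : |z| ≤ Y) : |P.heightNum u w z| ≤ (Y : ℤ) ^ 10 ∧ |P.heightDen u w| ≤ (Y : ℤ) ^ 10 ∧
      |P.xNum w * P.xDen u - P.xNum u * P.xDen w| ≤ (Y : ℤ) ^ 10 ∧
      |P.yNum w * P.yDen u - P.yNum u * P.yDen w| ≤ (Y : ℤ) ^ 10 := by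
  let s : State := ⟨fun
    | 0 => P.xNum u | 1 => P.xDen u | 2 => P.yNum u | 3 => P.yDen u
    | 4 => P.xNum w | 5 => P.xDen w | 6 => P.yNum w | 7 => P.yDen w | _ => z, fun _ _ => 0⟩
  have hv : ∀ r < 9, (v r).leafOk Y s := by
    intro r hr
    refine ⟨by omega, ?_⟩
    rcases hP with ⟨h₁, h₂, h₃, h₄⟩
    interval_cases r <;> simp [s, h₁, h₂, h₃, h₄, hz]
  have key : ∀ e : Ex, e.leafOk Y s → e.deg ≤ 10 → |e.eval s| ≤ (Y : ℤ) ^ 10 := fun e he hd =>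
    (abs_eval_le hY he).trans (pow_le_pow_right₀ (by omega) hd)
  refine ⟨key (v 2 * v 7 * (v 4 * v 1 - v 0 * v 5) + (v 6 * v 3 - v 2 * v 7) * (v 8 * v 1 - v 0) * v 5)
      ?_ (by decide), key (v 3 * v 7 * (v 4 * v 1 - v 0 * v 5)) ?_ (by decide),
    key (v 4 * v 1 - v 0 * v 5) ?_ (by decide), key (v 6 * v 3 - v 2 * v 7) ?_ (by decide)⟩ <;>
    simp only [leafOk_add, leafOk_sub, leafOk_mul, hv, Nat.reduceLT, and_self]

theorem profileStep_spec {V B Y : ℕ} (hV : 16 ≤ V) (hB : V ^ 10 ≤ B) {k : ℕ} {P : PolygonData k}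
    {e u w : Fin k} {s : State} (hs : SideRegs s P e u w) (hP : P.Bounded Y) (hY : 16 ≤ Y) (hYV : Y ^ 11 ≤ V)
    {z : ℤ} (hz : |z| ≤ Y) (hc : s.var 53 = z) (hD : s.var 51 = P.xNum w * P.xDen u - P.xNum u * P.xDen w)
    (hG : s.var 52 = P.yNum w * P.yDen u - P.yNum u * P.yDen w) (hden : s.var 55 = P.heightDen u w)
    (hlo : |s.arr 18 z| ≤ V) (hhi : |s.arr 19 z| ≤ V) :
    profileStep.Spec B s 40 (fun s' => s'.var 57 = P.heightNum u w z / P.heightDen u w ∧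
      s'.var 58 = (P.heightNum u w z - 1) / P.heightDen u w ∧
      (∀ j, s'.arr 18 j = if j = z then min (s.arr 18 z) (P.heightNum u w z / P.heightDen u w) else s.arr 18 j) ∧
      ∀ j, s'.arr 19 j = if j = z then max (s.arr 19 z) ((P.heightNum u w z - 1) / P.heightDen u w)
        else s.arr 19 j) := by
  obtain ⟨b₁, b₂, b₃, b₄⟩ := abs_heightNum_le hP hY u w hz
  have hYY := le_self_pow₀ (a := (Y : ℤ)) (n := 10) (by omega) (by norm_num)
  have d₄ : (Y : ℤ) ^ 10 + 1 ≤ V := by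
    have h₁ : (Y : ℤ) ^ 11 ≤ V := by exact_mod_cast hYV
    rw [pow_succ] at h₁
    nlinarith
  have q₁ := hP.xNum_le u
  have q₂ := hP.xDen_le u
  have q₃ := hP.yNum_le u
  have q₄ := hP.yDen_le w
  have q₅ := hP.xDen_le w
  have hnum : P.heightNum u w z = P.yNum u * P.yDen w * (P.xNum w * P.xDen u - P.xNum u * P.xDen w) +
    (P.yNum w * P.yDen u - P.yNum u * P.yDen w) * (z * P.xDen u - P.xNum u) * P.xDen w := rfl
  refine Spec.mono (Spec.assign_seq hV hB (P.heightNum u w z) (by decide) ?_ ?_ <|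
    Spec.of_wpV hV hB le_rfl (Q := fun s' => s'.var 57 = P.heightNum u w z / P.heightDen u w ∧
      s'.var 58 = (P.heightNum u w z - 1) / P.heightDen u w ∧
      (∀ j, s'.arr 18 j = if j = z then min (s.arr 18 z) (P.heightNum u w z / P.heightDen u w) else s.arr 18 j) ∧
      ∀ j, s'.arr 19 j = if j = z then max (s.arr 19 z) ((P.heightNum u w z - 1) / P.heightDen u w)
        else s.arr 19 j) ?_) (by decide) fun _ _ h => h
  · simp only [heightEx, leafOk_add, leafOk_sub, leafOk_mul, leafOk_v, hs.y₁n, hs.y₂d, hD, hG, hc, hs.x₁d,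
      hs.x₁n, hs.x₂d]
    refine ⟨⟨⟨⟨?_, ?_⟩, ?_, ?_⟩, ?_, ?_⟩, ⟨⟨?_, ?_⟩, ⟨⟨?_, ?_⟩, ?_, ?_⟩, ?_, ?_⟩, ?_, ?_⟩ <;> omega
  · simp only [heightEx, eval_add, eval_sub, eval_mul, eval_v, hs.y₁n, hs.y₂d, hD, hG, hc, hs.x₁d,
      hs.x₁n, hs.x₂d, hnum]
  · generalize P.heightNum u w z = N at *
    generalize P.heightDen u w = D at *
    have d₁ := Int.abs_ediv_le_abs N D
    have d₂ := Int.abs_ediv_le_abs (N - 1) D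
    have d₃ : |N - 1| ≤ |N| + 1 := (abs_sub _ _).trans (by simp)
    have d₅ : |N / D| ≤ V := by omega
    have d₆ : |(N - 1) / D| ≤ V := by omega
    have d₇ : |z| ≤ V := by omega
    have d₈ : |N| ≤ V := by omega
    have d₉ : |D| ≤ V := by omega
    simp [wpV, State.var_setVar, State.arr_setArr, hc, hden, hlo, hhi, d₅, d₆, d₇, d₈, d₉]
    exact ⟨fun h₁ => ⟨fun h₂ => ⟨fun j => by rw [min_eq_right h₁.le], fun j => by rw [max_eq_right h₂.le]⟩,
      fun h₂ => ⟨fun j => by rw [min_eq_right h₁.le], h₂⟩⟩,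
      fun h₁ => ⟨fun h₂ => ⟨h₁, fun j => by rw [max_eq_right h₂.le]⟩, fun h₂ => ⟨h₁, h₂⟩⟩⟩

/-- In a column the side line has one point, whose height must be an integer; the two strict
inequalities, with denominators cleared, exclude the endpoints of the side. -/
theorem _root_.PolygonData.directedPoints_column {k : ℕ} {P : PolygonData k} (hd : P.DenPos) (e : Fin k)
    {u w : Fin k} (hx : P.x u < P.x w) (z : ℤ) :
    {p ∈ P.directedPoints e u w | p.1 = z} = if ((P.heightNum u w z - 1) / P.heightDen u w <
      P.heightNum u w z / P.heightDen u w ∧ P.sideMem e = true) ∧ P.xNum u < z * P.xDen u ∧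
      z * P.xDen w < P.xNum w then {(z, P.heightNum u w z / P.heightDen u w)} else ∅ := by
  have h₁ := hd.xDen_pos u
  have h₂ := hd.xDen_pos w
  have e₁ : P.xNum u < z * P.xDen u ↔ P.x u < z := by
    rw [PolygonData.x_eq, div_lt_iff₀ h₁]; exact_mod_cast Iff.rfl
  have e₂ : z * P.xDen w < P.xNum w ↔ z < P.x w := by
    rw [PolygonData.x_eq, lt_div_iff₀ h₂]; exact_mod_cast Iff.rfl
  ext ⟨i, j⟩
  simp only [PolygonData.directedPoints, Set.mem_ofPred_eq, hx, true_or, true_and, hd.mem_openSegment_iff hx,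
    Int.cast_eq_div_iff (hd.heightDen_pos hx)]
  split_ifs with hc <;> rw [e₁, e₂] at hc
  · simp only [Set.mem_singleton_iff, Prod.mk.injEq]
    constructor
    · rintro ⟨⟨-, -, -, h, -⟩, rfl⟩
      exact ⟨rfl, h⟩
    · rintro ⟨rfl, rfl⟩
      exact ⟨⟨hc.1.2, hc.2.1, hc.2.2, rfl, hc.1.1⟩, rfl⟩
  · simp only [Set.mem_empty_iff_false, iff_false]
    rintro ⟨⟨k₁, k₂, k₃, -, k₄⟩, rfl⟩
    exact hc ⟨⟨k₄, k₁⟩, k₂, k₃⟩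

theorem sidePoint_spec {V B Y : ℕ} (hV : 16 ≤ V) (hB : V ^ 10 ≤ B) {k : ℕ} {P : PolygonData k}
    (hd : P.DenPos) {e u w : Fin k} (hx : P.x u < P.x w) {s : State} (hs : SideRegs s P e u w)
    (hP : P.Bounded Y) (hYV : Y ≤ V) {n : ℕ} (hn : ∀ i, s.arr 0 i ≠ 0 → 0 ≤ i ∧ i ≤ n)
    {z : ℤ} (hz : |z| ≤ Y) (hc : s.var 53 = z)
    (h57 : s.var 57 = P.heightNum u w z / P.heightDen u w)
    (h58 : s.var 58 = (P.heightNum u w z - 1) / P.heightDen u w)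
    (b57 : |s.var 57| ≤ V) (b58 : |s.var 58| ≤ V)
    (h0 : ∀ i, |s.arr 0 i| ≤ V) (h1 : ∀ i, |s.arr 1 i| ≤ V) (hout : ∀ m, |s.arr 8 m| ≤ V) :
    sidePoint.Spec B s 30 (fun s' => ∀ m, s'.arr 8 m = s.arr 8 m +
      latticeSum (s.arr 0) (s.arr 1) n {p ∈ P.directedPoints e u w | p.1 = z} m) := by
  have q₁ := hP.xNum_le u
  have q₂ := hP.xDen_le u
  have q₃ := hP.xNum_le w
  have q₄ := hP.xDen_le w
  have hYV' : (Y : ℤ) ≤ V := by exact_mod_cast hYV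
  rw [PolygonData.directedPoints_column hd e hx, ← h57, ← h58]
  have key : ∀ m, latticeSum (s.arr 0) (s.arr 1) n (if (s.var 58 < s.var 57 ∧ P.sideMem e = true) ∧
      P.xNum u < z * P.xDen u ∧ z * P.xDen w < P.xNum w then {(z, s.var 57)} else ∅) m =
      if ((s.var 58 < s.var 57 ∧ P.sideMem e = true) ∧ P.xNum u < z * P.xDen u ∧ z * P.xDen w < P.xNum w) ∧
        m = z + s.var 57 then s.arr 0 z * s.arr 1 (s.var 57) else 0 := by
    intro m
    split_ifs with h₁ h₂ h₂
    · rw [latticeSum_singleton _ hn, if_pos h₂.2]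
    · rw [latticeSum_singleton _ hn, if_neg fun h => h₂ ⟨h₁, h⟩]
    · exact absurd h₂.1 h₁
    · exact latticeSum_empty _ _ _ _
  simp only [key]
  have hm : |s.var 50| ≤ V := by rw [hs.mark]; split_ifs <;> simp; omega
  refine Spec.of_wpV hV hB (by decide) ?_
  simp only [sidePoint, addCell, wpV, deg_v, deg_c, deg_add, deg_mul, deg_ld, leafOk_v, leafOk_c, leafOk_add,
    leafOk_mul, leafOk_ld, eval_v, eval_c, eval_add, eval_mul, eval_ld, hc, hs.x₁n, hs.x₁d, hs.x₂n, hs.x₂d,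
    State.arr_setArr, h0, h1, hout, b57, b58, hm, q₁.trans hYV', q₂.trans hYV', q₃.trans hYV',
    q₄.trans hYV', hz.trans hYV', hs.mark]
  norm_num
  rw [hs.mark] at hm
  refine ⟨fun h₁ => ⟨hm, fun h₂ => ⟨fun h₃ => ⟨fun h₄ m => ?_, fun h₄ m _ _ _ h => absurd h (not_lt.2 h₄)⟩,
    fun h₃ m _ _ h => absurd h (not_lt.2 h₃)⟩, fun h₂ m _ h => ?_⟩, fun h₁ m h => absurd h (not_lt.2 h₁)⟩
  · have hM : P.sideMem e = true := by
      by_contra hM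
      simp [hM] at h₂
    simp only [h₁, hM, h₃, h₄, true_and]
    split_ifs with h₅
    · rw [h₅]
    · rw [add_zero]
  · simp [h] at h₂

end WordRAM

/-! ### Sides that are not vertical -/

namespace WordRAM

open Cmd Ex

/-- Set up the registers for the pass over the columns that meet a segment. -/
def sidePrep : Cmd :=
  .assign 51 (v 46 * v 43 - v 42 * v 47) ;;
  .assign 52 (v 48 * v 45 - v 44 * v 49) ;;
  .assign 55 (v 45 * v 49 * (v 46 * v 43 - v 42 * v 47)) ;;
  -- The columns from ⌈x₁⌉ up to, but excluding, ⌊x₂⌋ + 1. They belong to the closed segment,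
  -- because the endpoints matter for the profile although they are not points of the open side.
  .assign 53 ((v 42 - c 1) / v 43 + c 1) ;;
  .assign 54 (v 46 / v 47 + c 1)

/-- The pass over the columns that meet a segment. -/
def sideColumns : Cmd := sidePrep ;; forUp 53 54 (profileStep ;; sidePoint)

theorem sidePrep_spec {V B Y : ℕ} (hV : 16 ≤ V) (hB : V ^ 10 ≤ B) {k : ℕ} {P : PolygonData k}
    {e u w : Fin k} {s : State} (hs : SideRegs s P e u w) (hP : P.Bounded Y) (hYV : Y ≤ V) :
    sidePrep.Spec B s 40 (fun s' => s'.arr = s.arr ∧ SideRegs s' P e u w ∧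
      s'.var 51 = P.xNum w * P.xDen u - P.xNum u * P.xDen w ∧
      s'.var 52 = P.yNum w * P.yDen u - P.yNum u * P.yDen w ∧ s'.var 55 = P.heightDen u w ∧
      s'.var 53 = (P.xNum u - 1) / P.xDen u + 1 ∧ s'.var 54 = P.xNum w / P.xDen w + 1) := by
  have hYV' : (Y : ℤ) ≤ V := by exact_mod_cast hYV
  have b : ∀ i, (|P.xNum i| ≤ V ∧ |P.xDen i| ≤ V) ∧ |P.yNum i| ≤ V ∧ |P.yDen i| ≤ V := fun i =>
    ⟨⟨(hP.xNum_le i).trans hYV', (hP.xDen_le i).trans hYV'⟩, (hP.yNum_le i).trans hYV',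
      (hP.yDen_le i).trans hYV'⟩
  refine Spec.mono (Spec.of_wpV hV hB (T := 40) (by decide) (P := sidePrep) (Q := fun s' => s'.arr = s.arr ∧
      s'.var 51 = P.xNum w * P.xDen u - P.xNum u * P.xDen w ∧
      s'.var 52 = P.yNum w * P.yDen u - P.yNum u * P.yDen w ∧ s'.var 55 = P.heightDen u w ∧
      s'.var 53 = (P.xNum u - 1) / P.xDen u + 1 ∧ s'.var 54 = P.xNum w / P.xDen w + 1) ?_) le_rfl
    fun s' hF h => ⟨h.1, hs.congr fun r h₁ h₂ => hF.var r (by omega) ?_, h.2⟩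
  · simp [sidePrep, wpV, State.var_setVar, hs.x₁n, hs.x₁d, hs.x₂n, hs.x₂d, hs.y₁n, hs.y₁d, hs.y₂n, hs.y₂d, b,
      PolygonData.heightDen]
  · interval_cases r <;> rfl

theorem lt_min_ediv_iff {k : ℕ} {P : PolygonData k} (hd : P.DenPos) {u w : Fin k} (hx : P.x u < P.x w)
    (L i j : ℤ) (hi : P.x u ≤ i ∧ i ≤ P.x w) : min L (P.heightNum u w i / P.heightDen u w) < j ↔
      L < j ∨ ∃ z : ℝ, z < j ∧ !₂[(i : ℝ), z] ∈ _root_.segment ℝ (P.vertex u) (P.vertex w) := by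
  rw [min_lt_iff, Int.ediv_lt_iff_div_lt (hd.heightDen_pos hx)]
  simp only [hd.mem_segment_iff hx, hi, true_and]
  refine or_congr_right ⟨fun h => ⟨_, h, rfl⟩, ?_⟩
  rintro ⟨_, h, rfl⟩
  exact h

theorem le_max_ediv_iff {k : ℕ} {P : PolygonData k} (hd : P.DenPos) {u w : Fin k} (hx : P.x u < P.x w)
    (H i j : ℤ) (hi : P.x u ≤ i ∧ i ≤ P.x w) : j ≤ max H ((P.heightNum u w i - 1) / P.heightDen u w) ↔
      j ≤ H ∨ ∃ z : ℝ, j < z ∧ !₂[(i : ℝ), z] ∈ _root_.segment ℝ (P.vertex u) (P.vertex w) := by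
  rw [le_max_iff, Int.le_pred_ediv_iff (hd.heightDen_pos hx)]
  simp only [hd.mem_segment_iff hx, hi, true_and]
  refine or_congr_right ⟨fun h => ⟨_, h, rfl⟩, ?_⟩
  rintro ⟨_, h, rfl⟩
  exact h

/-- Each column takes part in the running minimum of ⌊z⌋ and the running maximum of ⌈z⌉ - 1, with z
the height of the side. In terms of integers `j` this adds the alternatives that a crossing lies
strictly below or strictly above `j`. -/
theorem sideColumns_spec {V B Y : ℕ} (hV : 16 ≤ V) (hB : V ^ 10 ≤ B) {k : ℕ} {P : PolygonData k}
    (hd : P.DenPos) {e u w : Fin k} (hx : P.x u < P.x w) {s : State} (hs : SideRegs s P e u w)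
    (hP : P.Bounded Y) (hY : 16 ≤ Y) (hYV : Y ^ 11 ≤ V) {n : ℕ} (hn : ∀ i, s.arr 0 i ≠ 0 → 0 ≤ i ∧ i ≤ n)
    (h0 : ∀ i, |s.arr 0 i| ≤ Y) (h1 : ∀ i, |s.arr 1 i| ≤ Y) (hlo : ∀ i, |s.arr 18 i| ≤ (Y : ℤ) ^ 11)
    (hhi : ∀ i, |s.arr 19 i| ≤ (Y : ℤ) ^ 11)
    {Z : ℤ} (hout : ∀ m, |s.arr 8 m| ≤ Z) (hZ : Z + (n + 1) * Y ^ 2 ≤ V) {N : ℕ}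
    (hN : P.xNum w / P.xDen w - (P.xNum u - 1) / P.xDen u ≤ N) :
    sideColumns.Spec B s (75 * N + 50) (fun s' =>
      (∀ j, |s'.arr 18 j| ≤ (Y : ℤ) ^ 11) ∧ (∀ j, |s'.arr 19 j| ≤ (Y : ℤ) ^ 11) ∧
      (∀ i j : ℤ, s'.arr 18 i < j ↔ s.arr 18 i < j ∨
        ∃ z : ℝ, z < j ∧ !₂[(i : ℝ), z] ∈ _root_.segment ℝ (P.vertex u) (P.vertex w)) ∧
      (∀ i j : ℤ, j ≤ s'.arr 19 i ↔ j ≤ s.arr 19 i ∨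
        ∃ z : ℝ, j < z ∧ !₂[(i : ℝ), z] ∈ _root_.segment ℝ (P.vertex u) (P.vertex w)) ∧
      ∀ m, s'.arr 8 m = s.arr 8 m + latticeSum (s.arr 0) (s.arr 1) n (P.directedPoints e u w) m) := by
  have hYV' : (Y : ℤ) ^ 11 ≤ V := by exact_mod_cast hYV
  have hY10 : (Y : ℤ) ^ 10 + 1 ≤ Y ^ 11 := by
    have : (1 : ℤ) ≤ Y ^ 10 := one_le_pow₀ (by omega)
    rw [pow_succ _ 10]
    nlinarith
  have hYY : 2 * (Y : ℤ) ≤ Y ^ 10 := by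
    have : (Y : ℤ) ^ 2 ≤ Y ^ 10 := pow_le_pow_right₀ (by omega) (by norm_num)
    nlinarith
  have hVB : (V : ℤ) ≤ B := by exact_mod_cast (Nat.le_self_pow (by norm_num) V).trans hB
  set x₀ := (P.xNum u - 1) / P.xDen u + 1 with hx₀
  set x₁ := P.xNum w / P.xDen w + 1 with hx₁
  have q₁ := hP.xNum_le u
  have q₂ := hP.xNum_le w
  have a₀ : |(P.xNum u - 1) / P.xDen u| ≤ Y + 1 :=
    (Int.abs_ediv_le_abs _ _).trans ((abs_sub _ _).trans (by simpa using q₁))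
  have a₁ : |P.xNum w / P.xDen w| ≤ Y := (Int.abs_ediv_le_abs _ _).trans q₂
  rw [abs_le] at a₀ a₁
  have hfl : ∀ z : ℤ, |z| ≤ Y → |P.heightNum u w z / P.heightDen u w| ≤ (Y : ℤ) ^ 11 ∧
      |(P.heightNum u w z - 1) / P.heightDen u w| ≤ (Y : ℤ) ^ 11 := fun z hz => by
    have b₁ := (abs_heightNum_le hP hY u w hz).1
    have := (abs_sub (P.heightNum u w z) 1).trans (add_le_add_left b₁ _)
    exact ⟨(Int.abs_ediv_le_abs _ _).trans (by omega), (Int.abs_ediv_le_abs _ _).trans (by simp at this; omega)⟩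
  refine Spec.mono (Spec.seq (sidePrep_spec hV hB hs hP (by omega)) fun s₁ F₁ ⟨hA, hR, h51, h52, h55, h53, h54⟩ =>
    Spec.forUp x₀ x₁ (fun t s' =>
      (∀ i, s'.arr 18 i = if x₀ ≤ i ∧ i < x₀ + t then
        min (s.arr 18 i) (P.heightNum u w i / P.heightDen u w) else s.arr 18 i) ∧
      (∀ i, s'.arr 19 i = if x₀ ≤ i ∧ i < x₀ + t then
        max (s.arr 19 i) ((P.heightNum u w i - 1) / P.heightDen u w) else s.arr 19 i) ∧
      ∀ m, s'.arr 8 m = s.arr 8 m + latticeSum (s.arr 0) (s.arr 1) n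
        {p ∈ P.directedPoints e u w | x₀ ≤ p.1 ∧ p.1 < x₀ + t} m) (fun _ => 70) (by decide) (by decide)
      (by decide) (by decide) (by decide) h53 h54 (by omega) (by rw [abs_le]; omega) (by rw [abs_le]; omega)
      ?_ ?_) ?_ ?_
  · rw [hA]
    refine ⟨fun i => by rw [if_neg (by omega)], fun i => by rw [if_neg (by omega)], fun m => ?_⟩
    rw [show {p ∈ P.directedPoints e u w | x₀ ≤ p.1 ∧ p.1 < x₀ + ((0 : ℕ) : ℤ)} = ∅ by
      ext p; simp; omega, latticeSum_empty, add_zero]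
  · rintro t ht s' h53' ⟨i₁, i₂, i₃⟩ hF
    have hz : |x₀ + t| ≤ (Y : ℤ) := by rw [abs_le]; omega
    have hR' : SideRegs s' P e u w := hR.congr fun r h₁ h₂ =>
      hF.var r (by omega) (by interval_cases r <;> rfl)
    have l₁ : s'.arr 18 (x₀ + t) = s.arr 18 (x₀ + t) := by rw [i₁, if_neg (by omega)]
    have l₂ : s'.arr 19 (x₀ + t) = s.arr 19 (x₀ + t) := by rw [i₂, if_neg (by omega)]
    have e₀ : s'.arr 0 = s.arr 0 := by rw [hF.arr _ (by decide), hA]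
    have e₁ : s'.arr 1 = s.arr 1 := by rw [hF.arr _ (by decide), hA]
    refine Spec.mono (Spec.seq (T' := 30) (profileStep_spec hV hB hR' hP hY hYV hz h53'
      (by rw [hF.var _ (by decide) (by decide), h51]) (by rw [hF.var _ (by decide) (by decide), h52])
      (by rw [hF.var _ (by decide) (by decide), h55])
      (by rw [l₁]; exact (hlo _).trans hYV') (by rw [l₂]; exact (hhi _).trans hYV'))
      fun s₂ F₂ ⟨j₁, j₂, j₃, j₄⟩ => ?_) le_rfl fun _ _ h => h
    have g₀ : s₂.arr 0 = s.arr 0 := by rw [F₂.arr _ (by decide), e₀]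
    have g₁ : s₂.arr 1 = s.arr 1 := by rw [F₂.arr _ (by decide), e₁]
    have g₈ : s₂.arr 8 = s'.arr 8 := by rw [F₂.arr _ (by decide)]
    refine Spec.mono (sidePoint_spec hV hB hd hx (hR'.congr fun r h₁ h₂ =>
      F₂.var r (by omega) (by interval_cases r <;> rfl)) hP (by omega) (by rw [g₀]; exact hn) hz
      (by rw [F₂.var _ (by decide) (by decide), h53']) j₁ j₂ (by rw [j₁]; exact (hfl _ hz).1.trans hYV')
      (by rw [j₂]; exact (hfl _ hz).2.trans hYV') (by rw [g₀]; exact fun i => (h0 i).trans (by omega))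
      (by rw [g₁]; exact fun i => (h1 i).trans (by omega)) fun m => ?_) le_rfl fun s₃ F₃ h₃ => ?_
    · rw [g₈, i₃]
      refine (abs_add_le _ _).trans ((add_le_add (hout m) (abs_latticeSum_le h0 h1 _ _ _)).trans hZ)
    · simp only [State.arr_setVar]
      rw [F₃.arr 18 (by decide), F₃.arr 19 (by decide)]
      refine ⟨fun i => ?_, fun i => ?_, fun m => ?_⟩
      · rw [j₃, l₁, i₁]
        push_cast
        split_ifs <;> first | rfl | omega | (subst i; rfl)
      · rw [j₄, l₂, i₂]
        push_cast
        split_ifs <;> first | rfl | omega | (subst i; rfl)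
      · rw [h₃, g₈, g₀, g₁, i₃, add_assoc, ← latticeSum_union]
        · congr 2
          ext p
          simp only [Set.mem_union, Set.mem_ofPred_eq, ← and_or_left]
          push_cast
          refine and_congr_right fun _ => ?_
          omega
        · rintro p ⟨-, h₁⟩ ⟨-, h₂⟩
          omega
  · simp
    omega
  · rintro s' - ⟨i₁, i₂, i₃⟩
    have hcol : ∀ i : ℤ, (x₀ ≤ i ∧ i < x₀ + (x₁ - x₀).toNat) ↔ P.x u ≤ i ∧ i ≤ P.x w := by
      intro i
      have e₁ := not_congr (hd.le_xCeil u i)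
      have e₂ := not_congr (hd.xFloor_lt w i)
      simp only [not_lt] at e₁ e₂
      rw [← e₁, ← e₂]
      omega
    refine ⟨fun i => ?_, fun i => ?_, fun i j => ?_, fun i j => ?_, fun m => ?_⟩
    · rw [i₁]
      split_ifs with hc
      · have := hlo i
        have := (hfl i (by rw [abs_le]; omega)).1
        rw [abs_le] at *
        omega
      · exact hlo i
    · rw [i₂]
      split_ifs with hc
      · have := hhi i
        have := (hfl i (by rw [abs_le]; omega)).2
        rw [abs_le] at *
        omega
      · exact hhi i
    · rw [i₁]
      split_ifs with hc
      · exact lt_min_ediv_iff hd hx _ i j ((hcol i).1 hc)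
      · rw [hcol] at hc
        simp only [hd.mem_segment_iff hx]
        exact ⟨Or.inl, fun h => h.elim id fun ⟨_, _, h₁, h₂, _⟩ => absurd ⟨h₁, h₂⟩ hc⟩
    · rw [i₂]
      split_ifs with hc
      · exact le_max_ediv_iff hd hx _ i j ((hcol i).1 hc)
      · rw [hcol] at hc
        simp only [hd.mem_segment_iff hx]
        exact ⟨Or.inl, fun h => h.elim id fun ⟨_, _, h₁, h₂, _⟩ => absurd ⟨h₁, h₂⟩ hc⟩
    · rw [i₃]
      congr 2
      ext p
      rw [Set.mem_ofPred_eq, hcol, and_iff_left_iff_imp]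
      rintro ⟨-, -, h⟩
      have := (hd.mem_openSegment_iff hx _ _).1 h
      exact ⟨this.1.le, this.2.1.le⟩

end WordRAM

/-! ### Vertical sides -/

namespace WordRAM

open Cmd Ex

/-- Count the lattice points on a vertical segment. -/
def sideVertical : Cmd :=
  .assign 57 (v 42 / v 43) ;;
  .assign 53 (v 44 / v 45 + c 1) ;;
  .assign 54 ((v 48 - c 1) / v 49 + c 1) ;;
  .ite (v 57 * v 43) (v 42) .skip (.ite (c 0) (v 50)
    (forUp 53 54 (addCell (v 57 + v 53) (ld 0 (v 57) * ld 1 (v 53)))) .skip)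

/-- The first condition says that the common first coordinate is an integer, since the product of
floor and denominator never exceeds the numerator. The bounds for the second coordinate already
exclude a segment that is directed downwards. -/
theorem _root_.PolygonData.mem_directedPoints_vertical {k : ℕ} {P : PolygonData k} (hd : P.DenPos) (e : Fin k)
    {u w : Fin k} (hx : P.x u = P.x w) (p : ℤ × ℤ) :
    p ∈ P.directedPoints e u w ↔ (¬ P.xNum u / P.xDen u * P.xDen u < P.xNum u ∧ P.sideMem e = true) ∧
      p.1 = P.xNum u / P.xDen u ∧ P.yNum u / P.yDen u < p.2 ∧ p.2 ≤ (P.yNum w - 1) / P.yDen w := by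
  have e₁ : (p.1 : ℝ) = P.x u ↔
      ¬ P.xNum u / P.xDen u * P.xDen u < P.xNum u ∧ p.1 = P.xNum u / P.xDen u := by
    have h₁ := hd.x u
    have h₂ : P.xNum u / P.xDen u * P.xDen u ≤ P.xNum u := Int.ediv_mul_le _ h₁.ne'
    rw [PolygonData.x_eq, eq_div_iff (hd.xDen_pos u).ne']
    have h₃ : (p.1 : ℝ) * P.xDen u = P.xNum u ↔ p.1 * P.xDen u = P.xNum u := by exact_mod_cast Iff.rfl
    rw [h₃]
    constructor
    · intro h
      have h₄ : P.xNum u / P.xDen u = p.1 := by rw [← h, Int.mul_ediv_cancel _ h₁.ne']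
      rw [h₄]
      exact ⟨by omega, rfl⟩
    · rintro ⟨h, h'⟩
      rw [h']
      omega
  rw [hd.yFloor_lt, hd.le_yCeil]
  simp only [PolygonData.directedPoints, Set.mem_ofPred_eq, hx, lt_irrefl, false_or, true_and]
  constructor
  · rintro ⟨h₁, h₂, h₃⟩
    obtain ⟨k₁, k₂⟩ := (PolygonData.mem_openSegment_of_x_eq hx h₂ _ _).1 h₃
    exact ⟨⟨(e₁.1 k₁).1, h₁⟩, (e₁.1 k₁).2, k₂⟩
  · rintro ⟨⟨h₁, h₂⟩, h₃, h₄⟩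
    have hy := h₄.1.trans h₄.2
    exact ⟨h₂, hy, (PolygonData.mem_openSegment_of_x_eq hx hy _ _).2 ⟨e₁.2 ⟨h₁, h₃⟩, h₄⟩⟩

theorem sideVertical_spec {V B Y : ℕ} (hV : 16 ≤ V) (hB : V ^ 10 ≤ B) {k : ℕ} {P : PolygonData k}
    (hd : P.DenPos) {e u w : Fin k} (hx : P.x u = P.x w) {s : State} (hs : SideRegs s P e u w)
    (hP : P.Bounded Y) (hYV : Y + 2 ≤ V) {n : ℕ} (hn : ∀ i, s.arr 0 i ≠ 0 → 0 ≤ i ∧ i ≤ n)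
    (h0 : ∀ i, |s.arr 0 i| ≤ Y) (h1 : ∀ i, |s.arr 1 i| ≤ Y)
    {Z : ℤ} (hout : ∀ m, |s.arr 8 m| ≤ Z) (hZ : Z + (n + 1) * Y ^ 2 ≤ V) {N : ℕ}
    (hN : (P.yNum w - 1) / P.yDen w - P.yNum u / P.yDen u ≤ N) :
    sideVertical.Spec B s (75 * N + 50) (fun s' =>
      ∀ m, s'.arr 8 m = s.arr 8 m + latticeSum (s.arr 0) (s.arr 1) n (P.directedPoints e u w) m) := by
  have hYV' : (Y : ℤ) + 2 ≤ V := by exact_mod_cast hYV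
  have hVB : (V : ℤ) ≤ B := by exact_mod_cast (Nat.le_self_pow (by norm_num) V).trans hB
  have q₁ := hP.xNum_le u
  have q₂ := hP.xDen_le u
  have q₃ := hP.yNum_le u
  have q₄ := hP.yDen_le u
  have q₅ := hP.yNum_le w
  have q₆ := hP.yDen_le w
  have a₀ : |P.xNum u / P.xDen u| ≤ Y := (Int.abs_ediv_le_abs _ _).trans q₁
  have a₁ : |P.yNum u / P.yDen u| ≤ Y := (Int.abs_ediv_le_abs _ _).trans q₃
  have a₂ : |(P.yNum w - 1) / P.yDen w| ≤ Y + 1 :=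
    (Int.abs_ediv_le_abs _ _).trans ((abs_sub _ _).trans (by simpa using q₅))
  rw [abs_le] at a₁ a₂
  have hmem := PolygonData.mem_directedPoints_vertical hd e hx
  have hempty : ¬ (¬ P.xNum u / P.xDen u * P.xDen u < P.xNum u ∧ P.sideMem e = true) →
      P.directedPoints e u w = ∅ := fun h => by
    ext p
    rw [hmem]
    simp only [Set.mem_empty_iff_false, iff_false]
    exact fun h' => h h'.1
  set f := P.xNum u / P.xDen u with hf
  set y₀ := P.yNum u / P.yDen u + 1 with hy₀
  set y₁ := (P.yNum w - 1) / P.yDen w + 1 with hy₁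
  have hm : |s.var 50| ≤ V := by rw [hs.mark]; split_ifs <;> simp; omega
  refine Spec.mono (Spec.assign_seq hV hB f (by decide) ?_ ?_ <| Spec.assign_seq hV hB y₀ (by decide) ?_ ?_ <|
    Spec.assign_seq hV hB y₁ (by decide) ?_ ?_ <| Spec.ite (T := 75 * N + 20) ?_ ?_ ?_ ?_) ?_ fun _ _ h => h
  · simp [hs.x₁n, hs.x₁d]; omega
  · simp [hs.x₁n, hs.x₁d, hf]
  · simp [hs.y₁n, hs.y₁d, State.var_setVar]; omega
  · simp [hs.y₁n, hs.y₁d, hy₀, State.var_setVar]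
  · simp [hs.y₂n, hs.y₂d, State.var_setVar]; omega
  · simp [hs.y₂n, hs.y₂d, hy₁, State.var_setVar]
  · refine ok_of_leafOk hV hB ?_ (by decide)
    simp [State.var_setVar, hs.x₁d]
    omega
  · simp [Ex.ok]
  · intro hlt
    simp only [eval_mul, eval_v, State.var_setVar] at hlt
    norm_num [hs.x₁n, hs.x₁d] at hlt
    refine Spec.of_wpV hV hB (Nat.zero_le _) ?_
    intro m
    rw [hempty fun h => h.1 hlt, latticeSum_empty, add_zero]
    rfl
  · intro hlt
    simp only [eval_mul, eval_v, State.var_setVar] at hlt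
    norm_num [hs.x₁n, hs.x₁d] at hlt
    rw [← not_lt] at hlt
    refine Spec.mono (Spec.ite (T := 75 * N + 10) ?_ ?_ ?_ ?_) (by simp [Ex.cost]; omega) fun _ _ h => h
    · refine ok_of_leafOk hV hB ?_ (by decide); simp
    · simp [Ex.ok]
    · intro hmk
      simp only [eval_c, eval_v, State.var_setVar] at hmk
      norm_num [hs.mark] at hmk
      have hM : P.sideMem e = true := by
        by_contra hM
        simp [hM] at hmk
      refine Spec.mono (Spec.forUp y₀ y₁ (fun t s' => ∀ m, s'.arr 8 m = s.arr 8 m +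
        latticeSum (s.arr 0) (s.arr 1) n {p | p.1 = f ∧ y₀ ≤ p.2 ∧ p.2 < y₀ + t} m) (fun _ => 70) (by decide)
        (by decide) rfl rfl (by decide) (by simp [State.var_setVar]) (by simp [State.var_setVar]) (by omega)
        (by rw [abs_le]; omega) (by rw [abs_le]; omega) ?_ ?_) ?_ ?_
      · intro m
        rw [show {p : ℤ × ℤ | p.1 = f ∧ y₀ ≤ p.2 ∧ p.2 < y₀ + ((0 : ℕ) : ℤ)} = ∅ by ext p; simp,
          latticeSum_empty, add_zero]
        rfl
      · rintro t ht s' h53' i₁ hF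
        have e₀ : s'.arr 0 = s.arr 0 := by rw [hF.arr _ (by decide)]; rfl
        have e₁ : s'.arr 1 = s.arr 1 := by rw [hF.arr _ (by decide)]; rfl
        have h57 : s'.var 57 = f := by
          rw [hF.var _ (by decide) (by decide)]; simp [State.var_setVar]
        have hz : |y₀ + t| ≤ (V : ℤ) := by rw [abs_le]; omega
        have c₈ : ∀ m, |s'.arr 8 m| ≤ V := by
          intro m
          rw [i₁]
          exact (abs_add_le _ _).trans ((add_le_add (hout m) (abs_latticeSum_le h0 h1 _ _ _)).trans hZ)
        have c₀ : |s.arr 0 f| ≤ V := (h0 _).trans (by omega)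
        have c₁ : |s.arr 1 (y₀ + t)| ≤ V := (h1 _).trans (by omega)
        have c₂ : |f| ≤ V := by omega
        refine Spec.of_wpV hV hB (by decide) ?_
        simp only [addCell, wpV, deg_v, deg_add, deg_mul, deg_ld, leafOk_v, leafOk_add, leafOk_mul, leafOk_ld,
          eval_v, eval_add, eval_mul, eval_ld, h53', h57, e₀, e₁, c₀, c₁, c₂, hz, c₈]
        refine ⟨by decide, by decide, by decide, fun m => ?_⟩
        simp only [State.arr_setVar, State.arr_setArr, true_and]
        have hU : {p : ℤ × ℤ | p.1 = f ∧ y₀ ≤ p.2 ∧ p.2 < y₀ + ((t + 1 : ℕ) : ℤ)} =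
            {p | p.1 = f ∧ y₀ ≤ p.2 ∧ p.2 < y₀ + t} ∪ {(f, y₀ + t)} := by
          ext ⟨i, j⟩
          simp only [Set.mem_union, Set.mem_ofPred_eq, Set.mem_singleton_iff, Prod.mk.injEq]
          push_cast
          omega
        rw [hU, latticeSum_union, latticeSum_singleton _ hn, i₁, i₁]
        · split_ifs with hc
          · subst m; ring
          · ring
        · rintro p ⟨-, h⟩ hp
          rw [Set.mem_singleton_iff] at hp
          rw [hp] at h
          omega
      · simp
        omega
      · intro s' _ i₁ m
        rw [i₁]
        congr 2
        ext p
        rw [hmem, Set.mem_ofPred_eq]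
        simp only [hlt, hM, not_false_eq_true, true_and]
        omega
    · intro hmk
      simp only [eval_c, eval_v, State.var_setVar] at hmk
      norm_num [hs.mark] at hmk
      have hM : ¬ P.sideMem e = true := by
        intro hM
        simp [hM] at hmk
      refine Spec.of_wpV hV hB (Nat.zero_le _) ?_
      intro m
      rw [hempty fun h => hM h.2, latticeSum_empty, add_zero]
      rfl
  · have k₁ : (v 42 / v 43).cost = 1 := rfl
    have k₂ : (v 44 / v 45 + c 1).cost = 3 := rfl
    have k₃ : ((v 48 - c 1) / v 49 + c 1).cost = 5 := rfl
    have k₄ : (v 57 * v 43).cost = 1 := rfl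
    have k₅ : (v 42).cost = 0 := rfl
    omega

end WordRAM

/-! ### Reading the sides from memory -/

namespace WordRAM

open Cmd Ex

/-- The input is still in memory. -/
structure Loaded (s : State) {n k : ℕ} (a b : Fin (n + 1) → ℤ) (P : PolygonData k) : Prop where
  arr : ∀ A < 8, s.arr A = (inputState a b P).arr A
  one : s.var 1 = k

section

variable {n k : ℕ} {a b : Fin (n + 1) → ℤ} {P : PolygonData k} {s s' : State}

theorem Loaded.of_frame (h : Loaded s a b P) {R : Cmd} (hF : R.Frame s s')
    (hA : ∀ A < 8, R.setsArr A = false) (h1 : R.setsVar 1 = false) : Loaded s' a b P :=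
  ⟨fun A hA' => (hF.arr A (hA A hA')).trans (h.arr A hA'), (hF.var 1 (by norm_num) h1).trans h.one⟩

theorem Loaded.xNum (h : Loaded s a b P) (i : Fin k) : s.arr 2 (i : ℕ) = P.xNum i := by
  rw [h.arr 2 (by norm_num)]; exact toArray_natCast _ i

theorem Loaded.xDen (h : Loaded s a b P) (i : Fin k) : s.arr 3 (i : ℕ) = P.xDen i := by
  rw [h.arr 3 (by norm_num)]; exact toArray_natCast _ i

theorem Loaded.yNum (h : Loaded s a b P) (i : Fin k) : s.arr 4 (i : ℕ) = P.yNum i := by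
  rw [h.arr 4 (by norm_num)]; exact toArray_natCast _ i

theorem Loaded.yDen (h : Loaded s a b P) (i : Fin k) : s.arr 5 (i : ℕ) = P.yDen i := by
  rw [h.arr 5 (by norm_num)]; exact toArray_natCast _ i

theorem Loaded.sideMem (h : Loaded s a b P) (i : Fin k) :
    s.arr 6 (i : ℕ) = if P.sideMem i then 1 else 0 := by
  rw [h.arr 6 (by norm_num)]; exact toArray_natCast (fun i => if P.sideMem i then 1 else 0) i

theorem Loaded.vertexMem (h : Loaded s a b P) (i : Fin k) :
    s.arr 7 (i : ℕ) = if P.vertexMem i then 1 else 0 := by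
  rw [h.arr 7 (by norm_num)]; exact toArray_natCast (fun i => if P.vertexMem i then 1 else 0) i

theorem Loaded.fst (h : Loaded s a b P) : s.arr 0 = toArray a := h.arr 0 (by norm_num)

theorem Loaded.snd (h : Loaded s a b P) : s.arr 1 = toArray b := h.arr 1 (by norm_num)

end

/-- Load the data of a directed segment. -/
def loadSide : Cmd :=
  .assign 42 (ld 2 (v 40)) ;; .assign 43 (ld 3 (v 40)) ;; .assign 44 (ld 4 (v 40)) ;; .assign 45 (ld 5 (v 40)) ;;
  .assign 46 (ld 2 (v 41)) ;; .assign 47 (ld 3 (v 41)) ;; .assign 48 (ld 4 (v 41)) ;; .assign 49 (ld 5 (v 41)) ;;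
  .assign 50 (ld 6 (v 39))

theorem loadSide_spec {V B Y : ℕ} (hV : 16 ≤ V) (hB : V ^ 10 ≤ B) {n k : ℕ} {a b : Fin (n + 1) → ℤ}
    {P : PolygonData k} (hP : P.Bounded Y) (hYV : Y ≤ V) (hkV : k ≤ V) {s : State} (hs : Loaded s a b P)
    {e u w : Fin k} (he : s.var 39 = (e : ℕ)) (hu : s.var 40 = (u : ℕ)) (hw : s.var 41 = (w : ℕ)) :
    loadSide.Spec B s 40 (fun s' => SideRegs s' P e u w ∧ s'.arr = s.arr) := by
  have hYV' : (Y : ℤ) ≤ V := by exact_mod_cast hYV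
  have b₀ : ∀ i, (|P.xNum i| ≤ V ∧ |P.xDen i| ≤ V) ∧ |P.yNum i| ≤ V ∧ |P.yDen i| ≤ V := fun i =>
    ⟨⟨(hP.xNum_le i).trans hYV', (hP.xDen_le i).trans hYV'⟩, (hP.yNum_le i).trans hYV',
      (hP.yDen_le i).trans hYV'⟩
  have b₁ : ∀ i : Fin k, |((i : ℕ) : ℤ)| ≤ V := fun i => by
    rw [Nat.abs_cast]; have := i.2; exact_mod_cast (by omega)
  have b₂ : |s.arr 6 (e : ℕ)| ≤ V := by rw [hs.sideMem]; split_ifs <;> simp; omega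
  refine Spec.of_wpV hV hB (by decide) ?_
  simp only [loadSide, wpV, deg_ld, deg_v, leafOk_ld, leafOk_v, eval_ld, eval_v, State.var_setVar,
    State.arr_setVar, he, hu, hw, hs.xNum, hs.xDen, hs.yNum, hs.yDen, b₀, b₁, b₂]
  norm_num [he, hu, hw, hs.xNum, hs.xDen, hs.yNum, hs.yDen, b₀, b₁, b₂]
  have h₁ : ∀ i : Fin k, (i : ℕ) ≤ V := fun i => i.2.le.trans hkV
  refine ⟨h₁ u, h₁ w, h₁ e, ?_⟩
  constructor <;> simp [State.var_setVar, hs.sideMem]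

/-- Process a side in one of its two directions. -/
def directedSide : Cmd :=
  loadSide ;; .ite (v 42 * v 47) (v 46 * v 43) sideColumns (.ite (v 46 * v 43) (v 42 * v 47) .skip sideVertical)

/-- What the pass over the lattice points on a directed segment does to the profile and the output. -/
structure SideStep (s s' : State) {n k : ℕ} (a b : Fin (n + 1) → ℤ) (P : PolygonData k) (Y : ℕ)
    (S : Set (ℤ × ℤ)) (R : ℤ → ℝ → Prop) : Prop where
  lo_le : ∀ j, |s'.arr 18 j| ≤ (Y : ℤ) ^ 11
  hi_le : ∀ j, |s'.arr 19 j| ≤ (Y : ℤ) ^ 11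
  lo : ∀ i j : ℤ, s'.arr 18 i < j ↔ s.arr 18 i < j ∨ ∃ z : ℝ, z < j ∧ R i z
  hi : ∀ i j : ℤ, j ≤ s'.arr 19 i ↔ j ≤ s.arr 19 i ∨ ∃ z : ℝ, j < z ∧ R i z
  out : ∀ m, s'.arr 8 m = s.arr 8 m + latticeSum (toArray a) (toArray b) n S m

/-- A segment directed to the left is skipped, a vertical one only contributes lattice points and
leaves the profile unchanged. The number of rounds is at most the length of the segment plus one. -/
theorem directedSide_spec {V B Y : ℕ} (hV : 16 ≤ V) (hB : V ^ 10 ≤ B) {n k : ℕ} {a b : Fin (n + 1) → ℤ}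
    {P : PolygonData k} (hd : P.DenPos) (hP : P.Bounded Y) (ha : ∀ i, |a i| ≤ Y) (hb : ∀ i, |b i| ≤ Y)
    (hY : 16 ≤ Y) (hYV : Y ^ 11 ≤ V) (hkV : k ≤ V) {s : State}
    (hs : Loaded s a b P) {e u w : Fin k} (he : s.var 39 = (e : ℕ)) (hu : s.var 40 = (u : ℕ))
    (hw : s.var 41 = (w : ℕ)) (hlo : ∀ j, |s.arr 18 j| ≤ (Y : ℤ) ^ 11) (hhi : ∀ j, |s.arr 19 j| ≤ (Y : ℤ) ^ 11)
    {Z : ℤ} (hout : ∀ m, |s.arr 8 m| ≤ Z) (hZ : Z + (n + 1) * Y ^ 2 ≤ V) {N : ℕ}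
    (hN : dist (P.vertex u) (P.vertex w) + 1 ≤ N) :
    directedSide.Spec B s (75 * N + 110) (fun s' => SideStep s s' a b P Y (P.directedPoints e u w)
      fun i z => P.x u < P.x w ∧ !₂[(i : ℝ), z] ∈ _root_.segment ℝ (P.vertex u) (P.vertex w)) := by
  have hYV' : (Y : ℤ) ^ 11 ≤ V := by exact_mod_cast hYV
  have hY2 : Y + 2 ≤ V := by
    have : Y ^ 2 ≤ Y ^ 11 := Nat.pow_le_pow_right (by omega) (by norm_num)
    nlinarith
  refine Spec.mono (Spec.seq (loadSide_spec hV hB hP (by omega) hkV hs he hu hw) fun s₁ F₁ ⟨hR, hA⟩ =>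
    Spec.ite (T := 75 * N + 60) ?_ ?_ ?_ ?_) ?_ fun _ _ h => h
  · refine ok_of_leafOk hV hB ?_ (by decide)
    simp only [leafOk_mul, leafOk_v, hR.x₁n, hR.x₂d]
    have := hP.xNum_le u
    have := hP.xDen_le w
    omega
  · refine ok_of_leafOk hV hB ?_ (by decide)
    simp only [leafOk_mul, leafOk_v, hR.x₂n, hR.x₁d]
    have := hP.xNum_le w
    have := hP.xDen_le u
    omega
  · intro hx
    simp only [eval_mul, eval_v, hR.x₁n, hR.x₂d, hR.x₂n, hR.x₁d] at hx
    rw [← hd.x_lt_iff] at hx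
    refine Spec.mono (sideColumns_spec hV hB hd hx hR hP hY hYV (n := n)
      (by rw [hA, hs.fst]; exact toArray_ne_zero a) (by rw [hA, hs.fst]; exact abs_toArray_le ha)
      (by rw [hA, hs.snd]; exact abs_toArray_le hb) (by rwa [hA]) (by rwa [hA]) (by rwa [hA]) hZ (N := N) ?_)
      (by omega) ?_
    -- The number of scanned columns is ⌊x₂⌋ - ⌈x₁⌉ + 1, hence at most the horizontal extent plus
    -- one.
    · have h₁ := not_congr (hd.le_xCeil u ((P.xNum u - 1) / P.xDen u + 1))
      have h₂ := not_congr (hd.xFloor_lt w (P.xNum w / P.xDen w))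
      have h₁ := h₁.1 (by omega)
      have h₂ := h₂.1 (by omega)
      have h₃ := (neg_abs_le _).trans' (neg_le_neg (PolygonData.abs_coord_sub_le (P.vertex u) (P.vertex w) 0))
      simp only [PolygonData.x] at h₁ h₂
      have : ((P.xNum w / P.xDen w - (P.xNum u - 1) / P.xDen u : ℤ) : ℝ) ≤ N := by
        push_cast at *
        linarith
      exact_mod_cast this
    · rintro s' F₂ ⟨i₁, i₂, i₃, i₄, i₅⟩
      rw [hA] at i₃ i₄ i₅
      rw [hs.fst, hs.snd] at i₅
      simp only [hx, true_and]
      exact ⟨i₁, i₂, i₃, i₄, i₅⟩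
  · intro hx
    simp only [eval_mul, eval_v, hR.x₁n, hR.x₂d, hR.x₂n, hR.x₁d] at hx
    rw [← hd.x_lt_iff] at hx
    refine Spec.mono (Spec.ite (T := 75 * N + 50) ?_ ?_ ?_ ?_) (show 1 + 1 + 1 + (75 * N + 50) ≤ _ by omega)
      fun _ _ h => h
    · refine ok_of_leafOk hV hB ?_ (by decide)
      simp only [leafOk_mul, leafOk_v, hR.x₂n, hR.x₁d]
      have := hP.xNum_le w
      have := hP.xDen_le u
      omega
    · refine ok_of_leafOk hV hB ?_ (by decide)
      simp only [leafOk_mul, leafOk_v, hR.x₁n, hR.x₂d]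
      have := hP.xNum_le u
      have := hP.xDen_le w
      omega
    · intro hx'
      simp only [eval_mul, eval_v, hR.x₁n, hR.x₂d, hR.x₂n, hR.x₁d] at hx'
      rw [← hd.x_lt_iff] at hx'
      have hE : P.directedPoints e u w = ∅ := by
        ext p
        simp [PolygonData.directedPoints, hx, hx'.ne']
      refine Spec.of_wpV hV hB (Nat.zero_le _) ?_
      simp only [hx, false_and, and_false, exists_false, hE]
      constructor <;> simp [hA, hlo, hhi, latticeSum_empty]
    · intro hx'
      simp only [eval_mul, eval_v, hR.x₁n, hR.x₂d, hR.x₂n, hR.x₁d] at hx'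
      rw [← hd.x_lt_iff] at hx'
      refine Spec.mono (sideVertical_spec hV hB hd (le_antisymm (not_lt.1 hx') (not_lt.1 hx)) hR hP hY2 (n := n)
        (by rw [hA, hs.fst]; exact toArray_ne_zero a) (by rw [hA, hs.fst]; exact abs_toArray_le ha)
        (by rw [hA, hs.snd]; exact abs_toArray_le hb) (by rwa [hA]) hZ (N := N) ?_) le_rfl ?_
      · have h₁ := (hd.yFloor_lt u (P.yNum u / P.yDen u + 1)).1 (by omega)
        have h₂ := (hd.le_yCeil w ((P.yNum w - 1) / P.yDen w)).1 le_rfl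
        have h₃ := (neg_abs_le _).trans' (neg_le_neg (PolygonData.abs_coord_sub_le (P.vertex u) (P.vertex w) 1))
        simp only [PolygonData.y] at h₁ h₂
        have : (((P.yNum w - 1) / P.yDen w - P.yNum u / P.yDen u : ℤ) : ℝ) ≤ N := by
          push_cast at *
          linarith
        exact_mod_cast this
      · rintro s' F₂ i₁
        simp only [hx, false_and]
        rw [hA, hs.fst, hs.snd] at i₁
        constructor
        · rw [F₂.arr _ (by decide), hA]; exact hlo
        · rw [F₂.arr _ (by decide), hA]; exact hhi
        · rw [F₂.arr _ (by decide), hA]; simp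
        · rw [F₂.arr _ (by decide), hA]; simp
        · exact i₁
  · have k₁ : (v 42 * v 47).cost = 1 := rfl
    have k₂ : (v 46 * v 43).cost = 1 := rfl
    omega

end WordRAM

/-! ### The pass over all sides -/

namespace WordRAM

open Cmd Ex

/-- Process a side in both directions. -/
def sideBody : Cmd :=
  .assign 40 (v 39) ;; .ite (v 39 + c 1) (v 1) (.assign 41 (v 39 + c 1)) (.assign 41 (c 0)) ;; directedSide ;;
  .assign 40 (v 41) ;; .assign 41 (v 39) ;; directedSide

/-- Process all sides. -/
def sidePass : Cmd := .assign 39 (c 0) ;; forUp 39 1 sideBody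

section

variable {V B Y : ℕ} {n k : ℕ} {a b : Fin (n + 1) → ℤ} {P : PolygonData k} {σ : ℝ}

theorem sideBody_spec (hV : 16 ≤ V) (hB : V ^ 10 ≤ B) (hO : P.Oriented σ)
    (hd : P.DenPos) (hP : P.Bounded Y) (ha : ∀ i, |a i| ≤ Y) (hb : ∀ i, |b i| ≤ Y)
    (hY : 16 ≤ Y) (hYV : Y ^ 11 ≤ V) (hkV : k ≤ V) {s : State}
    (hs : Loaded s a b P) {e : Fin k} (he : s.var 39 = (e : ℕ))
    (hlo : ∀ j, |s.arr 18 j| ≤ (Y : ℤ) ^ 11) (hhi : ∀ j, |s.arr 19 j| ≤ (Y : ℤ) ^ 11)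
    {Z : ℤ} (hout : ∀ m, |s.arr 8 m| ≤ Z) (hZ : Z + 2 * ((n + 1) * Y ^ 2) ≤ V) {N : ℕ}
    (hN : dist (P.vertex e) (P.vertex (finRotate k e)) + 1 ≤ N) :
    sideBody.Spec B s (150 * N + 240) (fun s' => SideStep s s' a b P Y
      {p | P.sideMem e = true ∧
        !₂[(p.1 : ℝ), (p.2 : ℝ)] ∈ openSegment ℝ (P.vertex e) (P.vertex (finRotate k e))}
      fun i z => P.x e ≠ P.x (finRotate k e) ∧
        !₂[(i : ℝ), z] ∈ _root_.segment ℝ (P.vertex e) (P.vertex (finRotate k e))) := by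
  have hek : ((e : ℕ) : ℤ) < k := by exact_mod_cast e.2
  have hkV' : (k : ℤ) ≤ V := by exact_mod_cast hkV
  have hnY : (0 : ℤ) ≤ (n + 1) * (Y : ℤ) ^ 2 := by positivity
  have hnY' : ∀ m, |latticeSum (toArray a) (toArray b) n (P.directedPoints e e (finRotate k e)) m| ≤
      (n + 1) * (Y : ℤ) ^ 2 := fun m => abs_latticeSum_le (abs_toArray_le ha) (abs_toArray_le hb) _ _ _
  obtain ⟨q, hq⟩ : ∃ q, q = finRotate k e := ⟨_, rfl⟩
  have hqe : ((q : ℕ) : ℤ) = if (e : ℕ) + 1 < k then ((e : ℕ) : ℤ) + 1 else 0 := by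
    rw [hq, coe_finRotate_eq]; split_ifs <;> simp
  have hqk := q.2
  have bq : |((q : ℕ) : ℤ)| ≤ V := by rw [Nat.abs_cast]; omega
  have be : |((e : ℕ) : ℤ)| ≤ V := by rw [Nat.abs_cast]; omega
  refine Spec.mono (Spec.assign_seq hV hB (e : ℕ) (by decide) (by simp [he]; omega) (by simp [he]) <|
    Spec.seq (T := 10) (Q := fun s' => s'.var 41 = (q : ℕ) ∧ s'.arr = s.arr)
      (Spec.of_wpV hV hB (by decide) ?_) fun s₁ F₁ ⟨h₁, A₁⟩ => ?_) (T := 2 + (10 + (150 * N + 224)))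
      (by omega) fun _ _ h => h
  · simp only [wpV, deg_add, deg_v, deg_c, leafOk_add, leafOk_v, leafOk_c, eval_add, eval_v, eval_c,
      State.var_setVar, State.arr_setVar, hqe]
    have h₂ : |(k : ℤ)| ≤ V := by rw [Nat.abs_cast]; omega
    norm_num [he, hs.one]
    have h₃ : (e : ℕ) ≤ V := by omega
    exact ⟨h₃, hkV, fun h => ⟨h₃, fun _ => by omega⟩, fun h _ => by omega⟩
  · have L₁ : Loaded s₁ a b P :=
      ⟨fun A hA => by rw [A₁]; exact hs.arr A hA, by
        rw [F₁.var _ (by decide) (by decide)]; simp [State.var_setVar, hs.one]⟩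
    have e₁ : s₁.var 39 = (e : ℕ) := by
      rw [F₁.var _ (by decide) (by decide)]; simp [State.var_setVar, he]
    have u₁ : s₁.var 40 = (e : ℕ) := by
      rw [F₁.var _ (by decide) (by decide)]; simp [State.var_setVar]
    refine Spec.mono (Spec.seq (directedSide_spec hV hB hd hP ha hb hY hYV hkV
      (e := e) (u := e) (w := q) (Z := Z) (N := N) L₁ e₁ u₁ h₁ (by rwa [A₁]) (by rwa [A₁])
      (by rwa [A₁]) (by omega) (by rwa [hq])) fun s₂ F₂ h₂ => 
      Spec.assign_seq hV hB (q : ℕ) (by decide) ?_ ?_ <| Spec.assign_seq hV hB (e : ℕ) (by decide) ?_ ?_ <|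
      Spec.mono (directedSide_spec hV hB hd hP ha hb hY hYV hkV
        (s := (s₂.setVar 40 (q : ℕ)).setVar 41 (e : ℕ)) (e := e) (u := q) (w := e) (Z := Z + (n + 1) * Y ^ 2) (N := N) ?_ ?_ ?_ ?_ h₂.lo_le h₂.hi_le ?_ (by linarith)
        (by rwa [dist_comm, hq])) le_rfl fun s₃ F₃ h₃ => ?_)
        (show 75 * N + 110 + (2 + (2 + (75 * N + 110))) ≤ _ by omega) fun _ _ h => h
    · simp only [leafOk_v]
      rw [F₂.var _ (by decide) (by decide), h₁]
      exact ⟨by norm_num, bq⟩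
    · rw [eval_v, F₂.var _ (by decide) (by decide), h₁]
    · simp only [leafOk_v, State.var_setVar]
      norm_num
      rw [F₂.var _ (by decide) (by decide), e₁]
      exact be
    · simp only [eval_v, State.var_setVar]
      norm_num
      rw [F₂.var _ (by decide) (by decide), e₁]
    · exact ⟨(L₁.of_frame F₂ (by decide) (by decide)).arr, by
        rw [State.var_setVar, State.var_setVar]
        exact (L₁.of_frame F₂ (by decide) (by decide)).one⟩
    · simp only [State.var_setVar]
      norm_num
      rw [F₂.var _ (by decide) (by decide), e₁]
    · simp [State.var_setVar]
    · simp [State.var_setVar]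
    · intro m
      rw [State.arr_setVar, State.arr_setVar, h₂.out, A₁, hq]
      exact (abs_add_le _ _).trans (add_le_add (hout m) (hnY' m))
    · have l := h₃.lo
      have r := h₃.hi
      have o := h₃.out
      simp only [State.arr_setVar, h₂.lo, h₂.hi, h₂.out, A₁] at l r o
      -- Only the direction to the right contributes crossings; both directions together give the
      -- side if it is not vertical.
      have hR : ∀ (i : ℤ) (z : ℝ), (P.x e < P.x q ∧ !₂[(i : ℝ), z] ∈ _root_.segment ℝ (P.vertex e) (P.vertex q)) ∨
          (P.x q < P.x e ∧ !₂[(i : ℝ), z] ∈ _root_.segment ℝ (P.vertex q) (P.vertex e)) ↔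
          P.x e ≠ P.x q ∧ !₂[(i : ℝ), z] ∈ _root_.segment ℝ (P.vertex e) (P.vertex q) := by
        intro i z
        rw [segment_symm ℝ (P.vertex q), ← or_and_right, ← ne_iff_lt_or_gt]
      refine ⟨h₃.lo_le, h₃.hi_le, fun i j => ?_, fun i j => ?_, fun m => ?_⟩
      · rw [l, ← hq, or_assoc, ← exists_or]
        simp only [← and_or_left, hR]
      · rw [r, ← hq, or_assoc, ← exists_or]
        simp only [← and_or_left, hR]
      · rw [o, hO.latticeSum_side, ← hq, add_assoc]

theorem sidePass_spec (hV : 16 ≤ V) (hB : V ^ 10 ≤ B) (hO : P.Oriented σ)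
    (hd : P.DenPos) (hP : P.Bounded Y) (ha : ∀ i, |a i| ≤ Y) (hb : ∀ i, |b i| ≤ Y)
    (hY : 16 ≤ Y) (hYV : Y ^ 11 ≤ V) (hkV : k ≤ V) {s : State} (hs : Loaded s a b P)
    (hlo : ∀ j, |s.arr 18 j| ≤ (Y : ℤ) ^ 11) (hhi : ∀ j, |s.arr 19 j| ≤ (Y : ℤ) ^ 11)
    {Z : ℤ} (hout : ∀ m, |s.arr 8 m| ≤ Z) (hZ : Z + 3 * ((n + 1) * Y ^ 2) ≤ V) (N : Fin k → ℕ)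
    (hN : ∀ e, dist (P.vertex e) (P.vertex (finRotate k e)) + 1 ≤ N e) :
    sidePass.Spec B s (∑ e, (150 * N e + 245) + 10) (fun s' => SideStep s s' a b P Y (P.sidePoints k)
      fun i z => P.Crosses i z) := by
  have hVB : (V : ℤ) ≤ B := by exact_mod_cast (Nat.le_self_pow (by norm_num) V).trans hB
  have hkV' : (k : ℤ) ≤ V := by exact_mod_cast hkV
  set T : ℕ → ℕ := fun i => if h : i < k then 150 * N ⟨i, h⟩ + 240 else 0 with hT
  refine Spec.mono (Spec.assign_seq hV hB 0 (by decide) (by simp) (by simp) <| Spec.forUp 0 k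
    (fun i s' => SideStep s s' a b P Y (P.sidePoints i) fun l z => ∃ e : Fin k, (e : ℕ) < i ∧
      P.x e ≠ P.x (finRotate k e) ∧
        !₂[(l : ℝ), z] ∈ _root_.segment ℝ (P.vertex e) (P.vertex (finRotate k e))) T (by decide) (by decide) rfl rfl
    (by decide) (by simp [State.var_setVar]) (by simp [State.var_setVar, hs.one]) (by omega) (by simp)
    (by rw [Nat.abs_cast]; omega) ?_ ?_) ?_ ?_
  · constructor <;> simp [hlo, hhi, PolygonData.sidePoints_zero, latticeSum_empty]
  · rintro i hi s' h39 hI hF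
    have hik : i < k := by omega
    have hs' : Loaded s' a b P :=
      ⟨fun A hA => by rw [hF.arr A (by interval_cases A <;> decide)]; exact hs.arr A hA, by
        rw [hF.var _ (by decide) (by decide)]; simp [State.var_setVar, hs.one]⟩
    rw [hT]
    simp only [hik, dif_pos]
    refine Spec.mono (sideBody_spec hV hB hO hd hP ha hb hY hYV hkV (e := ⟨i, hik⟩) hs' (by rw [h39]; simp)
      hI.lo_le hI.hi_le (Z := Z + (n + 1) * Y ^ 2) (fun m => ?_) (by linarith) (hN ⟨i, hik⟩)) le_rfl
      fun s'' F h => ?_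
    · rw [hI.out]
      exact (abs_add_le _ _).trans (add_le_add (hout m)
        (abs_latticeSum_le (abs_toArray_le ha) (abs_toArray_le hb) _ _ _))
    · have hR : ∀ e : Fin k, (e : ℕ) < i + 1 ↔ (e : ℕ) < i ∨ e = ⟨i, hik⟩ := fun e => by
        rw [Fin.ext_iff]; simp only; omega
      refine ⟨h.lo_le, h.hi_le, fun c j => ?_, fun c j => ?_, fun m => ?_⟩
      · rw [State.arr_setVar, h.lo, hI.lo, or_assoc, ← exists_or]
        simp only [← and_or_left, hR, or_and_right, exists_or, exists_eq_left]
      · rw [State.arr_setVar, h.hi, hI.hi, or_assoc, ← exists_or]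
        simp only [← and_or_left, hR, or_and_right, exists_or, exists_eq_left]
      · rw [State.arr_setVar, h.out, hI.out, add_assoc]
        exact congrArg _ (hO.latticeSum_sidePoints_succ _ _ _ ⟨i, hik⟩ _).symm
  · have : ∑ i ∈ Finset.range k, (T i + 5) = ∑ e, (150 * N e + 245) := by
      rw [Finset.sum_range]
      refine Finset.sum_congr rfl fun e _ => ?_
      simp [hT]
    have h₁ : ((k : ℤ) - 0).toNat = k := by omega
    have h₂ : (c 0).cost = 1 := rfl
    rw [h₁, this]
    omega
  · rintro s' - h
    have h₁ : ((k : ℤ) - 0).toNat = k := by omega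
    rw [h₁] at h
    simpa only [PolygonData.Crosses, Fin.is_lt, true_and] using h

end

end WordRAM

/-! ### Vertices, extreme coordinates and the initial profile -/

namespace WordRAM

open Cmd Ex

/-- Round the coordinates of the vertex `r64`. -/
def vertexLoad : Cmd :=
  .assign 65 (ld 2 (v 64) / ld 3 (v 64)) ;; .assign 66 ((ld 2 (v 64) - c 1) / ld 3 (v 64)) ;;
  .assign 67 (ld 4 (v 64) / ld 5 (v 64)) ;; .assign 68 ((ld 4 (v 64) - c 1) / ld 5 (v 64))

/-- Update the extreme coordinates. -/
def vertexExtent : Cmd :=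
  .ite (v 65) (v 60) (.assign 60 (v 65)) .skip ;; .ite (v 61) (v 66) (.assign 61 (v 66)) .skip ;;
  .ite (v 67) (v 62) (.assign 62 (v 67)) .skip ;; .ite (v 63) (v 68) (.assign 63 (v 68)) .skip

/-- Count a vertex if it is a lattice point. -/
def vertexCount : Cmd :=
  .ite (c 0) (ld 7 (v 64)) (.ite (v 66) (v 65) (.ite (v 68) (v 67)
    (addCell (v 65 + v 67) (ld 0 (v 65) * ld 1 (v 67))) .skip) .skip) .skip

/-- Process all vertices. -/
def vertexPass : Cmd :=
  -- Starting with vertex `0` ensures that the extreme values are attained, as `PolygonData.Extent`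
  -- demands.
  .assign 60 (ld 2 (c 0) / ld 3 (c 0)) ;; .assign 61 ((ld 2 (c 0) - c 1) / ld 3 (c 0)) ;;
  .assign 62 (ld 4 (c 0) / ld 5 (c 0)) ;; .assign 63 ((ld 4 (c 0) - c 1) / ld 5 (c 0)) ;;
  .assign 64 (c 0) ;; forUp 64 1 (vertexLoad ;; vertexExtent ;; vertexCount)

/-- Initialize the profile. -/
def profileInit : Cmd :=
  -- Only the columns strictly between the extreme first coordinates are initialized. The sides may
  -- also touch a column on the border, but the profile there is never used.
  .assign 64 (v 60 + c 1) ;; .assign 65 (v 61 + c 1) ;; .assign 66 (v 63 + c 1) ;; .assign 67 (v 62 - c 1) ;;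
  forUp 64 65 (.store 18 (v 64) (v 66) ;; .store 19 (v 64) (v 67))

section

variable {V B Y : ℕ} {n k : ℕ} {a b : Fin (n + 1) → ℤ} {P : PolygonData k} {σ : ℝ}

theorem vertexLoad_spec (hV : 16 ≤ V) (hB : V ^ 10 ≤ B) (hP : P.Bounded Y) (hYV : Y ≤ V) (hkV : k ≤ V)
    {s : State} (hs : Loaded s a b P) {e : Fin k} (he : s.var 64 = (e : ℕ)) :
    vertexLoad.Spec B s 30 (fun s' => s'.arr = s.arr ∧ s'.var 65 = P.xNum e / P.xDen e ∧
      s'.var 66 = (P.xNum e - 1) / P.xDen e ∧ s'.var 67 = P.yNum e / P.yDen e ∧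
      s'.var 68 = (P.yNum e - 1) / P.yDen e) := by
  have hYV' : (Y : ℤ) ≤ V := by exact_mod_cast hYV
  have h₁ := (hP.xNum_le e).trans hYV'
  have h₂ := (hP.xDen_le e).trans hYV'
  have h₃ := (hP.yNum_le e).trans hYV'
  have h₄ := (hP.yDen_le e).trans hYV'
  have h₅ : |((e : ℕ) : ℤ)| ≤ V := by
    rw [Nat.abs_cast]; have := e.2; exact_mod_cast (by omega)
  refine Spec.of_wpV hV hB (by decide) ?_
  simp only [vertexLoad, wpV, deg_ld, deg_v, deg_c, deg_div, deg_sub, leafOk_ld, leafOk_v, leafOk_c, leafOk_div,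
    leafOk_sub, eval_ld, eval_v, eval_c, eval_div, eval_sub, State.var_setVar, State.arr_setVar]
  norm_num [he, hs.xNum, hs.xDen, hs.yNum, hs.yDen, h₁, h₂, h₃, h₄, e.2.le.trans hkV]

theorem vertexExtent_spec (hV : 16 ≤ V) (hB : V ^ 10 ≤ B) {s : State}
    (h : ∀ r, 60 ≤ r → r ≤ 68 → |s.var r| ≤ V) :
    vertexExtent.Spec B s 12 (fun s' => s'.arr = s.arr ∧ s'.var 60 = min (s.var 60) (s.var 65) ∧
      s'.var 61 = max (s.var 61) (s.var 66) ∧ s'.var 62 = min (s.var 62) (s.var 67) ∧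
      s'.var 63 = max (s.var 63) (s.var 68)) := by
  have step : ∀ (r q : ℕ) (s : State), r < 100 → q < 100 → |s.var r| ≤ V → |s.var q| ≤ V →
      (Cmd.ite (v q) (v r) (.assign r (v q)) .skip).Spec B s 3
        (fun s' => s' = s.setVar r (min (s.var r) (s.var q))) ∧
      (Cmd.ite (v r) (v q) (.assign r (v q)) .skip).Spec B s 3
        (fun s' => s' = s.setVar r (max (s.var r) (s.var q))) := by
    intro r q s hr hq h₁ h₂
    have hself : s.setVar r (s.var r) = s := by
      simp [State.setVar]
    constructor <;> refine Spec.of_wpV hV hB (by simp [Cmd.cost, Ex.cost]) ?_ <;>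
      simp only [wpV, deg_v, leafOk_v, eval_v, hr, hq, h₁, h₂, true_and]
    · exact ⟨by decide, fun h => ⟨by decide, by rw [min_eq_right h.le]⟩, fun h => by rw [min_eq_left h, hself]⟩
    · exact ⟨by decide, fun h => ⟨by decide, by rw [max_eq_right h.le]⟩, fun h => by rw [max_eq_left h, hself]⟩
  have h₀ := h 60 (by norm_num) (by norm_num)
  have h₁ := h 61 (by norm_num) (by norm_num)
  have h₂ := h 62 (by norm_num) (by norm_num)
  have h₃ := h 63 (by norm_num) (by norm_num)
  have h₅ := h 65 (by norm_num) (by norm_num)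
  have h₆ := h 66 (by norm_num) (by norm_num)
  have h₇ := h 67 (by norm_num) (by norm_num)
  have h₈ := h 68 (by norm_num) (by norm_num)
  refine Spec.mono (Spec.seq (step 60 65 s (by norm_num) (by norm_num) h₀ h₅).1 fun s₁ _ e₁ =>
    Spec.seq (step 61 66 s₁ (by norm_num) (by norm_num) (by simpa [e₁, State.var_setVar]) (by simpa [e₁, State.var_setVar])).2
      fun s₂ _ e₂ => Spec.seq (step 62 67 s₂ (by norm_num) (by norm_num) (by simpa [e₁, e₂, State.var_setVar])
        (by simpa [e₁, e₂, State.var_setVar])).1 fun s₃ _ e₃ =>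
          Spec.mono (step 63 68 s₃ (by norm_num) (by norm_num) (by simpa [e₁, e₂, e₃, State.var_setVar])
            (by simpa [e₁, e₂, e₃, State.var_setVar])).2 le_rfl
            fun s' _ e => ?_) (show 3 + (3 + (3 + 3)) ≤ 12 by norm_num) fun _ _ h => h
  simp [*, State.var_setVar]

theorem _root_.PolygonData.latticeSum_vertex (hd : P.DenPos) (e : Fin k) {f : ℤ → ℤ} (g : ℤ → ℤ) {n : ℕ}
    (hf : ∀ i, f i ≠ 0 → 0 ≤ i ∧ i ≤ n) (m : ℤ) :
    latticeSum f g n {p | P.vertexMem e = true ∧ !₂[(p.1 : ℝ), (p.2 : ℝ)] = P.vertex e} m =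
      if (P.vertexMem e = true ∧ (P.xNum e - 1) / P.xDen e < P.xNum e / P.xDen e ∧
        (P.yNum e - 1) / P.yDen e < P.yNum e / P.yDen e) ∧ m = P.xNum e / P.xDen e + P.yNum e / P.yDen e
      then f (P.xNum e / P.xDen e) * g (P.yNum e / P.yDen e) else 0 := by
  have hmem : ∀ p : ℤ × ℤ, (P.vertexMem e = true ∧ !₂[(p.1 : ℝ), (p.2 : ℝ)] = P.vertex e) ↔
      (P.vertexMem e = true ∧ (P.xNum e - 1) / P.xDen e < P.xNum e / P.xDen e ∧
        (P.yNum e - 1) / P.yDen e < P.yNum e / P.yDen e) ∧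
        p = (P.xNum e / P.xDen e, P.yNum e / P.yDen e) := by
    rintro ⟨i, j⟩
    have : !₂[(i : ℝ), (j : ℝ)] = P.vertex e ↔
        (i : ℝ) = P.xNum e / P.xDen e ∧ (j : ℝ) = P.yNum e / P.yDen e := by
      rw [PolygonData.vertex]
      constructor
      · intro h
        exact ⟨by simpa using congrArg (fun q => q 0) h, by simpa using congrArg (fun q => q 1) h⟩
      · rintro ⟨h₁, h₂⟩
        rw [h₁, h₂]
    rw [this, Int.cast_eq_div_iff (hd.x e), Int.cast_eq_div_iff (hd.y e), Prod.mk.injEq]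
    exact ⟨fun ⟨h₁, ⟨h₂, h₃⟩, h₄, h₅⟩ => ⟨⟨h₁, h₃, h₅⟩, h₂, h₄⟩,
      fun ⟨⟨h₁, h₃, h₅⟩, h₂, h₄⟩ => ⟨h₁, ⟨h₂, h₃⟩, h₄, h₅⟩⟩
  simp only [hmem]
  by_cases hc : P.vertexMem e = true ∧ (P.xNum e - 1) / P.xDen e < P.xNum e / P.xDen e ∧
        (P.yNum e - 1) / P.yDen e < P.yNum e / P.yDen e
  · simp only [hc, true_and]
    exact latticeSum_singleton g hf _ _ m
  · simp only [hc, false_and, if_false]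
    exact latticeSum_empty f g n m

theorem vertexCount_spec (hV : 16 ≤ V) (hB : V ^ 10 ≤ B) (hd : P.DenPos) (ha : ∀ i, |a i| ≤ V)
    (hb : ∀ i, |b i| ≤ V) (hkV : k ≤ V) {s : State} (hs : Loaded s a b P) {e : Fin k}
    (he : s.var 64 = (e : ℕ)) (h65 : s.var 65 = P.xNum e / P.xDen e)
    (h66 : s.var 66 = (P.xNum e - 1) / P.xDen e) (h67 : s.var 67 = P.yNum e / P.yDen e)
    (h68 : s.var 68 = (P.yNum e - 1) / P.yDen e) (h : ∀ r, 60 ≤ r → r ≤ 68 → |s.var r| ≤ V)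
    (hout : ∀ m, |s.arr 8 m| ≤ V) :
    vertexCount.Spec B s 20 (fun s' => ∀ m, s'.arr 8 m = s.arr 8 m + latticeSum (toArray a) (toArray b) n
      {p | P.vertexMem e = true ∧ !₂[(p.1 : ℝ), (p.2 : ℝ)] = P.vertex e} m) := by
  have h₅ := h 65 (by norm_num) (by norm_num)
  have h₆ := h 66 (by norm_num) (by norm_num)
  have h₇ := h 67 (by norm_num) (by norm_num)
  have h₈ := h 68 (by norm_num) (by norm_num)
  have h₀ : ∀ i, |s.arr 0 i| ≤ V := by rw [hs.fst]; exact abs_toArray_le ha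
  have h₁ : ∀ i, |s.arr 1 i| ≤ V := by rw [hs.snd]; exact abs_toArray_le hb
  have hm : |if P.vertexMem e = true then (1 : ℤ) else 0| ≤ V := by split_ifs <;> simp; omega
  simp only [PolygonData.latticeSum_vertex hd e _ (toArray_ne_zero a), ← h65, ← h66, ← h67, ← h68]
  rw [← hs.fst, ← hs.snd]
  refine Spec.of_wpV hV hB (by decide) ?_
  simp only [vertexCount, addCell, wpV, deg_v, deg_c, deg_add, deg_mul, deg_ld, leafOk_v, leafOk_c, leafOk_add,
    leafOk_mul, leafOk_ld, eval_v, eval_c, eval_add, eval_mul, eval_ld, State.arr_setArr, h₀, h₁, hout, h₅, h₆, h₇,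
    h₈, he, hs.vertexMem, hm]
  norm_num
  refine ⟨e.2.le.trans hkV, fun k₁ => ⟨fun k₂ => ⟨fun k₃ m => ?_,
    fun k₃ m _ _ h => absurd h (not_lt.2 k₃)⟩, fun k₂ m _ h => absurd h (not_lt.2 k₂)⟩, fun k₁ m h => ?_⟩
  · have hM : P.vertexMem e = true := by
      by_contra hM
      simp [hM] at k₁
    simp only [hM, k₂, k₃, true_and]
    split_ifs with k₄
    · rw [k₄]
    · rw [add_zero]
  · simp [h] at k₁

theorem vertexPass_spec (hV : 16 ≤ V) (hB : V ^ 10 ≤ B) (hO : P.Oriented σ)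
    (hd : P.DenPos) (hP : P.Bounded Y) (ha : ∀ i, |a i| ≤ Y) (hb : ∀ i, |b i| ≤ Y)
    (hYV : Y + 2 ≤ V) (hkV : k ≤ V) {s : State} (hs : Loaded s a b P)
    (hout : ∀ m, s.arr 8 m = 0) (hZ : (n + 1) * (Y : ℤ) ^ 2 ≤ V) :
    vertexPass.Spec B s (67 * k + 60) (fun s' =>
      P.Extent (s'.var 60) (s'.var 61) (s'.var 62) (s'.var 63) ∧
      ∀ m, s'.arr 8 m = latticeSum (toArray a) (toArray b) n (P.vertexPoints k) m) := by
  have hVB : (V : ℤ) ≤ B := by exact_mod_cast (Nat.le_self_pow (by norm_num) V).trans hB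
  have hkV' : (k : ℤ) ≤ V := by exact_mod_cast hkV
  have hk := hO.three_le
  set o : Fin k := ⟨0, by omega⟩ with ho
  have hfl : ∀ i, (|P.xNum i / P.xDen i| ≤ V ∧ |(P.xNum i - 1) / P.xDen i| ≤ V) ∧
      |P.yNum i / P.yDen i| ≤ V ∧ |(P.yNum i - 1) / P.yDen i| ≤ V := fun i => by
    have h₁ := hP.xNum_le i
    have h₂ := hP.yNum_le i
    have h₃ := Int.abs_ediv_le_abs (P.xNum i) (P.xDen i)
    have h₄ := Int.abs_ediv_le_abs (P.xNum i - 1) (P.xDen i)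
    have h₅ := Int.abs_ediv_le_abs (P.yNum i) (P.yDen i)
    have h₆ := Int.abs_ediv_le_abs (P.yNum i - 1) (P.yDen i)
    have h₇ := abs_sub (P.xNum i) 1
    have h₈ := abs_sub (P.yNum i) 1
    rw [abs_one] at h₇ h₈
    omega
  have lo : ∀ (A : ℕ) (x : Fin k → ℤ), (∀ i, |x i| ≤ Y) → s.arr A 0 = x o → |s.arr A 0| ≤ V := by
    intro A x hx h
    rw [h]
    have := hx o
    omega
  have z₂ : s.arr 2 0 = P.xNum o := hs.xNum o
  have z₃ : s.arr 3 0 = P.xDen o := hs.xDen o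
  have z₄ : s.arr 4 0 = P.yNum o := hs.yNum o
  have z₅ : s.arr 5 0 = P.yDen o := hs.yDen o
  have y₂ := lo 2 _ hP.xNum_le z₂
  have y₃ := lo 3 _ hP.xDen_le z₃
  have y₄ := lo 4 _ hP.yNum_le z₄
  have y₅ := lo 5 _ hP.yDen_le z₅
  refine Spec.mono (Spec.assign_seq hV hB (P.xNum o / P.xDen o) (by decide) (by simp [y₂, y₃]) (by simp [z₂, z₃]) <|
    Spec.assign_seq hV hB ((P.xNum o - 1) / P.xDen o) (by decide) (by simp [y₂, y₃]) (by simp [z₂, z₃]) <|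
    Spec.assign_seq hV hB (P.yNum o / P.yDen o) (by decide) (by simp [y₄, y₅]) (by simp [z₄, z₅]) <|
    Spec.assign_seq hV hB ((P.yNum o - 1) / P.yDen o) (by decide) (by simp [y₄, y₅]) (by simp [z₄, z₅]) <|
    Spec.assign_seq hV hB 0 (by decide) (by simp) (by simp) <| Spec.forUp 0 k (fun i s' =>
      ((∀ e : Fin k, (e : ℕ) < i → s'.var 60 ≤ P.xNum e / P.xDen e ∧ (P.xNum e - 1) / P.xDen e ≤ s'.var 61 ∧
        s'.var 62 ≤ P.yNum e / P.yDen e ∧ (P.yNum e - 1) / P.yDen e ≤ s'.var 63) ∧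
      (∃ e, P.xNum e / P.xDen e = s'.var 60) ∧ (∃ e, (P.xNum e - 1) / P.xDen e = s'.var 61) ∧
      (∃ e, P.yNum e / P.yDen e = s'.var 62) ∧ ∃ e, (P.yNum e - 1) / P.yDen e = s'.var 63) ∧
      ∀ m, s'.arr 8 m = latticeSum (toArray a) (toArray b) n (P.vertexPoints i) m) (fun _ => 62) (by decide)
      (by decide) rfl rfl (by decide) (by simp [State.var_setVar]) (by simp [State.var_setVar, hs.one]) (by omega)
      (by simp) (by rw [Nat.abs_cast]; omega) ?_ ?_) ?_ ?_
  · refine ⟨⟨fun e he => absurd he (Nat.not_lt_zero _), ⟨o, ?_⟩, ⟨o, ?_⟩, ⟨o, ?_⟩, o, ?_⟩, fun m => ?_⟩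
    · simp [State.var_setVar]
    · simp [State.var_setVar]
    · simp [State.var_setVar]
    · simp [State.var_setVar]
    · rw [PolygonData.vertexPoints_zero, latticeSum_empty]
      exact hout m
  · rintro i hi s' h64 ⟨⟨i₁, i₂, i₃, i₄, i₅⟩, i₆⟩ hF
    have hik : i < k := by omega
    have hs' : Loaded s' a b P :=
      ⟨fun A hA => by rw [hF.arr A (by interval_cases A <;> decide)]; exact hs.arr A hA, by
        rw [hF.var _ (by decide) (by decide)]; simp [State.var_setVar, hs.one]⟩
    set e : Fin k := ⟨i, hik⟩ with he
    rw [zero_add] at h64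
    refine Spec.mono (Spec.seq (vertexLoad_spec hV hB hP (by omega) hkV hs' (e := e) h64)
      fun s₁ F₁ ⟨A₁, j₅, j₆, j₇, j₈⟩ => ?_) (show 30 + (12 + 20) ≤ 62 by norm_num) fun _ _ h => h
    have f₁ : ∀ r, 60 ≤ r → r ≤ 64 → s₁.var r = s'.var r := fun r _ _ =>
      F₁.var r (by omega) (by interval_cases r <;> rfl)
    have b₁ : ∀ r, 60 ≤ r → r ≤ 68 → |s₁.var r| ≤ V := by
      obtain ⟨e₂, k₂⟩ := i₂
      obtain ⟨e₃, k₃⟩ := i₃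
      obtain ⟨e₄, k₄⟩ := i₄
      obtain ⟨e₅, k₅⟩ := i₅
      intro r h₁ h₂
      interval_cases r
      · rw [f₁ _ (by norm_num) (by norm_num), ← k₂]; exact (hfl _).1.1
      · rw [f₁ _ (by norm_num) (by norm_num), ← k₃]; exact (hfl _).1.2
      · rw [f₁ _ (by norm_num) (by norm_num), ← k₄]; exact (hfl _).2.1
      · rw [f₁ _ (by norm_num) (by norm_num), ← k₅]; exact (hfl _).2.2
      · rw [f₁ _ (by norm_num) (by norm_num), h64, Nat.abs_cast]; omega
      · rw [j₅]; exact (hfl _).1.1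
      · rw [j₆]; exact (hfl _).1.2
      · rw [j₇]; exact (hfl _).2.1
      · rw [j₈]; exact (hfl _).2.2
    refine Spec.seq (vertexExtent_spec hV hB b₁) fun s₂ F₂ ⟨A₂, l₀, l₁, l₂, l₃⟩ => ?_
    have f₂ : ∀ r, 64 ≤ r → r ≤ 68 → s₂.var r = s₁.var r := fun r _ _ =>
      F₂.var r (by omega) (by interval_cases r <;> rfl)
    have hmin : ∀ x y : ℤ, |x| ≤ V → |y| ≤ V → |min x y| ≤ V ∧ |max x y| ≤ V := fun x y hx hy => by
      rcases le_total x y with h | h <;> simp [h, hx, hy]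
    have b₂ : ∀ r, 60 ≤ r → r ≤ 68 → |s₂.var r| ≤ V := by
      intro r h₁ h₂
      rcases le_or_gt 64 r with h₃ | h₃
      · rw [f₂ r h₃ h₂]; exact b₁ r h₁ h₂
      · interval_cases r
        · rw [l₀]; exact (hmin _ _ (b₁ _ (by norm_num) (by norm_num)) (b₁ _ (by norm_num) (by norm_num))).1
        · rw [l₁]; exact (hmin _ _ (b₁ _ (by norm_num) (by norm_num)) (b₁ _ (by norm_num) (by norm_num))).2
        · rw [l₂]; exact (hmin _ _ (b₁ _ (by norm_num) (by norm_num)) (b₁ _ (by norm_num) (by norm_num))).1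
        · rw [l₃]; exact (hmin _ _ (b₁ _ (by norm_num) (by norm_num)) (b₁ _ (by norm_num) (by norm_num))).2
    have hs₂ : Loaded s₂ a b P :=
      (hs'.of_frame F₁ (by decide) (by decide)).of_frame F₂ (by decide) (by decide)
    rw [f₁ 60 (by norm_num) (by norm_num), j₅] at l₀
    rw [f₁ 61 (by norm_num) (by norm_num), j₆] at l₁
    rw [f₁ 62 (by norm_num) (by norm_num), j₇] at l₂
    rw [f₁ 63 (by norm_num) (by norm_num), j₈] at l₃
    refine Spec.mono (vertexCount_spec hV hB hd (fun i => (ha i).trans (by omega)) (fun i => (hb i).trans (by omega))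
      hkV hs₂ (e := e) ?_ ?_ ?_ ?_ ?_ b₂ ?_) le_rfl fun s₃ F₃ h₃ => ?_
    · rw [f₂ _ (by norm_num) (by norm_num), f₁ _ (by norm_num) (by norm_num), h64]
    · rw [f₂ _ (by norm_num) (by norm_num), j₅]
    · rw [f₂ _ (by norm_num) (by norm_num), j₆]
    · rw [f₂ _ (by norm_num) (by norm_num), j₇]
    · rw [f₂ _ (by norm_num) (by norm_num), j₈]
    · intro m
      rw [A₂, A₁, i₆]
      exact (abs_latticeSum_le (abs_toArray_le ha) (abs_toArray_le hb) _ _ _).trans hZ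
    · have f₃ : ∀ r, 60 ≤ r → r ≤ 63 → (s₃.setVar 64 (0 + i + 1)).var r = s₂.var r := fun r _ _ => by
        rw [State.var_setVar, if_neg (by omega)]
        exact F₃.var r (by omega) (by interval_cases r <;> rfl)
      rw [f₃ 60 (by norm_num) (by norm_num), f₃ 61 (by norm_num) (by norm_num), f₃ 62 (by norm_num) (by norm_num),
        f₃ 63 (by norm_num) (by norm_num), l₀, l₁, l₂, l₃]
      have hex : ∀ (x y : ℤ) (u : Fin k → ℤ), (∃ e, u e = x) → (∃ e, u e = y) →
          (∃ e, u e = min x y) ∧ ∃ e, u e = max x y := fun x y u hx hy => by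
        rcases le_total x y with h | h <;> simp [h, hx, hy]
      refine ⟨⟨fun e' he' => ?_, (hex _ _ _ i₂ ⟨e, rfl⟩).1, (hex _ _ _ i₃ ⟨e, rfl⟩).2, (hex _ _ _ i₄ ⟨e, rfl⟩).1,
        (hex _ _ _ i₅ ⟨e, rfl⟩).2⟩, fun m => ?_⟩
      · rcases Nat.lt_succ_iff_lt_or_eq.1 he' with h | h
        · have := i₁ e' h
          omega
        · rw [show e' = e from Fin.ext h]
          omega
      · rw [State.arr_setVar, h₃, A₂, A₁, i₆]
        exact (hO.latticeSum_vertexPoints_succ _ _ _ e _).symm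
  · simp [Ex.cost, show (ld 2 (c 0) / ld 3 (c 0)).cost = 5 from rfl, show (ld 4 (c 0) / ld 5 (c 0)).cost = 5 from rfl,
      show ((ld 2 (c 0) - c 1) / ld 3 (c 0)).cost = 7 from rfl,
      show ((ld 4 (c 0) - c 1) / ld 5 (c 0)).cost = 7 from rfl]
    omega
  · rintro s' - ⟨⟨i₁, i₂, i₃, i₄, i₅⟩, i₆⟩
    have h₁ : ((k : ℤ) - 0).toNat = k := by omega
    rw [h₁] at i₁ i₆
    exact ⟨⟨fun e => (i₁ e e.2).1, i₂, fun e => (i₁ e e.2).2.1, i₃, fun e => (i₁ e e.2).2.2.1, i₄,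
      fun e => (i₁ e e.2).2.2.2, i₅⟩, i₆⟩

theorem profileInit_spec (hV : 16 ≤ V) (hB : V ^ 10 ≤ B) {s : State} {l r b t : ℤ} (hl : s.var 60 = l)
    (hr : s.var 61 = r) (hb : s.var 62 = b) (ht : s.var 63 = t) (h₁ : |l| + 1 ≤ V) (h₂ : |r| + 1 ≤ V)
    (h₃ : |b| + 1 ≤ V) (h₄ : |t| + 1 ≤ V) :
    profileInit.Spec B s (20 * (r - l).toNat + 30) (fun s' => ∀ c,
      s'.arr 18 c = (if l < c ∧ c ≤ r then t + 1 else s.arr 18 c) ∧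
      s'.arr 19 c = if l < c ∧ c ≤ r then b - 1 else s.arr 19 c) := by
  have hVB : (V : ℤ) ≤ B := by exact_mod_cast (Nat.le_self_pow (by norm_num) V).trans hB
  rw [← le_sub_iff_add_le, abs_le] at h₁ h₂ h₃ h₄
  have k₁ : |l| ≤ V := by rw [abs_le]; omega
  have k₂ : |r| ≤ V := by rw [abs_le]; omega
  have k₃ : |b| ≤ V := by rw [abs_le]; omega
  have k₄ : |t| ≤ V := by rw [abs_le]; omega
  refine Spec.mono (Spec.assign_seq hV hB (l + 1) (by decide) (by simp [hl, k₁]) (by simp [hl]) <|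
    Spec.assign_seq hV hB (r + 1) (by decide) (by simp [State.var_setVar, hr, k₂]) (by simp [State.var_setVar, hr]) <|
    Spec.assign_seq hV hB (t + 1) (by decide) (by simp [State.var_setVar, ht, k₄]) (by simp [State.var_setVar, ht]) <|
    Spec.assign_seq hV hB (b - 1) (by decide) (by simp [State.var_setVar, hb, k₃]) (by simp [State.var_setVar, hb]) <|
    Spec.forUp (l + 1) (r + 1) (fun i s' => ∀ c,
      s'.arr 18 c = (if l < c ∧ c ≤ l + i then t + 1 else s.arr 18 c) ∧
      s'.arr 19 c = if l < c ∧ c ≤ l + i then b - 1 else s.arr 19 c)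
      (fun _ => 2) (by decide) (by decide) rfl rfl (by decide) (by simp [State.var_setVar])
      (by simp [State.var_setVar]) (by omega) (by rw [abs_le]; omega) (by rw [abs_le]; omega) ?_ ?_) ?_ ?_
  · intro c
    rw [if_neg (by omega), if_neg (by omega)]
    exact ⟨rfl, rfl⟩
  · rintro i hi s' h64 hI hF
    have e₆ : s'.var 66 = t + 1 := by rw [hF.var _ (by decide) (by decide)]; simp [State.var_setVar]
    have e₇ : s'.var 67 = b - 1 := by rw [hF.var _ (by decide) (by decide)]; simp [State.var_setVar]
    have q₁ : |l + 1 + i| ≤ (V : ℤ) := by rw [abs_le]; omega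
    have q₂ : |t + 1| ≤ (V : ℤ) := by rw [abs_le]; omega
    have q₃ : |b - 1| ≤ (V : ℤ) := by rw [abs_le]; omega
    refine Spec.of_wpV hV hB (by decide) ?_
    simp only [wpV, deg_v, leafOk_v, eval_v, State.var_setArr, h64, e₆, e₇, q₁, q₂, q₃]
    refine ⟨by decide, by decide, by decide, by decide, by decide, by decide, fun c => ?_⟩
    have hc : (l < c ∧ c ≤ l + ((i + 1 : ℕ) : ℤ)) ↔ c = l + 1 + i ∨ l < c ∧ c ≤ l + i := by
      push_cast
      omega
    simp only [State.arr_setVar, State.arr_setArr, hc]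
    norm_num
    rcases eq_or_ne c (l + 1 + i) with h | h
    · simp [h]
    · simp [h, hI c]
  · have w₁ : (v 60 + c 1).cost = 2 := rfl
    have w₂ : (v 61 + c 1).cost = 2 := rfl
    have w₃ : (v 63 + c 1).cost = 2 := rfl
    have w₄ : (v 62 - c 1).cost = 2 := rfl
    simp
    omega
  · intro s' _ h c
    have hc : (l < c ∧ c ≤ l + ((r + 1 - (l + 1)).toNat : ℤ)) ↔ l < c ∧ c ≤ r := by omega
    simpa only [hc] using h c

end

end WordRAM

/-! ### The complete program -/

namespace WordRAM

open Cmd Ex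

/-- Set up the registers for the tree. -/
def interiorPrep : Cmd :=
  .assign treeX (v 60 + c 1) ;; .ite (v 60) (v 61) (.assign treeM (v 61 - v 60)) (.assign treeM (c 0)) ;;
  .assign treeB (v 62)

/-- Add the products that belong to the lattice points in the interior. -/
def interiorPass : Cmd := interiorPrep ;; treeAdd 19 1 ;; treeAdd 18 (-1)

/-- The complete program. -/
def polygonSum : Cmd := vertexPass ;; profileInit ;; sidePass ;; interiorPass

/-- The time bound for a tree over `Q` columns. -/
def treeTime (Q : ℕ) : ℕ := 21000 * Q * (Nat.clog 2 (3 * Q) + 1) ^ 2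

theorem treeTime_mono {Q R : ℕ} (h : Q ≤ R) : treeTime Q ≤ treeTime R := by
  unfold treeTime
  have := Nat.clog_mono_right 2 (show 3 * Q ≤ 3 * R by omega)
  gcongr

section

variable {V B Y : ℕ} {n k : ℕ} {a b : Fin (n + 1) → ℤ} {P : PolygonData k} {σ : ℝ}

theorem interiorPrep_spec (hV : 16 ≤ V) (hB : V ^ 10 ≤ B) {s : State} {l r d : ℤ} (hl : s.var 60 = l)
    (hr : s.var 61 = r) (hd : s.var 62 = d) (h₁ : |l| ≤ V) (h₂ : |r| ≤ V) (h₃ : |d| ≤ V) :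
    interiorPrep.Spec B s 20 (fun s' => s'.arr = s.arr ∧ s'.var treeX = l + 1 ∧
      s'.var treeM = ((r - l).toNat : ℕ) ∧ s'.var treeB = d) := by
  refine Spec.of_wpV hV hB (by decide) ?_
  simp [interiorPrep, wpV, State.var_setVar, hl, hr, hd, h₁, h₂, h₃]
  omega

/-- The region below `hi` is added and the region below `lo` subtracted, both over the same base
line. In between the output may be larger than the final result, hence the doubled bound for the
second tree. -/
theorem interiorPass_spec (hV : 16 ≤ V) (hB : V ^ 10 ≤ B) (hO : P.Oriented σ) (hd : P.DenPos)
    (ha : ∀ i, |a i| ≤ Y) (hb : ∀ i, |b i| ≤ Y) {s : State} (hs : Loaded s a b P) {l r d t : ℤ}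
    (hE : P.Extent l r d t) (hl : s.var 60 = l) (hr : s.var 61 = r) (hdv : s.var 62 = d)
    (hprof : P.Profile l r d t (s.arr 18) (s.arr 19)) {Q : ℕ} (hQ : Q = (r - l).toNat + (t - d).toNat + 1)
    (hXY : |l| + 1 + 2 * Q ≤ Y) (hbY : |d| + 1 + Q ≤ Y) (hQY : 3 * Q ≤ Y) (hY : 16 ≤ Y) (hYV : Y ^ 200 ≤ V)
    (hnY : n + 1 ≤ Y) (hout : ∀ m, |s.arr 8 m| ≤ (Y : ℤ) ^ 4) :
    interiorPass.Spec B s (20 + (treeTime Q + treeTime Q)) (fun s' => ∀ m, s'.arr 8 m = s.arr 8 m +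
      latticeSum (toArray a) (toArray b) n P.interiorPoints m) := by
  have hYV2 : 4 * Y ^ 4 ≤ V := by
    have h₁ : Y ^ 5 ≤ V := (Nat.pow_le_pow_right (by omega) (by norm_num)).trans hYV
    rw [pow_succ] at h₁
    nlinarith [Nat.zero_le (Y ^ 4)]
  have hY4 : Y ≤ Y ^ 4 := Nat.le_self_pow (by norm_num) Y
  have hYV' := hYV
  clear hYV
  -- The left bound and the width control `r` from above. From below, a floor differs from the
  -- corresponding ⌈·⌉ - 1 by at most one, so `l - 1 ≤ r`.
  have hrV : |r| ≤ V := by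
    obtain ⟨i, hi⟩ := hE.r_eq
    have h₁ := hE.l_le i
    have h₂ : (P.xNum i - 1) / P.xDen i ≤ P.xNum i / P.xDen i := Int.ediv_le_ediv (hd.x i) (by omega)
    have h₃ : P.xNum i / P.xDen i ≤ (P.xNum i - 1) / P.xDen i + 1 := by
      have h₄ := hd.x i
      rw [show (P.xNum i - 1) / P.xDen i + 1 = (P.xNum i - 1 + P.xDen i) / P.xDen i by
        rw [Int.add_ediv_of_dvd_right dvd_rfl, Int.ediv_self h₄.ne']]
      exact Int.ediv_le_ediv h₄ (by omega)
    have h₅ : l - 1 ≤ r := by omega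
    have h₆ := neg_abs_le l
    have h₇ := le_abs_self l
    rw [abs_le]
    omega
  have hin : ∀ s' : State, s'.arr 0 = s.arr 0 → s'.arr 1 = s.arr 1 → s'.var treeX = l + 1 →
      s'.var treeM = ((r - l).toNat : ℕ) → s'.var treeB = d →
      TreeColumns s' (l + 1) d (r - l).toNat Q Y := fun s' h₀ h₁ h₂ h₃ h₄ => by
    refine ⟨h₂, h₃, h₄, by omega, by omega, ?_, ?_, ?_, hbY, hQY, hY⟩
    · rw [h₀, hs.fst]; exact abs_toArray_le ha
    · rw [h₁, hs.snd]; exact abs_toArray_le hb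
    · have := abs_add_le l 1
      rw [abs_one] at this
      omega
  have hcol : ∀ (h : ℕ → ℕ) m, |columnSum (toArray a) (toArray b) (l + 1) (r - l).toNat d h m| ≤ (Y : ℤ) ^ 4 := by
    intro h m
    rw [columnSum_eq_latticeSum _ (toArray_ne_zero a)]
    refine (abs_latticeSum_le (abs_toArray_le ha) (abs_toArray_le hb) _ _ _).trans ?_
    have : (n + 1) * Y ^ 2 ≤ Y ^ 4 := by
      calc (n + 1) * Y ^ 2 ≤ Y ^ 2 * Y ^ 2 := by gcongr; exact hnY.trans (Nat.le_self_pow (by norm_num) Y)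
        _ = Y ^ 4 := by ring
    exact_mod_cast this
  have hbnd : ∀ {c}, l < c → c ≤ r → d ≤ s.arr 18 c ∧ s.arr 18 c ≤ s.arr 19 c ∧ s.arr 19 c ≤ t := fun h₁ h₂ =>
    hprof.bounds hO hd hE ⟨h₁, h₂⟩
  refine Spec.mono (Spec.seq (interiorPrep_spec hV hB hl hr hdv (by omega) hrV (by omega))
    fun s₁ F₁ ⟨A₁, x₁, m₁, b₁⟩ => Spec.seq (treeAdd_spec hV hB (A := 19) (sg := 1) (by norm_num) (by norm_num)
      (hin s₁ (by rw [A₁]) (by rw [A₁]) x₁ m₁ b₁) (h := PolygonData.heights l r d (s.arr 19)) (Z := Y ^ 4) ?_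
      (fun u hu => PolygonData.heights_of_le hu) ?_ ?_ hYV' (by rw [A₁]; exact_mod_cast hout) (by omega)) fun s₂ F₂ h₂ =>
    Spec.mono (treeAdd_spec hV hB (A := 18) (sg := -1) (by norm_num) (by norm_num)
      (hin s₂ ?_ ?_ ?_ ?_ ?_) (h := PolygonData.heights l r d (s.arr 18)) (Z := 2 * Y ^ 4) ?_
      (fun u hu => PolygonData.heights_of_le hu) ?_ ?_ hYV' ?_ (by omega)) le_rfl fun s₃ F₃ h₃ m => ?_) le_rfl fun _ _ h => h
  · intro u hu
    rw [A₁]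
    exact PolygonData.heights_eq (fun c k₁ k₂ => (hbnd k₁ k₂).1.trans (hbnd k₁ k₂).2.1) hu
  · intro u
    have := PolygonData.heights_le (l := l) (r := r) (b := d) (t := t) (f := s.arr 19)
      (fun c k₁ k₂ => (hbnd k₁ k₂).2.2) u
    omega
  · intro u
    have := hprof.variation_hi hO hd hE u
    omega
  · rw [F₂.arr _ (by decide), A₁]
  · rw [F₂.arr _ (by decide), A₁]
  · rw [F₂.var _ (by decide) (by decide), x₁]
  · rw [F₂.var _ (by decide) (by decide), m₁]
  · rw [F₂.var _ (by decide) (by decide), b₁]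
  · intro u hu
    rw [F₂.arr _ (by decide), A₁]
    exact PolygonData.heights_eq (fun c k₁ k₂ => (hbnd k₁ k₂).1) hu
  · intro u
    have := PolygonData.heights_le (l := l) (r := r) (b := d) (t := t) (f := s.arr 18)
      (fun c k₁ k₂ => (hbnd k₁ k₂).2.1.trans (hbnd k₁ k₂).2.2) u
    omega
  · intro u
    have := hprof.variation_lo hO hd hE u
    omega
  · intro m
    rw [h₂, A₁, hs.fst, hs.snd, one_mul]
    push_cast
    have h₁ := (abs_add_le _ _).trans (add_le_add (hout m) (hcol (PolygonData.heights l r d (s.arr 19)) m))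
    linarith
  · have g₀ : s₂.arr 0 = toArray a := by rw [F₂.arr _ (by decide), A₁, hs.fst]
    have g₁ : s₂.arr 1 = toArray b := by rw [F₂.arr _ (by decide), A₁, hs.snd]
    rw [h₃, h₂, g₀, g₁, A₁, hs.fst, hs.snd, hprof.latticeSum_interior hO hd hE _ (toArray_ne_zero a)]
    ring

/-- Two measures of size are kept apart: `Q`, bounded below by the perimeter, governs the time,
whereas the word size is governed by the actual extent, which is linear in `W`. -/
theorem polygonSum_spec {W : ℕ} (hc : P.IsConvexPolygon) (hW : InputBounded a b P W) {Q : ℕ}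
    (hQ : 4 * P.perimeter + 3 ≤ Q) (N : Fin k → ℕ)
    (hN : ∀ e, dist (P.vertex e) (P.vertex (finRotate k e)) + 1 ≤ N e) :
    polygonSum.Spec ((W + 2) ^ 6000) (inputState a b P) (67 * k + 60 + (20 * Q + 30 +
      (∑ e, (150 * N e + 245) + 10 + (20 + (treeTime Q + treeTime Q)))))
      (fun s' => ∀ m, s'.arr 8 m = diagonalSum a b P m) := by
  obtain ⟨σ, hO⟩ := hc.exists_oriented
  have hd : P.DenPos := ⟨hc.xDen_pos, hc.yDen_pos⟩
  have hW3 : 3 ≤ W := hc.three_le.trans hW.k_le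
  have hn := hW.n_le
  have hkW := hW.k_le
  -- The exponent is 3 · 200 · 10: `Y` exceeds all sizes, the convolutions need leaves up to Y²⁰⁰,
  -- and expressions have degree at most 10.
  obtain ⟨Y, hYdef⟩ : ∃ Y, Y = (W + 2) ^ 3 := ⟨_, rfl⟩
  obtain ⟨V, hVdef⟩ : ∃ V, V = Y ^ 200 := ⟨_, rfl⟩
  have hB : V ^ 10 ≤ (W + 2) ^ 6000 := by rw [hVdef, hYdef, ← pow_mul, ← pow_mul]
  generalize (W + 2) ^ 6000 = B at hB ⊢
  -- Since 3 ≤ k ≤ W, two of the three factors W + 2 already give 25.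
  have hYW : 25 * W + 50 ≤ Y := by
    rw [hYdef, pow_succ]
    have : 25 ≤ (W + 2) ^ 2 := by nlinarith
    nlinarith
  clear hYdef
  have hP : P.Bounded Y := by
    have h : (W : ℤ) ≤ Y := by exact_mod_cast (by omega : W ≤ Y)
    exact ⟨fun i => (hW.xNum_le i).trans h, fun i => (hW.xDen_le i).trans h,
      fun i => (hW.yNum_le i).trans h, fun i => (hW.yDen_le i).trans h⟩
  have ha : ∀ i, |a i| ≤ Y := fun i => (hW.a_le i).trans (by exact_mod_cast (by omega : W ≤ Y))
  have hb : ∀ i, |b i| ≤ Y := fun i => (hW.b_le i).trans (by exact_mod_cast (by omega : W ≤ Y))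
  have hYV : Y ^ 200 ≤ V := hVdef.ge
  clear hVdef
  have hY11 : Y ^ 11 ≤ V := (Nat.pow_le_pow_right (by omega) (by norm_num)).trans hYV
  have hY4 : Y ^ 4 ≤ V := (Nat.pow_le_pow_right (by omega) (by norm_num)).trans hYV
  have hY1 : Y ^ 1 + 2 ≤ Y ^ 4 := by nlinarith [Nat.pow_le_pow_right (show 0 < Y by omega) (show 2 ≤ 4 by norm_num)]
  have hnY : 4 * ((n + 1) * Y ^ 2) ≤ Y ^ 4 := by
    calc 4 * ((n + 1) * Y ^ 2) = (4 * (n + 1)) * Y ^ 2 := by ring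
      _ ≤ Y ^ 2 * Y ^ 2 := by gcongr; nlinarith
      _ = Y ^ 4 := by ring
  have hnYZ : 4 * ((n + 1) * (Y : ℤ) ^ 2) ≤ Y ^ 4 := by exact_mod_cast hnY
  have hY4Z : (Y : ℤ) ^ 4 ≤ V := by exact_mod_cast hY4
  have hYV1 : Y + 2 ≤ V := by rw [pow_one] at hY1; omega
  have hV : 16 ≤ V := by omega
  have hpos : (0 : ℤ) ≤ (n + 1) * (Y : ℤ) ^ 2 := by positivity
  have hL : Loaded (inputState a b P) a b P := ⟨fun _ _ => rfl, rfl⟩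
  have hS : ∀ (S : Set (ℤ × ℤ)) m, |latticeSum (toArray a) (toArray b) n S m| ≤ (n + 1) * (Y : ℤ) ^ 2 :=
    abs_latticeSum_le (abs_toArray_le ha) (abs_toArray_le hb) n
  have hY11Z : (Y : ℤ) + 2 ≤ (Y : ℤ) ^ 11 := by
    have : Y ^ 4 ≤ Y ^ 11 := Nat.pow_le_pow_right (by omega) (by norm_num)
    rw [pow_one] at hY1
    exact_mod_cast hY1.trans this
  have hkV : k ≤ V := by omega
  clear hYV1
  refine Spec.seq (vertexPass_spec hV hB hO hd hP ha hb (by rw [pow_one] at hY1; omega) hkV hL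
    (fun _ => rfl) (by linarith)) fun s₁ F₁ ⟨hE, h₁⟩ => ?_
  have hL₁ : Loaded s₁ a b P := hL.of_frame F₁ (by decide) (by decide)
  have z₁ : s₁.arr 18 = fun _ => 0 := F₁.arr 18 (by decide)
  have z₂ : s₁.arr 19 = fun _ => 0 := F₁.arr 19 (by decide)
  obtain ⟨l, hl⟩ : ∃ l, s₁.var 60 = l := ⟨_, rfl⟩
  obtain ⟨r, hr⟩ : ∃ r, s₁.var 61 = r := ⟨_, rfl⟩
  obtain ⟨d, hdv⟩ : ∃ d, s₁.var 62 = d := ⟨_, rfl⟩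
  obtain ⟨t, ht⟩ : ∃ t, s₁.var 63 = t := ⟨_, rfl⟩
  rw [hl, hr, hdv, ht] at hE
  have b₁ : |l| ≤ W := by
    obtain ⟨i, hi⟩ := hE.l_eq
    rw [← hi]; exact (Int.abs_ediv_le_abs _ _).trans (hW.xNum_le i)
  have b₂ : |r| ≤ W + 1 := by
    obtain ⟨i, hi⟩ := hE.r_eq
    rw [← hi]; exact (Int.abs_ediv_le_abs _ _).trans ((abs_sub _ _).trans (by simpa using hW.xNum_le i))
  have b₃ : |d| ≤ W := by
    obtain ⟨i, hi⟩ := hE.b_eq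
    rw [← hi]; exact (Int.abs_ediv_le_abs _ _).trans (hW.yNum_le i)
  have b₄ : |t| ≤ W + 1 := by
    obtain ⟨i, hi⟩ := hE.t_eq
    rw [← hi]; exact (Int.abs_ediv_le_abs _ _).trans ((abs_sub _ _).trans (by simpa using hW.yNum_le i))
  -- The extent of the tree: at most 4p + 3 and hence at most `Q`, but also at most 4W + 5.
  obtain ⟨R, hR⟩ : ∃ R, R = (r - l).toNat + (t - d).toNat + 1 := ⟨_, rfl⟩
  have hRQ : R ≤ Q := by
    have h₁ := hE.width_lt hd
    have h₂ := hE.height_lt hd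
    have h₃ := P.perimeter_nonneg
    have e₁ : (((r - l).toNat : ℕ) : ℝ) < 2 * P.perimeter + 1 := by
      rcases le_total 0 (r - l) with h | h
      · rw [← Int.toNat_of_nonneg h] at h₁; exact_mod_cast h₁
      · rw [Int.toNat_of_nonpos h]; push_cast; linarith
    have e₂ : (((t - d).toNat : ℕ) : ℝ) < 2 * P.perimeter + 1 := by
      rcases le_total 0 (t - d) with h | h
      · rw [← Int.toNat_of_nonneg h] at h₂; exact_mod_cast h₂
      · rw [Int.toNat_of_nonpos h]; push_cast; linarith
    have : (R : ℝ) ≤ Q := by rw [hR]; push_cast; linarith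
    exact_mod_cast this
  have hR' : R ≤ 4 * W + 5 := by
    rw [abs_le] at b₁ b₂ b₃ b₄
    omega
  have hYWZ : 25 * (W : ℤ) + 50 ≤ Y := by exact_mod_cast hYW
  have hYVZ : (Y : ℤ) + 2 ≤ V := by
    have : (Y : ℤ) ^ 11 ≤ V := by exact_mod_cast hY11
    linarith
  refine Spec.seq (Spec.mono (profileInit_spec hV hB hl hr hdv ht (by linarith) (by linarith) (by linarith)
    (by linarith)) (T' := 20 * Q + 30) (by omega) fun _ _ h => h) fun s₂ F₂ h₂ => ?_
  have hL₂ : Loaded s₂ a b P := hL₁.of_frame F₂ (by decide) (by decide)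
  have o₂ : s₂.arr 8 = s₁.arr 8 := F₂.arr 8 (by decide)
  rw [z₁, z₂] at h₂
  have p₁ : ∀ j, |s₂.arr 18 j| ≤ (Y : ℤ) ^ 11 := fun j => by
    rw [(h₂ j).1]
    split_ifs
    · have := abs_add_le t 1
      rw [abs_one] at this
      linarith
    · rw [abs_zero]; positivity
  have p₂ : ∀ j, |s₂.arr 19 j| ≤ (Y : ℤ) ^ 11 := fun j => by
    rw [(h₂ j).2]
    split_ifs
    · have := abs_sub d 1
      rw [abs_one] at this
      linarith
    · rw [abs_zero]; positivity
  refine Spec.seq (sidePass_spec hV hB hO hd hP ha hb (by omega) hY11 hkV hL₂ p₁ p₂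
    (Z := (n + 1) * (Y : ℤ) ^ 2) (fun m => by rw [o₂, h₁]; exact hS _ _) (by linarith) N hN) fun s₃ F₃ h₃ => ?_
  have hL₃ : Loaded s₃ a b P := hL₂.of_frame F₃ (by decide) (by decide)
  have hprof : P.Profile l r d t (s₃.arr 18) (s₃.arr 19) := by
    refine ⟨fun c k₁ k₂ j => ?_, fun c k₁ k₂ j => ?_⟩
    · rw [h₃.lo, (h₂ c).1, if_pos ⟨k₁, k₂⟩]
    · rw [h₃.hi, (h₂ c).2, if_pos ⟨k₁, k₂⟩]
  have hvar : ∀ x, 60 ≤ x → x ≤ 62 → s₃.var x = s₁.var x := fun x k₁ k₂ => by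
    rw [F₃.var x (by omega) (by interval_cases x <;> decide), F₂.var x (by omega) (by interval_cases x <;> decide)]
  refine Spec.mono (interiorPass_spec hV hB hO hd ha hb hL₃ hE (by rw [hvar _ (by norm_num) (by norm_num), hl])
    (by rw [hvar _ (by norm_num) (by norm_num), hr]) (by rw [hvar _ (by norm_num) (by norm_num), hdv]) hprof hR
    ?_ ?_ ?_ (by omega) hYV (by omega) fun m => ?_) ?_ fun s₄ F₄ h₄ m => ?_
  · have : (R : ℤ) ≤ 4 * W + 5 := by exact_mod_cast hR'
    linarith
  · have : (R : ℤ) ≤ 4 * W + 5 := by exact_mod_cast hR'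
    linarith
  · omega
  · rw [h₃.out, o₂, h₁]
    exact (abs_add_le _ _).trans ((add_le_add (hS _ _) (hS _ _)).trans (by linarith))
  · have := treeTime_mono hRQ
    omega
  · rw [h₄, h₃.out, o₂, h₁, diagonalSum_eq, hO.latticeSum_region]

end

end WordRAM

/-! ## The time bound -/

/-- From 3Q ≤ 18p ≤ 2⁵p ≤ p⁶ the binary logarithm is at most 9 log p. Rounding up and the summand 1
cost at most 2 ≤ 3 log p. -/
theorem clog_le_log {p : ℝ} (hp : 2 ≤ p) {Q : ℕ} (hQ : (Q : ℝ) ≤ 6 * p) (hQ1 : 1 ≤ Q) :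
    (Nat.clog 2 (3 * Q) + 1 : ℝ) ≤ 12 * Real.log p := by
  have hlog2 := Real.log_two_gt_d9
  have hlogp : Real.log 2 ≤ Real.log p := Real.log_le_log (by norm_num) hp
  have h3Q : (1 : ℝ) ≤ (3 * Q : ℕ) := by exact_mod_cast (by omega : 1 ≤ 3 * Q)
  have h₁ : ((3 * Q : ℕ) : ℝ) ≤ p ^ 6 := by
    have h₂ : (2 : ℝ) ^ 5 ≤ p ^ 5 := pow_le_pow_left₀ (by norm_num) hp 5
    push_cast
    calc (3 * Q : ℝ) ≤ 2 ^ 5 * p := by linarith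
      _ ≤ p ^ 5 * p := by gcongr
      _ = p ^ 6 := by ring
  have h₂ : Real.log (3 * Q : ℕ) ≤ 6 * Real.log p := by
    have := Real.log_le_log (by linarith) h₁
    rw [Real.log_pow] at this
    exact_mod_cast this
  have h₃ : 0 ≤ Real.logb 2 (3 * Q : ℕ) := Real.logb_nonneg (by norm_num) h3Q
  have h₄ := (Nat.ceil_lt_add_one h₃).le
  have h₅ := Real.natCeil_logb_natCast 2 (3 * Q)
  rw [Nat.cast_ofNat] at h₅
  rw [h₅] at h₄
  have h₆ : Real.logb 2 (3 * Q : ℕ) ≤ 9 * Real.log p := by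
    rw [Real.logb, div_le_iff₀ (by linarith)]
    nlinarith
  linarith

/-- For p ≥ 2 the logarithm of p is bounded below, so p (log p)² dominates both p and the time for
the trees. For smaller p this term may vanish, but then the trees have bounded size and `k` pays for
everything. As k ≥ 3 > e, the factor log k is at least 1. -/
theorem time_le {p : ℝ} (hp : 0 ≤ p) {k Q S : ℕ} (hk : 3 ≤ k) (hQ : (Q : ℝ) ≤ 4 * p + 4) (hQ1 : 1 ≤ Q)
    (hS : (S : ℝ) ≤ 150 * p + 545 * k) :
    ((67 * k + 60 + (20 * Q + 30 + (S + 10 + (20 + (WordRAM.treeTime Q + WordRAM.treeTime Q)))) : ℕ) : ℝ) ≤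
      10 ^ 8 * (k + p * Real.log p ^ 2 * Real.log k) := by
  have hk' : (3 : ℝ) ≤ k := by exact_mod_cast hk
  have hlogk : 1 ≤ Real.log k := by
    rw [Real.le_log_iff_exp_le (by linarith)]
    linarith [Real.exp_one_lt_d9]
  have hnn : 0 ≤ p * Real.log p ^ 2 := by positivity
  have hmul : p * Real.log p ^ 2 ≤ p * Real.log p ^ 2 * Real.log k := le_mul_of_one_le_right hnn hlogk
  rcases le_or_gt 2 p with h2 | h2
  · have hc := clog_le_log h2 (by linarith) hQ1
    have hlogp : 0.6 ≤ Real.log p :=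
      le_trans (by linarith [Real.log_two_gt_d9]) (Real.log_le_log (by norm_num) h2)
    have h₁ : (WordRAM.treeTime Q : ℝ) ≤ 21000 * (6 * p) * (12 * Real.log p) ^ 2 := by
      rw [WordRAM.treeTime]
      push_cast
      gcongr
      linarith
    have h₂ : 0.36 * p ≤ p * Real.log p ^ 2 := by
      have : 0.36 ≤ Real.log p ^ 2 := by nlinarith
      nlinarith
    push_cast
    linarith
  -- Here 4p + 4 < 12.
  · have hQ' : Q ≤ 11 := by
      have : (Q : ℝ) < 12 := by linarith
      have : Q < 12 := by exact_mod_cast this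
      omega
    have h₁ : WordRAM.treeTime Q ≤ 21000 * 11 * (6 + 1) ^ 2 := by
      refine (WordRAM.treeTime_mono hQ').trans ?_
      have : Nat.clog 2 (3 * 11) ≤ 6 := Nat.clog_le_of_le_pow (by norm_num)
      rw [WordRAM.treeTime]
      gcongr
    have h₂ : (WordRAM.treeTime Q : ℝ) ≤ 21000 * 11 * (6 + 1) ^ 2 := by exact_mod_cast h₁
    push_cast
    linarith

theorem mainTheorem1 :
    ∃ (A : WordRAM.Program) (C : ℝ) (d : ℕ),
      ∀ (n k : ℕ) (a b : Fin (n + 1) → ℤ) (P : PolygonData k), P.IsConvexPolygon →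
        ∀ W : ℕ, InputBounded a b P W →
          ∃ (t : ℕ) (s : WordRAM.State),
            WordRAM.Exec ((W + 2) ^ d) A (inputState a b P) t s ∧
            (∀ m : ℤ, outputArray s m = diagonalSum a b P m) ∧
            (t : ℝ) ≤ C * (k + P.perimeter * Real.log P.perimeter ^ 2 * Real.log k) := by
  refine ⟨WordRAM.polygonSum.compile, 10 ^ 8, 6000, fun n k a b P hP W hW => ?_⟩
  have hp := P.perimeter_nonneg
  obtain ⟨t, s, s', h₁, h₂, h₃, -, h₄⟩ := WordRAM.polygonSum_spec hP hW (Q := ⌈4 * P.perimeter + 3⌉₊)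
    (Nat.le_ceil _) (fun e => ⌈dist (P.vertex e) (P.vertex (finRotate k e))⌉₊ + 1)
    (fun e => by push_cast; linarith [Nat.le_ceil (dist (P.vertex e) (P.vertex (finRotate k e)))])
    _ (WordRAM.Agree.refl _)
  refine ⟨t, s, h₁, fun m => by rw [outputArray, h₃.1, h₄], le_trans (Nat.cast_le.2 h₂)
    (time_le hp hP.three_le ?_ ?_ ?_)⟩
  · linarith [Nat.ceil_lt_add_one (show 0 ≤ 4 * P.perimeter + 3 by linarith)]
  · exact Nat.one_le_ceil_iff.2 (by linarith)
  -- The constant is 150 · 2 + 245: one unit of the factor 2 from rounding up the length and one for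
  -- the additional column.
  · have h₅ : ∀ e ∈ Finset.univ, ((150 * (⌈dist (P.vertex e) (P.vertex (finRotate k e))⌉₊ + 1) + 245 : ℕ) : ℝ) ≤
        150 * dist (P.vertex e) (P.vertex (finRotate k e)) + 545 := fun e _ => by
      push_cast
      linarith [Nat.ceil_lt_add_one (dist_nonneg (x := P.vertex e) (y := P.vertex (finRotate k e)))]
    have h₆ := Finset.sum_le_sum h₅
    rw [Finset.sum_add_distrib, ← Finset.mul_sum] at h₆
    rw [Nat.cast_sum]
    refine h₆.trans (le_of_eq ?_)
    rw [PolygonData.perimeter]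
    simp
    ring
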